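/- **Setting.** Let $d\in\{2,3\}$, $T\in(0,\infty)$, and let $\Omega\subset\mathbb R^d$ be a smooth bounded domain. Consider the system $$\partial_t u+\operatorname{div}(u\otimes u)-\Delta u+\nabla p=\operatorname{div}(FF^\top),\quad \operatorname{div}u=0,\quad \partial_tF+\operatorname{div}(u\otimes F)=\nabla u\,F,\quad \operatorname{div}F=0$$ in $(0,T)\times\Omega$ with $u=0$ on $(0,T)\times\partial\Omega$, $u(0)=u_0$, $F(0)=F_0$, where $u$ is $\mathbb R^d$-valued, $F$ is $\mathbb R^{d\times d}$-valued, $(\nabla u)_{ij}=\partial_ju_i$ and $(\operatorname{div}F)_j=\sum_i\partial_iF_{ij}$. Write $(f,g)=\int_\Omega f\cdot g\,dx$; $(u\otimes F,\nabla\Psi)=\sum_{k,i,j}\int_\Omega u_kF_{ij}\partial_k\Psi_{ij}\,dx$. Let $L^2_{\operatorname{div}}(\Omega)$ and $W^{1,2}_{0,\operatorname{div}}(\Omega)^d$ be the closures of $\{v\in C_c^\infty(\Omega)^d:\operatorname{div}v=0\}$ in $L^2$ and in $W^{1,2}$, respectively, and $$\mathcal H=\{\Phi\in L^2(\Omega)^{d\times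 d}:\operatorname{div}\Phi=0\},\quad \mathcal W=\mathcal H\cap W^{1,2}(\Omega)^{d\times d},\quad \mathcal V=W^{1,2}_{0,\operatorname{div}}(\Omega)^d\cap W^{3,2}(\Omega)^d,$$ with distributional divergence. $\mathcal M(\overline\Omega)$ is the space of finite signed Radon measures on $\overline\Omega$ with the total variation norm. $C_w([0,T];X)$ is the set of $f\in L^\infty(0,T;X)$, defined at every $t\in[0,T]$, such that $t\mapsto\langle\phi,f(t)\rangle$ is continuous on $[0,T]$ for all $\phi\in X^*$. **Weak formulation.** Given $u_0,F_0$ and $\mathcal R$ with values in $\mathcal M(\overline\Omega)^{d\times d}$, $(u,F)$ satisfies (WF) with corrector $\mathcal R$ if $$(u(t),\psi(t))-(u_0,\psi(0))=\int_0^t(u,\partial_t\psi)+(u\otimes u,\nabla\psi)-(\nabla u+FF^\top,\nabla\psi)\,ds+\int_0^t\langle\mathcal R,\nabla\psi\rangle\,ds,$$ $$(F(t),\Psi(t))-(F_0,\Psi(0))=\int_0^t(F,\partial_t\Psi)+(u\otimes F,\nabla\Psi)+(\nabla u\,F,\Psi)\,ds$$ for all $t\in(0,T)$ and all $\psi\in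 C_c^\infty([0,T]\times\Omega)^d$, $\Psi\in C^\infty([0,T]\times\overline\Omega)^{d\times d}$ with $\operatorname{div}\psi=0$ and $\operatorname{div}\Psi=0$ in $(0,T)\times\Omega$. **Dissipative solution.** Let $u_0\in L^2_{\operatorname{div}}(\Omega)$ and $F_0\in\mathcal H$. A pair $(u,F)$ is a dissipative solution with initial data $(u_0,F_0)$ if $u\in C_w([0,T];L^2_{\operatorname{div}}(\Omega))\cap L^2(0,T;W^{1,2}_{0,\operatorname{div}}(\Omega)^d)$, $F\in C_w([0,T];\mathcal H)$, and there are a dissipation defect $\mathcal D\in L^\infty(0,T)$, $\mathcal D\ge0$, a corrector $\mathcal R\in L^\infty(0,T;\mathcal M(\overline\Omega)^{d\times d})$ (weakly-$*$ measurable and essentially bounded) and a constant $c$ such that $$\tfrac12\big(\|u(t)\|_{L^2}^2+\|F(t)\|_{L^2}^2\big)+\int_0^t\|\nabla u(s)\|_{L^2}^2\,ds+\mathcal D(t)\le\tfrac12\big(\|u_0\|_{L^2}^2+\|F_0\|_{L^2}^2\big)\quad\text{for a.e. }t\in(0,T),$$ (WF) holds with corrector $\mathcal R$, $\int_0^t\|\mathcal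 R(s)\|_{\mathcal M(\overline\Omega)}\,ds\le c\int_0^t\mathcal D(s)\,ds$ for all $t\in(0,T)$, and $\lim_{t\to0_+}\|u(t)-u_0\|_{L^2}^2+\|F(t)-F_0\|_{L^2}^2=0$. **Strong solution.** A pair $(\tilde u,\tilde F)$ is a strong solution with initial data $(u_0,F_0)$ if $$\tilde u\in L^\infty(0,T;\mathcal V)\cap L^2(0,T;W^{4,2}(\Omega)^d),\quad\partial_t\tilde u\in L^2(0,T;W^{2,2}(\Omega)^d),$$ $$\tilde F\in L^\infty(0,T;\mathcal W\cap W^{3,2}(\Omega)^{d\times d}),\quad\partial_t\tilde F\in L^\infty(0,T;W^{1,2}(\Omega)^{d\times d}),$$ and $(\tilde u,\tilde F)$ satisfies (WF) with $\mathcal R=0$. **Theorem.** Let $u_0\in\mathcal V$ and $F_0\in\mathcal W\cap W^{3,2}(\Omega)^{d\times d}$, let $(u,F)$ be a dissipative solution and $(\tilde u,\tilde F)$ a strong solution, both with initial data $(u_0,F_0)$. Then $(u,F)=(\tilde u,\tilde F)$ a.e. in $(0,T)\times\Omega$. -/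

import Mathlib

open MeasureTheory Set Filter Topology
open scoped ContDiff

noncomputable section

namespace Viscoelastic

/-! ### Domains, test functions, weak derivatives -/

/-- The Euclidean space `ℝ^d`. -/
abbrev Eu (d : ℕ) : Type := EuclideanSpace ℝ (Fin d)

/-- A smooth bounded domain: open, connected, nonempty, bounded, and near each boundary point the
sublevel set of a smooth function with nonvanishing gradient there. -/
structure IsSmoothBoundedDomain {d : ℕ} (Ω : Set (Eu d)) : Prop where
  isOpen : IsOpen Ω
  isConnected : IsConnected Ω
  isBounded : Bornology.IsBounded Ω
  smooth_boundary : ∀ x₀ ∈ frontier Ω, ∃ (U : Set (Eu d)) (ρ : Eu d → ℝ),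
    IsOpen U ∧ x₀ ∈ U ∧ ContDiffOn ℝ ∞ ρ U ∧ fderiv ℝ ρ x₀ ≠ 0 ∧ Ω ∩ U = {x ∈ U | ρ x < 0}

/-- The scalar space `L²(Ω)`. Vector (matrix) fields in `L²(Ω)` are `Fin d → L2 Ω`
(`Fin d → Fin d → L2 Ω`). -/
abbrev L2 {d : ℕ} (Ω : Set (Eu d)) : Type := Lp ℝ 2 ((volume : Measure (Eu d)).restrict Ω)

/-- Lebesgue measure on the time interval `(0,T)`. -/
abbrev timeMeasure (T : ℝ) : Measure ℝ := (volume : Measure ℝ).restrict (Ioo 0 T)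

/-- The classical partial derivative `∂_j φ (x)`. -/
def partialDeriv {d : ℕ} (j : Fin d) (φ : Eu d → ℝ) (x : Eu d) : ℝ :=
  fderiv ℝ φ x (EuclideanSpace.single j 1)

/-- `φ ∈ C_c^∞(Ω)`. -/
def IsTest {d : ℕ} (Ω : Set (Eu d)) (φ : Eu d → ℝ) : Prop :=
  ContDiff ℝ ∞ φ ∧ HasCompactSupport φ ∧ tsupport φ ⊆ Ω

/-- `φ ∈ C_c^∞(Ω)^d` with `div φ = 0` in `Ω`. -/
def IsSolenoidalTest {d : ℕ} (Ω : Set (Eu d)) (φ : Fin d → Eu d → ℝ) : Prop :=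
  (∀ i, IsTest Ω (φ i)) ∧ ∀ x ∈ Ω, ∑ i, partialDeriv i (φ i) x = 0

/-- `g ∈ L²(Ω)` is the weak derivative `∂_j f` of `f ∈ L²(Ω)`. -/
def HasWeakDeriv {d : ℕ} (Ω : Set (Eu d)) (j : Fin d) (f g : L2 Ω) : Prop :=
  ∀ φ : Eu d → ℝ, IsTest Ω φ →
    ∫ x in Ω, f x * partialDeriv j φ x = - ∫ x in Ω, g x * φ x

open Classical in
/-- The weak derivative `∂_j f` if it exists in `L²(Ω)` (it is then unique), and `0` otherwise. -/
def weakDeriv {d : ℕ} (Ω : Set (Eu d)) (j : Fin d) (f : L2 Ω) : L2 Ω :=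
  if h : ∃ g, HasWeakDeriv Ω j f g then h.choose else 0

/-! ### Function spaces on `Ω` -/

/-- `f ∈ W^{k,2}(Ω)`: all weak derivatives of order at most `k` exist in `L²(Ω)`. -/
def MemSobolev {d : ℕ} (Ω : Set (Eu d)) : ℕ → L2 Ω → Prop
  | 0, _ => True
  | k + 1, f => ∃ g : Fin d → L2 Ω, ∀ j, HasWeakDeriv Ω j f (g j) ∧ MemSobolev Ω k (g j)

/-- `L²_div(Ω)`: the closure in `L²(Ω)^d` of the solenoidal test fields. -/
def L2Div {d : ℕ} (Ω : Set (Eu d)) : Set (Fin d → L2 Ω) :=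
  closure {v | ∃ φ, IsSolenoidalTest Ω φ ∧ ∀ i, v i =ᵐ[volume.restrict Ω] φ i}

/-- `W^{1,2}_{0,div}(Ω)^d`: the closure in `W^{1,2}(Ω)^d` of the solenoidal test fields. The
`W^{1,2}` topology is that of convergence in `L²` of the field together with its gradient
(`G i j` stands for `∂_j v_i`). -/
def W12ZeroDiv {d : ℕ} (Ω : Set (Eu d)) : Set (Fin d → L2 Ω) :=
  {v | ∃ G : Fin d → Fin d → L2 Ω,
    (v, G) ∈ closure {p : (Fin d → L2 Ω) × (Fin d → Fin d → L2 Ω) |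
      ∃ φ, IsSolenoidalTest Ω φ ∧ (∀ i, p.1 i =ᵐ[volume.restrict Ω] φ i) ∧
        ∀ i j, p.2 i j =ᵐ[volume.restrict Ω] partialDeriv j (φ i)}}

/-- `𝒱(Ω) = W^{1,2}_{0,div}(Ω)^d ∩ W^{3,2}(Ω)^d`. -/
def VSpace {d : ℕ} (Ω : Set (Eu d)) : Set (Fin d → L2 Ω) :=
  {v | v ∈ W12ZeroDiv Ω ∧ ∀ i, MemSobolev Ω 3 (v i)}

/-- `ℋ(Ω)`: matrix fields in `L²(Ω)` whose distributional divergence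
`(div Φ)_j = ∑ i, ∂_i Φ_{ij}` vanishes in `Ω`. -/
def HSpace {d : ℕ} (Ω : Set (Eu d)) : Set (Fin d → Fin d → L2 Ω) :=
  {Φ | ∀ φ : Fin d → Eu d → ℝ, (∀ j, IsTest Ω (φ j)) →
    ∑ i, ∑ j, ∫ x in Ω, Φ i j x * partialDeriv i (φ j) x = 0}

/-- `𝒲(Ω)`: divergence-free matrix fields in `W^{1,2}(Ω)`. -/
def WSpace {d : ℕ} (Ω : Set (Eu d)) : Set (Fin d → Fin d → L2 Ω) :=
  {Φ | Φ ∈ HSpace Ω ∧ ∀ i j, MemSobolev Ω 1 (Φ i j)}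

/-! ### Function spaces on `(0,T)` -/

/-- `f ∈ C_w([0,T]; S)` for a closed subspace `S` of the Banach space `X`. -/
def MemCw {X : Type*} [NormedAddCommGroup X] [NormedSpace ℝ X] (T : ℝ) (S : Set X)
    (f : ℝ → X) : Prop :=
  (∀ t ∈ Icc 0 T, f t ∈ S) ∧ MemLp f ⊤ (timeMeasure T) ∧
    ∀ φ : StrongDual ℝ X, ContinuousOn (fun t => φ (f t)) (Icc 0 T)

/-- `f ∈ L^p(0,T; W^{k,2}(Ω))`: `f` and its weak spatial derivatives of order at most `k` lie in
the Bochner space `L^p(0,T; L²(Ω))`. -/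
def MemBochnerSobolev {d : ℕ} (Ω : Set (Eu d)) (T : ℝ) (p : ENNReal) : ℕ → (ℝ → L2 Ω) → Prop
  | 0, f => MemLp f p (timeMeasure T)
  | k + 1, f => MemLp f p (timeMeasure T) ∧ ∃ g : Fin d → ℝ → L2 Ω, ∀ j,
      (∀ᵐ t ∂timeMeasure T, HasWeakDeriv Ω j (f t) (g j t)) ∧ MemBochnerSobolev Ω T p k (g j)

/-- `g` is the weak time derivative of `f` on `(0,T)`. -/
def HasWeakTimeDeriv {X : Type*} [NormedAddCommGroup X] [NormedSpace ℝ X] (T : ℝ)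
    (f g : ℝ → X) : Prop :=
  ∀ θ : ℝ → ℝ, ContDiff ℝ ∞ θ → HasCompactSupport θ → tsupport θ ⊆ Ioo 0 T →
    ∫ t in Ioo 0 T, deriv θ t • f t = - ∫ t in Ioo 0 T, θ t • g t

/-! ### Space-time test functions and matrix-valued measures -/

/-- `ψ ∈ C_c^∞([0,T] × Ω)^d` with `div ψ = 0` in `(0,T) × Ω`. -/
def IsVelocityTest {d : ℕ} (Ω : Set (Eu d)) (T : ℝ) (ψ : Fin d → ℝ → Eu d → ℝ) : Prop :=
  (∀ i, ContDiff ℝ ∞ (fun p : ℝ × Eu d => ψ i p.1 p.2)) ∧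
  (∃ K : Set (Eu d), IsCompact K ∧ K ⊆ Ω ∧ ∀ i, ∀ t ∈ Icc 0 T, ∀ x ∉ K, ψ i t x = 0) ∧
  ∀ t ∈ Ioo 0 T, ∀ x ∈ Ω, ∑ i, partialDeriv i (ψ i t) x = 0

/-- `Ψ ∈ C^∞([0,T] × Ω̄)^{d×d}` (restrictions of smooth functions) with
`(div Ψ)_j = ∑ i, ∂_i Ψ_{ij} = 0` in `(0,T) × Ω`. -/
def IsDeformationTest {d : ℕ} (Ω : Set (Eu d)) (T : ℝ)
    (Ψ : Fin d → Fin d → ℝ → Eu d → ℝ) : Prop :=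
  (∀ i j, ContDiff ℝ ∞ (fun p : ℝ × Eu d => Ψ i j p.1 p.2)) ∧
  ∀ t ∈ Ioo 0 T, ∀ x ∈ Ω, ∀ j, ∑ i, partialDeriv i (Ψ i j t) x = 0

/-- `ℳ(Ω̄)^{d×d}`: matrices of finite signed (Radon) measures on the closure of `Ω`. -/
abbrev MatMeas {d : ℕ} (Ω : Set (Eu d)) : Type :=
  Fin d → Fin d → SignedMeasure (closure Ω)

/-- The total variation norm on `ℳ(Ω̄)^{d×d}` (sum over the entries). -/
def matMeasNorm {d : ℕ} {Ω : Set (Eu d)} (R : MatMeas Ω) : ℝ :=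
  ∑ i, ∑ j, ((R i j).totalVariation univ).toReal

/-- `R ∈ L^∞(0,T; ℳ(Ω̄)^{d×d})`: weakly-* measurable and essentially bounded in total variation. -/
def MemLinftyMeas {d : ℕ} (Ω : Set (Eu d)) (T : ℝ) (R : ℝ → MatMeas Ω) : Prop :=
  (∀ i j, ∀ φ : C(closure Ω, ℝ),
    AEMeasurable (fun t => ∫ᵛ x, φ x ∂•(R t i j)) (timeMeasure T)) ∧
  ∃ C : ℝ, ∀ᵐ t ∂timeMeasure T, matMeasNorm (R t) ≤ C

/-! ### The weak formulations -/

/-- The weak form of the momentum equation with corrector `R`. Here `(∇ψ)_{ij} = ∂_j ψ_i`. -/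
def MomentumWeakForm {d : ℕ} (Ω : Set (Eu d)) (T : ℝ) (u₀ : Fin d → L2 Ω)
    (u : ℝ → Fin d → L2 Ω) (F : ℝ → Fin d → Fin d → L2 Ω) (R : ℝ → MatMeas Ω) : Prop :=
  ∀ ψ : Fin d → ℝ → Eu d → ℝ, IsVelocityTest Ω T ψ → ∀ t ∈ Ioo 0 T,
    (∑ i, ∫ x in Ω, u t i x * ψ i t x) - (∑ i, ∫ x in Ω, u₀ i x * ψ i 0 x) =
      (∫ s in (0 : ℝ)..t,
        ((∑ i, ∫ x in Ω, u s i x * deriv (fun r => ψ i r x) s)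
          + (∑ i, ∑ j, ∫ x in Ω, u s i x * u s j x * partialDeriv j (ψ i s) x)
          - (∑ i, ∑ j, ∫ x in Ω, (weakDeriv Ω j (u s i) x + ∑ k, F s i k x * F s j k x)
              * partialDeriv j (ψ i s) x)))
      + ∫ s in (0 : ℝ)..t, ∑ i, ∑ j, ∫ᵛ x, partialDeriv j (ψ i s) (x : Eu d) ∂•(R s i j)

/-- The weak form of the transport equation for the deformation gradient. Here
`(u ⊗ F, ∇Ψ) = ∑ k i j, ∫ u_k F_{ij} ∂_k Ψ_{ij}` and `(∇u F)_{ij} = ∑ k, ∂_k u_i F_{kj}`. -/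
def TransportWeakForm {d : ℕ} (Ω : Set (Eu d)) (T : ℝ) (F₀ : Fin d → Fin d → L2 Ω)
    (u : ℝ → Fin d → L2 Ω) (F : ℝ → Fin d → Fin d → L2 Ω) : Prop :=
  ∀ Ψ : Fin d → Fin d → ℝ → Eu d → ℝ, IsDeformationTest Ω T Ψ → ∀ t ∈ Ioo 0 T,
    (∑ i, ∑ j, ∫ x in Ω, F t i j x * Ψ i j t x)
        - (∑ i, ∑ j, ∫ x in Ω, F₀ i j x * Ψ i j 0 x) =
      ∫ s in (0 : ℝ)..t,
        ((∑ i, ∑ j, ∫ x in Ω, F s i j x * deriv (fun r => Ψ i j r x) s)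
          + (∑ k, ∑ i, ∑ j, ∫ x in Ω, u s k x * F s i j x * partialDeriv k (Ψ i j s) x)
          + (∑ i, ∑ j, ∫ x in Ω, (∑ k, weakDeriv Ω k (u s i) x * F s k j x) * Ψ i j s x))

/-! ### Solutions -/

/-- `(u, F)` is a dissipative solution with initial data `(u₀, F₀)` and dissipation defect `D`. -/
structure IsDissipativeSolutionWithDefect {d : ℕ} (Ω : Set (Eu d)) (T : ℝ) (u₀ : Fin d → L2 Ω)
    (F₀ : Fin d → Fin d → L2 Ω) (D : ℝ → ℝ) (u : ℝ → Fin d → L2 Ω)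
    (F : ℝ → Fin d → Fin d → L2 Ω) : Prop where
  u₀_mem : u₀ ∈ L2Div Ω
  F₀_mem : F₀ ∈ HSpace Ω
  D_memLp : MemLp D ⊤ (timeMeasure T)
  D_nonneg : ∀ᵐ t ∂timeMeasure T, 0 ≤ D t
  u_memCw : MemCw T (L2Div Ω) u
  u_memSobolev : ∀ i, MemBochnerSobolev Ω T 2 1 (fun t => u t i)
  u_memW12ZeroDiv : ∀ᵐ t ∂timeMeasure T, u t ∈ W12ZeroDiv Ω
  F_memCw : MemCw T (HSpace Ω) F
  energy_inequality : ∀ᵐ t ∂timeMeasure T,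
    (1 / 2 : ℝ) * ((∑ i, ‖u t i‖ ^ 2) + ∑ i, ∑ j, ‖F t i j‖ ^ 2)
        + (∫ s in (0 : ℝ)..t, ∑ i, ∑ j, ‖weakDeriv Ω j (u s i)‖ ^ 2) + D t
      ≤ (1 / 2 : ℝ) * ((∑ i, ‖u₀ i‖ ^ 2) + ∑ i, ∑ j, ‖F₀ i j‖ ^ 2)
  weak_forms : ∃ R : ℝ → MatMeas Ω, MemLinftyMeas Ω T R ∧
    (∃ c : ℝ, ∀ t ∈ Ioo 0 T,
      ∫ s in (0 : ℝ)..t, matMeasNorm (R s) ≤ c * ∫ s in (0 : ℝ)..t, D s) ∧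
    MomentumWeakForm Ω T u₀ u F R ∧ TransportWeakForm Ω T F₀ u F
  initial_condition : Tendsto
    (fun t => (∑ i, ‖u t i - u₀ i‖ ^ 2) + ∑ i, ∑ j, ‖F t i j - F₀ i j‖ ^ 2) (𝓝[>] 0) (𝓝 0)

/-- `(u, F)` is a dissipative solution with initial data `(u₀, F₀)`. -/
def IsDissipativeSolution {d : ℕ} (Ω : Set (Eu d)) (T : ℝ) (u₀ : Fin d → L2 Ω)
    (F₀ : Fin d → Fin d → L2 Ω) (u : ℝ → Fin d → L2 Ω) (F : ℝ → Fin d → Fin d → L2 Ω) : Prop :=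
  ∃ D : ℝ → ℝ, IsDissipativeSolutionWithDefect Ω T u₀ F₀ D u F

/-- `(u, F)` is a strong solution with initial data `(u₀, F₀)`. -/
structure IsStrongSolution {d : ℕ} (Ω : Set (Eu d)) (T : ℝ) (u₀ : Fin d → L2 Ω)
    (F₀ : Fin d → Fin d → L2 Ω) (u : ℝ → Fin d → L2 Ω)
    (F : ℝ → Fin d → Fin d → L2 Ω) : Prop where
  u_memV : ∀ᵐ t ∂timeMeasure T, u t ∈ VSpace Ω
  u_memSobolev_three : ∀ i, MemBochnerSobolev Ω T ⊤ 3 (fun t => u t i)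
  u_memSobolev_four : ∀ i, MemBochnerSobolev Ω T 2 4 (fun t => u t i)
  u_timeDeriv : ∃ v : ℝ → Fin d → L2 Ω, HasWeakTimeDeriv T u v ∧
    ∀ i, MemBochnerSobolev Ω T 2 2 (fun t => v t i)
  F_memW : ∀ᵐ t ∂timeMeasure T, F t ∈ WSpace Ω
  F_memSobolev_three : ∀ i j, MemBochnerSobolev Ω T ⊤ 3 (fun t => F t i j)
  F_timeDeriv : ∃ G : ℝ → Fin d → Fin d → L2 Ω, HasWeakTimeDeriv T F G ∧
    ∀ i j, MemBochnerSobolev Ω T ⊤ 1 (fun t => G t i j)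
  momentum : MomentumWeakForm Ω T u₀ u F 0
  transport : TransportWeakForm Ω T F₀ u F

end Viscoelastic

end

noncomputable section

namespace Viscoelastic

/-! ### Integral operators with nonnegative kernels on L² -/

section Kernel

open scoped ENNReal

/-! This is weak-strong uniqueness by the relative energy method. Write (V, W) for the strong
solution and N(t) for the squared L² distance between the two states. The target is (1/2) N(t) +
𝒟(t) ≤ C ∫₀ᵗ N + B ∫₀ᵗ ‖R‖ (`relative_energy_inequality`). Since ∫ ‖R‖ ≤ c ∫ 𝒟, Gronwall's
inequality for (1/2) N + 𝒟 then gives N = 0 almost everywhere.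

To reach it, add the energy inequality of (u, F) to the energy identity of (V, W) and subtract the
weak equations of (u, F) tested with (V, W). The pairings of (u, F) with the time derivatives of (V,
W) are evaluated by the strong equations, tested with u and F. All cubic terms then collapse
(`relativeFlux_eq`) to expressions that are quadratic in the differences, with a coefficient from V,
W or their gradients. These coefficients are bounded, because W^{2,2} embeds into L^∞ for d ≤ 3
(`IsSmoothBoundedDomain.exists_sobolev_bound`). The single term containing ∇(u - V) is absorbed by
the viscous dissipation (`relativeFlux_le`).

The analytic difficulty is that (V, W) is not an admissible test pair: velocity tests must be
smooth, solenoidal and compactly supported in Ω, deformation tests must be smooth up to the boundary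
and solenoidal. A field is therefore regularized by mollifying its extension by zero, composing with
a smooth map Φ close to the identity, and multiplying by the adjugate of the Jacobian of Φ. This is
a Piola transform, so the divergence stays zero (`div_piola`). The map Φ is id ∓ εX for a field X
pointing into Ω. For velocities Φ = id - εX moves the support into Ω and uses the zero trace; for
deformations Φ = id + εX reads off interior values only, so no boundary condition is required. In
time one averages over the near future, which stays inside (0,T) even at t = 0.

The regularized fields converge only in L² with their gradients, which says nothing against the
measure R. What controls R is a bound on the regularized gradients in the sup norm, uniform in the
regularization. Thus `IsWeakState.momentum_cross` is an inequality with error B ∫ ‖R‖, and an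
identity if R = 0.

The strong solution is only assumed to satisfy the weak formulation. Its equations at almost every
time follow by testing with time-independent fields, differentiating in t, and extending by density
(`ae_momentum_equation`, `ae_transport_equation`). Limits of cubic terms are handled by truncating
one factor (`tri`), which makes the form continuous on L² × L² × L². -/

theorem eLpNorm_two_sq {α X : Type*} [MeasurableSpace α] [NormedAddCommGroup X] (μ : Measure α)
    (f : α → X) : eLpNorm f 2 μ ^ 2 = ∫⁻ x, ‖f x‖ₑ ^ 2 ∂μ := by
  have h := eLpNorm_nnreal_pow_eq_lintegral (f := f) (μ := μ) (p := 2) (by norm_num)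
  simpa using h

/-- Cauchy–Schwarz for the weighted measure k μ, splitting k g as k^{1/2} · (k^{1/2} g). -/
theorem lintegral_mul_sq_le {α : Type*} [MeasurableSpace α] {μ : Measure α} {k g : α → ENNReal}
    (hk : AEMeasurable k μ) (hg : AEMeasurable g μ) :
    (∫⁻ x, k x * g x ∂μ) ^ 2 ≤ (∫⁻ x, k x ∂μ) * ∫⁻ x, k x * g x ^ 2 ∂μ := by
  have h := ENNReal.lintegral_mul_le_Lp_mul_Lq μ (p := 2) (q := 2)
    (by constructor <;> norm_num) (f := fun x => k x ^ (1 / 2 : ℝ))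
    (g := fun x => k x ^ (1 / 2 : ℝ) * g x) (hk.pow_const _) ((hk.pow_const _).mul hg)
  have e1 : ∀ a : ENNReal, a ^ (1 / 2 : ℝ) * a ^ (1 / 2 : ℝ) = a := fun a => by
    rw [← ENNReal.rpow_add_of_nonneg _ _ (by norm_num) (by norm_num)]; norm_num
  have e2 : ∀ a : ENNReal, (a ^ (1 / 2 : ℝ)) ^ (2 : ℝ) = a := fun a => by
    rw [← ENNReal.rpow_mul]; norm_num
  have h' : ∫⁻ x, k x * g x ∂μ ≤
      (∫⁻ x, k x ∂μ) ^ (1 / 2 : ℝ) * (∫⁻ x, k x * g x ^ 2 ∂μ) ^ (1 / 2 : ℝ) := by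
    refine le_trans (le_of_eq ?_) (h.trans (le_of_eq ?_))
    · refine lintegral_congr fun x => ?_
      simp only [Pi.mul_apply]
      rw [← mul_assoc, e1]
    · congr 2
      · exact lintegral_congr fun x => e2 _
      · refine lintegral_congr fun x => ?_
        rw [ENNReal.mul_rpow_of_nonneg _ _ (by norm_num), e2]; norm_num
  calc (∫⁻ x, k x * g x ∂μ) ^ 2
      ≤ ((∫⁻ x, k x ∂μ) ^ (1 / 2 : ℝ) * (∫⁻ x, k x * g x ^ 2 ∂μ) ^ (1 / 2 : ℝ)) ^ 2 := by gcongr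
    _ = _ := by
      rw [sq, mul_mul_mul_comm, e1, e1]

/-- Schur-type bound for an integral operator with nonnegative kernel. -/
theorem eLpNorm_kernel_sq_le {α β X : Type*} [MeasurableSpace α] [MeasurableSpace β]
    [NormedAddCommGroup X] [NormedSpace ℝ X] {m : Measure α} {ν : Measure β} [SFinite m]
    [SFinite ν] {k : α → β → ℝ} (hk : Measurable (Function.uncurry k)) (hk0 : ∀ x y, 0 ≤ k x y)
    (h1 : ∀ᵐ x ∂m, ∫⁻ y, ENNReal.ofReal (k x y) ∂ν ≤ 1) {C : ENNReal}
    (h2 : ∀ y, ∫⁻ x, ENNReal.ofReal (k x y) ∂m ≤ C) {f : β → X}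
    (hf : AEStronglyMeasurable f ν) :
    eLpNorm (fun x => ∫ y, k x y • f y ∂ν) 2 m ^ 2 ≤ C * eLpNorm f 2 ν ^ 2 := by
  rw [eLpNorm_two_sq, eLpNorm_two_sq]
  have hkm : Measurable (fun p : α × β => ENNReal.ofReal (k p.1 p.2)) := hk.ennreal_ofReal
  -- The mass in y is at most 1, so the weighted Cauchy–Schwarz inequality acts as Jensen's; Tonelli
  -- then leaves the mass in x.
  calc ∫⁻ x, ‖∫ y, k x y • f y ∂ν‖ₑ ^ 2 ∂m
      ≤ ∫⁻ x, ∫⁻ y, ENNReal.ofReal (k x y) * ‖f y‖ₑ ^ 2 ∂ν ∂m := by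
        refine lintegral_mono_ae ?_
        filter_upwards [h1] with x hx
        calc ‖∫ y, k x y • f y ∂ν‖ₑ ^ 2
            ≤ (∫⁻ y, ENNReal.ofReal (k x y) * ‖f y‖ₑ ∂ν) ^ 2 := by
              gcongr
              refine (enorm_integral_le_lintegral_enorm _).trans (le_of_eq ?_)
              refine lintegral_congr fun y => ?_
              rw [enorm_smul, Real.enorm_of_nonneg (hk0 x y)]
          _ ≤ (∫⁻ y, ENNReal.ofReal (k x y) ∂ν) *
                ∫⁻ y, ENNReal.ofReal (k x y) * ‖f y‖ₑ ^ 2 ∂ν :=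
              lintegral_mul_sq_le (hkm.comp measurable_prodMk_left).aemeasurable hf.enorm
          _ ≤ _ := mul_le_of_le_one_left bot_le hx
    _ = ∫⁻ y, ∫⁻ x, ENNReal.ofReal (k x y) * ‖f y‖ₑ ^ 2 ∂m ∂ν := by
        refine lintegral_lintegral_swap ?_
        refine hkm.aemeasurable.mul ?_
        exact (hf.enorm.pow_const 2).comp_snd
    _ = ∫⁻ y, (∫⁻ x, ENNReal.ofReal (k x y) ∂m) * ‖f y‖ₑ ^ 2 ∂ν := by
        refine lintegral_congr fun y => ?_
        rw [lintegral_mul_const]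
        exact hkm.comp measurable_prodMk_right
    _ ≤ ∫⁻ y, C * ‖f y‖ₑ ^ 2 ∂ν := by
        gcongr with y
        exact h2 y
    _ = C * ∫⁻ y, ‖f y‖ₑ ^ 2 ∂ν := lintegral_const_mul'' _ (hf.enorm.pow_const 2)

/-- The mass in x may be 2 instead of 1 because the kernels in use are φ(Φ x - y), and substituting
z = Φ x costs a Jacobian factor of at most 2. -/
theorem eLpNorm_kernel_le {α β X : Type*} [MeasurableSpace α] [MeasurableSpace β]
    [NormedAddCommGroup X] [NormedSpace ℝ X] {m : Measure α} {ν : Measure β} [SFinite m]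
    [SFinite ν] {k : α → β → ℝ} (hk : Measurable (Function.uncurry k)) (hk0 : ∀ x y, 0 ≤ k x y)
    (h1 : ∀ᵐ x ∂m, ∫⁻ y, ENNReal.ofReal (k x y) ∂ν ≤ 1)
    (h2 : ∀ y, ∫⁻ x, ENNReal.ofReal (k x y) ∂m ≤ 2) {f : β → X}
    (hf : AEStronglyMeasurable f ν) :
    eLpNorm (fun x => ∫ y, k x y • f y ∂ν) 2 m ≤ 2 * eLpNorm f 2 ν := by
  have h := eLpNorm_kernel_sq_le hk hk0 h1 h2 hf
  have h' : eLpNorm (fun x => ∫ y, k x y • f y ∂ν) 2 m ^ 2 ≤ (2 * eLpNorm f 2 ν) ^ 2 := by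
    refine h.trans ?_
    rw [mul_pow]
    gcongr
    norm_num
  exact (ENNReal.pow_le_pow_left_iff (by norm_num)).1 h'

/-- Approximate identities converge strongly in `L²`. -/
theorem tendsto_eLpNorm_kernel_sub {E X : Type*} [NormedAddCommGroup E] [MeasurableSpace E]
    [BorelSpace E] [LocallyCompactSpace E] [SecondCountableTopology E]
    [NormedAddCommGroup X] [NormedSpace ℝ X] {m ν : Measure E} [IsFiniteMeasure m] [SFinite ν]
    [ν.Regular] (hm : m ≤ ν) {k : ℕ → E → E → ℝ}
    (hk : ∀ n, Measurable (Function.uncurry (k n))) (hk0 : ∀ n x y, 0 ≤ k n x y)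
    (h1 : ∀ n, ∀ᵐ x ∂m, ∫⁻ y, ENNReal.ofReal (k n x y) ∂ν = 1)
    (h2 : ∀ n y, ∫⁻ x, ENNReal.ofReal (k n x y) ∂m ≤ 2)
    {e : ℕ → ℝ} (he : Tendsto e atTop (𝓝 0))
    (h3 : ∀ n, ∀ᵐ x ∂m, ∀ y, k n x y ≠ 0 → dist y x ≤ e n)
    [CompleteSpace X] {f : E → X} (hf : MemLp f 2 ν) :
    Tendsto (fun n => eLpNorm (fun x => (∫ y, k n x y • f y ∂ν) - f x) 2 m) atTop (𝓝 0) := by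
  have hki : ∀ n, ∀ᵐ x ∂m, Integrable (k n x) ν := by
    intro n
    filter_upwards [h1 n] with x hx
    refine ⟨((hk n).comp measurable_prodMk_left).aestronglyMeasurable, ?_⟩
    rw [HasFiniteIntegral]
    simp only [fun y => Real.enorm_of_nonneg (hk0 n x y), hx]
    exact ENNReal.one_lt_top
  have hki1 : ∀ n, ∀ᵐ x ∂m, ∫ y, k n x y ∂ν = 1 := by
    intro n
    filter_upwards [h1 n] with x hx
    rw [integral_eq_lintegral_of_nonneg_ae (Eventually.of_forall (hk0 n x))
      ((hk n).comp measurable_prodMk_left).aestronglyMeasurable, hx]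
    simp
  rw [ENNReal.tendsto_atTop_zero]
  intro ε hε
  by_cases hεt : ε = ⊤
  · exact ⟨0, fun n _ => hεt ▸ le_top⟩
  -- The total error will be 2ε' + ε' + ε': the operator on f - g, the approximation error for the
  -- continuous g, and g - f itself.
  obtain ⟨ε', hε', h4⟩ : ∃ ε' : ENNReal, 0 < ε' ∧ 4 * ε' ≤ ε :=
    ⟨ε / 4, ENNReal.div_pos hε.ne' (by norm_num), ENNReal.mul_div_le⟩
  have hε't : ε' ≠ ⊤ := by
    rintro rfl
    simp at h4
    exact hεt h4
  obtain ⟨g, hgc, hg, hgcont, hgm⟩ := hf.exists_hasCompactSupport_eLpNorm_sub_le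
    (by norm_num) hε'.ne'
  have huc : UniformContinuous g := hgc.uniformContinuous_of_continuous hgcont
  -- A pointwise error c has L² norm at most ε' for the finite measure m.
  obtain ⟨c, hc, hcm⟩ : ∃ c : ℝ, 0 < c ∧
      ENNReal.ofReal c * m univ ^ (1 / 2 : ℝ) ≤ ε' := by
    have hM : m univ ^ (1 / 2 : ℝ) ≠ ⊤ := by
      refine ENNReal.rpow_ne_top_of_nonneg (by norm_num) (measure_ne_top _ _)
    refine ⟨ε'.toReal / ((m univ ^ (1 / 2 : ℝ)).toReal + 1), ?_, ?_⟩
    · exact div_pos (ENNReal.toReal_pos hε'.ne' hε't) (by positivity)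
    · rw [← ENNReal.ofReal_toReal hM, ← ENNReal.ofReal_mul (by positivity)]
      refine ENNReal.ofReal_le_of_le_toReal ?_
      rw [div_mul_eq_mul_div, div_le_iff₀ (by positivity)]
      rw [ENNReal.toReal_ofReal (by positivity)]
      nlinarith [ENNReal.toReal_nonneg (a := ε')]
  obtain ⟨δ, hδ, hδg⟩ := Metric.uniformContinuous_iff.1 huc c hc
  obtain ⟨N, hN⟩ := (eventually_atTop.1 (he.eventually (gt_mem_nhds hδ)))
  refine ⟨N, fun n hn => le_trans ?_ h4⟩
  have hfg : AEStronglyMeasurable (fun y => f y - g y) ν :=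
    hf.aestronglyMeasurable.sub hgcont.aestronglyMeasurable
  have hA := eLpNorm_kernel_le (hk n) (hk0 n) ((h1 n).mono fun x hx => hx.le) (h2 n) hfg
  have hB : eLpNorm (fun x => (∫ y, k n x y • g y ∂ν) - g x) 2 m ≤ ε' := by
    have : ∀ᵐ x ∂m, ‖(∫ y, k n x y • g y ∂ν) - g x‖ ≤ c := by
      filter_upwards [hki n, hki1 n, h3 n] with x hx hx1 hx3
      have : (∫ y, k n x y • g y ∂ν) - g x = ∫ y, k n x y • (g y - g x) ∂ν := by
        have hi : Integrable (fun y => k n x y • g y) ν := by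
          obtain ⟨B, hB⟩ := hgcont.bounded_above_of_compact_support hgc
          exact hx.smul_bdd B hgcont.aestronglyMeasurable (Eventually.of_forall hB)
        simp only [smul_sub]
        rw [integral_sub hi (hx.smul_const _), integral_smul_const, hx1, one_smul]
      rw [this]
      calc ‖∫ y, k n x y • (g y - g x) ∂ν‖ ≤ ∫ y, k n x y * c ∂ν := by
            refine norm_integral_le_of_norm_le (hx.mul_const _) (Eventually.of_forall fun y => ?_)
            rw [norm_smul, Real.norm_of_nonneg (hk0 n x y)]
            by_cases hky : k n x y = 0
            · simp [hky]
            · refine mul_le_mul_of_nonneg_left ?_ (hk0 n x y)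
              have := hδg ((hx3 y hky).trans_lt (hN n hn))
              rw [dist_eq_norm] at this
              exact this.le
        _ = c := by rw [integral_mul_const, hx1, one_mul]
    refine (eLpNorm_le_of_ae_bound this).trans ?_
    rw [mul_comm]
    refine le_trans (le_of_eq ?_) hcm
    norm_num
  have hC : eLpNorm (fun x => g x - f x) 2 m ≤ ε' := by
    refine (eLpNorm_mono_measure _ hm).trans ?_
    rw [← eLpNorm_neg]
    refine le_trans (le_of_eq ?_) hg
    congr 1
    ext x
    simp
  -- Splitting the integral of k f needs integrability for almost every x. Tonelli makes the
  -- k-weighted square integral finite for such x, and Cauchy–Schwarz with unit mass gives the first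
  -- power.
  have hfi : ∀ᵐ x ∂m, Integrable (fun y => k n x y • (f y - g y)) ν := by
    have hfin : ∫⁻ x, ∫⁻ y, ENNReal.ofReal (k n x y) * ‖f y - g y‖ₑ ^ 2 ∂ν ∂m < ⊤ := by
      rw [lintegral_lintegral_swap]
      · calc ∫⁻ y, ∫⁻ x, ENNReal.ofReal (k n x y) * ‖f y - g y‖ₑ ^ 2 ∂m ∂ν
            = ∫⁻ y, (∫⁻ x, ENNReal.ofReal (k n x y) ∂m) * ‖f y - g y‖ₑ ^ 2 ∂ν := by
              refine lintegral_congr fun y => ?_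
              rw [lintegral_mul_const]
              exact (hk n).ennreal_ofReal.comp measurable_prodMk_right
          _ ≤ ∫⁻ y, 2 * ‖f y - g y‖ₑ ^ 2 ∂ν := by
              gcongr with y
              exact h2 n y
          _ = 2 * eLpNorm (fun y => f y - g y) 2 ν ^ 2 := by
              rw [eLpNorm_two_sq, lintegral_const_mul'' _ (hfg.enorm.pow_const 2)]
          _ < ⊤ := ENNReal.mul_lt_top (by norm_num)
              (ENNReal.pow_lt_top (hf.sub hgm).eLpNorm_lt_top)
      · exact (hk n).ennreal_ofReal.aemeasurable.mul (hfg.enorm.pow_const 2).comp_snd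
    have hmeas : AEMeasurable (fun x => ∫⁻ y, ENNReal.ofReal (k n x y) * ‖f y - g y‖ₑ ^ 2 ∂ν) m :=
      ((hk n).ennreal_ofReal.aemeasurable.mul
        (hfg.enorm.pow_const 2).comp_snd).lintegral_prod_right'
    filter_upwards [ae_lt_top' hmeas hfin.ne, h1 n] with x hx hx1
    refine ⟨(((hk n).comp measurable_prodMk_left).aestronglyMeasurable).smul hfg, ?_⟩
    rw [HasFiniteIntegral]
    simp only [enorm_smul, fun y => Real.enorm_of_nonneg (hk0 n x y)]
    have hcs := lintegral_mul_sq_le (μ := ν) (k := fun y => ENNReal.ofReal (k n x y))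
      (g := fun y => ‖f y - g y‖ₑ)
      ((hk n).ennreal_ofReal.comp measurable_prodMk_left).aemeasurable hfg.enorm
    rw [hx1, one_mul] at hcs
    have := hcs.trans_lt hx
    exact lt_top_iff_ne_top.2 fun h => by simp [h] at this
  have hgi : ∀ᵐ x ∂m, Integrable (fun y => k n x y • g y) ν := by
    filter_upwards [hki n] with x hx
    obtain ⟨B, hB⟩ := hgcont.bounded_above_of_compact_support hgc
    exact hx.smul_bdd B hgcont.aestronglyMeasurable (Eventually.of_forall hB)
  have hmeasA : ∀ {h : E → X}, AEStronglyMeasurable h ν →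
      AEStronglyMeasurable (fun x => ∫ y, k n x y • h y ∂ν) m := by
    intro h hh
    exact AEStronglyMeasurable.integral_prod_right'
      (f := fun p : E × E => k n p.1 p.2 • h p.2) ((hk n).aestronglyMeasurable.smul hh.comp_snd)
  have hdec : (fun x => (∫ y, k n x y • f y ∂ν) - f x) =ᵐ[m]
      fun x => ((∫ y, k n x y • (f y - g y) ∂ν) + ((∫ y, k n x y • g y ∂ν) - g x))
        + (g x - f x) := by
    filter_upwards [hfi, hgi] with x hx hx'
    have : ∫ y, k n x y • f y ∂ν =
        (∫ y, k n x y • (f y - g y) ∂ν) + ∫ y, k n x y • g y ∂ν := by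
      rw [← integral_add hx hx']
      refine integral_congr_ae (Eventually.of_forall fun y => ?_)
      simp [smul_sub]
    rw [this]
    abel
  have hfm := hf.aestronglyMeasurable.mono_measure hm
  have hgmm := hgcont.aestronglyMeasurable (μ := m)
  rw [eLpNorm_congr_ae hdec]
  calc _ ≤ eLpNorm (fun x => (∫ y, k n x y • (f y - g y) ∂ν) +
              ((∫ y, k n x y • g y ∂ν) - g x)) 2 m + eLpNorm (fun x => g x - f x) 2 m :=
        eLpNorm_add_le ((hmeasA hfg).add ((hmeasA hgcont.aestronglyMeasurable).sub hgmm))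
          (hgmm.sub hfm) (by norm_num)
    _ ≤ (eLpNorm (fun x => (∫ y, k n x y • (f y - g y) ∂ν)) 2 m +
          eLpNorm (fun x => (∫ y, k n x y • g y ∂ν) - g x) 2 m) + ε' := by
        gcongr
        exact eLpNorm_add_le (hmeasA hfg) ((hmeasA hgcont.aestronglyMeasurable).sub hgmm)
          (by norm_num)
    _ ≤ (2 * ε' + ε') + ε' := by
        gcongr
        exact hA.trans (by gcongr; exact hg)
    _ = 4 * ε' := by ring

end Kernel

/-! ### Trilinear integrals with one truncated factor -/

section Tri

variable {α : Type*} [MeasurableSpace α] {μ : Measure α}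

/-- Truncation of a real number to `[-M, M]`. -/
def clamp (M r : ℝ) : ℝ := max (-M) (min r M)

theorem abs_clamp_le {M : ℝ} (hM : 0 ≤ M) (r : ℝ) : |clamp M r| ≤ M :=
  abs_le.2 ⟨le_max_left _ _, max_le (by linarith) (min_le_right _ _)⟩

theorem clamp_of_abs_le {M r : ℝ} (h : |r| ≤ M) : clamp M r = r := by
  rw [clamp, min_eq_left (abs_le.1 h).2, max_eq_right (abs_le.1 h).1]

theorem continuous_clamp (M : ℝ) : Continuous (clamp M) := by
  unfold clamp; fun_prop

theorem aestronglyMeasurable_clamp (M : ℝ) (q : Lp ℝ 2 μ) :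
    AEStronglyMeasurable (fun x => clamp M (q x)) μ :=
  (continuous_clamp M).comp_aestronglyMeasurable (Lp.aestronglyMeasurable q)

theorem integral_mul_eq_inner (f g : Lp ℝ 2 μ) : ∫ x, f x * g x ∂μ = inner ℝ f g := by
  rw [L2.inner_def]
  exact integral_congr_ae (Eventually.of_forall fun x => by simp [mul_comm])

theorem integral_mul_eq_inner_toLp (f : Lp ℝ 2 μ) {g : α → ℝ} (hg : MemLp g 2 μ) :
    ∫ x, f x * g x ∂μ = inner ℝ f (hg.toLp g) := by
  rw [← integral_mul_eq_inner]
  refine integral_congr_ae ?_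
  filter_upwards [hg.coeFn_toLp] with x hx
  rw [hx]

theorem integrable_mul_L2 (f g : Lp ℝ 2 μ) : Integrable (fun x => f x * g x) μ :=
  (Lp.memLp f).integrable_mul (Lp.memLp g)

theorem integral_abs_mul_le (f g : Lp ℝ 2 μ) : ∫ x, |f x * g x| ∂μ ≤ ‖f‖ * ‖g‖ := by
  have h := integral_mul_norm_le_Lp_mul_Lq (μ := μ) (p := 2) (q := 2) (f := f) (g := g)
    (by constructor <;> norm_num) (by simpa using Lp.memLp f) (by simpa using Lp.memLp g)
  have hn : ∀ f : Lp ℝ 2 μ, (∫ a, ‖f a‖ ^ (2 : ℝ) ∂μ) ^ (1 / 2 : ℝ) = ‖f‖ := by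
    intro f
    have h2 : ‖f‖ ^ 2 = ∫ a, ‖f a‖ ^ (2 : ℝ) ∂μ := by
      rw [← real_inner_self_eq_norm_sq, ← integral_mul_eq_inner]
      refine integral_congr_ae (Eventually.of_forall fun x => ?_)
      simp [sq]
    rw [← h2, ← Real.sqrt_eq_rpow, Real.sqrt_sq (norm_nonneg _)]
  rw [hn, hn] at h
  simpa [abs_mul] using h

/-- `∫ a b q`, the last factor being truncated to `[-M, M]`. -/
def tri (M : ℝ) (a b q : Lp ℝ 2 μ) : ℝ := ∫ x, a x * b x * clamp M (q x) ∂μ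

theorem integrable_tri {M : ℝ} (hM : 0 ≤ M) (a b q : Lp ℝ 2 μ) :
    Integrable (fun x => a x * b x * clamp M (q x)) μ :=
  (integrable_mul_L2 a b).mul_bdd (aestronglyMeasurable_clamp M q)
    (Eventually.of_forall fun _ => abs_clamp_le hM _)

theorem tri_eq_of_abs_le {M : ℝ} {a b q : Lp ℝ 2 μ} (hq : ∀ᵐ x ∂μ, |q x| ≤ M) :
    tri M a b q = ∫ x, a x * b x * q x ∂μ := by
  refine integral_congr_ae ?_
  filter_upwards [hq] with x hx
  rw [clamp_of_abs_le hx]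

theorem tri_comm (M : ℝ) (a b q : Lp ℝ 2 μ) : tri M a b q = tri M b a q := by
  simp only [tri, mul_comm (a _)]

/-- If two factors are bounded by M, the truncation is invisible on either of them and can be moved
from one to the other. -/
theorem tri_swap {M : ℝ} {a b q : Lp ℝ 2 μ} (hb : ∀ᵐ x ∂μ, |b x| ≤ M)
    (hq : ∀ᵐ x ∂μ, |q x| ≤ M) : tri M a b q = tri M a q b := by
  rw [tri_eq_of_abs_le hb, tri_eq_of_abs_le hq]
  refine integral_congr_ae (Eventually.of_forall fun x => by ring)

theorem tri_sub_left {M : ℝ} (hM : 0 ≤ M) (a a' b q : Lp ℝ 2 μ) :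
    tri M (a - a') b q = tri M a b q - tri M a' b q := by
  rw [tri, tri, tri, ← integral_sub (integrable_tri hM a b q) (integrable_tri hM a' b q)]
  refine integral_congr_ae ?_
  filter_upwards [Lp.coeFn_sub a a'] with x hx
  rw [hx, Pi.sub_apply]; ring

theorem tri_sub_mid {M : ℝ} (hM : 0 ≤ M) (a b b' q : Lp ℝ 2 μ) :
    tri M a (b - b') q = tri M a b q - tri M a b' q := by
  rw [tri_comm, tri_sub_left hM, tri_comm M b, tri_comm M b']

theorem abs_tri_le {M : ℝ} (hM : 0 ≤ M) (a b q : Lp ℝ 2 μ) :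
    |tri M a b q| ≤ M * (‖a‖ * ‖b‖) := by
  calc |tri M a b q| ≤ ∫ x, |a x * b x| * M ∂μ := by
        rw [tri, ← Real.norm_eq_abs]
        refine norm_integral_le_of_norm_le ((integrable_mul_L2 a b).abs.mul_const M)
          (Eventually.of_forall fun x => ?_)
        rw [norm_mul]
        exact mul_le_mul_of_nonneg_left (abs_clamp_le hM _) (abs_nonneg _)
    _ = M * ∫ x, |a x * b x| ∂μ := by rw [integral_mul_const, mul_comm]
    _ ≤ _ := mul_le_mul_of_nonneg_left (integral_abs_mul_le a b) hM

/-- The truncated factor is bounded, so along an almost everywhere convergent subsequence M |a b| is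
an integrable majorant. -/
theorem tendsto_tri_right {M : ℝ} (hM : 0 ≤ M) (a b : Lp ℝ 2 μ) {q : ℕ → Lp ℝ 2 μ}
    {q' : Lp ℝ 2 μ} (hq : Tendsto q atTop (𝓝 q')) :
    Tendsto (fun n => tri M a b (q n)) atTop (𝓝 (tri M a b q')) := by
  refine tendsto_of_subseq_tendsto fun ns hns => ?_
  have h1 : TendstoInMeasure μ (fun n => (q (ns n) : α → ℝ)) atTop q' :=
    tendstoInMeasure_of_tendsto_Lp (hq.comp hns)
  obtain ⟨ms, -, hms⟩ := h1.exists_seq_tendsto_ae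
  refine ⟨ms, ?_⟩
  refine tendsto_integral_of_dominated_convergence (fun x => |a x * b x| * M)
    (fun n => (integrable_tri hM a b _).aestronglyMeasurable)
    ((integrable_mul_L2 a b).abs.mul_const M)
    (fun n => Eventually.of_forall fun x => ?_) ?_
  · rw [norm_mul]
    exact mul_le_mul_of_nonneg_left (abs_clamp_le hM _) (abs_nonneg _)
  · filter_upwards [hms] with x hx
    exact tendsto_const_nhds.mul (((continuous_clamp M).tendsto _).comp hx)

/-- This is the purpose of the truncation: a product of three L² functions need not be integrable,
while the truncated form is jointly continuous. Identities therefore pass to L² limits, and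
measurability in time comes for free. -/
theorem continuous_tri {M : ℝ} (hM : 0 ≤ M) :
    Continuous (fun p : Lp ℝ 2 μ × Lp ℝ 2 μ × Lp ℝ 2 μ => tri M p.1 p.2.1 p.2.2) := by
  refine continuous_iff_seqContinuous.2 fun p p' hp => ?_
  have ha : Tendsto (fun n => (p n).1) atTop (𝓝 p'.1) := (continuous_fst.tendsto _).comp hp
  have hb : Tendsto (fun n => (p n).2.1) atTop (𝓝 p'.2.1) :=
    ((continuous_fst.comp continuous_snd).tendsto _).comp hp
  have hq : Tendsto (fun n => (p n).2.2) atTop (𝓝 p'.2.2) :=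
    ((continuous_snd.comp continuous_snd).tendsto _).comp hp
  have h1 : Tendsto (fun n => tri M ((p n).1 - p'.1) (p n).2.1 (p n).2.2) atTop (𝓝 0) := by
    refine squeeze_zero_norm (fun n => abs_tri_le hM _ _ _) ?_
    have := ((ha.sub_const p'.1).norm.mul hb.norm).const_mul M
    simpa using this
  have h2 : Tendsto (fun n => tri M p'.1 ((p n).2.1 - p'.2.1) (p n).2.2) atTop (𝓝 0) := by
    refine squeeze_zero_norm (fun n => abs_tri_le hM _ _ _) ?_
    have := ((tendsto_const_nhds (x := ‖p'.1‖)).mul (hb.sub_const p'.2.1).norm).const_mul M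
    simpa using this
  have h3 := tendsto_tri_right hM p'.1 p'.2.1 hq
  have h := (h1.add h2).add h3
  simp only [zero_add] at h
  refine h.congr fun n => ?_
  rw [tri_sub_left hM, tri_sub_mid hM]
  simp

theorem tendsto_tri {ι : Type*} {l : Filter ι} {M : ℝ} (hM : 0 ≤ M) {a b q : ι → Lp ℝ 2 μ}
    {a' b' q' : Lp ℝ 2 μ} (ha : Tendsto a l (𝓝 a')) (hb : Tendsto b l (𝓝 b'))
    (hq : Tendsto q l (𝓝 q')) :
    Tendsto (fun n => tri M (a n) (b n) (q n)) l (𝓝 (tri M a' b' q')) :=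
  ((continuous_tri hM).tendsto (a', b', q')).comp
    (ha.prodMk_nhds (hb.prodMk_nhds hq))

theorem aestronglyMeasurable_tri {β : Type*} [MeasurableSpace β] {ν : Measure β} {M : ℝ}
    (hM : 0 ≤ M) {a b q : β → Lp ℝ 2 μ} (ha : AEStronglyMeasurable a ν)
    (hb : AEStronglyMeasurable b ν) (hq : AEStronglyMeasurable q ν) :
    AEStronglyMeasurable (fun s => tri M (a s) (b s) (q s)) ν :=
  (continuous_tri hM).comp_aestronglyMeasurable (ha.prodMk (hb.prodMk hq))

theorem memLp_bdd_mul {b f : α → ℝ} {C : ℝ} (hf : MemLp f 2 μ) (hb : AEStronglyMeasurable b μ)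
    (hC : ∀ᵐ x ∂μ, |b x| ≤ C) : MemLp (fun x => b x * f x) 2 μ := by
  refine hf.of_le_mul (c := C) (hb.mul hf.aestronglyMeasurable) ?_
  filter_upwards [hC] with x hx
  rw [norm_mul]
  exact mul_le_mul_of_nonneg_right hx (norm_nonneg _)

/-- Multiplication by a bounded measurable function, on `L²`. -/
def mulOp (b : α → ℝ) (C : ℝ) (hb : AEStronglyMeasurable b μ) (hC : ∀ᵐ x ∂μ, |b x| ≤ C) :
    Lp ℝ 2 μ →L[ℝ] Lp ℝ 2 μ :=
  LinearMap.mkContinuous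
    { toFun := fun f => (memLp_bdd_mul (Lp.memLp f) hb hC).toLp (fun x => b x * f x)
      map_add' := fun f g => by
        refine Lp.ext ?_
        refine (MemLp.coeFn_toLp _).trans ?_
        refine EventuallyEq.trans ?_ (Lp.coeFn_add _ _).symm
        filter_upwards [Lp.coeFn_add f g, MemLp.coeFn_toLp (memLp_bdd_mul (Lp.memLp f) hb hC),
          MemLp.coeFn_toLp (memLp_bdd_mul (Lp.memLp g) hb hC)] with x h1 h2 h3
        rw [Pi.add_apply, h1, h2, h3, Pi.add_apply, mul_add]
      map_smul' := fun c f => by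
        refine Lp.ext ?_
        refine (MemLp.coeFn_toLp _).trans ?_
        refine EventuallyEq.trans ?_ (Lp.coeFn_smul _ _).symm
        filter_upwards [Lp.coeFn_smul c f,
          MemLp.coeFn_toLp (memLp_bdd_mul (Lp.memLp f) hb hC)] with x h1 h2
        rw [RingHom.id_apply, Pi.smul_apply, h1, h2, Pi.smul_apply, smul_eq_mul, smul_eq_mul]
        ring } |C| (fun f => by
      refine Lp.norm_le_mul_norm_of_ae_le_mul ?_
      filter_upwards [hC, MemLp.coeFn_toLp (memLp_bdd_mul (Lp.memLp f) hb hC)] with x h1 h2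
      change ‖(MemLp.toLp _ (memLp_bdd_mul (Lp.memLp f) hb hC) : α → ℝ) x‖ ≤ _
      rw [h2, norm_mul]
      exact mul_le_mul_of_nonneg_right (h1.trans (le_abs_self C)) (norm_nonneg _))

theorem mulOp_coeFn {b : α → ℝ} {C : ℝ} (hb : AEStronglyMeasurable b μ)
    (hC : ∀ᵐ x ∂μ, |b x| ≤ C) (f : Lp ℝ 2 μ) :
    mulOp b C hb hC f =ᵐ[μ] fun x => b x * f x :=
  MemLp.coeFn_toLp (memLp_bdd_mul (Lp.memLp f) hb hC)

theorem norm_mulOp_le {b : α → ℝ} {C : ℝ} (hb : AEStronglyMeasurable b μ)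
    (hC : ∀ᵐ x ∂μ, |b x| ≤ C) (f : Lp ℝ 2 μ) :
    ‖mulOp b C hb hC f‖ ≤ C * ‖f‖ := by
  refine Lp.norm_le_mul_norm_of_ae_le_mul ?_
  filter_upwards [hC, mulOp_coeFn hb hC f] with x h1 h2
  rw [h2, norm_mul]
  exact mul_le_mul_of_nonneg_right h1 (norm_nonneg _)

end Tri

/-! ### Calculus of classical partial derivatives -/

section PartialDeriv

variable {d : ℕ}

theorem fderiv_apply_eq_sum (φ : Eu d → ℝ) (x h : Eu d) :
    fderiv ℝ φ x h = ∑ j, h j * partialDeriv j φ x := by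
  have : h = ∑ j, h j • EuclideanSpace.single j (1 : ℝ) := by
    ext i
    simp [Finset.sum_apply, Pi.single_apply]
  conv_lhs => rw [this]
  simp [map_sum, partialDeriv]

theorem contDiff_partialDeriv {φ : Eu d → ℝ} (hφ : ContDiff ℝ ∞ φ) (j : Fin d) :
    ContDiff ℝ ∞ (partialDeriv j φ) :=
  (hφ.fderiv_right (m := ∞) (by simp)).clm_apply contDiff_const

theorem support_partialDeriv_subset (φ : Eu d → ℝ) (j : Fin d) :
    tsupport (partialDeriv j φ) ⊆ tsupport φ := by
  refine (closure_mono fun x hx => ?_).trans (tsupport_fderiv_subset ℝ)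
  intro h
  apply hx
  simp [partialDeriv, h]

theorem hasCompactSupport_partialDeriv {φ : Eu d → ℝ} (hφ : HasCompactSupport φ) (j : Fin d) :
    HasCompactSupport (partialDeriv j φ) :=
  hφ.mono' ((subset_tsupport _).trans (support_partialDeriv_subset φ j))

theorem IsTest.partialDeriv {Ω : Set (Eu d)} {φ : Eu d → ℝ} (hφ : IsTest Ω φ) (j : Fin d) :
    IsTest Ω (partialDeriv j φ) :=
  ⟨contDiff_partialDeriv hφ.1 j, hasCompactSupport_partialDeriv hφ.2.1 j,
    (support_partialDeriv_subset φ j).trans hφ.2.2⟩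

theorem partialDeriv_const_sub {χ : Eu d → ℝ} (hχ : Differentiable ℝ χ) (z y : Eu d)
    (j : Fin d) : partialDeriv j (fun y => χ (z - y)) y = -partialDeriv j χ (z - y) := by
  have := ((hχ (z - y)).hasFDerivAt.comp y ((hasFDerivAt_id y).const_sub z)).fderiv
  rw [partialDeriv]
  change fderiv ℝ (χ ∘ HSub.hSub z) y _ = _
  rw [this]
  simp [partialDeriv]

theorem partialDeriv_add {f g : Eu d → ℝ} {x : Eu d} (hf : DifferentiableAt ℝ f x)
    (hg : DifferentiableAt ℝ g x) (j : Fin d) :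
    partialDeriv j (fun y => f y + g y) x = partialDeriv j f x + partialDeriv j g x := by
  simp only [partialDeriv]
  rw [fderiv_fun_add hf hg]; rfl

theorem partialDeriv_sub {f g : Eu d → ℝ} {x : Eu d} (hf : DifferentiableAt ℝ f x)
    (hg : DifferentiableAt ℝ g x) (j : Fin d) :
    partialDeriv j (fun y => f y - g y) x = partialDeriv j f x - partialDeriv j g x := by
  simp only [partialDeriv]
  rw [fderiv_fun_sub hf hg]; rfl

theorem partialDeriv_neg (f : Eu d → ℝ) (x : Eu d) (j : Fin d) :
    partialDeriv j (fun y => - f y) x = - partialDeriv j f x := by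
  simp only [partialDeriv]
  rw [fderiv_fun_neg]; rfl

theorem partialDeriv_sum {ι : Type*} {s : Finset ι} {f : ι → Eu d → ℝ} {x : Eu d}
    (hf : ∀ i ∈ s, DifferentiableAt ℝ (f i) x) (j : Fin d) :
    partialDeriv j (fun y => ∑ i ∈ s, f i y) x = ∑ i ∈ s, partialDeriv j (f i) x := by
  simp only [partialDeriv]
  rw [fderiv_fun_sum hf]
  simp

theorem partialDeriv_mul {f g : Eu d → ℝ} {x : Eu d} (hf : DifferentiableAt ℝ f x)
    (hg : DifferentiableAt ℝ g x) (j : Fin d) :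
    partialDeriv j (fun y => f y * g y) x
      = f x * partialDeriv j g x + partialDeriv j f x * g x := by
  simp only [partialDeriv]
  rw [fderiv_fun_mul hf hg]
  simp [mul_comm]

theorem partialDeriv_comp {f : Eu d → ℝ} {Φ : Eu d → Eu d} {x : Eu d}
    (hf : DifferentiableAt ℝ f (Φ x)) (hΦ : DifferentiableAt ℝ Φ x) (j : Fin d) :
    partialDeriv j (fun y => f (Φ y)) x
      = ∑ l, partialDeriv l f (Φ x) * partialDeriv j (fun y => Φ y l) x := by
  have h1 : fderiv ℝ (fun y => f (Φ y)) x = (fderiv ℝ f (Φ x)).comp (fderiv ℝ Φ x) :=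
    fderiv_comp x hf hΦ
  have h2 : ∀ l, partialDeriv j (fun y => Φ y l) x
      = fderiv ℝ Φ x (EuclideanSpace.single j 1) l := by
    intro l
    have := ((EuclideanSpace.proj l : Eu d →L[ℝ] ℝ).hasFDerivAt.comp x hΦ.hasFDerivAt).fderiv
    rw [partialDeriv]
    change fderiv ℝ (⇑(EuclideanSpace.proj l : Eu d →L[ℝ] ℝ) ∘ Φ) x _ = _
    rw [this]
    rfl
  rw [partialDeriv, h1, ContinuousLinearMap.comp_apply, fderiv_apply_eq_sum]
  refine Finset.sum_congr rfl fun l _ => ?_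
  rw [h2, mul_comm]

theorem partialDeriv_symm {f : Eu d → ℝ} (hf : ContDiff ℝ ∞ f) (i j : Fin d) (x : Eu d) :
    partialDeriv i (partialDeriv j f) x = partialDeriv j (partialDeriv i f) x := by
  have hd : DifferentiableAt ℝ (fderiv ℝ f) x :=
    ((hf.fderiv_right (m := ∞) (by simp)).differentiable (by simp)) x
  have h : ∀ i j, partialDeriv i (partialDeriv j f) x
      = fderiv ℝ (fderiv ℝ f) x (EuclideanSpace.single i 1) (EuclideanSpace.single j 1) := by
    intro i j
    change fderiv ℝ (fun y => fderiv ℝ f y (EuclideanSpace.single j 1)) x _ = _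
    rw [fderiv_clm_apply hd (differentiableAt_const _)]
    simp
  rw [h, h]
  have hs : IsSymmSndFDerivAt ℝ f x :=
    hf.contDiffAt.isSymmSndFDerivAt (by simpa using ENat.LEInfty.out)
  exact hs _ _

end PartialDeriv

/-! ### Translated kernels as a smooth L²-valued map -/

section Translate

variable {d : ℕ} {Ω : Set (Eu d)}

open Classical in
/-- The function `y ↦ χ (z - y)` as an element of `L²(Ω)`. -/
def reflTranslate (Ω : Set (Eu d)) (χ : Eu d → ℝ) (z : Eu d) : L2 Ω :=
  if h : MemLp (fun y => χ (z - y)) 2 (volume.restrict Ω) then h.toLp _ else 0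

theorem memLp_comp_sub {χ : Eu d → ℝ} (hχ : Continuous χ) (hc : HasCompactSupport χ) (z : Eu d) :
    MemLp (fun y => χ (z - y)) 2 (volume.restrict Ω) := by
  refine MemLp.restrict _ ?_
  refine (hχ.comp (continuous_const.sub continuous_id)).memLp_of_hasCompactSupport ?_
  exact hc.comp_homeomorph (Homeomorph.subLeft z)

theorem coeFn_reflTranslate {χ : Eu d → ℝ} (hχ : Continuous χ) (hc : HasCompactSupport χ)
    (z : Eu d) : reflTranslate Ω χ z =ᵐ[volume.restrict Ω] fun y => χ (z - y) := by
  rw [reflTranslate, dif_pos (memLp_comp_sub hχ hc z)]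
  exact MemLp.coeFn_toLp _

theorem inner_reflTranslate {χ : Eu d → ℝ} (hχ : Continuous χ) (hc : HasCompactSupport χ)
    (z : Eu d) (f : L2 Ω) : inner ℝ (reflTranslate Ω χ z) f = ∫ y in Ω, χ (z - y) * f y := by
  rw [← integral_mul_eq_inner]
  refine integral_congr_ae ?_
  filter_upwards [coeFn_reflTranslate hχ hc z] with y hy
  rw [hy]

/-- The gradient is continuous with compact support, hence uniformly continuous, so the Taylor
remainder is uniform in the base point. -/
theorem exists_uniform_taylor {χ : Eu d → ℝ} (hχ : ContDiff ℝ ∞ χ) (hc : HasCompactSupport χ)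
    {ε : ℝ} (hε : 0 < ε) : ∃ δ > 0, ∀ a h : Eu d, ‖h‖ < δ →
      |χ (a + h) - χ a - ∑ j, h j * partialDeriv j χ a| ≤ ε * ‖h‖ := by
  have huc : UniformContinuous (fderiv ℝ χ) :=
    (hc.fderiv ℝ).uniformContinuous_of_continuous (hχ.continuous_fderiv (by simp))
  obtain ⟨δ, hδ, h⟩ := Metric.uniformContinuous_iff.1 huc ε hε
  refine ⟨δ, hδ, fun a k hk => ?_⟩
  have := (convex_ball a δ).norm_image_sub_le_of_norm_fderiv_le' (𝕜 := ℝ) (f := χ)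
    (φ := fderiv ℝ χ a) (C := ε) (x := a) (y := a + k)
    (fun x _ => (hχ.differentiable (by simp)) x)
    (fun x hx => by
      have := h (Metric.mem_ball.1 hx)
      rw [dist_eq_norm] at this
      exact this.le) (Metric.mem_ball_self hδ) (by simpa [Metric.mem_ball, dist_eq_norm] using hk)
  rw [add_sub_cancel_left, fderiv_apply_eq_sum] at this
  exact this

/-- A uniform Taylor remainder is an L² remainder on a set of finite measure. Every mollification
below is an inner product with this L²-valued map and inherits its regularity. -/
theorem hasFDerivAt_reflTranslate [IsFiniteMeasure (volume.restrict Ω : Measure (Eu d))]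
    {χ : Eu d → ℝ} (hχ : ContDiff ℝ ∞ χ) (hc : HasCompactSupport χ) (z : Eu d) :
    HasFDerivAt (reflTranslate Ω χ)
      (∑ j, (EuclideanSpace.proj j : Eu d →L[ℝ] ℝ).smulRight
        (reflTranslate Ω (partialDeriv j χ) z)) z := by
  rw [hasFDerivAt_iff_isLittleO_nhds_zero, Asymptotics.isLittleO_iff]
  intro c hc0
  set V := (volume.restrict Ω : Measure (Eu d)).real univ ^ (1 / 2 : ℝ) with hV
  have hV0 : 0 ≤ V := by positivity
  -- V = |Ω|^{1/2} is the price for passing from the sup norm to L²; V + 1 avoids dividing by zero.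
  obtain ⟨δ, hδ, hT⟩ := exists_uniform_taylor hχ hc (ε := c / (V + 1)) (by positivity)
  filter_upwards [Metric.ball_mem_nhds (0 : Eu d) hδ] with h hh
  rw [mem_ball_zero_iff] at hh
  have hb : ∀ᵐ y ∂(volume.restrict Ω : Measure (Eu d)),
      ‖(reflTranslate Ω χ (z + h) - reflTranslate Ω χ z -
      (∑ j, (EuclideanSpace.proj j : Eu d →L[ℝ] ℝ).smulRight
        (reflTranslate Ω (partialDeriv j χ) z)) h : L2 Ω) y‖ ≤ c / (V + 1) * ‖h‖ := by
    have e1 : (∑ j, (EuclideanSpace.proj j : Eu d →L[ℝ] ℝ).smulRight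
        (reflTranslate Ω (partialDeriv j χ) z)) h
        = ∑ j, h j • reflTranslate Ω (partialDeriv j χ) z := by
      simp
    rw [e1]
    have e2 : ∀ j, ∀ᵐ y ∂(volume.restrict Ω : Measure (Eu d)),
        (h j • reflTranslate Ω (partialDeriv j χ) z : L2 Ω) y
          = h j * partialDeriv j χ (z - y) := by
      intro j
      filter_upwards [Lp.coeFn_smul (h j) (reflTranslate Ω (partialDeriv j χ) z),
        coeFn_reflTranslate (Ω := Ω) (contDiff_partialDeriv hχ j).continuous
          (hasCompactSupport_partialDeriv hc j) z] with y h1 h2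
      rw [h1, Pi.smul_apply, h2, smul_eq_mul]
    have e3 : ∀ᵐ y ∂(volume.restrict Ω : Measure (Eu d)),
        (∑ j, h j • reflTranslate Ω (partialDeriv j χ) z : L2 Ω) y
          = ∑ j, h j * partialDeriv j χ (z - y) := by
      filter_upwards [Lp.coeFn_finsetSum Finset.univ
        (fun j => h j • reflTranslate Ω (partialDeriv j χ) z), ae_all_iff.2 e2] with y h1 h2
      rw [h1, Finset.sum_apply]
      exact Finset.sum_congr rfl fun j _ => h2 j
    filter_upwards [e3, coeFn_reflTranslate (Ω := Ω) hχ.continuous hc z,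
      coeFn_reflTranslate (Ω := Ω) hχ.continuous hc (z + h),
      Lp.coeFn_sub (reflTranslate Ω χ (z + h) - reflTranslate Ω χ z)
        (∑ j, h j • reflTranslate Ω (partialDeriv j χ) z),
      Lp.coeFn_sub (reflTranslate Ω χ (z + h)) (reflTranslate Ω χ z)] with y h1 h2 h3 h4 h5
    rw [h4, Pi.sub_apply, h5, Pi.sub_apply, h1, h2, h3]
    have := hT (z - y) h hh
    rwa [show z - y + h = z + h - y by abel] at this
  refine (Lp.norm_le_of_ae_bound (by positivity) hb).trans ?_
  have : ((measureUnivNNReal (volume.restrict Ω : Measure (Eu d)) : ℝ) ^ (ENNReal.toReal 2)⁻¹) = V := by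
    simp [hV, measureUnivNNReal, Measure.real]; rfl
  rw [this]
  calc V * (c / (V + 1) * ‖h‖) = (V / (V + 1)) * (c * ‖h‖) := by ring
    _ ≤ 1 * (c * ‖h‖) := by
      gcongr
      rw [div_le_one (by positivity)]; linarith
    _ = _ := one_mul _

/-- The derivative is assembled from maps of the same kind with χ replaced by its partial
derivatives, so one induction, over all χ at once, suffices. -/
theorem contDiff_reflTranslate [IsFiniteMeasure (volume.restrict Ω : Measure (Eu d))]
    {χ : Eu d → ℝ} (hχ : ContDiff ℝ ∞ χ) (hc : HasCompactSupport χ) :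
    ContDiff ℝ ∞ (reflTranslate Ω χ) := by
  rw [contDiff_infty]
  intro n
  induction n generalizing χ with
  | zero =>
    exact contDiff_zero.2 (continuous_iff_continuousAt.2 fun z =>
      (hasFDerivAt_reflTranslate hχ hc z).continuousAt)
  | succ n ih =>
    push_cast
    rw [contDiff_succ_iff_fderiv]
    refine ⟨fun z => (hasFDerivAt_reflTranslate hχ hc z).differentiableAt, by simp, ?_⟩
    have : fderiv ℝ (reflTranslate Ω χ) = fun z =>
        ∑ j, (EuclideanSpace.proj j : Eu d →L[ℝ] ℝ).smulRight
          (reflTranslate Ω (partialDeriv j χ) z) :=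
      funext fun z => (hasFDerivAt_reflTranslate hχ hc z).fderiv
    rw [this]
    refine ContDiff.sum fun j _ => ?_
    exact contDiff_const.smulRight
      (ih (contDiff_partialDeriv hχ j) (hasCompactSupport_partialDeriv hc j))

theorem partialDeriv_inner_reflTranslate [IsFiniteMeasure (volume.restrict Ω : Measure (Eu d))]
    {χ : Eu d → ℝ} (hχ : ContDiff ℝ ∞ χ) (hc : HasCompactSupport χ) (f : L2 Ω) (z : Eu d)
    (j : Fin d) :
    partialDeriv j (fun z => inner ℝ (reflTranslate Ω χ z) f) z
      = inner ℝ (reflTranslate Ω (partialDeriv j χ) z) f := by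
  have h := (hasFDerivAt_reflTranslate (Ω := Ω) hχ hc z).inner ℝ (hasFDerivAt_const f z)
  rw [partialDeriv, h.fderiv]
  simp [fderivInnerCLM_apply]

end Translate

/-! ### Weak derivatives, solenoidal closures and zero traces -/

section WeakDeriv

variable {d : ℕ} {Ω : Set (Eu d)}

theorem memLp_of_compact {χ : Eu d → ℝ} (hχ : Continuous χ) (hc : HasCompactSupport χ) :
    MemLp χ 2 (volume.restrict Ω) :=
  (hχ.memLp_of_hasCompactSupport hc).restrict _

theorem IsTest.memLp {φ : Eu d → ℝ} (hφ : IsTest Ω φ) : MemLp φ 2 (volume.restrict Ω) :=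
  memLp_of_compact hφ.1.continuous hφ.2.1

/-- The fundamental lemma of the calculus of variations. It identifies `weakDeriv`, defined by
choice, with any weak derivative at hand. -/
theorem HasWeakDeriv.unique (hΩ : IsOpen Ω) {j : Fin d} {f g g' : L2 Ω}
    (h : HasWeakDeriv Ω j f g) (h' : HasWeakDeriv Ω j f g') : g = g' := by
  have hloc : ∀ g : L2 Ω, LocallyIntegrableOn g Ω volume := fun g =>
    locallyIntegrableOn_of_locallyIntegrable_restrict
      ((Lp.memLp g).locallyIntegrable (by norm_num))
  have key : ∀ᵐ x ∂volume, x ∈ Ω → (g x - g' x) = 0 := by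
    refine hΩ.ae_eq_zero_of_integral_contDiff_smul_eq_zero ((hloc g).sub (hloc g')) ?_
    intro φ h1 h2 h3
    have hφ : IsTest Ω φ := ⟨h1, h2, h3⟩
    have hi : ∀ g : L2 Ω, Integrable (fun x => g x * φ x) (volume.restrict Ω) := fun g =>
      (Lp.memLp g).integrable_mul hφ.memLp
    have e : ∫ x, φ x • (g x - g' x) = ∫ x in Ω, (g x * φ x - g' x * φ x) := by
      rw [← setIntegral_eq_integral_of_forall_compl_eq_zero (s := Ω)]
      · refine integral_congr_ae (Eventually.of_forall fun x => ?_)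
        simp only [smul_eq_mul]; ring
      · intro x hx
        have : φ x = 0 := by
          by_contra hne
          exact hx (h3 (subset_tsupport _ hne))
        simp [this]
    rw [e, integral_sub (hi g) (hi g')]
    have a := h φ hφ
    have b := h' φ hφ
    linarith
  refine Lp.ext ?_
  filter_upwards [ae_restrict_of_ae key, ae_restrict_mem hΩ.measurableSet] with x hx hxΩ
  linarith [hx hxΩ]

theorem weakDeriv_eq (hΩ : IsOpen Ω) {j : Fin d} {f g : L2 Ω} (h : HasWeakDeriv Ω j f g) :
    weakDeriv Ω j f = g := by
  have hex : ∃ g, HasWeakDeriv Ω j f g := ⟨g, h⟩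
  rw [weakDeriv, dif_pos hex]
  exact hex.choose_spec.unique hΩ h

/-- `g = ∂_j f` tested against all of `C_c^∞(ℝ^d)`: the extensions by zero are related by
`∂_j`. -/
def HasZeroWeakDeriv (Ω : Set (Eu d)) (j : Fin d) (f g : L2 Ω) : Prop :=
  ∀ φ : Eu d → ℝ, ContDiff ℝ ∞ φ → HasCompactSupport φ →
    ∫ x in Ω, f x * partialDeriv j φ x = - ∫ x in Ω, g x * φ x

theorem HasZeroWeakDeriv.hasWeakDeriv {j : Fin d} {f g : L2 Ω} (h : HasZeroWeakDeriv Ω j f g) :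
    HasWeakDeriv Ω j f g := fun φ hφ => h φ hφ.1 hφ.2.1

theorem integral_test_mul_partialDeriv {φ χ : Eu d → ℝ} (hφ : IsTest Ω φ)
    (hχ : ContDiff ℝ ∞ χ) (j : Fin d) :
    ∫ x in Ω, φ x * partialDeriv j χ x = - ∫ x in Ω, partialDeriv j φ x * χ x := by
  have hz : ∀ {ψ : Eu d → ℝ}, IsTest Ω ψ → ∀ x ∉ Ω, ψ x = 0 := by
    intro ψ hψ x hx
    by_contra hne
    exact hx (hψ.2.2 (subset_tsupport _ hne))
  rw [setIntegral_eq_integral_of_forall_compl_eq_zero fun x hx => by rw [hz hφ x hx, zero_mul],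
    setIntegral_eq_integral_of_forall_compl_eq_zero fun x hx => by
      rw [hz (hφ.partialDeriv j) x hx, zero_mul]]
  have hc : ∀ {a b : Eu d → ℝ}, Continuous a → HasCompactSupport a → Continuous b →
      Integrable (fun x => a x * b x) volume := by
    intro a b ha hac hb
    exact (ha.mul hb).integrable_of_hasCompactSupport hac.mul_right
  refine integral_mul_fderiv_eq_neg_fderiv_mul_of_integrable ?_ ?_ ?_
    (fun x _ => hφ.1.differentiable (by simp) x) (fun x _ => hχ.differentiable (by simp) x)
  · exact hc (hφ.partialDeriv j).1.continuous (hφ.partialDeriv j).2.1 hχ.continuous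
  · exact hc hφ.1.continuous hφ.2.1 (contDiff_partialDeriv hχ j).continuous
  · exact hc hφ.1.continuous hφ.2.1 hχ.continuous

theorem integral_congr_mul_ae {f : L2 Ω} {φ : Eu d → ℝ} (h : f =ᵐ[volume.restrict Ω] φ)
    (χ : Eu d → ℝ) : ∫ x in Ω, f x * χ x = ∫ x in Ω, φ x * χ x := by
  refine integral_congr_ae ?_
  filter_upwards [h] with x hx
  rw [hx]

theorem IsSolenoidalTest.sum_integral {φ : Fin d → Eu d → ℝ} (hφ : IsSolenoidalTest Ω φ)
    {χ : Eu d → ℝ} (hχ : ContDiff ℝ ∞ χ) :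
    ∑ i, ∫ x in Ω, φ i x * partialDeriv i χ x = 0 := by
  simp only [fun i => integral_test_mul_partialDeriv (hφ.1 i) hχ i]
  rw [Finset.sum_neg_distrib, ← integral_finsetSum]
  · rw [neg_eq_zero]
    refine setIntegral_eq_zero_of_forall_eq_zero fun x hx => ?_
    rw [← Finset.sum_mul, hφ.2 x hx, zero_mul]
  · intro i _
    have h := (hφ.1 i).partialDeriv i
    exact ((h.1.continuous.mul hχ.continuous).integrable_of_hasCompactSupport
      h.2.1.mul_right).restrict

/-- Limits of solenoidal test fields are orthogonal to ∇χ even when χ does not vanish on the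
boundary: their normal trace is zero. Equivalently, the extension by zero is divergence free in the
whole space. -/
theorem L2Div.sum_inner_eq_zero {v : Fin d → L2 Ω} (hv : v ∈ L2Div Ω)
    {χ : Eu d → ℝ} (hχ : ContDiff ℝ ∞ χ) (hc : HasCompactSupport χ) :
    ∑ i, ∫ x in Ω, v i x * partialDeriv i χ x = 0 := by
  have hm : ∀ i, MemLp (partialDeriv i χ) 2 (volume.restrict Ω) := fun i =>
    memLp_of_compact (contDiff_partialDeriv hχ i).continuous (hasCompactSupport_partialDeriv hc i)
  simp only [fun i => integral_mul_eq_inner_toLp (v i) (hm i)]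
  refine closure_minimal (t := {v : Fin d → L2 Ω | ∑ i, inner ℝ (v i) ((hm i).toLp _) = 0})
    ?_ (isClosed_eq (by fun_prop) continuous_const) hv
  rintro w ⟨φ, hφ, hw⟩
  simp only [mem_ofPred_eq, ← fun i => integral_mul_eq_inner_toLp (w i) (hm i)]
  simp only [fun i => integral_congr_mul_ae (hw i)]
  exact hφ.sum_integral hχ

theorem isClosed_L2Div : IsClosed (L2Div Ω) := isClosed_closure

theorem W12ZeroDiv.subset_L2Div {v : Fin d → L2 Ω} (hv : v ∈ W12ZeroDiv Ω) : v ∈ L2Div Ω := by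
  obtain ⟨G, hG⟩ := hv
  refine closure_minimal (t := Prod.fst ⁻¹' (L2Div Ω)) ?_
    (isClosed_L2Div.preimage continuous_fst) hG
  rintro p ⟨φ, hφ, h1, -⟩
  exact subset_closure ⟨φ, hφ, h1⟩

/-- For compactly supported fields the integration by parts has no boundary term, whatever χ is;
both sides are continuous in L², so this survives the closure and encodes the zero trace. -/
theorem hasZeroWeakDeriv_of_mem_closure {v : Fin d → L2 Ω} {G : Fin d → Fin d → L2 Ω}
    (hG : (v, G) ∈ closure {p : (Fin d → L2 Ω) × (Fin d → Fin d → L2 Ω) |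
      ∃ φ, IsSolenoidalTest Ω φ ∧ (∀ i, p.1 i =ᵐ[volume.restrict Ω] φ i) ∧
        ∀ i j, p.2 i j =ᵐ[volume.restrict Ω] partialDeriv j (φ i)}) (i j : Fin d) :
    HasZeroWeakDeriv Ω j (v i) (G i j) := by
  intro χ hχ hc
  have hm : MemLp (partialDeriv j χ) 2 (volume.restrict Ω) :=
    memLp_of_compact (contDiff_partialDeriv hχ j).continuous (hasCompactSupport_partialDeriv hc j)
  have hm' : MemLp χ 2 (volume.restrict Ω) := memLp_of_compact hχ.continuous hc
  rw [integral_mul_eq_inner_toLp (v i) hm, integral_mul_eq_inner_toLp (G i j) hm']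
  refine closure_minimal (t := {p : (Fin d → L2 Ω) × (Fin d → Fin d → L2 Ω) |
    inner ℝ (p.1 i) (hm.toLp _) = - inner ℝ (p.2 i j) (hm'.toLp _)})
    ?_ (isClosed_eq (by fun_prop) (by fun_prop)) hG
  rintro p ⟨φ, hφ, h1, h2⟩
  rw [mem_ofPred_eq, ← integral_mul_eq_inner_toLp (p.1 i) hm,
    ← integral_mul_eq_inner_toLp (p.2 i j) hm', integral_congr_mul_ae (h1 i),
    integral_congr_mul_ae (h2 i j)]
  exact integral_test_mul_partialDeriv (hφ.1 i) hχ j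

end WeakDeriv

/-! ### Mollification of the extension by zero -/

section Moll

variable {d : ℕ} {Ω : Set (Eu d)}

/-- Mollification of the extension by zero of `f ∈ L²(Ω)`. -/
def moll (φ : ContDiffBump (0 : Eu d)) (f : L2 Ω) (z : Eu d) : ℝ :=
  inner ℝ (reflTranslate Ω (φ.normed volume) z) f

theorem moll_eq_integral (φ : ContDiffBump (0 : Eu d)) (f : L2 Ω) (z : Eu d) :
    moll φ f z = ∫ y in Ω, φ.normed volume (z - y) * f y :=
  inner_reflTranslate φ.continuous_normed φ.hasCompactSupport_normed z f

theorem contDiff_normed_infty (φ : ContDiffBump (0 : Eu d)) :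
    ContDiff ℝ ∞ (φ.normed (volume : Measure (Eu d))) := φ.contDiff_normed (n := ⊤)

theorem contDiff_moll [IsFiniteMeasure (volume.restrict Ω : Measure (Eu d))]
    (φ : ContDiffBump (0 : Eu d)) (f : L2 Ω) : ContDiff ℝ ∞ (moll φ f) :=
  (contDiff_reflTranslate (contDiff_normed_infty φ) φ.hasCompactSupport_normed).inner ℝ
    contDiff_const

theorem abs_moll_le (φ : ContDiffBump (0 : Eu d)) {f : L2 Ω} {M : ℝ} (hM : 0 ≤ M)
    (hf : ∀ᵐ x ∂(volume.restrict Ω), |f x| ≤ M) (z : Eu d) : |moll φ f z| ≤ M := by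
  have hi : Integrable (fun y => φ.normed volume (z - y)) (volume : Measure (Eu d)) :=
    φ.integrable_normed.comp_sub_left z
  rw [moll_eq_integral]
  calc |∫ y in Ω, φ.normed volume (z - y) * f y|
      ≤ ∫ y in Ω, φ.normed volume (z - y) * M := by
        rw [← Real.norm_eq_abs]
        refine norm_integral_le_of_norm_le (hi.restrict.mul_const M) ?_
        filter_upwards [hf] with y hy
        rw [norm_mul, Real.norm_of_nonneg (φ.nonneg_normed _)]
        exact mul_le_mul_of_nonneg_left hy (φ.nonneg_normed _)
    _ = (∫ y in Ω, φ.normed volume (z - y)) * M := integral_mul_const _ _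
    _ ≤ 1 * M := by
        gcongr
        calc ∫ y in Ω, φ.normed volume (z - y) ≤ ∫ y, φ.normed volume (z - y) :=
              setIntegral_le_integral hi (Eventually.of_forall fun y => φ.nonneg_normed _)
          _ = ∫ y, φ.normed volume y := integral_sub_left_eq_self _ _ _
          _ = 1 := φ.integral_normed
    _ = M := one_mul _

theorem partialDeriv_moll_eq_inner [IsFiniteMeasure (volume.restrict Ω : Measure (Eu d))]
    (φ : ContDiffBump (0 : Eu d)) (f : L2 Ω) (z : Eu d) (j : Fin d) :
    partialDeriv j (moll φ f) z
      = inner ℝ (reflTranslate Ω (partialDeriv j (φ.normed volume)) z) f :=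
  partialDeriv_inner_reflTranslate (contDiff_normed_infty φ) φ.hasCompactSupport_normed f z j

theorem contDiff_comp_sub (φ : ContDiffBump (0 : Eu d)) (z : Eu d) :
    ContDiff ℝ ∞ (fun y => φ.normed (volume : Measure (Eu d)) (z - y)) :=
  (contDiff_normed_infty φ).comp (contDiff_const.sub contDiff_id)

theorem hasCompactSupport_comp_sub (φ : ContDiffBump (0 : Eu d)) (z : Eu d) :
    HasCompactSupport (fun y => φ.normed (volume : Measure (Eu d)) (z - y)) :=
  φ.hasCompactSupport_normed.comp_homeomorph (Homeomorph.subLeft z)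

theorem partialDeriv_moll_eq_integral [IsFiniteMeasure (volume.restrict Ω : Measure (Eu d))]
    (φ : ContDiffBump (0 : Eu d)) (f : L2 Ω) (z : Eu d) (j : Fin d) :
    partialDeriv j (moll φ f) z
      = - ∫ y in Ω, f y * partialDeriv j (fun y => φ.normed volume (z - y)) y := by
  rw [partialDeriv_moll_eq_inner, inner_reflTranslate
    (contDiff_partialDeriv (contDiff_normed_infty φ) j).continuous
    (hasCompactSupport_partialDeriv φ.hasCompactSupport_normed j), ← integral_neg]
  refine integral_congr_ae (Eventually.of_forall fun y => ?_)
  simp only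
  rw [partialDeriv_const_sub ((contDiff_normed_infty φ).differentiable (by simp))]
  ring

theorem isTest_comp_sub (φ : ContDiffBump (0 : Eu d)) {z : Eu d}
    (hz : Metric.closedBall z φ.rOut ⊆ Ω) :
    IsTest Ω (fun y => φ.normed (volume : Measure (Eu d)) (z - y)) := by
  refine ⟨contDiff_comp_sub φ z, hasCompactSupport_comp_sub φ z, ?_⟩
  refine (closure_minimal (fun y hy => ?_) Metric.isClosed_closedBall).trans hz
  have : z - y ∈ Function.support (φ.normed (volume : Measure (Eu d))) := hy
  rw [φ.support_normed_eq, mem_ball_zero_iff] at this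
  rw [Metric.mem_closedBall, dist_comm, dist_eq_norm]
  exact this.le

/-- The kernel centred at z must be a test function in Ω, so this works only inside the domain. With
zero trace the restriction disappears (`partialDeriv_moll_of_zero`). The same contrast separates
`div_moll_of_HSpace` from `div_moll_of_L2Div`, and it is the reason why two kinds of deformation are
needed. -/
theorem partialDeriv_moll [IsFiniteMeasure (volume.restrict Ω : Measure (Eu d))]
    {φ : ContDiffBump (0 : Eu d)} {j : Fin d} {f g : L2 Ω} (h : HasWeakDeriv Ω j f g) {z : Eu d}
    (hz : Metric.closedBall z φ.rOut ⊆ Ω) : partialDeriv j (moll φ f) z = moll φ g z := by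
  rw [partialDeriv_moll_eq_integral, h _ (isTest_comp_sub φ hz), neg_neg, moll_eq_integral]
  exact integral_congr_ae (Eventually.of_forall fun y => mul_comm _ _)

theorem partialDeriv_moll_of_zero [IsFiniteMeasure (volume.restrict Ω : Measure (Eu d))]
    {φ : ContDiffBump (0 : Eu d)} {j : Fin d} {f g : L2 Ω} (h : HasZeroWeakDeriv Ω j f g)
    (z : Eu d) : partialDeriv j (moll φ f) z = moll φ g z := by
  rw [partialDeriv_moll_eq_integral, h _ (contDiff_comp_sub φ z) (hasCompactSupport_comp_sub φ z),
    neg_neg, moll_eq_integral]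
  exact integral_congr_ae (Eventually.of_forall fun y => mul_comm _ _)

theorem div_moll_of_L2Div [IsFiniteMeasure (volume.restrict Ω : Measure (Eu d))]
    (φ : ContDiffBump (0 : Eu d)) {v : Fin d → L2 Ω} (hv : v ∈ L2Div Ω)
    (z : Eu d) : ∑ i, partialDeriv i (moll φ (v i)) z = 0 := by
  simp only [partialDeriv_moll_eq_integral]
  rw [Finset.sum_neg_distrib, L2Div.sum_inner_eq_zero hv (contDiff_comp_sub φ z)
    (hasCompactSupport_comp_sub φ z), neg_zero]

theorem div_moll_of_HSpace [IsFiniteMeasure (volume.restrict Ω : Measure (Eu d))]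
    (φ : ContDiffBump (0 : Eu d)) {V : Fin d → Fin d → L2 Ω} (hV : V ∈ HSpace Ω)
    {z : Eu d} (hz : Metric.closedBall z φ.rOut ⊆ Ω) (j : Fin d) :
    ∑ i, partialDeriv i (moll φ (V i j)) z = 0 := by
  simp only [partialDeriv_moll_eq_integral]
  rw [Finset.sum_neg_distrib, neg_eq_zero]
  -- A test field with a single nonzero component isolates the divergence of column j.
  have h := hV (fun k => if k = j then (fun y => φ.normed volume (z - y)) else 0) (fun k => by
    by_cases hk : k = j
    · simpa [hk] using isTest_comp_sub φ hz
    · simp only [hk, if_false]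
      exact ⟨contDiff_const, HasCompactSupport.zero, by simp⟩)
  rw [← h]
  refine Finset.sum_congr rfl fun i _ => ?_
  rw [Finset.sum_eq_single j]
  · simp
  · intro k _ hk
    simp [hk, partialDeriv]
  · simp

/-- The extension by zero of `f ∈ L²(Ω)`. -/
def zeroExt (f : L2 Ω) : Eu d → ℝ := Ω.indicator f

theorem memLp_zeroExt (hΩ : MeasurableSet Ω) (f : L2 Ω) : MemLp (zeroExt f) 2 volume :=
  (memLp_indicator_iff_restrict hΩ).2 (Lp.memLp f)

theorem moll_eq_integral_zeroExt (hΩ : MeasurableSet Ω) (φ : ContDiffBump (0 : Eu d)) (f : L2 Ω)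
    (z : Eu d) : moll φ f z = ∫ y, φ.normed volume (z - y) • zeroExt f y := by
  rw [moll_eq_integral, ← integral_indicator hΩ]
  refine integral_congr_ae (Eventually.of_forall fun y => ?_)
  by_cases hy : y ∈ Ω <;> simp [zeroExt, hy]

theorem eLpNorm_zeroExt (hΩ : MeasurableSet Ω) (f : L2 Ω) :
    eLpNorm (zeroExt f) 2 volume = ENNReal.ofReal ‖f‖ := by
  rw [zeroExt, eLpNorm_indicator_eq_eLpNorm_restrict hΩ, Lp.norm_def,
    ENNReal.ofReal_toReal (Lp.eLpNorm_ne_top f)]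

theorem lintegral_normed_sub (φ : ContDiffBump (0 : Eu d)) (z : Eu d) :
    ∫⁻ y, ENNReal.ofReal (φ.normed volume (z - y)) = 1 := by
  rw [← ofReal_integral_eq_lintegral_ofReal (φ.integrable_normed.comp_sub_left z)
    (Eventually.of_forall fun y => φ.nonneg_normed _), integral_sub_left_eq_self
      (φ.normed (volume : Measure (Eu d))) volume z, φ.integral_normed]
  simp

end Moll

/-! ### A smooth vector field pointing into the domain -/

section Geometry

open scoped Manifold

variable {d : ℕ} {Ω : Set (Eu d)}

/-- Short segments issuing from points of `closure Ω` near `y` in directions close to `v`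
enter `Ω`. -/
def InwardAt (Ω : Set (Eu d)) (y v : Eu d) : Prop :=
  ∃ r > 0, ∀ z ∈ closure Ω, dist z y < r → ∀ v', ‖v' - v‖ < r → ∀ ε : ℝ, 0 < ε → ε < r →
    z + ε • v' ∈ Ω

/-- One fixed direction serves all nearby points. With convexity in the direction, this is the input
for gluing by a smooth partition of unity. -/
theorem InwardAt.eventually {y v : Eu d} (h : InwardAt Ω y v) : ∀ᶠ y' in 𝓝 y, InwardAt Ω y' v := by
  obtain ⟨r, hr, h⟩ := h
  filter_upwards [Metric.ball_mem_nhds y (half_pos hr)] with y' hy'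
  refine ⟨r / 2, half_pos hr, fun z hz hzy v' hv' ε hε hε' => h z hz ?_ v' (by linarith) ε hε
    (by linarith)⟩
  have := dist_triangle z y' y
  rw [Metric.mem_ball] at hy'
  linarith

/-- A step ε along a v + b w is a step ε a along v followed by a step ε b along w. The first one
lands in Ω, so the second may start there. The deviation q of the actual direction from a v + b w is
added to both v and w, which works since a + b = 1. -/
theorem convex_inwardAt (y : Eu d) : Convex ℝ {v | InwardAt Ω y v} := by
  rintro v ⟨r, hr, hv⟩ w ⟨s, hs, hw⟩ a b ha hb hab
  rcases ha.eq_or_lt with rfl | ha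
  · have : b = 1 := by linarith
    subst this
    exact ⟨s, hs, by simpa using hw⟩
  rcases hb.eq_or_lt with rfl | hb
  · have : a = 1 := by linarith
    subst this
    exact ⟨r, hr, by simpa using hv⟩
  have hN : 0 < 1 + ‖v‖ + r := by positivity
  -- The last bound keeps the intermediate point, at distance at most ε (‖v‖ + r) from z, within s
  -- of y.
  refine ⟨min (min r s) (s / (1 + ‖v‖ + r)), by positivity, fun z hz hzy u hu ε hε hε' => ?_⟩
  simp only [lt_min_iff] at hzy hu hε'
  obtain ⟨⟨hz1, hz2⟩, hz3⟩ := hzy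
  obtain ⟨⟨hu1, hu2⟩, hu3⟩ := hu
  obtain ⟨⟨he1, he2⟩, he3⟩ := hε'
  set q := u - (a • v + b • w) with hq
  have hav : ‖v + q‖ ≤ ‖v‖ + r := (norm_add_le _ _).trans (by linarith)
  have h1 : z + (ε * a) • (v + q) ∈ Ω :=
    hv z hz hz1 (v + q) (by simpa using hu1) _ (by positivity) (by nlinarith)
  have h2 := hw _ (subset_closure h1) (by
    calc dist (z + (ε * a) • (v + q)) y ≤ ‖(ε * a) • (v + q)‖ + dist z y := by
          rw [dist_eq_norm, dist_eq_norm]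
          calc ‖z + (ε * a) • (v + q) - y‖ = ‖(ε * a) • (v + q) + (z - y)‖ := by congr 1; abel
            _ ≤ _ := norm_add_le _ _
      _ ≤ ε * (‖v‖ + r) + dist z y := by
          rw [norm_smul, Real.norm_of_nonneg (by positivity)]
          have : ε * a ≤ ε := by nlinarith
          gcongr
      _ < s := by
          rw [lt_div_iff₀ hN] at hz3 he3
          nlinarith [norm_nonneg v]) (w + q) (by simpa using hu2) (ε * b) (by positivity)
    (by nlinarith)
  convert h2 using 1
  have : u = a • (v + q) + b • (w + q) := by
    have h3 : a • q + b • q = q := by rw [← add_smul, hab, one_smul]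
    calc u = q + (a • v + b • w) := by rw [hq]; abel
      _ = (a • q + b • q) + (a • v + b • w) := by rw [h3]
      _ = _ := by module
  rw [add_assoc, mul_smul, mul_smul, ← smul_add, ← this]

theorem inwardAt_zero_of_mem (hΩ : IsOpen Ω) {y : Eu d} (hy : y ∈ Ω) : InwardAt Ω y 0 := by
  obtain ⟨R, hR, hball⟩ := Metric.isOpen_iff.1 hΩ y hy
  refine ⟨min (R / 2) 1, by positivity, fun z _ hzy v hv ε hε hε' => hball ?_⟩
  simp only [lt_min_iff, sub_zero] at hzy hv hε'
  rw [Metric.mem_ball]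
  calc dist (z + ε • v) y ≤ dist (z + ε • v) z + dist z y := dist_triangle _ _ _
    _ = ε * ‖v‖ + dist z y := by
      rw [dist_eq_norm, add_sub_cancel_left, norm_smul, Real.norm_of_nonneg hε.le]
    _ < R := by nlinarith [norm_nonneg v]

/-- Take n with dρ(n) < 0 at x₀. By continuity dρ stays negative at nearby points in nearby
directions, so ρ decreases strictly along short segments. Near x₀ one has ρ ≤ 0 on the closure of Ω,
hence ρ < 0 at the end of the segment. -/
theorem inwardAt_of_frontier {x₀ : Eu d} {U : Set (Eu d)} {ρ : Eu d → ℝ}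
    (hU : IsOpen U) (hx₀ : x₀ ∈ U) (hρ : ContDiffOn ℝ ∞ ρ U) (hd : fderiv ℝ ρ x₀ ≠ 0)
    (hΩU : Ω ∩ U = {x ∈ U | ρ x < 0}) : ∃ n, InwardAt Ω x₀ n := by
  obtain ⟨n, hn⟩ : ∃ n, fderiv ℝ ρ x₀ n < 0 := by
    by_contra! h
    refine hd (ContinuousLinearMap.ext fun w => le_antisymm ?_ (h w))
    have := h (-w)
    rw [map_neg] at this
    simpa using this
  have hdiff : ∀ y ∈ U, DifferentiableAt ℝ ρ y := fun y hy =>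
    (hρ.contDiffAt (hU.mem_nhds hy)).differentiableAt (by simp)
  have hcont : ContinuousAt (fun p : Eu d × Eu d => fderiv ℝ ρ p.1 p.2) (x₀, n) := by
    have h1 : ContinuousAt (fderiv ℝ ρ) x₀ :=
      (hρ.continuousOn_fderiv_of_isOpen hU (by simp)).continuousAt (hU.mem_nhds hx₀)
    exact (h1.comp (x := (x₀, n)) continuousAt_fst).clm_apply continuousAt_snd
  have hev : ∀ᶠ p : Eu d × Eu d in 𝓝 (x₀, n), fderiv ℝ ρ p.1 p.2 < 0 :=
    hcont.eventually (gt_mem_nhds hn)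
  obtain ⟨R1, hR1, hU1⟩ := Metric.isOpen_iff.1 hU x₀ hx₀
  obtain ⟨R2, hR2, hneg⟩ := Metric.eventually_nhds_iff.1 hev
  set R := min R1 R2 with hR
  have hR0 : 0 < R := lt_min hR1 hR2
  have hneg' : ∀ y v, dist y x₀ < R → ‖v - n‖ < R → fderiv ℝ ρ y v < 0 := by
    intro y v hy hv
    refine hneg (y := (y, v)) ?_
    rw [Prod.dist_eq, max_lt_iff, dist_eq_norm v n]
    exact ⟨hy.trans_le (min_le_right _ _), hv.trans_le (min_le_right _ _)⟩
  have hballU : ∀ y, dist y x₀ < R → y ∈ U := fun y hy => hU1 (hy.trans_le (min_le_left _ _))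
  have hle : ∀ z ∈ closure Ω, z ∈ U → ρ z ≤ 0 := by
    intro z hz hzU
    by_contra! hpos
    have h1 : ∀ᶠ y in 𝓝 z, 0 < ρ y := (hdiff z hzU).continuousAt.eventually (lt_mem_nhds hpos)
    obtain ⟨y, hyΩ, hy1, hyU⟩ :=
      ((mem_closure_iff_frequently.1 hz).and_eventually (h1.and (hU.mem_nhds hzU))).exists
    have : y ∈ Ω ∩ U := ⟨hyΩ, hyU⟩
    rw [hΩU] at this
    exact absurd this.2 (by linarith)
  have hN : 0 < 2 + ‖n‖ + R := by positivity
  refine ⟨n, min (R / 2) (R / (2 + ‖n‖ + R)), by positivity, fun z hz hzx v hv ε hε hε' => ?_⟩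
  rw [lt_min_iff] at hzx hv hε'
  have hv1 : ‖v‖ ≤ ‖n‖ + R := by
    calc ‖v‖ = ‖n + (v - n)‖ := by congr 1; abel
      _ ≤ ‖n‖ + ‖v - n‖ := norm_add_le _ _
      _ ≤ _ := by linarith
  have hseg : ∀ t ∈ Icc 0 ε, dist (z + t • v) x₀ < R := by
    intro t ht
    calc dist (z + t • v) x₀ ≤ dist (z + t • v) z + dist z x₀ := dist_triangle _ _ _
      _ = t * ‖v‖ + dist z x₀ := by
        rw [dist_eq_norm, add_sub_cancel_left, norm_smul, Real.norm_of_nonneg ht.1]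
      _ ≤ ε * (‖n‖ + R) + dist z x₀ := by
        gcongr
        exact ht.2
      _ < R := by
        have h1 := hε'.2
        have h2 := hzx.2
        rw [lt_div_iff₀ hN] at h1 h2
        nlinarith [norm_nonneg n]
  have hanti : StrictAntiOn (fun t : ℝ => ρ (z + t • v)) (Icc 0 ε) := by
    have hder : ∀ t ∈ Icc 0 ε,
        HasDerivAt (fun t : ℝ => ρ (z + t • v)) (fderiv ℝ ρ (z + t • v) v) t := by
      intro t ht
      have h1 : HasDerivAt (fun t : ℝ => z + t • v) v t := by
        simpa using ((hasDerivAt_id t).smul_const v).const_add z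
      exact (hdiff _ (hballU _ (hseg t ht))).hasFDerivAt.comp_hasDerivAt t h1
    refine strictAntiOn_of_deriv_neg (convex_Icc _ _)
      (fun t ht => (hder t ht).continuousAt.continuousWithinAt) fun t ht => ?_
    rw [interior_Icc] at ht
    have ht' := Ioo_subset_Icc_self ht
    rw [(hder t ht').deriv]
    exact hneg' _ _ (hseg t ht') (hv.1.trans (by linarith))
  have hfin : ρ (z + ε • v) < 0 := by
    have h := hanti (left_mem_Icc.2 hε.le) (right_mem_Icc.2 hε.le) hε
    simp only [zero_smul, add_zero] at h
    exact h.trans_le (hle z hz (hballU z (hzx.1.trans (by linarith))))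
  have : z + ε • v ∈ Ω ∩ U := by
    rw [hΩU]
    exact ⟨hballU _ (hseg ε (right_mem_Icc.2 hε.le)), hfin⟩
  exact this.1

theorem IsSmoothBoundedDomain.exists_inwardAt (hΩ : IsSmoothBoundedDomain Ω) (y : Eu d) :
    ∃ v, InwardAt Ω y v := by
  by_cases hy : y ∈ closure Ω
  · by_cases hyΩ : y ∈ Ω
    · exact ⟨0, inwardAt_zero_of_mem hΩ.isOpen hyΩ⟩
    · have hf : y ∈ frontier Ω := by
        rw [hΩ.isOpen.frontier_eq]
        exact ⟨hy, hyΩ⟩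
      obtain ⟨U, ρ, h1, h2, h3, h4, h5⟩ := hΩ.smooth_boundary y hf
      exact inwardAt_of_frontier h1 h2 h3 h4 h5
  -- Away from the closure the condition is vacuous, so the field can be built on the whole space.
  · obtain ⟨R, hR, h⟩ := Metric.isOpen_iff.1 isClosed_closure.isOpen_compl y hy
    exact ⟨0, R, hR, fun z hz hzy => absurd hz (h hzy)⟩

theorem IsSmoothBoundedDomain.isCompact_closure (hΩ : IsSmoothBoundedDomain Ω) :
    IsCompact (closure Ω) := hΩ.isBounded.isCompact_closure

theorem IsSmoothBoundedDomain.isFiniteMeasure (hΩ : IsSmoothBoundedDomain Ω) :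
    IsFiniteMeasure (volume.restrict Ω : Measure (Eu d)) :=
  ⟨by rw [Measure.restrict_apply_univ]; exact hΩ.isBounded.measure_lt_top⟩

/-- A smooth compactly supported vector field that points uniformly into the domain. -/
theorem IsSmoothBoundedDomain.exists_inward_field (hΩ : IsSmoothBoundedDomain Ω) :
    ∃ X : Eu d → Eu d, ContDiff ℝ ∞ X ∧ HasCompactSupport X ∧ ∃ r > 0, ∀ z ∈ closure Ω,
      ∀ v, ‖v - X z‖ < r → ∀ ε : ℝ, 0 < ε → ε < r → z + ε • v ∈ Ω := by
  obtain ⟨Y, hY⟩ := exists_contMDiffMap_forall_mem_convex_of_local_const (n := (⊤ : ℕ∞))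
    (I := 𝓘(ℝ, Eu d)) (t := fun y => {v | InwardAt Ω y v})
    convex_inwardAt (fun y => by
      obtain ⟨v, hv⟩ := hΩ.exists_inwardAt y
      exact ⟨v, hv.eventually⟩)
  obtain ⟨R, hR, hsub⟩ := hΩ.isCompact_closure.isBounded.subset_closedBall_lt 0 0
  -- The cutoff equals 1 on the closure of Ω; it makes the field compactly supported without
  -- changing it where it has to point inwards.
  let χ : ContDiffBump (0 : Eu d) := ⟨R, R + 1, hR, by linarith⟩
  have hYs : ContDiff ℝ ∞ Y := Y.contMDiff.contDiff
  have hXY : ∀ z ∈ closure Ω, χ z • Y z = Y z := fun z hz => by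
    rw [χ.one_of_mem_closedBall (hsub hz), one_smul]
  refine ⟨fun z => χ z • Y z, (χ.contDiff (n := ⊤)).smul hYs, χ.hasCompactSupport.smul_right, ?_⟩
  -- Membership in the closure appears twice because the compactness induction replaces the first
  -- occurrence by an arbitrary set.
  have key : ∃ r > 0, ∀ z ∈ closure Ω, z ∈ closure Ω →
      ∀ v, ‖v - Y z‖ < r → ∀ ε : ℝ, 0 < ε → ε < r → z + ε • v ∈ Ω := by
    refine hΩ.isCompact_closure.induction_on (p := fun s => ∃ r > 0, ∀ z ∈ s, z ∈ closure Ω →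
      ∀ v, ‖v - Y z‖ < r → ∀ ε : ℝ, 0 < ε → ε < r → z + ε • v ∈ Ω) ⟨1, one_pos, by simp⟩ ?_ ?_ ?_
    · rintro s t hst ⟨r, hr, h⟩
      exact ⟨r, hr, fun z hz => h z (hst hz)⟩
    · rintro s t ⟨r, hr, h⟩ ⟨r', hr', h'⟩
      refine ⟨min r r', lt_min hr hr', fun z hz hzc v hv ε hε hε' => ?_⟩
      rw [lt_min_iff] at hv hε'
      rcases hz with hz | hz
      · exact h z hz hzc v hv.1 ε hε hε'.1
      · exact h' z hz hzc v hv.2 ε hε hε'.2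
    · intro y _
      obtain ⟨r, hr, h⟩ := hY y
      have hc : ∀ᶠ z in 𝓝 y, ‖Y z - Y y‖ < r / 2 := by
        have h1 : Continuous fun z => ‖Y z - Y y‖ := (hYs.continuous.sub continuous_const).norm
        exact h1.continuousAt.eventually (gt_mem_nhds (by simpa using half_pos hr))
      refine ⟨{z | ‖Y z - Y y‖ < r / 2} ∩ Metric.ball y r,
        mem_nhdsWithin_of_mem_nhds (inter_mem hc (Metric.ball_mem_nhds y hr)), r / 2, half_pos hr,
        fun z hz hzc v hv ε hε hε' => h z hzc hz.2 v ?_ ε hε (by linarith)⟩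
      calc ‖v - Y y‖ = ‖(v - Y z) + (Y z - Y y)‖ := by congr 1; abel
        _ ≤ ‖v - Y z‖ + ‖Y z - Y y‖ := norm_add_le _ _
        _ < r := by
          have := hz.1
          simp only [mem_ofPred_eq] at this
          linarith
  obtain ⟨r, hr, h⟩ := key
  refine ⟨r, hr, fun z hz v hv => h z hz hz v ?_⟩
  rwa [← hXY z hz]

end Geometry

/-! ### The Piola transform -/

section Piola

variable {d : ℕ}

/-- The Jacobian matrix `(∂_j Φ_l)_{lj}`. -/
def jacobian (Φ : Eu d → Eu d) (x : Eu d) : Matrix (Fin d) (Fin d) ℝ :=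
  Matrix.of fun l j => partialDeriv j (fun y => Φ y l) x

/-- The adjugate of the Jacobian matrix. -/
def cof (Φ : Eu d → Eu d) (i k : Fin d) (x : Eu d) : ℝ := (jacobian Φ x).adjugate i k

theorem contDiff_det {E : Type*} [NormedAddCommGroup E] [NormedSpace ℝ E] {n : ℕ}
    {M : E → Matrix (Fin n) (Fin n) ℝ} (hM : ∀ i j, ContDiff ℝ ∞ (fun x => M x i j)) :
    ContDiff ℝ ∞ (fun x => (M x).det) := by
  simp only [Matrix.det_apply]
  refine ContDiff.sum fun σ _ => ?_
  exact (contDiff_prod fun i _ => hM (σ i) i).const_smul _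

theorem contDiff_adjugate {E : Type*} [NormedAddCommGroup E] [NormedSpace ℝ E] {n : ℕ}
    {M : E → Matrix (Fin n) (Fin n) ℝ} (hM : ∀ i j, ContDiff ℝ ∞ (fun x => M x i j))
    (i j : Fin n) : ContDiff ℝ ∞ (fun x => (M x).adjugate i j) := by
  simp only [Matrix.adjugate_apply]
  refine contDiff_det fun k l => ?_
  by_cases hk : k = j
  · subst hk
    simp only [Matrix.updateRow_self]
    exact contDiff_const
  · simp only [Matrix.updateRow_ne hk]
    exact hM k l

theorem contDiff_coord {Φ : Eu d → Eu d} (hΦ : ContDiff ℝ ∞ Φ) (l : Fin d) :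
    ContDiff ℝ ∞ (fun y => Φ y l) := contDiff_euclidean.1 hΦ l

theorem contDiff_jacobian {Φ : Eu d → Eu d} (hΦ : ContDiff ℝ ∞ Φ) (l j : Fin d) :
    ContDiff ℝ ∞ (fun x => jacobian Φ x l j) := contDiff_partialDeriv (contDiff_coord hΦ l) j

theorem contDiff_cof {Φ : Eu d → Eu d} (hΦ : ContDiff ℝ ∞ Φ) (i k : Fin d) :
    ContDiff ℝ ∞ (cof Φ i k) := contDiff_adjugate (contDiff_jacobian hΦ) i k

/-- The Piola identity in dimensions two and three. -/
theorem sum_partialDeriv_cof (hd : d = 2 ∨ d = 3) {Φ : Eu d → Eu d} (hΦ : ContDiff ℝ ∞ Φ)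
    (k : Fin d) (x : Eu d) : ∑ i, partialDeriv i (cof Φ i k) x = 0 := by
  have hD : ∀ l j, Differentiable ℝ (partialDeriv j (fun y => Φ y l)) := fun l j =>
    (contDiff_partialDeriv (contDiff_coord hΦ l) j).differentiable (by simp)
  have hs : ∀ l i j, partialDeriv i (partialDeriv j (fun y => Φ y l)) x
      = partialDeriv j (partialDeriv i (fun y => Φ y l)) x := fun l i j =>
    partialDeriv_symm (contDiff_coord hΦ l) i j x
  rcases hd with rfl | rfl
  · have h : ∀ i k, cof Φ i k = fun x => (!![partialDeriv 1 (fun y => Φ y 1) x,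
        -partialDeriv 1 (fun y => Φ y 0) x; -partialDeriv 0 (fun y => Φ y 1) x,
        partialDeriv 0 (fun y => Φ y 0) x] : Matrix (Fin 2) (Fin 2) ℝ) i k := by
      intro i k
      funext x
      rw [cof, Matrix.adjugate_fin_two]
      rfl
    simp only [h]
    fin_cases k <;> simp [Fin.sum_univ_two, partialDeriv_neg]
    · rw [hs 1 0 1]; ring
    · rw [hs 0 0 1]; ring
  · have hp : ∀ (l j l' j' i : Fin 3),
        partialDeriv i (fun x => partialDeriv j (fun y => Φ y l) x *
          partialDeriv j' (fun y => Φ y l') x) x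
        = partialDeriv j (fun y => Φ y l) x * partialDeriv i (partialDeriv j' (fun y => Φ y l')) x
          + partialDeriv i (partialDeriv j (fun y => Φ y l)) x *
            partialDeriv j' (fun y => Φ y l') x := fun l j l' j' i =>
      partialDeriv_mul (hD l j x) (hD l' j' x) i
    have hdp : ∀ (l j l' j' : Fin 3), DifferentiableAt ℝ (fun x =>
        partialDeriv j (fun y => Φ y l) x * partialDeriv j' (fun y => Φ y l') x) x :=
      fun l j l' j' => (hD l j x).mul (hD l' j' x)
    have hsub : ∀ (l j l' j' m n m' n' i : Fin 3),
        partialDeriv i (fun x => partialDeriv j (fun y => Φ y l) x *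
          partialDeriv j' (fun y => Φ y l') x - partialDeriv n (fun y => Φ y m) x *
          partialDeriv n' (fun y => Φ y m') x) x
        = (partialDeriv j (fun y => Φ y l) x *
            partialDeriv i (partialDeriv j' (fun y => Φ y l')) x
          + partialDeriv i (partialDeriv j (fun y => Φ y l)) x *
            partialDeriv j' (fun y => Φ y l') x) -
          (partialDeriv n (fun y => Φ y m) x *
            partialDeriv i (partialDeriv n' (fun y => Φ y m')) x
          + partialDeriv i (partialDeriv n (fun y => Φ y m)) x *
            partialDeriv n' (fun y => Φ y m') x) := fun l j l' j' m n m' n' i => by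
      rw [partialDeriv_sub (hdp l j l' j') (hdp m n m' n'), hp, hp]
    have h : ∀ i k, cof Φ i k = fun x => (jacobian Φ x).adjugate i k := fun i k => rfl
    have hJ : ∀ x l j, jacobian Φ x l j = partialDeriv j (fun y => Φ y l) x := fun _ _ _ => rfl
    simp only [h, Matrix.adjugate_fin_three, hJ]
    fin_cases k <;>
    · simp only [Fin.sum_univ_three, Matrix.of_apply, Matrix.cons_val, Fin.reduceFinMk,
        Fin.zero_eta, Fin.mk_one, neg_add_eq_sub, hsub]
      -- Mixed second derivatives are put into one fixed order, after which the Piola identity is a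
      -- polynomial cancellation.
      simp only [fun l => hs l 1 0, fun l => hs l 2 0, fun l => hs l 2 1]
      ring

theorem jacobian_mul_cof (Φ : Eu d → Eu d) (x : Eu d) (l k : Fin d) :
    ∑ i, jacobian Φ x l i * cof Φ i k x = (jacobian Φ x).det * if l = k then 1 else 0 := by
  have h := congr_fun (congr_fun (Matrix.mul_adjugate (jacobian Φ x)) l) k
  rw [Matrix.mul_apply, Matrix.smul_apply, Matrix.one_apply] at h
  simpa [cof] using h

theorem partialDeriv_piola {Φ : Eu d → Eu d} (hΦ : ContDiff ℝ ∞ Φ) {v : Fin d → Eu d → ℝ}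
    (hv : ∀ k, ContDiff ℝ ∞ (v k)) (i j : Fin d) (x : Eu d) :
    partialDeriv j (fun x => ∑ k, cof Φ i k x * v k (Φ x)) x
      = ∑ k, (partialDeriv j (cof Φ i k) x * v k (Φ x)
          + cof Φ i k x * ∑ l, partialDeriv l (v k) (Φ x) * jacobian Φ x l j) := by
  have h1 : ∀ k, DifferentiableAt ℝ (cof Φ i k) x := fun k =>
    (contDiff_cof hΦ i k).differentiable (by simp) x
  have h2 : ∀ k, DifferentiableAt ℝ (fun x => v k (Φ x)) x := fun k =>
    ((hv k).comp hΦ).differentiable (by simp) x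
  rw [partialDeriv_sum (f := fun k x => cof Φ i k x * v k (Φ x)) fun k _ => (h1 k).mul (h2 k)]
  refine Finset.sum_congr rfl fun k _ => ?_
  rw [partialDeriv_mul (h1 k) (h2 k), partialDeriv_comp ((hv k).differentiable (by simp) _)
    (hΦ.differentiable (by simp) x), add_comm]
  rfl

/-- Let J be the Jacobian matrix of Φ. The terms in which adj J is differentiated vanish by the
Piola identity, and J adj J = det J contracts the remaining ones to the divergence of v at Φ x.
Hence a deformation corrected by adj J preserves solenoidal fields. -/
theorem div_piola (hd : d = 2 ∨ d = 3) {Φ : Eu d → Eu d} (hΦ : ContDiff ℝ ∞ Φ)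
    {v : Fin d → Eu d → ℝ} (hv : ∀ k, ContDiff ℝ ∞ (v k)) (x : Eu d) :
    ∑ i, partialDeriv i (fun x => ∑ k, cof Φ i k x * v k (Φ x)) x
      = (jacobian Φ x).det * ∑ k, partialDeriv k (v k) (Φ x) := by
  simp only [partialDeriv_piola hΦ hv, Finset.sum_add_distrib]
  rw [Finset.sum_comm]
  simp only [← Finset.sum_mul, sum_partialDeriv_cof hd hΦ, zero_mul, Finset.sum_const_zero,
    zero_add, Finset.mul_sum]
  rw [Finset.sum_comm]
  refine Finset.sum_congr rfl fun k _ => ?_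
  rw [Finset.sum_comm]
  have : ∀ l, ∑ i, cof Φ i k x * (partialDeriv l (v k) (Φ x) * jacobian Φ x l i)
      = partialDeriv l (v k) (Φ x) * ((jacobian Φ x).det * if l = k then 1 else 0) := by
    intro l
    rw [← jacobian_mul_cof, Finset.mul_sum]
    exact Finset.sum_congr rfl fun i _ => by ring
  simp only [this]
  simp
  ring

end Piola

set_option linter.unusedSectionVars false

/-! ### Regularization: mollify, deform, correct by the adjugate -/

section Regularizer

variable {d : ℕ} {Ω : Set (Eu d)}

/-- A smooth deformation close to the identity on `closure Ω`, together with a mollifier. -/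
structure Regularizer (Ω : Set (Eu d)) where
  Φ : Eu d → Eu d
  φ : ContDiffBump (0 : Eu d)
  e : ℝ
  e_le : e ≤ 1
  contDiff : ContDiff ℝ ∞ Φ
  lintegral_comp_le : ∀ g : Eu d → ENNReal, ∫⁻ x in Ω, g (Φ x) ≤ 2 * ∫⁻ x, g x
  dist_le : ∀ x ∈ closure Ω, dist (Φ x) x ≤ e / 2
  rOut_le : φ.rOut ≤ e / 2
  cof_le : ∀ i k, ∀ x ∈ closure Ω, |cof Φ i k x - if i = k then 1 else 0| ≤ e
  cofDeriv_le : ∀ i k j, ∀ x ∈ closure Ω, |partialDeriv j (cof Φ i k) x| ≤ e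
  jacobian_le : ∀ l j, ∀ x ∈ closure Ω, |jacobian Φ x l j - if l = j then 1 else 0| ≤ e

namespace Regularizer

variable (A : Regularizer Ω)

theorem e_pos : 0 < A.e := by
  have := A.rOut_le
  have := A.φ.rOut_pos
  linarith

/-- The scalar operator `f ↦ (ρ * f) ∘ Φ`. -/
def opFun (f : L2 Ω) (x : Eu d) : ℝ := moll A.φ f (A.Φ x)

theorem lintegral_kernel_le (y : Eu d) :
    ∫⁻ x in Ω, ENNReal.ofReal (A.φ.normed volume (A.Φ x - y)) ≤ 2 := by
  refine (A.lintegral_comp_le (fun z => ENNReal.ofReal (A.φ.normed volume (z - y)))).trans ?_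
  rw [lintegral_sub_right_eq_self (fun z => ENNReal.ofReal (A.φ.normed volume z)) y,
    ← ofReal_integral_eq_lintegral_ofReal A.φ.integrable_normed
      (Eventually.of_forall fun y => A.φ.nonneg_normed _), A.φ.integral_normed]
  simp

theorem measurable_kernel :
    Measurable (Function.uncurry fun x y => A.φ.normed (volume : Measure (Eu d)) (A.Φ x - y)) := by
  refine Continuous.measurable ?_
  exact A.φ.continuous_normed.comp
    ((A.contDiff.continuous.comp continuous_fst).sub continuous_snd)

variable [IsFiniteMeasure (volume.restrict Ω : Measure (Eu d))]

theorem continuous_opFun (f : L2 Ω) : Continuous (A.opFun f) :=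
  (contDiff_moll A.φ f).continuous.comp A.contDiff.continuous

theorem eLpNorm_opFun_le (hΩ : MeasurableSet Ω) (f : L2 Ω) :
    eLpNorm (A.opFun f) 2 (volume.restrict Ω) ≤ 2 * ENNReal.ofReal ‖f‖ := by
  have h := eLpNorm_kernel_le (m := volume.restrict Ω) (ν := volume) A.measurable_kernel
    (fun x y => A.φ.nonneg_normed _)
    (Eventually.of_forall fun x => (lintegral_normed_sub A.φ (A.Φ x)).le) A.lintegral_kernel_le
    (memLp_zeroExt hΩ f).aestronglyMeasurable
  rw [eLpNorm_zeroExt hΩ] at h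
  refine le_trans (le_of_eq (congrArg (fun g => eLpNorm g 2 _) ?_)) h
  funext x
  exact moll_eq_integral_zeroExt hΩ A.φ f (A.Φ x)

theorem memLp_opFun (hΩ : MeasurableSet Ω) (f : L2 Ω) :
    MemLp (A.opFun f) 2 (volume.restrict Ω) :=
  ⟨(A.continuous_opFun f).aestronglyMeasurable,
    (A.eLpNorm_opFun_le hΩ f).trans_lt (ENNReal.mul_lt_top (by norm_num) (by simp))⟩

/-- `f ↦ (ρ * f) ∘ Φ` as a bounded operator on `L²(Ω)`. -/
def op (hΩ : MeasurableSet Ω) : L2 Ω →L[ℝ] L2 Ω :=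
  LinearMap.mkContinuous
    { toFun := fun f => (A.memLp_opFun hΩ f).toLp _
      map_add' := fun f g => by
        rw [← MemLp.toLp_add]
        congr 1
        funext x
        simp [opFun, moll, inner_add_right]
      map_smul' := fun c f => by
        rw [RingHom.id_apply, ← MemLp.toLp_const_smul]
        congr 1
        funext x
        simp [opFun, moll, inner_smul_right] } 2 (fun f => by
      change ‖(A.memLp_opFun hΩ f).toLp _‖ ≤ _
      rw [Lp.norm_toLp]
      refine ENNReal.toReal_le_of_le_ofReal (by positivity) ?_
      rw [ENNReal.ofReal_mul (by norm_num)]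
      simpa using A.eLpNorm_opFun_le hΩ f)

theorem coeFn_op (hΩ : MeasurableSet Ω) (f : L2 Ω) :
    A.op hΩ f =ᵐ[volume.restrict Ω] A.opFun f := MemLp.coeFn_toLp (A.memLp_opFun hΩ f)

theorem norm_op_le (hΩ : MeasurableSet Ω) (f : L2 Ω) : ‖A.op hΩ f‖ ≤ 2 * ‖f‖ :=
  (A.op hΩ).le_of_opNorm_le (LinearMap.mkContinuous_norm_le _ (by norm_num) _) f

/-- Displacement and mollification radius are each at most e / 2, so the kernel at x is supported
within distance e of x and forms an approximate identity as e tends to 0. -/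
theorem tendsto_op {A : ℕ → Regularizer Ω} (hA : Tendsto (fun n => (A n).e) atTop (𝓝 0))
    (hΩ : MeasurableSet Ω) (f : L2 Ω) : Tendsto (fun n => (A n).op hΩ f) atTop (𝓝 f) := by
  rw [Lp.tendsto_Lp_iff_tendsto_eLpNorm']
  have h := tendsto_eLpNorm_kernel_sub (m := volume.restrict Ω) (ν := volume)
    Measure.restrict_le_self (fun n => (A n).measurable_kernel)
    (fun n x y => (A n).φ.nonneg_normed _)
    (fun n => Eventually.of_forall fun x => lintegral_normed_sub (A n).φ ((A n).Φ x))
    (fun n => (A n).lintegral_kernel_le) hA (fun n => by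
      filter_upwards [ae_restrict_mem hΩ] with x hx y hy
      have h1 : (A n).Φ x - y ∈ Function.support ((A n).φ.normed (volume : Measure (Eu d))) := hy
      rw [(A n).φ.support_normed_eq, mem_ball_zero_iff, ← dist_eq_norm] at h1
      have h2 := (A n).dist_le x (subset_closure hx)
      have h3 := (A n).rOut_le
      have h4 : dist y x ≤ dist y ((A n).Φ x) + dist ((A n).Φ x) x := dist_triangle _ _ _
      rw [dist_comm y ((A n).Φ x)] at h4
      linarith) (memLp_zeroExt hΩ f)
  refine h.congr fun n => eLpNorm_congr_ae ?_
  filter_upwards [(A n).coeFn_op hΩ f, ae_restrict_mem hΩ] with x hx hxΩ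
  rw [Pi.sub_apply, hx, opFun, moll_eq_integral_zeroExt hΩ]
  simp [zeroExt, hxΩ]

theorem tendsto_op_of_tendsto {A : ℕ → Regularizer Ω}
    (hA : Tendsto (fun n => (A n).e) atTop (𝓝 0)) (hΩ : MeasurableSet Ω) {f : ℕ → L2 Ω} {g : L2 Ω}
    (hf : Tendsto f atTop (𝓝 g)) : Tendsto (fun n => (A n).op hΩ (f n)) atTop (𝓝 g) := by
  have h1 : Tendsto (fun n => (A n).op hΩ (f n - g)) atTop (𝓝 0) := by
    refine squeeze_zero_norm (fun n => (A n).norm_op_le hΩ _) ?_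
    have := (tendsto_iff_norm_sub_tendsto_zero.1 hf).const_mul 2
    simpa using this
  have h2 := h1.add (tendsto_op hA hΩ g)
  rw [zero_add] at h2
  refine h2.congr fun n => ?_
  rw [map_sub]; abel

/-- The Piola regularization of a vector field. -/
def reg (V : Fin d → L2 Ω) (i : Fin d) (x : Eu d) : ℝ :=
  ∑ k, cof A.Φ i k x * A.opFun (V k) x

/-- The gradient of the regularization in terms of the gradient `D k l = ∂_l V_k`. -/
def regGrad (V : Fin d → L2 Ω) (D : Fin d → Fin d → L2 Ω) (i j : Fin d) (x : Eu d) : ℝ :=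
  ∑ k, (partialDeriv j (cof A.Φ i k) x * A.opFun (V k) x
    + ∑ l, cof A.Φ i k x * jacobian A.Φ x l j * A.opFun (D k l) x)

theorem contDiff_reg (V : Fin d → L2 Ω) (i : Fin d) : ContDiff ℝ ∞ (A.reg V i) :=
  ContDiff.sum fun k _ => (contDiff_cof A.contDiff i k).mul
    ((contDiff_moll A.φ (V k)).comp A.contDiff)

theorem partialDeriv_reg {V : Fin d → L2 Ω} {D : Fin d → Fin d → L2 Ω} {x : Eu d}
    (h : ∀ k l, partialDeriv l (moll A.φ (V k)) (A.Φ x) = moll A.φ (D k l) (A.Φ x))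
    (i j : Fin d) : partialDeriv j (A.reg V i) x = A.regGrad V D i j x := by
  refine (partialDeriv_piola A.contDiff (fun k => contDiff_moll A.φ (V k)) i j x).trans ?_
  refine Finset.sum_congr rfl fun k _ => ?_
  congr 1
  rw [Finset.mul_sum]
  refine Finset.sum_congr rfl fun l _ => ?_
  rw [h k l, opFun]; ring

theorem div_reg (hd : d = 2 ∨ d = 3) {V : Fin d → L2 Ω} {x : Eu d}
    (h : ∑ k, partialDeriv k (moll A.φ (V k)) (A.Φ x) = 0) :
    ∑ i, partialDeriv i (A.reg V i) x = 0 := by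
  have := div_piola hd A.contDiff (fun k => contDiff_moll A.φ (V k)) x
  rw [h, mul_zero] at this
  exact this

theorem abs_cof_le {x : Eu d} (hx : x ∈ closure Ω) (i k : Fin d) : |cof A.Φ i k x| ≤ 2 := by
  have h := A.cof_le i k x hx
  have h1 := A.e_le
  rw [abs_le] at *
  split_ifs at h <;> constructor <;> linarith

theorem abs_jacobian_le {x : Eu d} (hx : x ∈ closure Ω) (l j : Fin d) :
    |jacobian A.Φ x l j| ≤ 2 := by
  have h := A.jacobian_le l j x hx
  have h1 := A.e_le
  rw [abs_le] at *
  split_ifs at h <;> constructor <;> linarith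

theorem abs_cofDeriv_le {x : Eu d} (hx : x ∈ closure Ω) (i k j : Fin d) :
    |partialDeriv j (cof A.Φ i k) x| ≤ 1 := (A.cofDeriv_le i k j x hx).trans A.e_le

theorem abs_reg_le {V : Fin d → L2 Ω} {M : ℝ} {x : Eu d}
    (hV : ∀ k, |A.opFun (V k) x| ≤ M) (hx : x ∈ closure Ω) (i : Fin d) :
    |A.reg V i x| ≤ d * (2 * M) := by
  refine (Finset.abs_sum_le_sum_abs _ _).trans ?_
  calc _ ≤ ∑ _k : Fin d, 2 * M := by
        refine Finset.sum_le_sum fun k _ => ?_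
        rw [abs_mul]
        exact mul_le_mul (A.abs_cof_le hx i k) (hV k) (abs_nonneg _) (by norm_num)
    _ = _ := by simp

/-- The bound is pointwise and does not depend on the regularizer. It is what controls the
measure-valued corrector, against which L² convergence of gradients is useless. -/
theorem abs_regGrad_le {V : Fin d → L2 Ω} {D : Fin d → Fin d → L2 Ω} {M : ℝ}
    {x : Eu d} (hV : ∀ k, |A.opFun (V k) x| ≤ M) (hD : ∀ k l, |A.opFun (D k l) x| ≤ M)
    (hx : x ∈ closure Ω) (i j : Fin d) : |A.regGrad V D i j x| ≤ d * (M + d * (4 * M)) := by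
  refine (Finset.abs_sum_le_sum_abs _ _).trans ?_
  calc _ ≤ ∑ _k : Fin d, (M + d * (4 * M)) := by
        refine Finset.sum_le_sum fun k _ => (abs_add_le _ _).trans (add_le_add ?_ ?_)
        · rw [abs_mul]
          calc _ ≤ 1 * M := mul_le_mul (A.abs_cofDeriv_le hx i k j) (hV k) (abs_nonneg _)
                (by norm_num)
            _ = M := one_mul M
        · refine (Finset.abs_sum_le_sum_abs _ _).trans ?_
          calc _ ≤ ∑ _l : Fin d, 4 * M := by
                refine Finset.sum_le_sum fun l _ => ?_
                rw [abs_mul, abs_mul]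
                refine mul_le_mul ?_ (hD k l) (abs_nonneg _) (by norm_num)
                nlinarith [A.abs_cof_le hx i k, A.abs_jacobian_le hx l j,
                  abs_nonneg (cof A.Φ i k x), abs_nonneg (jacobian A.Φ x l j)]
            _ = _ := by simp
    _ = _ := by simp; ring

theorem aestronglyMeasurable_cof (i k : Fin d) :
    AEStronglyMeasurable (cof A.Φ i k) (volume.restrict Ω) :=
  (contDiff_cof A.contDiff i k).continuous.aestronglyMeasurable

theorem ae_mem_closure (hΩ : MeasurableSet Ω) :
    ∀ᵐ x ∂(volume.restrict Ω : Measure (Eu d)), x ∈ closure Ω := by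
  filter_upwards [ae_restrict_mem hΩ] with x hx
  exact subset_closure hx

/-- Multiplication by an entry of the cofactor matrix. -/
def cofOp (hΩ : MeasurableSet Ω) (i k : Fin d) : L2 Ω →L[ℝ] L2 Ω :=
  mulOp (cof A.Φ i k) 2 (A.aestronglyMeasurable_cof i k)
    ((ae_mem_closure hΩ).mono fun _ hx => A.abs_cof_le hx i k)

/-- Multiplication by a derivative of an entry of the cofactor matrix. -/
def cofDerivOp (hΩ : MeasurableSet Ω) (i k j : Fin d) : L2 Ω →L[ℝ] L2 Ω :=
  mulOp (partialDeriv j (cof A.Φ i k)) 1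
    (contDiff_partialDeriv (contDiff_cof A.contDiff i k) j).continuous.aestronglyMeasurable
    ((ae_mem_closure hΩ).mono fun _ hx => A.abs_cofDeriv_le hx i k j)

/-- Multiplication by an entry of the Jacobian matrix. -/
def jacOp (hΩ : MeasurableSet Ω) (l j : Fin d) : L2 Ω →L[ℝ] L2 Ω :=
  mulOp (fun x => jacobian A.Φ x l j) 2
    (contDiff_jacobian A.contDiff l j).continuous.aestronglyMeasurable
    ((ae_mem_closure hΩ).mono fun _ hx => A.abs_jacobian_le hx l j)

/-- The regularization as a bounded operator on `L²`. -/
def regL (hΩ : MeasurableSet Ω) (i : Fin d) : (Fin d → L2 Ω) →L[ℝ] L2 Ω :=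
  ∑ k, (A.cofOp hΩ i k ∘L A.op hΩ) ∘L ContinuousLinearMap.proj k

/-- The gradient of the regularization as a bounded operator on `L²`. -/
def regGradL (hΩ : MeasurableSet Ω) (i j : Fin d) :
    (Fin d → L2 Ω) × (Fin d → Fin d → L2 Ω) →L[ℝ] L2 Ω :=
  ∑ k, ((A.cofDerivOp hΩ i k j ∘L A.op hΩ) ∘L ContinuousLinearMap.proj k ∘L
        ContinuousLinearMap.fst ℝ _ _
    + ∑ l, (A.cofOp hΩ i k ∘L A.jacOp hΩ l j ∘L A.op hΩ) ∘L ContinuousLinearMap.proj l ∘L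
        ContinuousLinearMap.proj k ∘L ContinuousLinearMap.snd ℝ _ _)

theorem regL_apply (hΩ : MeasurableSet Ω) (i : Fin d) (V : Fin d → L2 Ω) :
    A.regL hΩ i V = ∑ k, A.cofOp hΩ i k (A.op hΩ (V k)) := by
  simp [regL]

theorem regGradL_apply (hΩ : MeasurableSet Ω) (i j : Fin d) (V : Fin d → L2 Ω)
    (D : Fin d → Fin d → L2 Ω) :
    A.regGradL hΩ i j (V, D) = ∑ k, (A.cofDerivOp hΩ i k j (A.op hΩ (V k))
      + ∑ l, A.cofOp hΩ i k (A.jacOp hΩ l j (A.op hΩ (D k l)))) := by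
  simp [regGradL]

theorem coeFn_regL (hΩ : MeasurableSet Ω) (i : Fin d) (V : Fin d → L2 Ω) :
    A.regL hΩ i V =ᵐ[volume.restrict Ω] A.reg V i := by
  rw [regL_apply]
  have h : ∀ k, ∀ᵐ x ∂(volume.restrict Ω), A.cofOp hΩ i k (A.op hΩ (V k)) x
      = cof A.Φ i k x * A.opFun (V k) x := fun k => by
    filter_upwards [mulOp_coeFn _ _ (A.op hΩ (V k)), A.coeFn_op hΩ (V k)] with x h1 h2
    rw [cofOp, h1, h2]
  filter_upwards [Lp.coeFn_finsetSum Finset.univ (fun k => A.cofOp hΩ i k (A.op hΩ (V k))),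
    ae_all_iff.2 h] with x h1 h2
  rw [h1, Finset.sum_apply]
  exact Finset.sum_congr rfl fun k _ => h2 k

theorem coeFn_regGradL (hΩ : MeasurableSet Ω) (i j : Fin d) (V : Fin d → L2 Ω)
    (D : Fin d → Fin d → L2 Ω) :
    A.regGradL hΩ i j (V, D) =ᵐ[volume.restrict Ω] A.regGrad V D i j := by
  rw [regGradL_apply]
  have h : ∀ k, ∀ᵐ x ∂(volume.restrict Ω), A.cofDerivOp hΩ i k j (A.op hΩ (V k)) x
      = partialDeriv j (cof A.Φ i k) x * A.opFun (V k) x := fun k => by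
    filter_upwards [mulOp_coeFn _ _ (A.op hΩ (V k)), A.coeFn_op hΩ (V k)] with x h1 h2
    rw [cofDerivOp, h1, h2]
  have h' : ∀ k l, ∀ᵐ x ∂(volume.restrict Ω),
      A.cofOp hΩ i k (A.jacOp hΩ l j (A.op hΩ (D k l))) x
      = cof A.Φ i k x * jacobian A.Φ x l j * A.opFun (D k l) x := fun k l => by
    filter_upwards [mulOp_coeFn _ _ (A.jacOp hΩ l j (A.op hΩ (D k l))),
      mulOp_coeFn _ _ (A.op hΩ (D k l)), A.coeFn_op hΩ (D k l)] with x h1 h2 h3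
    rw [cofOp, h1, jacOp, h2, h3, mul_assoc]
  filter_upwards [Lp.coeFn_finsetSum Finset.univ (fun k => A.cofDerivOp hΩ i k j (A.op hΩ (V k))
      + ∑ l, A.cofOp hΩ i k (A.jacOp hΩ l j (A.op hΩ (D k l)))), ae_all_iff.2 h,
    ae_all_iff.2 fun k => ae_all_iff.2 (h' k),
    ae_all_iff.2 fun k => Lp.coeFn_add (A.cofDerivOp hΩ i k j (A.op hΩ (V k)))
      (∑ l, A.cofOp hΩ i k (A.jacOp hΩ l j (A.op hΩ (D k l)))),
    ae_all_iff.2 fun k => Lp.coeFn_finsetSum Finset.univ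
      (fun l => A.cofOp hΩ i k (A.jacOp hΩ l j (A.op hΩ (D k l))))] with x h1 h2 h3 h4 h5
  rw [h1, Finset.sum_apply]
  refine Finset.sum_congr rfl fun k _ => ?_
  rw [h4, Pi.add_apply, h2, h5, Finset.sum_apply]
  congr 1
  exact Finset.sum_congr rfl fun l _ => h3 k l

theorem norm_regL_le (hΩ : MeasurableSet Ω) (i : Fin d) (V : Fin d → L2 Ω) :
    ‖A.regL hΩ i V‖ ≤ d * (4 * ‖V‖) := by
  rw [regL_apply]
  refine (norm_sum_le _ _).trans ?_
  calc _ ≤ ∑ _k : Fin d, 4 * ‖V‖ := by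
        refine Finset.sum_le_sum fun k _ => ?_
        have h1 := norm_mulOp_le (A.aestronglyMeasurable_cof i k)
          ((ae_mem_closure hΩ).mono fun _ hx => A.abs_cof_le hx i k) (A.op hΩ (V k))
        have h2 := A.norm_op_le hΩ (V k)
        have h3 := norm_le_pi_norm V k
        rw [cofOp]
        linarith
    _ = _ := by simp

/-- The multipliers converge uniformly on Ω to the constant c, hence the operators converge even
along moving arguments. -/
theorem tendsto_mulOp {b : ℕ → Eu d → ℝ} {C : ℝ} {c : ℝ} {e : ℕ → ℝ}
    (hb : ∀ n, AEStronglyMeasurable (b n) (volume.restrict Ω))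
    (hC : ∀ n, ∀ᵐ x ∂(volume.restrict Ω), |b n x| ≤ C)
    (hc : ∀ n, ∀ᵐ x ∂(volume.restrict Ω), |b n x - c| ≤ e n) (he : Tendsto e atTop (𝓝 0))
    {f : ℕ → L2 Ω} {g : L2 Ω} (hf : Tendsto f atTop (𝓝 g)) :
    Tendsto (fun n => mulOp (b n) C (hb n) (hC n) (f n)) atTop (𝓝 (c • g)) := by
  have h1 : Tendsto (fun n => mulOp (b n) C (hb n) (hC n) (f n) - c • f n) atTop (𝓝 0) := by
    refine squeeze_zero_norm (a := fun n => e n * ‖f n‖) (fun n => ?_) ?_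
    · refine Lp.norm_le_mul_norm_of_ae_le_mul ?_
      filter_upwards [hc n, mulOp_coeFn (hb n) (hC n) (f n), Lp.coeFn_smul c (f n),
        Lp.coeFn_sub (mulOp (b n) C (hb n) (hC n) (f n)) (c • f n)] with x h1 h2 h3 h4
      rw [h4, Pi.sub_apply, h2, h3, Pi.smul_apply, smul_eq_mul, ← sub_mul, norm_mul]
      exact mul_le_mul_of_nonneg_right h1 (norm_nonneg _)
    · simpa using he.mul hf.norm
  have h2 := h1.add (hf.const_smul c)
  rw [zero_add] at h2
  exact h2.congr fun n => by abel

theorem tendsto_regL {A : ℕ → Regularizer Ω} (hA : Tendsto (fun n => (A n).e) atTop (𝓝 0))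
    (hΩ : MeasurableSet Ω) {V : ℕ → Fin d → L2 Ω} {V' : Fin d → L2 Ω}
    (hV : Tendsto V atTop (𝓝 V')) (i : Fin d) :
    Tendsto (fun n => (A n).regL hΩ i (V n)) atTop (𝓝 (V' i)) := by
  simp only [regL_apply]
  have h : ∀ k, Tendsto (fun n => (A n).cofOp hΩ i k ((A n).op hΩ (V n k))) atTop
      (𝓝 ((if i = k then (1 : ℝ) else 0) • V' k)) := fun k =>
    tendsto_mulOp _ _ (fun n => (ae_mem_closure hΩ).mono fun x hx => (A n).cof_le i k x hx) hA
      (tendsto_op_of_tendsto hA hΩ (tendsto_pi_nhds.1 hV k))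
  have h2 := tendsto_finsetSum Finset.univ fun k _ => h k
  simpa using h2

/-- In the limit the derivatives of the adjugate vanish and both adjugate and Jacobian become the
identity matrix, so that only the entry `D' i j` survives. -/
theorem tendsto_regGradL {A : ℕ → Regularizer Ω} (hA : Tendsto (fun n => (A n).e) atTop (𝓝 0))
    (hΩ : MeasurableSet Ω) {V : ℕ → Fin d → L2 Ω} {V' : Fin d → L2 Ω}
    (hV : Tendsto V atTop (𝓝 V')) {D : ℕ → Fin d → Fin d → L2 Ω} {D' : Fin d → Fin d → L2 Ω}
    (hD : Tendsto D atTop (𝓝 D')) (i j : Fin d) :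
    Tendsto (fun n => (A n).regGradL hΩ i j (V n, D n)) atTop (𝓝 (D' i j)) := by
  simp only [regGradL_apply]
  have h : ∀ k, Tendsto (fun n => (A n).cofDerivOp hΩ i k j ((A n).op hΩ (V n k))) atTop
      (𝓝 ((0 : ℝ) • V' k)) := fun k =>
    tendsto_mulOp _ _ (fun n => (ae_mem_closure hΩ).mono fun x hx => by
        simpa using (A n).cofDeriv_le i k j x hx) hA
      (tendsto_op_of_tendsto hA hΩ (tendsto_pi_nhds.1 hV k))
  have h' : ∀ k l, Tendsto (fun n => (A n).cofOp hΩ i k ((A n).jacOp hΩ l j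
      ((A n).op hΩ (D n k l)))) atTop
      (𝓝 ((if i = k then (1 : ℝ) else 0) • (if l = j then (1 : ℝ) else 0) • D' k l)) := fun k l =>
    tendsto_mulOp _ _ (fun n => (ae_mem_closure hΩ).mono fun x hx => (A n).cof_le i k x hx) hA
      (tendsto_mulOp _ _ (fun n => (ae_mem_closure hΩ).mono fun x hx => (A n).jacobian_le l j x hx)
        hA (tendsto_op_of_tendsto hA hΩ (tendsto_pi_nhds.1 (tendsto_pi_nhds.1 hD k) l)))
  have h2 := tendsto_finsetSum Finset.univ fun k _ =>
    (h k).add (tendsto_finsetSum Finset.univ fun l _ => h' k l)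
  simpa [← Finset.smul_sum] using h2

end Regularizer

end Regularizer

/-! ### Deformations along the inward field -/

section Flow

variable {d : ℕ} {Ω : Set (Eu d)}

/-- The deformation `x ↦ x + s X(x)`. -/
def flow (X : Eu d → Eu d) (s : ℝ) (x : Eu d) : Eu d := x + s • X x

theorem contDiff_flow {X : Eu d → Eu d} (hX : ContDiff ℝ ∞ X) (s : ℝ) :
    ContDiff ℝ ∞ (flow X s) := contDiff_id.add (hX.const_smul s)

theorem partialDeriv_coord (l j : Fin d) (x : Eu d) :
    partialDeriv j (fun y : Eu d => y l) x = if l = j then 1 else 0 := by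
  have : fderiv ℝ (fun y : Eu d => y l) x = EuclideanSpace.proj l :=
    (EuclideanSpace.proj l : Eu d →L[ℝ] ℝ).hasFDerivAt.fderiv
  rw [partialDeriv, this]
  simp

theorem jacobian_flow {X : Eu d → Eu d} (hX : ContDiff ℝ ∞ X) (s : ℝ) (x : Eu d) (l j : Fin d) :
    jacobian (flow X s) x l j
      = (if l = j then 1 else 0) + s * partialDeriv j (fun y => X y l) x := by
  have hc : Differentiable ℝ (fun y => X y l) := (contDiff_coord hX l).differentiable (by simp)
  have h1 : jacobian (flow X s) x l j = partialDeriv j (fun y : Eu d => y l + s * X y l) x := rfl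
  rw [h1, partialDeriv_add (f := fun y : Eu d => y l) (g := fun y => s * X y l)
    ((EuclideanSpace.proj l : Eu d →L[ℝ] ℝ).differentiableAt) ((hc x).const_mul s),
    partialDeriv_coord, partialDeriv_mul (differentiableAt_const s) (hc x)]
  simp [partialDeriv]

theorem contDiff_jacobian_flow {X : Eu d → Eu d} (hX : ContDiff ℝ ∞ X) (l j : Fin d) :
    ContDiff ℝ ∞ (fun p : ℝ × Eu d => jacobian (flow X p.1) p.2 l j) := by
  simp only [jacobian_flow hX]
  exact contDiff_const.add (contDiff_fst.mul
    ((contDiff_partialDeriv (contDiff_coord hX l) j).comp contDiff_snd))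

theorem contDiff_cof_flow {X : Eu d → Eu d} (hX : ContDiff ℝ ∞ X) (i k : Fin d) :
    ContDiff ℝ ∞ (fun p : ℝ × Eu d => cof (flow X p.1) i k p.2) :=
  contDiff_adjugate (M := fun p : ℝ × Eu d => jacobian (flow X p.1) p.2)
    (contDiff_jacobian_flow hX) i k

theorem cof_flow_zero {X : Eu d → Eu d} (hX : ContDiff ℝ ∞ X) (i k : Fin d) (x : Eu d) :
    cof (flow X 0) i k x = if i = k then 1 else 0 := by
  have : jacobian (flow X 0) x = 1 := by
    ext l j
    rw [jacobian_flow hX, zero_mul, add_zero, Matrix.one_apply]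
  rw [cof, this, Matrix.adjugate_one, Matrix.one_apply]

/-- Compactness of K turns continuity at s = 0 into closeness that is uniform on K; all estimates
for small deformations are instances of this. -/
theorem eventually_forall_abs_sub_lt {g : ℝ × Eu d → ℝ} (hg : Continuous g) {K : Set (Eu d)}
    (hK : IsCompact K) {η : ℝ} (hη : 0 < η) :
    ∀ᶠ s in 𝓝 (0 : ℝ), ∀ x ∈ K, |g (s, x) - g (0, x)| < η := by
  refine hK.eventually_forall_of_forall_eventually (P := fun s x => |g (s, x) - g (0, x)| < η)
    fun x _ => ?_
  have hc : Continuous fun p : ℝ × Eu d => |g (p.1, p.2) - g (0, p.2)| := by fun_prop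
  exact hc.continuousAt.eventually (gt_mem_nhds (by simpa using hη))

theorem continuous_partialDeriv_cof_flow {X : Eu d → Eu d} (hX : ContDiff ℝ ∞ X) (i k j : Fin d) :
    Continuous (fun p : ℝ × Eu d => partialDeriv j (cof (flow X p.1) i k) p.2) := by
  have hf : ContDiff ℝ 1 (Function.uncurry fun p : ℝ × Eu d => cof (flow X p.1) i k) :=
    ((contDiff_cof_flow hX i k).comp
      ((contDiff_fst.comp contDiff_fst).prodMk contDiff_snd)).of_le (by simp)
  have hg : ContDiff ℝ 0 (fun p : ℝ × Eu d => p.2) := contDiff_snd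
  have h := ContDiff.fderiv hf hg (by simp)
  exact h.continuous.clm_apply continuous_const

/-- For small s the perturbation s X has Lipschitz constant below 1, so the deformation is
injective, and its Jacobian determinant exceeds 1/2 on Ω. The change of variables then loses at most
a factor 2. -/
theorem eventually_lintegral_comp_flow_le (hΩ : IsSmoothBoundedDomain Ω) {X : Eu d → Eu d}
    (hX : ContDiff ℝ ∞ X) (hXc : HasCompactSupport X) :
    ∀ᶠ s in 𝓝 (0 : ℝ), ∀ g : Eu d → ENNReal,
      ∫⁻ x in Ω, g (flow X s x) ≤ 2 * ∫⁻ x, g x := by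
  obtain ⟨C, hC⟩ := ContDiff.lipschitzWith_of_hasCompactSupport hXc hX (by simp)
  have hder : ∀ s x, HasFDerivAt (flow X s)
      (ContinuousLinearMap.id ℝ (Eu d) + s • fderiv ℝ X x) x := fun s x =>
    (hasFDerivAt_id x).add ((hX.differentiable (by simp) x).hasFDerivAt.const_smul s)
  have hdet : ∀ᶠ s in 𝓝 (0 : ℝ), ∀ x ∈ closure Ω,
      |(ContinuousLinearMap.id ℝ (Eu d) + s • fderiv ℝ X x).det - 1| < 1 / 2 := by
    have hc : Continuous fun p : ℝ × Eu d =>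
        (ContinuousLinearMap.id ℝ (Eu d) + p.1 • fderiv ℝ X p.2).det := by
      refine ContinuousLinearMap.continuous_det.comp ?_
      exact continuous_const.add (continuous_fst.smul
        ((hX.continuous_fderiv (by simp)).comp continuous_snd))
    filter_upwards [eventually_forall_abs_sub_lt hc hΩ.isCompact_closure
      (η := 1 / 2) (by norm_num)] with s hs x hx
    have h0 : (ContinuousLinearMap.id ℝ (Eu d) + (0 : ℝ) • fderiv ℝ X x).det = 1 := by
      have e0 : ContinuousLinearMap.id ℝ (Eu d) + (0 : ℝ) • fderiv ℝ X x
          = ContinuousLinearMap.id ℝ (Eu d) := by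
        ext1 v
        simp
      rw [e0]
      simp [ContinuousLinearMap.det]
    have h1 := hs x hx
    rwa [h0] at h1
  have hinj : ∀ᶠ s in 𝓝 (0 : ℝ), |s| * (C : ℝ) < 1 := by
    have hc : Continuous fun s : ℝ => |s| * (C : ℝ) := by fun_prop
    exact hc.continuousAt.eventually (gt_mem_nhds (by simp))
  filter_upwards [hdet, hinj] with s hs1 hs2 g
  have hi : InjOn (flow X s) Ω := by
    intro x _ y _ hxy
    have h1 : x - y = s • (X y - X x) := by
      simp only [flow] at hxy
      rw [smul_sub, sub_eq_sub_iff_add_eq_add, hxy]; abel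
    have h2 : ‖x - y‖ ≤ (|s| * C) * ‖x - y‖ := by
      calc ‖x - y‖ = |s| * ‖X y - X x‖ := by rw [h1, norm_smul, Real.norm_eq_abs]
        _ ≤ |s| * (C * ‖y - x‖) := by
          gcongr
          exact hC.norm_sub_le y x
        _ = _ := by rw [norm_sub_rev y x]; ring
    have h3 : ‖x - y‖ = 0 := by nlinarith [norm_nonneg (x - y)]
    exact sub_eq_zero.1 (norm_eq_zero.1 h3)
  have him := lintegral_image_eq_lintegral_abs_det_fderiv_mul volume hΩ.isOpen.measurableSet
    (fun x _ => (hder s x).hasFDerivWithinAt) hi g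
  calc ∫⁻ x in Ω, g (flow X s x)
      ≤ ∫⁻ x in Ω, 2 * (ENNReal.ofReal
          |(ContinuousLinearMap.id ℝ (Eu d) + s • fderiv ℝ X x).det| * g (flow X s x)) := by
        refine setLIntegral_mono' hΩ.isOpen.measurableSet fun x hx => ?_
        have h := abs_lt.1 (hs1 x (subset_closure hx))
        rw [← mul_assoc]
        refine le_mul_of_one_le_left bot_le ?_
        have e2 : (2 : ENNReal) = ENNReal.ofReal 2 := by simp
        refine le_of_le_of_eq ?_ (congrArg (· * _) e2.symm)
        rw [← ENNReal.ofReal_mul (by norm_num), ENNReal.one_le_ofReal]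
        have := le_abs_self (ContinuousLinearMap.id ℝ (Eu d) + s • fderiv ℝ X x).det
        linarith
    _ = 2 * ∫⁻ x in flow X s '' Ω, g x := by
        rw [lintegral_const_mul' _ _ (by norm_num), him]
    _ ≤ 2 * ∫⁻ x, g x := by
        gcongr
        exact Measure.restrict_le_self

/-- Everything needed of `flow X s`, for small `s`. -/
theorem eventually_flow_close (hΩ : IsSmoothBoundedDomain Ω) {X : Eu d → Eu d}
    (hX : ContDiff ℝ ∞ X) (hXc : HasCompactSupport X) {η : ℝ} (hη : 0 < η) :
    ∀ᶠ s in 𝓝 (0 : ℝ), (∀ g : Eu d → ENNReal, ∫⁻ x in Ω, g (flow X s x) ≤ 2 * ∫⁻ x, g x) ∧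
      (∀ x ∈ closure Ω, dist (flow X s x) x ≤ η / 2) ∧
      (∀ i k, ∀ x ∈ closure Ω, |cof (flow X s) i k x - if i = k then 1 else 0| ≤ η) ∧
      (∀ i k j, ∀ x ∈ closure Ω, |partialDeriv j (cof (flow X s) i k) x| ≤ η) ∧
      (∀ l j, ∀ x ∈ closure Ω, |jacobian (flow X s) x l j - if l = j then 1 else 0| ≤ η) := by
  have hK := hΩ.isCompact_closure
  refine (eventually_lintegral_comp_flow_le hΩ hX hXc).and (Eventually.and ?_
    (Eventually.and ?_ (Eventually.and ?_ ?_)))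
  · have hc : Continuous fun p : ℝ × Eu d => ‖p.1 • X p.2‖ :=
      (continuous_fst.smul (hX.continuous.comp continuous_snd)).norm
    filter_upwards [eventually_forall_abs_sub_lt hc hK (half_pos hη)] with s hs x hx
    have := hs x hx
    simp only [zero_smul, norm_zero, sub_zero, abs_norm] at this
    rw [dist_eq_norm, flow, add_sub_cancel_left]
    exact this.le
  · rw [eventually_all]
    intro i
    rw [eventually_all]
    intro k
    filter_upwards [eventually_forall_abs_sub_lt (contDiff_cof_flow hX i k).continuous hK hη]
      with s hs x hx
    have := hs x hx
    simp only [cof_flow_zero hX] at this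
    exact this.le
  · rw [eventually_all]
    intro i
    rw [eventually_all]
    intro k
    rw [eventually_all]
    intro j
    filter_upwards [eventually_forall_abs_sub_lt (continuous_partialDeriv_cof_flow hX i k j) hK hη]
      with s hs x hx
    have := hs x hx
    have h0 : cof (flow X 0) i k = fun _ => if i = k then 1 else 0 :=
      funext fun x => cof_flow_zero hX i k x
    simp only [h0, partialDeriv, fderiv_fun_const, Pi.zero_apply,
      zero_apply, sub_zero] at this
    exact this.le
  · rw [eventually_all]
    intro l
    rw [eventually_all]
    intro j
    filter_upwards [eventually_forall_abs_sub_lt (contDiff_jacobian_flow hX l j).continuous hK hη]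
      with s hs x hx
    have := hs x hx
    simp only [jacobian_flow hX, zero_mul, add_zero] at this
    simp only [jacobian_flow hX]
    exact this.le

/-- Regularizers that keep the regularization of a field on `Ω` compactly supported in `Ω`. -/
def Regularizer.IsContracting (A : Regularizer Ω) : Prop :=
  ∃ K : Set (Eu d), IsCompact K ∧ K ⊆ Ω ∧ ∀ x ∉ K, ∀ y ∈ closure Ω, A.φ.rOut ≤ dist y (A.Φ x)

/-- Regularizers that only use values of a field well inside `Ω`. -/
def Regularizer.IsExpanding (A : Regularizer Ω) : Prop :=
  ∀ x ∈ closure Ω, Metric.closedBall (A.Φ x) A.φ.rOut ⊆ Ω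

/-- Take Φ = id - εX. Since x = Φ x + ε X(x), a point with Φ x in the closure of Ω already lies in
Ω. So Φ sends the complement of Ω outside the closure, at a positive distance by compactness, and
fields extended by zero become compactly supported in Ω. -/
theorem IsSmoothBoundedDomain.exists_contracting (hΩ : IsSmoothBoundedDomain Ω) {η : ℝ}
    (hη : 0 < η) (hη1 : η ≤ 1) : ∃ A : Regularizer Ω, A.e = η ∧ A.IsContracting := by
  obtain ⟨X, hX, hXc, r, hr, hin⟩ := hΩ.exists_inward_field
  obtain ⟨C, hC⟩ := ContDiff.lipschitzWith_of_hasCompactSupport hXc hX (by simp)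
  obtain ⟨B, hB⟩ := hX.continuous.bounded_above_of_compact_support hXc
  have hev1 : ∀ᶠ s in 𝓝 (0 : ℝ), C * (|s| * B) < r := by
    have hc : Continuous fun s : ℝ => C * (|s| * B) := by fun_prop
    exact hc.continuousAt.eventually (gt_mem_nhds (by simpa using hr))
  obtain ⟨δ, hδ, hall⟩ := Metric.eventually_nhds_iff.1
    ((eventually_flow_close hΩ hX hXc hη).and hev1)
  set ε := min (δ / 2) (r / 2) with hε
  have hε0 : 0 < ε := by positivity
  obtain ⟨⟨h1, h2, h3, h4, h5⟩, h6⟩ := hall (y := -ε) (by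
    rw [Real.dist_eq, sub_zero, abs_neg, abs_of_pos hε0]
    exact (min_le_left _ _).trans_lt (by linarith))
  rw [abs_neg, abs_of_pos hε0] at h6
  -- Inwardness is known in directions close to X(Φ x), whereas the step uses X(x); the Lipschitz
  -- bound makes the difference less than r.
  have hpre : ∀ x, flow X (-ε) x ∈ closure Ω → x ∈ Ω := by
    intro x hx
    have e1 : x = flow X (-ε) x + ε • X x := by simp [flow]
    have e2 := hin _ hx (X x) (by
      refine (hC.norm_sub_le _ _).trans_lt (lt_of_le_of_lt ?_ h6)
      gcongr
      rw [flow, sub_add_cancel_left, norm_neg, norm_smul, norm_neg, Real.norm_of_nonneg hε0.le]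
      gcongr
      exact hB x) ε hε0 ((min_le_right _ _).trans_lt (by linarith))
    rwa [← e1] at e2
  obtain ⟨R, hR⟩ := hΩ.isCompact_closure.isBounded.subset_closedBall 0
  have hfar : ∀ x ∉ Metric.closedBall (0 : Eu d) (R + ε * B + 1), ∀ y ∈ closure Ω,
      1 ≤ dist (flow X (-ε) x) y := by
    intro x hx y hy
    rw [mem_closedBall_zero_iff, not_le] at hx
    have hy' := hR hy
    rw [mem_closedBall_zero_iff] at hy'
    have e2 : ‖ε • X x‖ ≤ ε * B := by
      rw [norm_smul, Real.norm_of_nonneg hε0.le]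
      gcongr
      exact hB x
    have e3 : ‖x‖ ≤ ‖flow X (-ε) x - y‖ + ‖y‖ + ‖ε • X x‖ := by
      calc ‖x‖ = ‖(flow X (-ε) x - y) + y + ε • X x‖ := by congr 1; simp [flow]
        _ ≤ _ := norm_add₃_le
    rw [dist_eq_norm]
    linarith
  have hΦc : Continuous (flow X (-ε)) := (contDiff_flow hX _).continuous
  -- Points outside Ω are split: in a large ball compactness gives a distance a > 0, beyond the ball
  -- the distance is at least 1.
  set S := Metric.closedBall (0 : Eu d) (R + ε * B + 1) \ Ω with hS
  have hSc : IsCompact S := (isCompact_closedBall _ _).diff hΩ.isOpen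
  obtain ⟨a, ha, hsep⟩ := (hSc.prod hΩ.isCompact_closure).exists_forall_le'
    (f := fun p : Eu d × Eu d => dist (flow X (-ε) p.1) p.2)
    ((hΦc.comp continuous_fst).dist continuous_snd).continuousOn (a := 0) (by
      rintro ⟨x, y⟩ ⟨hx, hy⟩
      refine dist_pos.2 fun h => hx.2 (hpre x ?_)
      simp only at h
      rwa [h])
  have hne : (closure Ω).Nonempty := hΩ.isConnected.nonempty.closure
  -- b lies strictly below both separations, so the set where Φ x is within b of the closure is
  -- contained in Ω; a mollification radius of at most b keeps the support in that set.
  set b := min a 1 / 2 with hb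
  have hb0 : 0 < b := by positivity
  have hba : b < min a 1 := by rw [hb]; linarith [show 0 < min a 1 by positivity]
  set ρ := min b (η / 2) with hρ
  have hρ0 : 0 < ρ := by positivity
  let φ : ContDiffBump (0 : Eu d) := ⟨ρ / 2, ρ, by positivity, by linarith⟩
  refine ⟨⟨flow X (-ε), φ, η, hη1, contDiff_flow hX _, h1, h2, min_le_right _ _, h3, h4, h5⟩, rfl,
    {x | Metric.infDist (flow X (-ε) x) (closure Ω) ≤ b}, ?_, ?_, ?_⟩
  · refine (isCompact_closedBall (0 : Eu d) (R + ε * B + 1)).of_isClosed_subset ?_ ?_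
    · exact isClosed_le ((Metric.continuous_infDist_pt _).comp hΦc) continuous_const
    · intro x hx
      by_contra hx'
      have h7 : 1 ≤ Metric.infDist (flow X (-ε) x) (closure Ω) := (Metric.le_infDist hne).2 fun y hy => hfar x hx' y hy
      simp only [mem_ofPred_eq] at hx
      linarith [min_le_right a 1]
  · intro x hx
    by_contra hxΩ
    simp only [mem_ofPred_eq] at hx
    by_cases hxb : x ∈ Metric.closedBall (0 : Eu d) (R + ε * B + 1)
    · have h7 : a ≤ Metric.infDist (flow X (-ε) x) (closure Ω) :=
        (Metric.le_infDist hne).2 fun y hy => hsep (x, y) ⟨⟨hxb, hxΩ⟩, hy⟩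
      linarith [min_le_left a 1]
    · have h7 : 1 ≤ Metric.infDist (flow X (-ε) x) (closure Ω) :=
        (Metric.le_infDist hne).2 fun y hy => hfar x hxb y hy
      linarith [min_le_right a 1]
  · intro x hx y hy
    simp only [mem_ofPred_eq, not_le] at hx
    have h := Metric.infDist_le_dist_of_mem (x := flow X (-ε) x) hy
    rw [dist_comm]
    exact (min_le_left _ _).trans (hx.le.trans h)

/-- Take Φ = id + εX. It maps the compact closure into Ω, hence to a positive distance from the
complement, and a small mollification radius uses interior values only. No boundary condition on the
field is needed. -/
theorem IsSmoothBoundedDomain.exists_expanding (hΩ : IsSmoothBoundedDomain Ω) {η : ℝ}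
    (hη : 0 < η) (hη1 : η ≤ 1) : ∃ A : Regularizer Ω, A.e = η ∧ A.IsExpanding := by
  obtain ⟨X, hX, hXc, r, hr, hin⟩ := hΩ.exists_inward_field
  obtain ⟨δ, hδ, hall⟩ := Metric.eventually_nhds_iff.1 (eventually_flow_close hΩ hX hXc hη)
  set ε := min (δ / 2) (r / 2) with hε
  have hε0 : 0 < ε := by positivity
  obtain ⟨h1, h2, h3, h4, h5⟩ := hall (y := ε) (by
    rw [Real.dist_eq, sub_zero, abs_of_pos hε0]
    exact (min_le_left _ _).trans_lt (by linarith))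
  have hΦc : Continuous (flow X ε) := (contDiff_flow hX _).continuous
  have himg : flow X ε '' closure Ω ⊆ Ω := by
    rintro _ ⟨x, hx, rfl⟩
    exact hin x hx (X x) (by simpa using hr) ε hε0 ((min_le_right _ _).trans_lt (by linarith))
  obtain ⟨b, hb, hsub⟩ := (hΩ.isCompact_closure.image hΦc).exists_cthickening_subset_open
    hΩ.isOpen himg
  set ρ := min b (η / 2) with hρ
  have hρ0 : 0 < ρ := by positivity
  let φ : ContDiffBump (0 : Eu d) := ⟨ρ / 2, ρ, by positivity, by linarith⟩
  refine ⟨⟨flow X ε, φ, η, hη1, contDiff_flow hX _, h1, h2, min_le_right _ _, h3, h4, h5⟩, rfl,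
    fun x hx => ?_⟩
  refine (Metric.closedBall_subset_closedBall (min_le_left _ _)).trans
    ((Metric.closedBall_subset_cthickening (mem_image_of_mem _ hx) b).trans hsub)

/-- A sequence of regularizers converging to the identity. -/
theorem IsSmoothBoundedDomain.exists_seq_contracting (hΩ : IsSmoothBoundedDomain Ω) :
    ∃ A : ℕ → Regularizer Ω, Tendsto (fun n => (A n).e) atTop (𝓝 0) ∧
      ∀ n, (A n).IsContracting := by
  choose A hA hA' using fun n : ℕ => hΩ.exists_contracting (η := 1 / ((n : ℝ) + 1))
    (by positivity) (by rw [div_le_one (by positivity)]; linarith [n.cast_nonneg (α := ℝ)])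
  refine ⟨A, ?_, hA'⟩
  simp only [hA]
  exact tendsto_one_div_add_atTop_nhds_zero_nat

theorem IsSmoothBoundedDomain.exists_seq_expanding (hΩ : IsSmoothBoundedDomain Ω) :
    ∃ A : ℕ → Regularizer Ω, Tendsto (fun n => (A n).e) atTop (𝓝 0) ∧
      ∀ n, (A n).IsExpanding := by
  choose A hA hA' using fun n : ℕ => hΩ.exists_expanding (η := 1 / ((n : ℝ) + 1))
    (by positivity) (by rw [div_le_one (by positivity)]; linarith [n.cast_nonneg (α := ℝ)])
  refine ⟨A, ?_, hA'⟩
  simp only [hA]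
  exact tendsto_one_div_add_atTop_nhds_zero_nat

end Flow

/-! ### Plain mollification as a special case -/

section Identity

variable {d : ℕ} {Ω : Set (Eu d)}

/-- Plain mollification as a regularizer. -/
def idRegularizer (Ω : Set (Eu d)) (ρ : ℝ) (h0 : 0 < ρ) (h1 : ρ ≤ 1 / 2) : Regularizer Ω where
  Φ := flow 0 0
  φ := ⟨ρ / 2, ρ, by positivity, by linarith⟩
  e := 2 * ρ
  e_le := by linarith
  contDiff := contDiff_flow contDiff_const 0
  lintegral_comp_le g := by
    simp only [flow, zero_smul, add_zero]
    calc ∫⁻ x in Ω, g x ≤ ∫⁻ x, g x := lintegral_mono' Measure.restrict_le_self le_rfl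
      _ ≤ 2 * ∫⁻ x, g x := le_mul_of_one_le_left bot_le (by norm_num)
  dist_le x _ := by simp [flow, h0.le]
  rOut_le := by simp
  cof_le i k x _ := by simp [cof_flow_zero (X := (0 : Eu d → Eu d)) contDiff_const, h0.le]
  cofDeriv_le i k j x _ := by
    have h : cof (flow (0 : Eu d → Eu d) 0) i k = fun _ => if i = k then 1 else 0 :=
      funext fun x => cof_flow_zero contDiff_const i k x
    simp [h, partialDeriv, h0.le]
  jacobian_le l j x _ := by
    simp [jacobian_flow (X := (0 : Eu d → Eu d)) contDiff_const, h0.le]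

theorem idRegularizer_Φ {ρ : ℝ} {h0 : 0 < ρ} {h1 : ρ ≤ 1 / 2} (x : Eu d) :
    (idRegularizer Ω ρ h0 h1).Φ x = x := by simp [idRegularizer, flow]

theorem idRegularizer_rOut {ρ : ℝ} {h0 : 0 < ρ} {h1 : ρ ≤ 1 / 2} :
    (idRegularizer Ω ρ h0 h1).φ.rOut = ρ := rfl

/-- Mollification with radius at most `δ`, tending to zero. -/
theorem exists_seq_mollifier (Ω : Set (Eu d)) {δ : ℝ} (hδ : 0 < δ) :
    ∃ A : ℕ → Regularizer Ω, Tendsto (fun n => (A n).e) atTop (𝓝 0) ∧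
      (∀ n x, (A n).Φ x = x) ∧ (∀ n, (A n).φ.rOut ≤ δ) := by
  have h0 : ∀ n : ℕ, 0 < min δ (1 / 2) * (1 / ((n : ℝ) + 1)) := fun n => by positivity
  have h1 : ∀ n : ℕ, min δ (1 / 2) * (1 / ((n : ℝ) + 1)) ≤ min δ (1 / 2) := fun n => by
    refine mul_le_of_le_one_right (by positivity) ?_
    rw [div_le_one (by positivity)]
    linarith [n.cast_nonneg (α := ℝ)]
  refine ⟨fun n => idRegularizer Ω _ (h0 n) ((h1 n).trans (min_le_right _ _)), ?_,
    fun n x => idRegularizer_Φ x, fun n => ?_⟩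
  · change Tendsto (fun n : ℕ => 2 * (min δ (1 / 2) * (1 / ((n : ℝ) + 1)))) atTop (𝓝 0)
    have := (tendsto_one_div_add_atTop_nhds_zero_nat (𝕜 := ℝ)).const_mul (min δ (1 / 2))
    simpa using this.const_mul 2
  · rw [idRegularizer_rOut]
    exact (h1 n).trans (min_le_left _ _)

end Identity

/-! ### Leibniz rule and integration by parts along solenoidal fields -/

section Product

variable {d : ℕ} {Ω : Set (Eu d)} [IsFiniteMeasure (volume.restrict Ω : Measure (Eu d))]

theorem exists_bound_of_compact {φ : Eu d → ℝ} (hφ : Continuous φ) (hc : HasCompactSupport φ) :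
    ∃ C, ∀ x, |φ x| ≤ C := hφ.bounded_above_of_compact_support hc

/-- The Leibniz rule for `f h` tested against `φ ∈ C_c^∞(Ω)`. -/
theorem integral_test_mul_leibniz (hΩ : IsOpen Ω) {j : Fin d} {f Df h Dh : L2 Ω}
    (hf : HasWeakDeriv Ω j f Df) (hh : HasWeakDeriv Ω j h Dh) {φ : Eu d → ℝ} (hφ : IsTest Ω φ) :
    (∫ x in Ω, φ x * f x * Dh x) + (∫ x in Ω, φ x * Df x * h x)
      = -∫ x in Ω, partialDeriv j φ x * f x * h x := by
  obtain ⟨δ, hδ, hsub⟩ := hφ.2.1.exists_cthickening_subset_open hΩ hφ.2.2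
  obtain ⟨A, hA, hAΦ, hAr⟩ := exists_seq_mollifier Ω hδ
  obtain ⟨C, hC⟩ := exists_bound_of_compact hφ.1.continuous hφ.2.1
  obtain ⟨C', hC'⟩ := exists_bound_of_compact (hφ.partialDeriv j).1.continuous
    (hφ.partialDeriv j).2.1
  have hφm := hφ.1.continuous.aestronglyMeasurable (μ := (volume.restrict Ω : Measure (Eu d)))
  have hφm' := (hφ.partialDeriv j).1.continuous.aestronglyMeasurable
    (μ := (volume.restrict Ω : Measure (Eu d)))
  let P := mulOp φ C hφm (Eventually.of_forall hC)
  let Q := mulOp (partialDeriv j φ) C' hφm' (Eventually.of_forall hC')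
  have hP : ∀ a b : L2 Ω, inner ℝ (P a) b = ∫ x in Ω, φ x * a x * b x := fun a b => by
    rw [← integral_mul_eq_inner]
    refine integral_congr_ae ?_
    filter_upwards [mulOp_coeFn hφm (Eventually.of_forall hC) a] with x hx
    rw [hx]
  have hQ : ∀ a b : L2 Ω, inner ℝ (Q a) b = ∫ x in Ω, partialDeriv j φ x * a x * b x :=
    fun a b => by
    rw [← integral_mul_eq_inner]
    refine integral_congr_ae ?_
    filter_upwards [mulOp_coeFn hφm' (Eventually.of_forall hC') a] with x hx
    rw [hx]
  have hmol : ∀ n (k : L2 Ω), (A n).op hΩ.measurableSet k =ᵐ[volume.restrict Ω] moll (A n).φ k := by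
    intro n k
    filter_upwards [(A n).coeFn_op hΩ.measurableSet k] with x hx
    rw [hx, Regularizer.opFun, hAΦ]
  have key : ∀ n, inner ℝ (P f) ((A n).op hΩ.measurableSet Dh) +
      inner ℝ (P Df) ((A n).op hΩ.measurableSet h) =
      -inner ℝ (Q f) ((A n).op hΩ.measurableSet h) := by
    intro n
    have hs := contDiff_moll (A n).φ h
    -- Only h is mollified: φ times a smooth function may be tested against the weak derivative of
    -- f. The radius is small enough for mollification and differentiation to commute on the support
    -- of φ.
    have hθ : IsTest Ω (fun x => φ x * moll (A n).φ h x) :=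
      ⟨hφ.1.mul hs, hφ.2.1.mul_right, (tsupport_mul_subset_left).trans hφ.2.2⟩
    have hder : ∀ x, partialDeriv j (fun x => φ x * moll (A n).φ h x) x
        = φ x * moll (A n).φ Dh x + partialDeriv j φ x * moll (A n).φ h x := by
      intro x
      rw [partialDeriv_mul (hφ.1.differentiable (by simp) x) (hs.differentiable (by simp) x)]
      by_cases hx : x ∈ tsupport φ
      · rw [partialDeriv_moll hh]
        exact (Metric.closedBall_subset_closedBall (hAr n)).trans
          ((Metric.closedBall_subset_cthickening hx δ).trans hsub)
      · simp [image_eq_zero_of_notMem_tsupport hx]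
    have hw := hf _ hθ
    simp only [hder] at hw
    rw [hP, hP, hQ]
    have e1 : ∫ x in Ω, φ x * f x * ((A n).op hΩ.measurableSet Dh) x
        = ∫ x in Ω, f x * (φ x * moll (A n).φ Dh x) := by
      refine integral_congr_ae ?_
      filter_upwards [hmol n Dh] with x hx
      rw [hx]; ring
    have e2 : ∫ x in Ω, partialDeriv j φ x * f x * ((A n).op hΩ.measurableSet h) x
        = ∫ x in Ω, f x * (partialDeriv j φ x * moll (A n).φ h x) := by
      refine integral_congr_ae ?_
      filter_upwards [hmol n h] with x hx
      rw [hx]; ring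
    have e3 : ∫ x in Ω, φ x * Df x * ((A n).op hΩ.measurableSet h) x
        = ∫ x in Ω, Df x * (φ x * moll (A n).φ h x) := by
      refine integral_congr_ae ?_
      filter_upwards [hmol n h] with x hx
      rw [hx]; ring
    have hi : ∀ (p : Eu d → ℝ) (k : L2 Ω), IsTest Ω p →
        Integrable (fun x => f x * (p x * moll (A n).φ k x)) (volume.restrict Ω) := by
      intro p k hp
      refine (Lp.memLp f).integrable_mul (p := 2) (q := 2) ?_
      exact memLp_of_compact (hp.1.continuous.mul (contDiff_moll (A n).φ k).continuous)
        hp.2.1.mul_right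
    have e4 : ∫ x in Ω, f x * (φ x * moll (A n).φ Dh x + partialDeriv j φ x * moll (A n).φ h x)
        = (∫ x in Ω, f x * (φ x * moll (A n).φ Dh x)) +
          ∫ x in Ω, f x * (partialDeriv j φ x * moll (A n).φ h x) := by
      rw [← integral_add (hi _ _ hφ) (hi _ _ (hφ.partialDeriv j))]
      refine integral_congr_ae (Eventually.of_forall fun x => by ring)
    rw [e1, e2, e3]
    rw [e4] at hw
    linarith
  have hl := ((tendsto_const_nhds (x := P f)).inner (𝕜 := ℝ)
    (Regularizer.tendsto_op hA hΩ.measurableSet Dh)).add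
    ((tendsto_const_nhds (x := P Df)).inner (𝕜 := ℝ) (Regularizer.tendsto_op hA hΩ.measurableSet h))
  have hr := ((tendsto_const_nhds (x := Q f)).inner (𝕜 := ℝ)
    (Regularizer.tendsto_op hA hΩ.measurableSet h)).neg
  have := tendsto_nhds_unique (hl.congr key) hr
  rwa [hP, hP, hQ] at this

/-- Integration by parts of `v · ∇(f h)` for solenoidal `v`. -/
theorem sum_tri_eq_zero_of_L2Div (hΩ : IsOpen Ω) {v : Fin d → L2 Ω} (hv : v ∈ L2Div Ω) {M : ℝ}
    (hM : 0 ≤ M) {f h : L2 Ω} {Df Dh : Fin d → L2 Ω} (hf : ∀ j, HasWeakDeriv Ω j f (Df j))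
    (hh : ∀ j, HasWeakDeriv Ω j h (Dh j)) (hfM : ∀ᵐ x ∂(volume.restrict Ω), |f x| ≤ M)
    (hDfM : ∀ j, ∀ᵐ x ∂(volume.restrict Ω), |Df j x| ≤ M) :
    ∑ j, (tri M (v j) h (Df j) + tri M (v j) (Dh j) f) = 0 := by
  -- The truncated form is continuous in v for the L² topology, so solenoidal test fields suffice;
  -- for them the truncation is harmless because f and Df are bounded.
  have hcont : Continuous fun v : Fin d → L2 Ω =>
      ∑ j, (tri M (v j) h (Df j) + tri M (v j) (Dh j) f) := by
    refine continuous_finsetSum _ fun j _ => Continuous.add ?_ ?_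
    · exact (continuous_tri hM).comp (f := fun v : Fin d → L2 Ω => (v j, h, Df j)) (by fun_prop)
    · exact (continuous_tri hM).comp (f := fun v : Fin d → L2 Ω => (v j, Dh j, f)) (by fun_prop)
  refine closure_minimal (t := {v : Fin d → L2 Ω |
    ∑ j, (tri M (v j) h (Df j) + tri M (v j) (Dh j) f) = 0}) ?_
    (isClosed_eq hcont continuous_const) hv
  rintro w ⟨φ, hφ, hw⟩
  have hterm : ∀ j, tri M (w j) h (Df j) + tri M (w j) (Dh j) f
      = -∫ x in Ω, partialDeriv j (φ j) x * f x * h x := by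
    intro j
    rw [← integral_test_mul_leibniz hΩ (hf j) (hh j) (hφ.1 j), add_comm,
      tri_eq_of_abs_le hfM, tri_eq_of_abs_le (hDfM j)]
    congr 1
    · refine integral_congr_ae ?_
      filter_upwards [hw j] with x hx
      rw [hx]; ring
    · refine integral_congr_ae ?_
      filter_upwards [hw j] with x hx
      rw [hx]; ring
  rw [mem_ofPred_eq, Finset.sum_congr rfl fun j _ => hterm j, Finset.sum_neg_distrib,
    neg_eq_zero, ← integral_finsetSum]
  · refine setIntegral_eq_zero_of_forall_eq_zero fun x hx => ?_
    have : ∑ j, partialDeriv j (φ j) x * f x * h x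
        = (∑ j, partialDeriv j (φ j) x) * (f x * h x) := by
      rw [Finset.sum_mul]
      exact Finset.sum_congr rfl fun j _ => by ring
    rw [this, hφ.2 x hx, zero_mul]
  · intro j _
    obtain ⟨C, hC⟩ := exists_bound_of_compact ((hφ.1 j).partialDeriv j).1.continuous
      ((hφ.1 j).partialDeriv j).2.1
    have := (integrable_mul_L2 f h).bdd_mul (c := C)
      ((hφ.1 j).partialDeriv j).1.continuous.aestronglyMeasurable (Eventually.of_forall hC)
    refine this.congr (Eventually.of_forall fun x => by simp only; ring)

end Product

/-! ### Embedding of W^{2,2} into L^∞ by averaging over cones -/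

section Sobolev

/-- Taylor's formula at `0` with the weight `(1 - τ)²`. -/
theorem eq_integral_cone {γ γ' γ'' : ℝ → ℝ} (h1 : ∀ τ, HasDerivAt γ (γ' τ) τ)
    (h2 : ∀ τ, HasDerivAt γ' (γ'' τ) τ) (hc : Continuous γ'') :
    γ 0 = ∫ τ in (0 : ℝ)..1, τ * (2 * γ τ - 4 * (1 - τ) * γ' τ + (1 - τ) ^ 2 * γ'' τ) := by
  have hc1 : Continuous γ := continuous_iff_continuousAt.2 fun τ => (h1 τ).continuousAt
  have hc2 : Continuous γ' := continuous_iff_continuousAt.2 fun τ => (h2 τ).continuousAt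
  have hs : ∀ τ : ℝ, HasDerivAt (fun τ => 1 - τ) (-1) τ := fun τ =>
    (hasDerivAt_id τ).const_sub 1
  -- The primitive is -γ 0 at τ = 0 and 0 at τ = 1; it is arranged so that its whole derivative
  -- carries a factor τ.
  have hder : ∀ τ : ℝ, HasDerivAt (fun τ => τ * (-2 * (1 - τ) * γ τ + (1 - τ) ^ 2 * γ' τ)
      - (1 - τ) ^ 2 * γ τ)
      (τ * (2 * γ τ - 4 * (1 - τ) * γ' τ + (1 - τ) ^ 2 * γ'' τ)) τ := by
    intro τ
    have := ((hasDerivAt_id τ).mul ((((hs τ).const_mul (-2)).mul (h1 τ)).add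
      (((hs τ).pow 2).mul (h2 τ)))).sub (((hs τ).pow 2).mul (h1 τ))
    refine this.congr_deriv ?_
    simp only [Pi.add_apply, Pi.mul_apply, Pi.pow_apply, id_eq, Nat.cast_ofNat,
      Nat.add_one_sub_one, pow_one]
    ring
  rw [intervalIntegral.integral_eq_sub_of_hasDerivAt (fun τ _ => hder τ)
    (Continuous.intervalIntegrable (by fun_prop) _ _)]
  simp

variable {d : ℕ}

theorem abs_sum_mul_le {u : Eu d} {B : ℝ} (hu : ‖u‖ ≤ B) (a : Fin d → ℝ) :
    |∑ j, u j * a j| ≤ B * ∑ j, |a j| := by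
  rw [Finset.mul_sum]
  refine (Finset.abs_sum_le_sum_abs _ _).trans (Finset.sum_le_sum fun j _ => ?_)
  rw [abs_mul]
  have : |u j| ≤ ‖u‖ := by simpa using PiLp.norm_apply_le u j
  exact mul_le_mul_of_nonneg_right (this.trans hu) (abs_nonneg _)

theorem hasDerivAt_ray {G : Eu d → ℝ} (hG : ContDiff ℝ ∞ G) (x u : Eu d) (τ : ℝ) :
    HasDerivAt (fun τ : ℝ => G (x + τ • u)) (∑ j, u j * partialDeriv j G (x + τ • u)) τ := by
  have h1 : HasDerivAt (fun τ : ℝ => x + τ • u) u τ := by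
    simpa using ((hasDerivAt_id τ).smul_const u).const_add x
  have h2 := ((hG.differentiable (by simp)) (x + τ • u)).hasFDerivAt.comp_hasDerivAt τ h1
  rwa [fderiv_apply_eq_sum] at h2

/-- Taylor's formula on the segment from x to x + u, the coefficients 2, 4B and B² all being at most
4B². The majorant Q has to dominate the derivatives on the segment only, so it can be a function
with a global L² bound. -/
theorem ofReal_abs_le_ray {G : Eu d → ℝ} (hG : ContDiff ℝ ∞ G) {x u : Eu d} {B : ℝ} (hB : 1 ≤ B)
    (hu : ‖u‖ ≤ B) {Q : Eu d → ℝ} (hQ : Continuous Q)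
    (h : ∀ τ ∈ Icc (0 : ℝ) 1, |G (x + τ • u)| + (∑ j, |partialDeriv j G (x + τ • u)|) +
      (∑ j, ∑ k, |partialDeriv k (partialDeriv j G) (x + τ • u)|) ≤ Q (x + τ • u)) :
    ENNReal.ofReal |G x| ≤ ENNReal.ofReal (4 * B ^ 2) *
      ∫⁻ τ in Ioo (0 : ℝ) 1, ENNReal.ofReal τ * ENNReal.ofReal (Q (x + τ • u)) := by
  have hG1 := fun j => contDiff_partialDeriv hG j
  have hG2 := fun j k => contDiff_partialDeriv (hG1 j) k
  have hd1 := hasDerivAt_ray hG x u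
  have hd2 : ∀ τ : ℝ, HasDerivAt (fun τ : ℝ => ∑ j, u j * partialDeriv j G (x + τ • u))
      (∑ j, u j * ∑ k, u k * partialDeriv k (partialDeriv j G) (x + τ • u)) τ := fun τ =>
    HasDerivAt.fun_sum fun j _ => (hasDerivAt_ray (hG1 j) x u τ).const_mul (u j)
  have hcont2 : Continuous fun τ : ℝ =>
      ∑ j, u j * ∑ k, u k * partialDeriv k (partialDeriv j G) (x + τ • u) := by
    have := fun j k => (hG2 j k).continuous
    fun_prop
  have hid := eq_integral_cone hd1 hd2 hcont2
  simp only [zero_smul, add_zero] at hid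
  have hle : |G x| ≤ ∫ τ in (0 : ℝ)..1, τ * (4 * B ^ 2 * Q (x + τ • u)) := by
    rw [hid, ← Real.norm_eq_abs]
    refine intervalIntegral.norm_integral_le_of_norm_le zero_le_one
      (Eventually.of_forall fun τ hτ => ?_) (Continuous.intervalIntegrable (by fun_prop) _ _)
    rw [norm_mul, Real.norm_of_nonneg hτ.1.le]
    refine mul_le_mul_of_nonneg_left ?_ hτ.1.le
    have hh := h τ ⟨hτ.1.le, hτ.2⟩
    have e1 := abs_sum_mul_le hu (fun j => partialDeriv j G (x + τ • u))
    have e2 : |∑ j, u j * ∑ k, u k * partialDeriv k (partialDeriv j G) (x + τ • u)|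
        ≤ B ^ 2 * ∑ j, ∑ k, |partialDeriv k (partialDeriv j G) (x + τ • u)| := by
      refine (abs_sum_mul_le hu _).trans ?_
      rw [pow_two, mul_assoc]
      refine mul_le_mul_of_nonneg_left ?_ (by linarith)
      rw [Finset.mul_sum]
      exact Finset.sum_le_sum fun j _ => abs_sum_mul_le hu _
    set a := G (x + τ • u)
    set b := ∑ j, u j * partialDeriv j G (x + τ • u)
    set c := ∑ j, u j * ∑ k, u k * partialDeriv k (partialDeriv j G) (x + τ • u)
    set b' := ∑ j, |partialDeriv j G (x + τ • u)| with hb'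
    set c' := ∑ j, ∑ k, |partialDeriv k (partialDeriv j G) (x + τ • u)| with hc'
    have hb0 : 0 ≤ b' := Finset.sum_nonneg fun _ _ => abs_nonneg _
    have hc0 : 0 ≤ c' := Finset.sum_nonneg fun _ _ => Finset.sum_nonneg fun _ _ => abs_nonneg _
    have hB2 : B ≤ B ^ 2 := by nlinarith
    have t1 : |1 - τ| ≤ 1 := by rw [abs_le]; constructor <;> linarith [hτ.1, hτ.2]
    calc ‖2 * a - 4 * (1 - τ) * b + (1 - τ) ^ 2 * c‖
        ≤ ‖2 * a‖ + ‖4 * (1 - τ) * b‖ + ‖(1 - τ) ^ 2 * c‖ :=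
          (norm_add_le _ _).trans (add_le_add_left (norm_sub_le _ _) _)
      _ = 2 * |a| + 4 * |1 - τ| * |b| + |1 - τ| ^ 2 * |c| := by
          simp
      _ ≤ 4 * B ^ 2 * |a| + 4 * B ^ 2 * b' + 4 * B ^ 2 * c' := by
          refine add_le_add (add_le_add ?_ ?_) ?_
          · exact mul_le_mul_of_nonneg_right (by nlinarith) (abs_nonneg _)
          · calc 4 * |1 - τ| * |b| ≤ 4 * 1 * (B * b') := by gcongr
              _ ≤ 4 * B ^ 2 * b' := by nlinarith
          · calc |1 - τ| ^ 2 * |c| ≤ 1 ^ 2 * (B ^ 2 * c') := by gcongr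
              _ ≤ 4 * B ^ 2 * c' := by nlinarith [mul_nonneg (sq_nonneg B) hc0]
      _ = 4 * B ^ 2 * (|a| + b' + c') := by ring
      _ ≤ 4 * B ^ 2 * Q (x + τ • u) := by gcongr
  refine (ENNReal.ofReal_le_ofReal hle).trans ?_
  rw [intervalIntegral.integral_of_le zero_le_one, integral_Ioc_eq_integral_Ioo]
  have hQ0 : ∀ τ ∈ Ioo (0 : ℝ) 1, 0 ≤ Q (x + τ • u) := fun τ hτ =>
    le_trans (by positivity) (h τ ⟨hτ.1.le, hτ.2.le⟩)
  rw [ofReal_integral_eq_lintegral_ofReal, ← lintegral_const_mul]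
  · refine setLIntegral_mono (by fun_prop) fun τ hτ => ?_
    rw [← ENNReal.ofReal_mul hτ.1.le, ← ENNReal.ofReal_mul (by positivity)]
    exact ENNReal.ofReal_le_ofReal (by linarith)
  · fun_prop
  · exact (Continuous.integrableOn_Icc (by fun_prop)).mono_set Ioo_subset_Icc_self
  · filter_upwards [ae_restrict_mem measurableSet_Ioo] with τ hτ
    have := hQ0 τ hτ
    have := hτ.1
    simp only [Pi.zero_apply]
    positivity

/-- The dilation by τ has Jacobian τ^d, and τ^d ≥ τ³ for 0 < τ < 1; this is where d ≤ 3 enters. -/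
theorem lintegral_ray_sq_le (hd : d ≤ 3) {q : Eu d → ENNReal} (hq : Measurable q) (x : Eu d)
    {τ : ℝ} (h0 : 0 < τ) (h1 : τ < 1) :
    ∫⁻ u, q (x + τ • u) ^ 2 ≤ ENNReal.ofReal ((τ ^ 3)⁻¹) * ∫⁻ z, q z ^ 2 := by
  have e1 : ∫⁻ u, q (x + τ • u) ^ 2 =
      ∫⁻ v, q (x + v) ^ 2 ∂(Measure.map (fun u : Eu d => τ • u) volume) := by
    rw [lintegral_map (by fun_prop) (by fun_prop)]
  rw [e1, Measure.map_addHaar_smul _ h0.ne', lintegral_smul_measure, smul_eq_mul,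
    lintegral_add_left_eq_self (fun v => q v ^ 2) x, finrank_euclideanSpace_fin]
  gcongr
  rw [abs_of_pos (by positivity)]
  exact inv_anti₀ (by positivity) (pow_le_pow_of_le_one h0.le h1.le hd)

/-- Cauchy–Schwarz in u and the dilation bound leave τ · τ^{-3/2} = τ^{-1/2}, which is integrable at
0. The factor τ in `eq_integral_cone` exists for this reason. -/
theorem exists_average_ray_le (hd : d ≤ 3) (κ : ℝ) : ∃ K : ENNReal, K ≠ ⊤ ∧
    ∀ (q : Eu d → ENNReal), Measurable q → ∀ x c : Eu d,
      ∫⁻ u in Metric.ball c κ, ∫⁻ τ in Ioo (0 : ℝ) 1, ENNReal.ofReal τ * q (x + τ • u)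
        ≤ K * (∫⁻ z, q z ^ 2) ^ (1 / 2 : ℝ) := by
  set V := (volume : Measure (Eu d)) (Metric.ball 0 κ) with hV
  have hVtop : V ≠ ⊤ := measure_ball_lt_top.ne
  refine ⟨V ^ (1 / 2 : ℝ) * ∫⁻ τ in Ioo (0 : ℝ) 1, ENNReal.ofReal (τ ^ (-(1 / 2) : ℝ)), ?_, ?_⟩
  · refine ENNReal.mul_ne_top (ENNReal.rpow_ne_top_of_nonneg (by norm_num) hVtop) ?_
    have h := (intervalIntegral.intervalIntegrable_rpow' (a := 0) (b := 1) (r := -(1 / 2))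
      (by norm_num))
    rw [intervalIntegrable_iff_integrableOn_Ioo_of_le zero_le_one] at h
    have h2 := h.2
    rw [hasFiniteIntegral_iff_enorm] at h2
    refine ne_top_of_le_ne_top h2.ne (lintegral_mono fun τ => ?_)
    exact Real.ofReal_le_enorm _
  · intro q hq x c
    rw [lintegral_lintegral_swap (by fun_prop)]
    rw [mul_right_comm, ← lintegral_const_mul]
    · refine setLIntegral_mono (by fun_prop) fun τ hτ => ?_
      rw [lintegral_const_mul _ (by fun_prop)]
      have hcs : (∫⁻ u in Metric.ball c κ, q (x + τ • u)) ^ 2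
          ≤ V * (ENNReal.ofReal ((τ ^ 3)⁻¹) * ∫⁻ z, q z ^ 2) := by
        have := lintegral_mul_sq_le (μ := (volume : Measure (Eu d)).restrict (Metric.ball c κ))
          (k := fun _ => 1) (g := fun u => q (x + τ • u)) aemeasurable_const (by fun_prop)
        simp only [one_mul, lintegral_one, Measure.restrict_apply_univ] at this
        refine this.trans ?_
        rw [hV, Measure.addHaar_ball_center volume c κ]
        gcongr
        exact (lintegral_mono' Measure.restrict_le_self le_rfl).trans
          (lintegral_ray_sq_le hd hq x hτ.1 hτ.2)
      have hcs' : (∫⁻ u in Metric.ball c κ, q (x + τ • u))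
          ≤ (V * (ENNReal.ofReal ((τ ^ 3)⁻¹) * ∫⁻ z, q z ^ 2)) ^ (1 / 2 : ℝ) := by
        have := ENNReal.rpow_le_rpow hcs (z := 1 / 2) (by norm_num)
        rwa [← ENNReal.rpow_natCast, ← ENNReal.rpow_mul,
          show ((2 : ℕ) : ℝ) * (1 / 2) = 1 by norm_num, ENNReal.rpow_one] at this
      refine (mul_le_mul_right hcs' _).trans (le_of_eq ?_)
      rw [ENNReal.mul_rpow_of_nonneg _ _ (by norm_num), ENNReal.mul_rpow_of_nonneg _ _ (by norm_num),
        ENNReal.ofReal_rpow_of_nonneg (by have := hτ.1; positivity) (by norm_num)]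
      have : ENNReal.ofReal τ * ENNReal.ofReal ((τ ^ 3)⁻¹ ^ (1 / 2 : ℝ))
          = ENNReal.ofReal (τ ^ (-(1 / 2) : ℝ)) := by
        rw [← ENNReal.ofReal_mul hτ.1.le]
        congr 1
        have h0 := hτ.1
        rw [← Real.rpow_natCast, ← Real.rpow_neg h0.le, ← Real.rpow_mul h0.le,
          ← Real.rpow_one_add' h0.le (by norm_num)]
        norm_num
      rw [← this]
      ring
    · fun_prop

end Sobolev

/-! ### The Sobolev bound on the domain -/

section Sobolev

variable {d : ℕ} {Ω : Set (Eu d)}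

theorem eLpNorm_moll_le [IsFiniteMeasure (volume.restrict Ω : Measure (Eu d))]
    (hΩ : MeasurableSet Ω) (φ : ContDiffBump (0 : Eu d)) (f : L2 Ω) :
    eLpNorm (moll φ f) 2 volume ≤ 2 * ENNReal.ofReal ‖f‖ := by
  have hk : Measurable (Function.uncurry fun x y => φ.normed (volume : Measure (Eu d)) (x - y)) :=
    (φ.continuous_normed.comp (continuous_fst.sub continuous_snd)).measurable
  have h := eLpNorm_kernel_le (m := volume) (ν := volume) hk (fun x y => φ.nonneg_normed _)
    (Eventually.of_forall fun x => (lintegral_normed_sub φ x).le) (fun y => ?_)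
    (memLp_zeroExt hΩ f).aestronglyMeasurable
  · rw [eLpNorm_zeroExt hΩ] at h
    refine le_trans (le_of_eq (congrArg (fun g => eLpNorm g 2 _) ?_)) h
    funext x
    exact moll_eq_integral_zeroExt hΩ φ f x
  · rw [lintegral_sub_right_eq_self (fun z => ENNReal.ofReal (φ.normed volume z)) y,
      ← ofReal_integral_eq_lintegral_ofReal φ.integrable_normed
      (Eventually.of_forall fun y => φ.nonneg_normed _), φ.integral_normed]
    norm_num

/-- `H²(Ω) ⊂ L^∞(Ω)` in dimension at most three. -/
theorem IsSmoothBoundedDomain.exists_sobolev_bound (hd : d ≤ 3) (hΩ : IsSmoothBoundedDomain Ω) :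
    ∃ C : ℝ, 0 ≤ C ∧ ∀ (f : L2 Ω) (g : Fin d → L2 Ω) (h : Fin d → Fin d → L2 Ω),
      (∀ j, HasWeakDeriv Ω j f (g j)) → (∀ j k, HasWeakDeriv Ω k (g j) (h j k)) →
      ∀ᵐ x ∂(volume.restrict Ω), |f x| ≤ C * (‖f‖ + (∑ j, ‖g j‖) + ∑ j, ∑ k, ‖h j k‖) := by
  have := hΩ.isFiniteMeasure
  have hm := hΩ.isOpen.measurableSet
  obtain ⟨X, hXs, hXc, r, hr, hX⟩ := hΩ.exists_inward_field
  set r₀ := min (r / 2) 1 with hr₀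
  have hr₀0 : 0 < r₀ := lt_min (half_pos hr) one_pos
  have hr₀r : r₀ < r := (min_le_left _ _).trans_lt (half_lt_self hr)
  have hr₀1 : r₀ ≤ 1 := min_le_right _ _
  obtain ⟨B, hB⟩ := hXs.continuous.bounded_above_of_compact_support hXc
  have hB0 : 0 ≤ B := (norm_nonneg _).trans (hB 0)
  have hκ : 0 < r₀ * r₀ := mul_pos hr₀0 hr₀0
  obtain ⟨K, hK, havg⟩ := exists_average_ray_le hd (r₀ * r₀)
  set V := (volume : Measure (Eu d)) (Metric.ball 0 (r₀ * r₀)) with hV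
  have hVtop : V ≠ ⊤ := measure_ball_lt_top.ne
  have hV0 : V ≠ 0 := (Metric.measure_ball_pos volume 0 hκ).ne'
  set C := V⁻¹ * (ENNReal.ofReal (4 * (B + 1) ^ 2) * (K * 2)) with hC
  have hCtop : C ≠ ⊤ := ENNReal.mul_ne_top (ENNReal.inv_ne_top.2 hV0)
    (ENNReal.mul_ne_top ENNReal.ofReal_ne_top (ENNReal.mul_ne_top hK (by norm_num)))
  refine ⟨C.toReal, ENNReal.toReal_nonneg, fun f g h hg hh => ?_⟩
  set N := ‖f‖ + (∑ j, ‖g j‖) + ∑ j, ∑ k, ‖h j k‖ with hN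
  have hN0 : 0 ≤ N := by positivity
  -- Write x + τ u = x + (τ r₀)(u / r₀): the direction u / r₀ is within r₀ < r of X x, and the step
  -- length τ r₀ is below r.
  have hcone : ∀ x ∈ Ω, ∀ u ∈ Metric.closedBall (r₀ • X x) (r₀ * r₀), ∀ τ ∈ Icc (0 : ℝ) 1,
      x + τ • u ∈ Ω := by
    intro x hx u hu τ hτ
    rcases hτ.1.eq_or_lt with h0 | h0
    · rwa [← h0, zero_smul, add_zero]
    · have := hX x (subset_closure hx) (r₀⁻¹ • u) ?_ (τ * r₀) (by positivity) ?_
      · rwa [smul_smul, mul_assoc, mul_inv_cancel₀ hr₀0.ne', mul_one] at this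
      · rw [mem_closedBall_iff_norm] at hu
        have e : r₀⁻¹ • u - X x = r₀⁻¹ • (u - r₀ • X x) := by
          rw [smul_sub, smul_smul, inv_mul_cancel₀ hr₀0.ne', one_smul]
        rw [e, norm_smul, norm_inv, Real.norm_of_nonneg hr₀0.le]
        refine lt_of_le_of_lt ?_ hr₀r
        rw [inv_mul_le_iff₀ hr₀0]
        exact hu
      · nlinarith [hτ.2]
  -- The admissible radius δ depends on x but the bound does not, which is enough for a limit at
  -- almost every point.
  have key : ∀ x ∈ Ω, ∃ δ > 0, ∀ φ : ContDiffBump (0 : Eu d), φ.rOut ≤ δ →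
      |moll φ f x| ≤ C.toReal * N := by
    intro x hx
    set S := (fun p : ℝ × Eu d => x + p.1 • p.2) ''
      (Icc (0 : ℝ) 1 ×ˢ Metric.closedBall (r₀ • X x) (r₀ * r₀)) with hS
    have hSc : IsCompact S := (isCompact_Icc.prod (isCompact_closedBall _ _)).image (by fun_prop)
    have hSΩ : S ⊆ Ω := by
      rintro _ ⟨p, hp, rfl⟩
      exact hcone x hx p.2 hp.2 p.1 hp.1
    obtain ⟨δ, hδ, hsub⟩ := hSc.exists_cthickening_subset_open hΩ.isOpen hSΩ
    refine ⟨δ / 2, half_pos hδ, fun φ hφ => ?_⟩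
    have hnear : ∀ z ∈ S, ∀ z' ∈ Metric.ball z (δ / 2), Metric.closedBall z' φ.rOut ⊆ Ω := by
      intro z hz z' hz'
      refine Subset.trans ?_ ((Metric.closedBall_subset_cthickening hz δ).trans hsub)
      refine Metric.closedBall_subset_closedBall' ?_
      rw [Metric.mem_ball] at hz'
      linarith
    -- Q uses the mollified weak derivatives, whose L² norms over the whole space are controlled;
    -- they agree with the derivatives of the mollified f only near the cone.
    set Q : Eu d → ℝ := fun z => |moll φ f z| + (∑ j, |moll φ (g j) z|) +
      ∑ j, ∑ k, |moll φ (h j k) z| with hQdef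
    have hcm : ∀ k : L2 Ω, Continuous (moll φ k) := fun k => (contDiff_moll φ k).continuous
    have hQc : Continuous Q := by
      have h1 := hcm f
      have h2 := fun j => hcm (g j)
      have h3 := fun j k => hcm (h j k)
      fun_prop
    have hptw : ∀ z ∈ S, |moll φ f z| + (∑ j, |partialDeriv j (moll φ f) z|) +
        (∑ j, ∑ k, |partialDeriv k (partialDeriv j (moll φ f)) z|) ≤ Q z := by
      intro z hz
      have e1 : ∀ j, ∀ z' ∈ Metric.ball z (δ / 2),
          partialDeriv j (moll φ f) z' = moll φ (g j) z' :=
        fun j z' hz' => partialDeriv_moll (hg j) (hnear z hz z' hz')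
      have hzz : z ∈ Metric.ball z (δ / 2) := Metric.mem_ball_self (half_pos hδ)
      have e2 : ∀ j k, partialDeriv k (partialDeriv j (moll φ f)) z = moll φ (h j k) z := by
        intro j k
        rw [← partialDeriv_moll (hh j k) (hnear z hz z hzz)]
        have : partialDeriv j (moll φ f) =ᶠ[𝓝 z] moll φ (g j) :=
          eventually_of_mem (Metric.ball_mem_nhds z (half_pos hδ)) (e1 j)
        unfold partialDeriv at this ⊢
        rw [this.fderiv_eq]
      simp only [hQdef, fun j => e1 j z hzz, e2]
      exact le_rfl
    have hu : ∀ u ∈ Metric.ball (r₀ • X x) (r₀ * r₀), ENNReal.ofReal |moll φ f x| ≤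
        ENNReal.ofReal (4 * (B + 1) ^ 2) *
          ∫⁻ τ in Ioo (0 : ℝ) 1, ENNReal.ofReal τ * ENNReal.ofReal (Q (x + τ • u)) := by
      intro u hu
      refine ofReal_abs_le_ray (contDiff_moll φ f) (by linarith) ?_ hQc fun τ hτ => ?_
      · have h1 : ‖u - r₀ • X x‖ ≤ 1 := by
          rw [mem_ball_iff_norm] at hu
          nlinarith
        have h2 : ‖r₀ • X x‖ ≤ B := by
          rw [norm_smul, Real.norm_of_nonneg hr₀0.le]
          have := hB x
          nlinarith [norm_nonneg (X x)]
        calc ‖u‖ = ‖r₀ • X x + (u - r₀ • X x)‖ := by congr 1; abel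
          _ ≤ _ := (norm_add_le _ _).trans (by linarith)
      · exact hptw _ ⟨(τ, u), ⟨hτ, Metric.ball_subset_closedBall hu⟩, rfl⟩
    have hint : ENNReal.ofReal |moll φ f x| * V ≤ ENNReal.ofReal (4 * (B + 1) ^ 2) *
        (K * (∫⁻ z, ENNReal.ofReal (Q z) ^ 2) ^ (1 / 2 : ℝ)) := by
      rw [hV, ← Measure.addHaar_ball_center volume (r₀ • X x), ← setLIntegral_const]
      refine (setLIntegral_mono (by fun_prop) hu).trans ?_
      rw [lintegral_const_mul _ (by fun_prop)]
      gcongr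
      exact havg (fun z => ENNReal.ofReal (Q z)) (by fun_prop) x _
    have hQN : (∫⁻ z, ENNReal.ofReal (Q z) ^ 2) ^ (1 / 2 : ℝ) ≤ 2 * ENNReal.ofReal N := by
      have e : (∫⁻ z, ENNReal.ofReal (Q z) ^ 2) = eLpNorm Q 2 volume ^ 2 := by
        rw [eLpNorm_two_sq]
        refine lintegral_congr fun z => ?_
        rw [Real.enorm_eq_ofReal (by simp only [hQdef]; positivity)]
      rw [e, ← ENNReal.rpow_natCast, ← ENNReal.rpow_mul,
        show ((2 : ℕ) : ℝ) * (1 / 2) = 1 by norm_num, ENNReal.rpow_one]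
      have hab : ∀ k : L2 Ω, AEStronglyMeasurable (fun z => |moll φ k z|) volume := fun k =>
        (hcm k).abs.aestronglyMeasurable
      have hb : ∀ k : L2 Ω, eLpNorm (fun z => |moll φ k z|) 2 volume ≤ 2 * ENNReal.ofReal ‖k‖ :=
        fun k => by
          have := eLpNorm_moll_le hm φ k
          rwa [← eLpNorm_norm] at this
      have hs1 : AEStronglyMeasurable (fun z => ∑ j, |moll φ (g j) z|) volume :=
        Finset.aestronglyMeasurable_fun_sum _ fun j _ => hab _
      have hs2 : ∀ j, AEStronglyMeasurable (fun z => ∑ k, |moll φ (h j k) z|) volume := fun j =>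
        Finset.aestronglyMeasurable_fun_sum _ fun k _ => hab _
      calc eLpNorm Q 2 volume
          ≤ eLpNorm (fun z => |moll φ f z|) 2 volume
            + eLpNorm (fun z => ∑ j, |moll φ (g j) z|) 2 volume
            + eLpNorm (fun z => ∑ j, ∑ k, |moll φ (h j k) z|) 2 volume := by
            refine (eLpNorm_add_le ((hab f).add hs1)
              (Finset.aestronglyMeasurable_fun_sum _ fun j _ => hs2 j) (by norm_num)).trans ?_
            gcongr
            exact eLpNorm_add_le (hab f) hs1 (by norm_num)
        _ ≤ 2 * ENNReal.ofReal ‖f‖ + (∑ j, 2 * ENNReal.ofReal ‖g j‖) +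
            ∑ j, ∑ k, 2 * ENNReal.ofReal ‖h j k‖ := by
            refine add_le_add (add_le_add (hb f) ?_) ?_
            · have := eLpNorm_sum_le (μ := (volume : Measure (Eu d))) (p := 2)
                (s := Finset.univ) (f := fun j z => |moll φ (g j) z|)
                (fun j _ => hab _) (by norm_num)
              rw [Finset.sum_fn] at this
              exact this.trans (Finset.sum_le_sum fun j _ => hb _)
            · have := eLpNorm_sum_le (μ := (volume : Measure (Eu d))) (p := 2)
                (s := Finset.univ) (f := fun j z => ∑ k, |moll φ (h j k) z|)
                (fun j _ => hs2 j) (by norm_num)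
              rw [Finset.sum_fn] at this
              refine this.trans (Finset.sum_le_sum fun j _ => ?_)
              have := eLpNorm_sum_le (μ := (volume : Measure (Eu d))) (p := 2)
                (s := Finset.univ) (f := fun k z => |moll φ (h j k) z|)
                (fun k _ => hab _) (by norm_num)
              rw [Finset.sum_fn] at this
              exact this.trans (Finset.sum_le_sum fun k _ => hb _)
        _ = 2 * ENNReal.ofReal N := by
            rw [hN, ENNReal.ofReal_add (by positivity) (by positivity),
              ENNReal.ofReal_add (by positivity) (by positivity),
              ENNReal.ofReal_sum_of_nonneg fun _ _ => norm_nonneg _,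
              ENNReal.ofReal_sum_of_nonneg fun _ _ => by positivity]
            simp only [ENNReal.ofReal_sum_of_nonneg fun _ _ => norm_nonneg _, mul_add,
              Finset.mul_sum]
    have hfin : ENNReal.ofReal |moll φ f x| ≤ C * ENNReal.ofReal N := by
      have h1 : ENNReal.ofReal |moll φ f x| * V ≤
          ENNReal.ofReal (4 * (B + 1) ^ 2) * (K * (2 * ENNReal.ofReal N)) :=
        hint.trans (by gcongr)
      calc ENNReal.ofReal |moll φ f x| = V⁻¹ * (ENNReal.ofReal |moll φ f x| * V) := by
            rw [mul_comm, mul_assoc, ENNReal.mul_inv_cancel hV0 hVtop, mul_one]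
        _ ≤ V⁻¹ * (ENNReal.ofReal (4 * (B + 1) ^ 2) * (K * (2 * ENNReal.ofReal N))) := by gcongr
        _ = C * ENNReal.ofReal N := by rw [hC]; ring
    rw [← ENNReal.ofReal_toReal hCtop, ← ENNReal.ofReal_mul ENNReal.toReal_nonneg] at hfin
    exact (ENNReal.ofReal_le_ofReal_iff (by positivity)).1 hfin
  obtain ⟨A, hA, hAΦ, -⟩ := exists_seq_mollifier Ω one_pos
  have hme : TendstoInMeasure (volume.restrict Ω) (fun n => ((A n).op hm f : Eu d → ℝ)) atTop f :=
    tendstoInMeasure_of_tendsto_Lp (Regularizer.tendsto_op hA hm f)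
  obtain ⟨ns, hns, hlim⟩ := hme.exists_seq_tendsto_ae
  filter_upwards [hlim, ae_restrict_mem hm, ae_all_iff.2 fun n => (A n).coeFn_op hm f]
    with x hx hxΩ hAx
  obtain ⟨δ, hδ, hb⟩ := key x hxΩ
  -- Along the subsequence the mollifications converge at x and their radii eventually drop below δ.
  refine le_of_tendsto hx.abs ?_
  have hev := (hA.comp hns.tendsto_atTop).eventually (gt_mem_nhds hδ)
  filter_upwards [hev] with n hn
  have h1 := (A (ns n)).rOut_le
  have h2 := (A (ns n)).e_pos
  simp only [Function.comp_apply] at hn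
  rw [hAx, Regularizer.opFun, hAΦ]
  exact hb _ (by linarith)

/-- Essential boundedness in space-time of functions in `L^∞(0,T; W^{2,2}(Ω))`. -/
theorem MemBochnerSobolev.exists_ae_bound (hd : d ≤ 3) (hΩ : IsSmoothBoundedDomain Ω) {T : ℝ}
    {f : ℝ → L2 Ω} (hf : MemBochnerSobolev Ω T ⊤ 2 f) :
    ∃ M, 0 ≤ M ∧ ∀ᵐ t ∂timeMeasure T, ∀ᵐ x ∂(volume.restrict Ω), |f t x| ≤ M := by
  obtain ⟨C, hC0, hC⟩ := hΩ.exists_sobolev_bound hd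
  obtain ⟨hf0, g, hg⟩ := hf
  choose hg1 hg2 using hg
  have hg0 := fun j => (hg2 j).1
  choose h hh using fun j => (hg2 j).2
  choose hh1 hh2 using hh
  have hb : ∀ {k : ℝ → L2 Ω}, MemLp k ⊤ (timeMeasure T) →
      ∃ B : ℝ, ∀ᵐ t ∂timeMeasure T, ‖k t‖ ≤ B := by
    intro k hk
    have h1 : eLpNormEssSup k (timeMeasure T) ≠ ⊤ := by simpa using hk.2.ne
    refine ⟨(eLpNormEssSup k (timeMeasure T)).toReal, ?_⟩
    filter_upwards [ae_le_eLpNormEssSup (f := k) (μ := timeMeasure T)] with t ht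
    rw [← toReal_enorm]
    exact ENNReal.toReal_mono h1 ht
  obtain ⟨B0, hB0⟩ := hb hf0
  choose B1 hB1 using fun j => hb (hg0 j)
  choose B2 hB2 using fun j k => hb (hh2 j k)
  refine ⟨C * |B0 + (∑ j, B1 j) + ∑ j, ∑ k, B2 j k|, by positivity, ?_⟩
  filter_upwards [hB0, ae_all_iff.2 hB1, ae_all_iff.2 fun j => ae_all_iff.2 (hB2 j),
    ae_all_iff.2 hg1, ae_all_iff.2 fun j => ae_all_iff.2 (hh1 j)] with t h0 h1 h2 h3 h4
  filter_upwards [hC (f t) (fun j => g j t) (fun j k => h j k t) h3 h4] with x hx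
  refine hx.trans (mul_le_mul_of_nonneg_left (le_trans ?_ (le_abs_self _)) hC0)
  exact add_le_add (add_le_add h0 (Finset.sum_le_sum fun j _ => h1 j))
    (Finset.sum_le_sum fun j _ => Finset.sum_le_sum fun k _ => h2 j k)

end Sobolev

/-! ### Averages over the near future and primitives in time -/

section TimeMollification

set_option linter.unusedSectionVars false

/-- A bump function concentrated to the left of the origin. -/
def timeBump (n : ℕ) : ContDiffBump (-2 / ((n : ℝ) + 1)) :=
  ⟨1 / (2 * ((n : ℝ) + 1)), 1 / ((n : ℝ) + 1), by positivity, by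
    apply one_div_lt_one_div_of_lt <;> linarith [n.cast_nonneg (α := ℝ)]⟩

theorem timeBump_rOut (n : ℕ) : (timeBump n).rOut = 1 / ((n : ℝ) + 1) := rfl

/-- The normalized kernel of the forward time average. -/
def timeKernel (n : ℕ) : ℝ → ℝ := (timeBump n).normed volume

theorem timeKernel_nonneg (n : ℕ) (s : ℝ) : 0 ≤ timeKernel n s := (timeBump n).nonneg_normed s

theorem contDiff_timeKernel (n : ℕ) : ContDiff ℝ ∞ (timeKernel n) :=
  (timeBump n).contDiff_normed (n := ⊤)

theorem hasCompactSupport_timeKernel (n : ℕ) : HasCompactSupport (timeKernel n) :=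
  (timeBump n).hasCompactSupport_normed

/-- The average at time t sees only times in [t + 1/(n+1), t + 3/(n+1)]. These are positive even for
t = 0, which gives access to the initial value; the price is the condition t + 3/(n+1) < T. -/
theorem tsupport_timeKernel (n : ℕ) :
    tsupport (timeKernel n) ⊆ Icc (-(3 / ((n : ℝ) + 1))) (-(1 / ((n : ℝ) + 1))) := by
  rw [timeKernel, (timeBump n).tsupport_normed_eq, Real.closedBall_eq_Icc, timeBump_rOut]
  refine Icc_subset_Icc (le_of_eq ?_) (le_of_eq ?_) <;> ring

theorem integral_timeKernel_sub (n : ℕ) (t : ℝ) : ∫ s, timeKernel n (t - s) = 1 := by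
  rw [integral_sub_left_eq_self (timeKernel n) volume t]
  exact (timeBump n).integral_normed

theorem lintegral_timeKernel_sub (n : ℕ) (t : ℝ) :
    ∫⁻ s, ENNReal.ofReal (timeKernel n (t - s)) = 1 := by
  rw [← ofReal_integral_eq_lintegral_ofReal ?_ (Eventually.of_forall fun s => timeKernel_nonneg n _),
    integral_timeKernel_sub, ENNReal.ofReal_one]
  exact (timeBump n).integrable_normed.comp_sub_left t

variable {X : Type*} [NormedAddCommGroup X] [NormedSpace ℝ X]

/-- Forward average in time of a function on `(0,T)`. -/
def timeMoll (T : ℝ) (n : ℕ) (f : ℝ → X) (t : ℝ) : X :=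
  ∫ s in Ioo 0 T, timeKernel n (t - s) • f s

theorem timeMoll_eq_indicator (T : ℝ) (n : ℕ) (f : ℝ → X) (t : ℝ) :
    timeMoll T n f t = ∫ s, timeKernel n (t - s) • (Ioo 0 T).indicator f s := by
  rw [timeMoll, ← integral_indicator measurableSet_Ioo]
  refine integral_congr_ae (Eventually.of_forall fun s => ?_)
  by_cases hs : s ∈ Ioo 0 T <;> simp [hs]

theorem timeMoll_eq_convolution (T : ℝ) (n : ℕ) (f : ℝ → X) :
    timeMoll T n f = convolution (timeKernel n) ((Ioo 0 T).indicator f)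
      (ContinuousLinearMap.lsmul ℝ ℝ) volume := by
  funext t
  rw [timeMoll_eq_indicator, convolution_lsmul_swap]

theorem locallyIntegrable_indicator {T : ℝ} {f : ℝ → X} (hf : Integrable f (timeMeasure T)) :
    LocallyIntegrable ((Ioo 0 T).indicator f) :=
  ((integrable_indicator_iff measurableSet_Ioo).2 hf).locallyIntegrable

theorem contDiff_timeMoll {T : ℝ} {f : ℝ → X} (hf : Integrable f (timeMeasure T)) (n : ℕ) :
    ContDiff ℝ ∞ (timeMoll T n f) := by
  rw [timeMoll_eq_convolution]
  exact (hasCompactSupport_timeKernel n).contDiff_convolution_left _ (contDiff_timeKernel n)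
    (locallyIntegrable_indicator hf)

/-- The derivative falls on the kernel, which as a function of s is a test function on (0,T); the
conditions on t place its support there. -/
theorem hasDerivAt_timeMoll {T : ℝ} {f g : ℝ → X} (hf : Integrable f (timeMeasure T))
    (h : HasWeakTimeDeriv T f g) {n : ℕ} {t : ℝ} (h0 : 0 ≤ t) (h1 : t + 3 / ((n : ℝ) + 1) < T) :
    HasDerivAt (timeMoll T n f) (timeMoll T n g t) t := by
  have hd := (hasCompactSupport_timeKernel n).hasDerivAt_convolution_left
    (ContinuousLinearMap.lsmul ℝ ℝ) ((contDiff_timeKernel n).of_le (by simp))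
    (locallyIntegrable_indicator hf) (μ := volume) t
  rw [← timeMoll_eq_convolution] at hd
  refine hd.congr_deriv ?_
  have hw := h (fun s => timeKernel n (t - s)) ((contDiff_timeKernel n).comp
    (contDiff_const.sub contDiff_id)) ((hasCompactSupport_timeKernel n).comp_homeomorph
      (Homeomorph.subLeft t)) ?_
  · rw [convolution_lsmul_swap]
    have e1 : ∀ s, deriv (fun s => timeKernel n (t - s)) s = -deriv (timeKernel n) (t - s) :=
      fun s => deriv_comp_const_sub _ _ _
    simp only [e1, neg_smul, integral_neg, neg_inj] at hw
    rw [timeMoll, ← hw, ← integral_indicator measurableSet_Ioo]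
    refine integral_congr_ae (Eventually.of_forall fun s => ?_)
    by_cases hs : s ∈ Ioo 0 T <;> simp [hs]
  · have hp : (0 : ℝ) < 1 / ((n : ℝ) + 1) := by positivity
    refine (closure_minimal (t := Icc (t + 1 / ((n : ℝ) + 1)) (t + 3 / ((n : ℝ) + 1)))
      (fun s hs => ?_) isClosed_Icc).trans (Icc_subset_Ioo (by linarith) h1)
    have := tsupport_timeKernel n (subset_tsupport _ hs)
    exact ⟨by linarith [this.2], by linarith [this.1]⟩

theorem timeKernel_bounded (n : ℕ) : ∃ C, ∀ s, ‖timeKernel n s‖ ≤ C :=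
  (contDiff_timeKernel n).continuous.bounded_above_of_compact_support
    (hasCompactSupport_timeKernel n)

theorem integrable_timeKernel_smul {T : ℝ} {f : ℝ → X} (hf : Integrable f (timeMeasure T)) (n : ℕ)
    (t : ℝ) : Integrable (fun s => timeKernel n (t - s) • f s) (timeMeasure T) := by
  obtain ⟨C, hC⟩ := timeKernel_bounded n
  exact hf.bdd_smul C (((contDiff_timeKernel n).continuous.comp
    (continuous_const.sub continuous_id)).aestronglyMeasurable) (Eventually.of_forall fun s => hC _)

theorem clm_timeMoll [CompleteSpace X] {Y : Type*} [NormedAddCommGroup Y] [NormedSpace ℝ Y]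
    [CompleteSpace Y] {T : ℝ} {f : ℝ → X} (hf : Integrable f (timeMeasure T)) (L : X →L[ℝ] Y)
    (n : ℕ) (t : ℝ) : L (timeMoll T n f t) = timeMoll T n (fun s => L (f s)) t := by
  rw [timeMoll, ← L.integral_comp_comm (integrable_timeKernel_smul hf n t)]
  simp [timeMoll]

theorem norm_timeMoll_le {T : ℝ} {f : ℝ → X} {M : ℝ} (hM : 0 ≤ M)
    (hf : ∀ᵐ s ∂timeMeasure T, ‖f s‖ ≤ M) (n : ℕ) (t : ℝ) : ‖timeMoll T n f t‖ ≤ M := by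
  have hi : Integrable (fun s => timeKernel n (t - s)) :=
    (timeBump n).integrable_normed.comp_sub_left t
  calc ‖timeMoll T n f t‖ ≤ ∫ s in Ioo 0 T, timeKernel n (t - s) * M := by
        refine norm_integral_le_of_norm_le (hi.restrict.mul_const M) ?_
        filter_upwards [hf] with s hs
        rw [norm_smul, Real.norm_of_nonneg (timeKernel_nonneg n _)]
        exact mul_le_mul_of_nonneg_left hs (timeKernel_nonneg n _)
    _ = (∫ s in Ioo 0 T, timeKernel n (t - s)) * M := integral_mul_const _ _
    _ ≤ 1 * M := by
        refine mul_le_mul_of_nonneg_right ?_ hM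
        rw [← integral_timeKernel_sub n t]
        exact setIntegral_le_integral hi (Eventually.of_forall fun s => timeKernel_nonneg n _)
    _ = M := one_mul M

theorem timeMoll_congr {T : ℝ} {f g : ℝ → X} (h : f =ᵐ[timeMeasure T] g) (n : ℕ) (t : ℝ) :
    timeMoll T n f t = timeMoll T n g t := by
  refine integral_congr_ae ?_
  filter_upwards [h] with s hs
  rw [hs]

variable [CompleteSpace X]

theorem timeMoll_apply {ι : Type*} [Fintype ι] {T : ℝ} {f : ℝ → ι → X}
    (hf : Integrable f (timeMeasure T)) (n : ℕ) (t : ℝ) (i : ι) :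
    timeMoll T n f t i = timeMoll T n (fun s => f s i) t :=
  clm_timeMoll hf (ContinuousLinearMap.proj (R := ℝ) (φ := fun _ : ι => X) i) n t

theorem tendsto_eLpNorm_timeMoll_sub {T : ℝ} {f : ℝ → X} (hf : MemLp f 2 (timeMeasure T)) :
    Tendsto (fun n => eLpNorm (fun t => timeMoll T n f t - f t) 2 (timeMeasure T)) atTop (𝓝 0) := by
  have hf' : MemLp ((Ioo 0 T).indicator f) 2 volume :=
    (memLp_indicator_iff_restrict measurableSet_Ioo).2 hf
  have h := tendsto_eLpNorm_kernel_sub (m := timeMeasure T) (ν := (volume : Measure ℝ))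
    Measure.restrict_le_self (k := fun n t s => timeKernel n (t - s))
    (fun n => ((contDiff_timeKernel n).continuous.comp
      (continuous_fst.sub continuous_snd)).measurable)
    (fun n t s => timeKernel_nonneg n _)
    (fun n => Eventually.of_forall fun t => lintegral_timeKernel_sub n t)
    (fun n s => ?_) (e := fun n => 3 / ((n : ℝ) + 1)) ?_ (fun n => Eventually.of_forall
      fun t s hts => ?_) hf'
  · refine h.congr fun n => eLpNorm_congr_ae ?_
    filter_upwards [ae_restrict_mem measurableSet_Ioo] with t ht
    rw [timeMoll_eq_indicator, indicator_of_mem ht]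
  · refine (lintegral_mono' Measure.restrict_le_self le_rfl).trans ?_
    rw [lintegral_sub_right_eq_self (fun z => ENNReal.ofReal (timeKernel n z)) s]
    have := lintegral_timeKernel_sub n 0
    rw [lintegral_sub_left_eq_self (fun z => ENNReal.ofReal (timeKernel n z)) 0] at this
    rw [this]
    norm_num
  · have := tendsto_one_div_add_atTop_nhds_zero_nat (𝕜 := ℝ)
    simpa [div_eq_mul_inv] using this.const_mul 3
  · have := tsupport_timeKernel n (subset_tsupport _ hts)
    have hp : (0 : ℝ) < 1 / ((n : ℝ) + 1) := by positivity
    have h3 : 3 / ((n : ℝ) + 1) = 3 * (1 / ((n : ℝ) + 1)) := by ring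
    rw [Real.dist_eq, abs_le]
    exact ⟨by linarith [this.2], by linarith [this.1]⟩

theorem aestronglyMeasurable_timeMoll {T : ℝ} {f : ℝ → X} (hf : Integrable f (timeMeasure T))
    (n : ℕ) {μ : Measure ℝ} : AEStronglyMeasurable (timeMoll T n f) μ :=
  (contDiff_timeMoll hf n).continuous.aestronglyMeasurable

theorem tendsto_integral_norm_timeMoll_sub {T : ℝ} {f : ℝ → X} (hf : MemLp f 2 (timeMeasure T)) :
    Tendsto (fun n => ∫ t in Ioo 0 T, ‖timeMoll T n f t - f t‖) atTop (𝓝 0) := by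
  have hfi := hf.integrable (by norm_num)
  have hm : ∀ n, AEStronglyMeasurable (fun t => timeMoll T n f t - f t) (timeMeasure T) := fun n =>
    (aestronglyMeasurable_timeMoll hfi n).sub hf.1
  have h := tendsto_eLpNorm_timeMoll_sub hf
  have h1 : Tendsto (fun n => eLpNorm (fun t => timeMoll T n f t - f t) 1 (timeMeasure T)) atTop
      (𝓝 0) := by
    have hc : (timeMeasure T univ) ^ (1 / (1 : ENNReal).toReal - 1 / (2 : ENNReal).toReal) ≠ ⊤ :=
      ENNReal.rpow_ne_top_of_nonneg (by norm_num) (measure_ne_top _ _)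
    have hz := ENNReal.Tendsto.mul_const h (Or.inr hc)
    rw [zero_mul] at hz
    refine tendsto_of_tendsto_of_tendsto_of_le_of_le tendsto_const_nhds hz (fun n => bot_le)
      (fun n => eLpNorm_le_eLpNorm_mul_rpow_measure_univ (by norm_num) (hm n))
  have h2 := (ENNReal.tendsto_toReal ENNReal.zero_ne_top).comp h1
  simp only [ENNReal.toReal_zero] at h2
  refine h2.congr fun n => ?_
  rw [Function.comp_apply, eLpNorm_one_eq_lintegral_enorm, integral_norm_eq_lintegral_enorm (hm n)]

theorem exists_subseq_tendsto_timeMoll {T : ℝ} {f : ℝ → X} (hf : MemLp f 2 (timeMeasure T)) :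
    ∃ ns : ℕ → ℕ, StrictMono ns ∧
      ∀ᵐ t ∂timeMeasure T, Tendsto (fun n => timeMoll T (ns n) f t) atTop (𝓝 (f t)) := by
  have hfi := hf.integrable (by norm_num)
  have hme : TendstoInMeasure (timeMeasure T) (fun n => timeMoll T n f) atTop f :=
    tendstoInMeasure_of_tendsto_eLpNorm (by norm_num)
      (fun n => aestronglyMeasurable_timeMoll hfi n) hf.1 (tendsto_eLpNorm_timeMoll_sub hf)
  exact hme.exists_seq_tendsto_ae

/-- A function with a weak time derivative has an absolutely continuous representative, to which
its forward averages converge pointwise. -/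
theorem HasWeakTimeDeriv.exists_primitive {T : ℝ} (hT : 0 < T) {f g : ℝ → X}
    (hf : MemLp f 2 (timeMeasure T)) (hg : MemLp g 2 (timeMeasure T))
    (h : HasWeakTimeDeriv T f g) {ns : ℕ → ℕ} (hns : StrictMono ns)
    (hae : ∀ᵐ t ∂timeMeasure T, Tendsto (fun n => timeMoll T (ns n) f t) atTop (𝓝 (f t))) :
    ∃ c, (∀ t ∈ Ico 0 T, Tendsto (fun n => timeMoll T (ns n) f t) atTop
        (𝓝 (c + ∫ s in (0 : ℝ)..t, g s))) ∧
      ∀ᵐ t ∂timeMeasure T, f t = c + ∫ s in (0 : ℝ)..t, g s := by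
  have hfi := hf.integrable (by norm_num)
  have hgi := hg.integrable (by norm_num)
  have hgI : ∀ a b, a ∈ Icc 0 T → b ∈ Icc 0 T → IntervalIntegrable g volume a b := by
    intro a b ha hb
    rw [intervalIntegrable_iff]
    have : IntegrableOn g (Icc 0 T) := by
      rw [integrableOn_Icc_iff_integrableOn_Ioo]; exact hgi
    exact this.mono_set (uIoc_subset_uIcc.trans (uIcc_subset_Icc ha hb))
  have : (ae (timeMeasure T)).NeBot := by
    rw [ae_neBot, Ne, Measure.restrict_eq_zero, Real.volume_Ioo]
    simpa using hT
  -- An anchor time at which the averages converge. The fundamental theorem of calculus, with L¹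
  -- convergence of the averaged derivative, carries the convergence to every t in [0,T).
  obtain ⟨t₁, ht₁lim, ht₁⟩ := (hae.and (ae_restrict_mem measurableSet_Ioo)).exists
  have key : ∀ t ∈ Ico 0 T, Tendsto (fun n => timeMoll T (ns n) f t) atTop
      (𝓝 (f t₁ + ∫ s in t₁..t, g s)) := by
    intro t ht
    have h1 : Tendsto (fun n => ∫ s in t₁..t, timeMoll T (ns n) g s) atTop
        (𝓝 (∫ s in t₁..t, g s)) := by
      rw [tendsto_iff_norm_sub_tendsto_zero]
      refine squeeze_zero (fun _ => norm_nonneg _) (fun n => ?_)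
        ((tendsto_integral_norm_timeMoll_sub hg).comp hns.tendsto_atTop)
      rw [← intervalIntegral.integral_sub
        ((contDiff_timeMoll hgi _).continuous.intervalIntegrable _ _)
        (hgI _ _ (Ioo_subset_Icc_self ht₁) (Ico_subset_Icc_self ht))]
      refine intervalIntegral.norm_integral_le_integral_norm_uIoc.trans ?_
      refine setIntegral_mono_set ?_ (Eventually.of_forall fun _ => norm_nonneg _)
        (LE.le.eventuallyLE ?_)
      · refine Integrable.norm ?_
        have hb : MemLp (timeMoll T (ns n) g) ⊤ (timeMeasure T) := by
          have hc := (contDiff_timeMoll hgi (ns n)).continuous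
          obtain ⟨C, hC⟩ := (isCompact_Icc (a := (0 : ℝ)) (b := T)).exists_bound_of_continuousOn
            hc.continuousOn
          refine memLp_top_of_bound hc.aestronglyMeasurable C ?_
          filter_upwards [ae_restrict_mem measurableSet_Ioo] with s hs
          exact hC s (Ioo_subset_Icc_self hs)
        exact (hb.integrable le_top).sub hgi
      · intro s hs
        rw [mem_uIoc] at hs
        rcases hs with hs | hs
        · exact ⟨ht₁.1.trans hs.1, hs.2.trans_lt ht.2⟩
        · exact ⟨ht.1.trans_lt hs.1, hs.2.trans_lt ht₁.2⟩
    have h2 : ∀ᶠ n in atTop, timeMoll T (ns n) f t₁ + (∫ s in t₁..t, timeMoll T (ns n) g s)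
        = timeMoll T (ns n) f t := by
      have hmax : max t₁ t < T := max_lt ht₁.2 ht.2
      have hlim : Tendsto (fun n : ℕ => max t₁ t + 3 / ((ns n : ℝ) + 1)) atTop
          (𝓝 (max t₁ t + 0)) := by
        refine Tendsto.const_add _ ?_
        have := (tendsto_one_div_add_atTop_nhds_zero_nat (𝕜 := ℝ)).const_mul 3
        simpa [div_eq_mul_inv, Function.comp_def] using this.comp hns.tendsto_atTop
      rw [add_zero] at hlim
      filter_upwards [hlim.eventually (gt_mem_nhds hmax)] with n hn
      rw [intervalIntegral.integral_eq_sub_of_hasDerivAt (f := timeMoll T (ns n) f)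
        (f' := timeMoll T (ns n) g)]
      · abel
      · intro s hs
        have hs' := uIcc_subset_Icc (Ioo_subset_Icc_self ht₁) (Ico_subset_Icc_self ht) hs
        refine hasDerivAt_timeMoll hfi h hs'.1 (lt_of_le_of_lt ?_ hn)
        have : s ≤ max t₁ t := hs.2
        linarith
      · exact (contDiff_timeMoll hgi _).continuous.intervalIntegrable _ _
    exact (ht₁lim.add h1).congr' h2
  have hadd : ∀ t ∈ Ico 0 T, f t₁ + ∫ s in t₁..t, g s
      = (f t₁ - ∫ s in (0 : ℝ)..t₁, g s) + ∫ s in (0 : ℝ)..t, g s := by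
    intro t ht
    rw [← intervalIntegral.integral_add_adjacent_intervals
      (hgI 0 t₁ (left_mem_Icc.2 hT.le) (Ioo_subset_Icc_self ht₁))
      (hgI t₁ t (Ioo_subset_Icc_self ht₁) (Ico_subset_Icc_self ht))]
    abel
  refine ⟨f t₁ - ∫ s in (0 : ℝ)..t₁, g s, fun t ht => hadd t ht ▸ key t ht, ?_⟩
  filter_upwards [hae, ae_restrict_mem measurableSet_Ioo] with t hlim ht
  rw [← hadd t ⟨ht.1.le, ht.2⟩]
  exact tendsto_nhds_unique hlim (key t ⟨ht.1.le, ht.2⟩)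

end TimeMollification

/-! ### Regularized strong solutions as admissible test fields -/

section Approximation

set_option linter.unusedSectionVars false

variable {d : ℕ} {Ω : Set (Eu d)}

theorem inner_timeMoll {T : ℝ} {f : ℝ → L2 Ω} (hf : Integrable f (timeMeasure T)) (a : L2 Ω)
    (n : ℕ) (t : ℝ) :
    inner ℝ a (timeMoll T n f t) = timeMoll T n (fun s => (inner ℝ a (f s) : ℝ)) t :=
  clm_timeMoll hf (innerSL ℝ a) n t

variable [IsFiniteMeasure (volume.restrict Ω : Measure (Eu d))]

theorem moll_timeMoll {T : ℝ} {f : ℝ → L2 Ω} (hf : Integrable f (timeMeasure T))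
    (φ : ContDiffBump (0 : Eu d)) (z : Eu d) (n : ℕ) (t : ℝ) :
    moll φ (timeMoll T n f t) z = timeMoll T n (fun s => moll φ (f s) z) t :=
  inner_timeMoll hf _ n t

/-- Exchanging the two averages, the spatial one turns a bound for almost every x into a bound at
every z, and the temporal one preserves it. No joint measurability in (s, x) is required. -/
theorem abs_moll_timeMoll_le {T : ℝ} {f : ℝ → L2 Ω} (hf : Integrable f (timeMeasure T)) {M : ℝ}
    (hM : 0 ≤ M) (hb : ∀ᵐ s ∂timeMeasure T, ∀ᵐ x ∂(volume.restrict Ω), |f s x| ≤ M)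
    (φ : ContDiffBump (0 : Eu d)) (z : Eu d) (n : ℕ) (t : ℝ) :
    |moll φ (timeMoll T n f t) z| ≤ M := by
  rw [moll_timeMoll hf]
  exact norm_timeMoll_le (f := fun s => moll φ (f s) z) hM
    (hb.mono fun s hs => abs_moll_le φ hM hs z) n t

theorem partialDeriv_moll_timeMoll {T : ℝ} {f g : ℝ → L2 Ω} (hf : Integrable f (timeMeasure T))
    (hg : Integrable g (timeMeasure T)) {φ : ContDiffBump (0 : Eu d)} {z : Eu d} {l : Fin d}
    (h : ∀ᵐ s ∂timeMeasure T, partialDeriv l (moll φ (f s)) z = moll φ (g s) z) (n : ℕ) (t : ℝ) :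
    partialDeriv l (moll φ (timeMoll T n f t)) z = moll φ (timeMoll T n g t) z := by
  rw [partialDeriv_moll_eq_inner, inner_timeMoll hf, moll_timeMoll hg]
  refine timeMoll_congr ?_ n t
  filter_upwards [h] with s hs
  rw [← hs, partialDeriv_moll_eq_inner]

theorem div_moll_timeMoll {T : ℝ} {V : Fin d → ℝ → L2 Ω}
    (hV : ∀ k, Integrable (V k) (timeMeasure T)) {φ : ContDiffBump (0 : Eu d)} {z : Eu d}
    (h : ∀ᵐ s ∂timeMeasure T, ∑ k, partialDeriv k (moll φ (V k s)) z = 0) (n : ℕ) (t : ℝ) :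
    ∑ k, partialDeriv k (moll φ (timeMoll T n (V k) t)) z = 0 := by
  have e : ∀ k, partialDeriv k (moll φ (timeMoll T n (V k) t)) z
      = ∫ s in Ioo 0 T, timeKernel n (t - s) • partialDeriv k (moll φ (V k s)) z := by
    intro k
    simp only [partialDeriv_moll_eq_inner]
    rw [inner_timeMoll (hV k)]
    rfl
  simp only [e]
  rw [← integral_finsetSum]
  · refine integral_eq_zero_of_ae ?_
    filter_upwards [h] with s hs
    rw [← Finset.smul_sum, hs, smul_zero, Pi.zero_apply]
  · intro k _
    refine integrable_timeKernel_smul ?_ n t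
    simp only [partialDeriv_moll_eq_inner]
    exact (hV k).const_inner _

namespace Regularizer

variable (A : Regularizer Ω)

/-- Joint smoothness in (t, x) holds because each term is an inner product of a smooth L²-valued
function of x with a smooth L²-valued function of t. -/
theorem contDiff_reg_time {V : ℝ → Fin d → L2 Ω} (hV : ContDiff ℝ ∞ V) (i : Fin d) :
    ContDiff ℝ ∞ (fun p : ℝ × Eu d => A.reg (V p.1) i p.2) := by
  unfold reg opFun moll
  refine ContDiff.sum fun k _ => ((contDiff_cof A.contDiff i k).comp contDiff_snd).mul ?_
  exact ((contDiff_reflTranslate (contDiff_normed_infty A.φ) A.φ.hasCompactSupport_normed).comp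
    (A.contDiff.comp contDiff_snd)).inner ℝ ((contDiff_pi.1 hV k).comp contDiff_fst)

theorem deriv_reg_time {V : ℝ → Fin d → L2 Ω} {V' : Fin d → L2 Ω} {s : ℝ}
    (h : HasDerivAt V V' s) (i : Fin d) (x : Eu d) :
    deriv (fun r => A.reg (V r) i x) s = A.reg V' i x := by
  refine HasDerivAt.deriv ?_
  unfold reg opFun moll
  refine HasDerivAt.fun_sum fun k _ => HasDerivAt.const_mul _ ?_
  exact (innerSL ℝ (reflTranslate Ω (A.φ.normed volume) (A.Φ x))).hasFDerivAt.comp_hasDerivAt s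
    (hasDerivAt_pi.1 h k)

theorem opFun_eq_zero {f : L2 Ω} {x : Eu d} (h : ∀ y ∈ closure Ω, A.φ.rOut ≤ dist y (A.Φ x)) :
    A.opFun f x = 0 := by
  rw [opFun, moll_eq_integral]
  refine setIntegral_eq_zero_of_forall_eq_zero fun y hy => ?_
  have : A.φ.normed volume (A.Φ x - y) = 0 := by
    rw [← Function.notMem_support, A.φ.support_normed_eq, mem_ball_zero_iff, not_lt, ← dist_eq_norm,
      dist_comm]
    exact h y (subset_closure hy)
  rw [this, zero_mul]

end Regularizer

/-- A bounded velocity field with bounded gradient `D` and weak time derivative `g`. -/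
structure IsRegularVelocity (Ω : Set (Eu d)) (T M : ℝ) (V g : ℝ → Fin d → L2 Ω)
    (D : ℝ → Fin d → Fin d → L2 Ω) : Prop where
  nonneg : 0 ≤ M
  memLp : MemLp V ⊤ (timeMeasure T)
  memLp_grad : MemLp D ⊤ (timeMeasure T)
  memLp_deriv : MemLp g 2 (timeMeasure T)
  hasWeakTimeDeriv : HasWeakTimeDeriv T V g
  mem : ∀ᵐ s ∂timeMeasure T, V s ∈ W12ZeroDiv Ω
  grad : ∀ᵐ s ∂timeMeasure T, ∀ i j, HasZeroWeakDeriv Ω j (V s i) (D s i j)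
  bound : ∀ᵐ s ∂timeMeasure T, ∀ i, ∀ᵐ x ∂(volume.restrict Ω), |V s i x| ≤ M
  bound_grad : ∀ᵐ s ∂timeMeasure T, ∀ i j, ∀ᵐ x ∂(volume.restrict Ω), |D s i j x| ≤ M

/-- A bounded deformation gradient with bounded gradient `D` and weak time derivative `g`. -/
structure IsRegularDeformation (Ω : Set (Eu d)) (T M : ℝ) (V g : ℝ → Fin d → Fin d → L2 Ω)
    (D : ℝ → Fin d → Fin d → Fin d → L2 Ω) : Prop where
  nonneg : 0 ≤ M
  memLp : MemLp V ⊤ (timeMeasure T)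
  memLp_grad : MemLp D ⊤ (timeMeasure T)
  memLp_deriv : MemLp g 2 (timeMeasure T)
  hasWeakTimeDeriv : HasWeakTimeDeriv T V g
  mem : ∀ᵐ s ∂timeMeasure T, V s ∈ HSpace Ω
  grad : ∀ᵐ s ∂timeMeasure T, ∀ i j k, HasWeakDeriv Ω k (V s i j) (D s i j k)
  bound : ∀ᵐ s ∂timeMeasure T, ∀ i j, ∀ᵐ x ∂(volume.restrict Ω), |V s i j x| ≤ M
  bound_grad : ∀ᵐ s ∂timeMeasure T, ∀ i j k, ∀ᵐ x ∂(volume.restrict Ω), |D s i j k x| ≤ M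

/-- The bound for the regularized gradient. -/
def gradBound (d : ℕ) (M : ℝ) : ℝ := d * (M + d * (4 * M)) + d * (2 * M) + M

theorem gradBound_nonneg {M : ℝ} (hM : 0 ≤ M) : 0 ≤ gradBound d M := by
  unfold gradBound; positivity

theorem le_gradBound {M : ℝ} (hM : 0 ≤ M) : M ≤ gradBound d M := by
  unfold gradBound
  have : 0 ≤ d * (M + d * (4 * M)) + d * (2 * M) := by positivity
  linarith

variable {T M : ℝ}

namespace IsRegularVelocity

variable {V g : ℝ → Fin d → L2 Ω} {D : ℝ → Fin d → Fin d → L2 Ω}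

theorem integrable (h : IsRegularVelocity Ω T M V g D) : Integrable V (timeMeasure T) :=
  h.memLp.integrable le_top

theorem integrable_grad (h : IsRegularVelocity Ω T M V g D) : Integrable D (timeMeasure T) :=
  h.memLp_grad.integrable le_top

theorem integrable_deriv (h : IsRegularVelocity Ω T M V g D) : Integrable g (timeMeasure T) :=
  h.memLp_deriv.integrable (by norm_num)

theorem partialDeriv_reg (h : IsRegularVelocity Ω T M V g D) (A : Regularizer Ω) (n : ℕ)
    (t : ℝ) (i j : Fin d) (x : Eu d) :
    partialDeriv j (A.reg (timeMoll T n V t) i) x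
      = A.regGrad (timeMoll T n V t) (timeMoll T n D t) i j x := by
  refine A.partialDeriv_reg (fun k l => ?_) i j
  rw [timeMoll_apply h.integrable, timeMoll_apply h.integrable_grad,
    timeMoll_apply (h.integrable_grad.eval k)]
  refine partialDeriv_moll_timeMoll (h.integrable.eval k) ((h.integrable_grad.eval k).eval l) ?_ n t
  filter_upwards [h.grad] with s hs
  exact partialDeriv_moll_of_zero (hs k l) _

theorem abs_opFun_le (h : IsRegularVelocity Ω T M V g D) (A : Regularizer Ω) (n : ℕ)
    (t : ℝ) (x : Eu d) (k : Fin d) : |A.opFun (timeMoll T n V t k) x| ≤ M := by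
  rw [timeMoll_apply h.integrable]
  refine abs_moll_timeMoll_le (h.integrable.eval k) h.nonneg ?_ _ _ n t
  filter_upwards [h.bound] with s hs using hs k

theorem abs_opFun_grad_le (h : IsRegularVelocity Ω T M V g D) (A : Regularizer Ω) (n : ℕ)
    (t : ℝ) (x : Eu d) (k l : Fin d) : |A.opFun (timeMoll T n D t k l) x| ≤ M := by
  rw [timeMoll_apply h.integrable_grad, timeMoll_apply (h.integrable_grad.eval k)]
  refine abs_moll_timeMoll_le ((h.integrable_grad.eval k).eval l) h.nonneg ?_ _ _ n t
  filter_upwards [h.bound_grad] with s hs using hs k l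

theorem abs_regGrad_le (h : IsRegularVelocity Ω T M V g D) (A : Regularizer Ω) (n : ℕ)
    (t : ℝ) (i j : Fin d) {x : Eu d} (hx : x ∈ closure Ω) :
    |A.regGrad (timeMoll T n V t) (timeMoll T n D t) i j x| ≤ gradBound d M := by
  refine (A.abs_regGrad_le (h.abs_opFun_le A n t x) (h.abs_opFun_grad_le A n t x) hx i j).trans ?_
  have := h.nonneg
  have : 0 ≤ d * (2 * M) := by positivity
  unfold gradBound
  linarith

/-- Contraction supplies the compact support. The zero normal trace makes the mollified field
solenoidal everywhere, and the Piola transform keeps it so. -/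
theorem isVelocityTest_reg (hd : d = 2 ∨ d = 3)
    (h : IsRegularVelocity Ω T M V g D) {A : Regularizer Ω} (hA : A.IsContracting) (n : ℕ) :
    IsVelocityTest Ω T (fun i t x => A.reg (timeMoll T n V t) i x) := by
  refine ⟨fun i => A.contDiff_reg_time (contDiff_timeMoll h.integrable n) i, ?_, ?_⟩
  · obtain ⟨K, hK, hKΩ, hKA⟩ := hA
    refine ⟨K, hK, hKΩ, fun i t _ x hx => Finset.sum_eq_zero fun k _ => ?_⟩
    rw [A.opFun_eq_zero (hKA x hx), mul_zero]
  · intro t _ x _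
    refine A.div_reg hd ?_
    simp only [timeMoll_apply h.integrable]
    refine div_moll_timeMoll (fun k => h.integrable.eval k) ?_ n t
    filter_upwards [h.mem] with s hs
    exact div_moll_of_L2Div _ (W12ZeroDiv.subset_L2Div hs) _

end IsRegularVelocity

namespace IsRegularDeformation

variable {V g : ℝ → Fin d → Fin d → L2 Ω} {D : ℝ → Fin d → Fin d → Fin d → L2 Ω}

theorem integrable (h : IsRegularDeformation Ω T M V g D) : Integrable V (timeMeasure T) :=
  h.memLp.integrable le_top

theorem integrable_grad (h : IsRegularDeformation Ω T M V g D) : Integrable D (timeMeasure T) :=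
  h.memLp_grad.integrable le_top

theorem integrable_deriv (h : IsRegularDeformation Ω T M V g D) : Integrable g (timeMeasure T) :=
  h.memLp_deriv.integrable (by norm_num)

/-- The `j`-th column of a matrix field. -/
def col {α : Type*} (j : Fin d) (V : Fin d → Fin d → α) : Fin d → α := fun i => V i j

theorem partialDeriv_reg (h : IsRegularDeformation Ω T M V g D) {A : Regularizer Ω}
    (hA : A.IsExpanding) (n : ℕ) (t : ℝ) (i j k : Fin d) {x : Eu d} (hx : x ∈ closure Ω) :
    partialDeriv k (A.reg (col j (timeMoll T n V t)) i) x
      = A.regGrad (col j (timeMoll T n V t)) (col j (timeMoll T n D t)) i k x := by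
  refine A.partialDeriv_reg (fun m l => ?_) i k
  simp only [col]
  rw [timeMoll_apply h.integrable, timeMoll_apply (h.integrable.eval m),
    timeMoll_apply h.integrable_grad, timeMoll_apply (h.integrable_grad.eval m),
    timeMoll_apply ((h.integrable_grad.eval m).eval j)]
  refine partialDeriv_moll_timeMoll ((h.integrable.eval m).eval j)
    (((h.integrable_grad.eval m).eval j).eval l) ?_ n t
  filter_upwards [h.grad] with s hs
  exact partialDeriv_moll (hs m j l) (hA x hx)

theorem abs_opFun_le (h : IsRegularDeformation Ω T M V g D) (A : Regularizer Ω) (n : ℕ)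
    (t : ℝ) (x : Eu d) (k j : Fin d) : |A.opFun (timeMoll T n V t k j) x| ≤ M := by
  rw [timeMoll_apply h.integrable, timeMoll_apply (h.integrable.eval k)]
  refine abs_moll_timeMoll_le ((h.integrable.eval k).eval j) h.nonneg ?_ _ _ n t
  filter_upwards [h.bound] with s hs using hs k j

theorem abs_opFun_grad_le (h : IsRegularDeformation Ω T M V g D) (A : Regularizer Ω) (n : ℕ)
    (t : ℝ) (x : Eu d) (k j l : Fin d) : |A.opFun (timeMoll T n D t k j l) x| ≤ M := by
  rw [timeMoll_apply h.integrable_grad, timeMoll_apply (h.integrable_grad.eval k),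
    timeMoll_apply ((h.integrable_grad.eval k).eval j)]
  refine abs_moll_timeMoll_le (((h.integrable_grad.eval k).eval j).eval l) h.nonneg ?_ _ _ n t
  filter_upwards [h.bound_grad] with s hs using hs k j l

theorem abs_reg_le (h : IsRegularDeformation Ω T M V g D) (A : Regularizer Ω) (n : ℕ)
    (t : ℝ) (i j : Fin d) {x : Eu d} (hx : x ∈ closure Ω) :
    |A.reg (col j (timeMoll T n V t)) i x| ≤ gradBound d M := by
  refine (A.abs_reg_le (fun k => h.abs_opFun_le A n t x k j) hx i).trans ?_
  have := h.nonneg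
  have : 0 ≤ d * (M + d * (4 * M)) + M := by positivity
  unfold gradBound
  linarith

theorem abs_regGrad_le (h : IsRegularDeformation Ω T M V g D) (A : Regularizer Ω) (n : ℕ)
    (t : ℝ) (i j k : Fin d) {x : Eu d} (hx : x ∈ closure Ω) :
    |A.regGrad (col j (timeMoll T n V t)) (col j (timeMoll T n D t)) i k x| ≤ gradBound d M := by
  refine (A.abs_regGrad_le (fun k => h.abs_opFun_le A n t x k j)
    (fun k l => h.abs_opFun_grad_le A n t x k j l) hx i k).trans ?_
  have := h.nonneg
  have : 0 ≤ d * (2 * M) := by positivity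
  unfold gradBound
  linarith

/-- The divergence acts on columns, so each column is regularized as a vector field. `HSpace`
carries no boundary condition, so mollification is solenoidal only inside Ω, which is where an
expanding Φ evaluates it. -/
theorem isDeformationTest_reg (hd : d = 2 ∨ d = 3) (h : IsRegularDeformation Ω T M V g D)
    {A : Regularizer Ω} (hA : A.IsExpanding) (n : ℕ) :
    IsDeformationTest Ω T (fun i j t x => A.reg (col j (timeMoll T n V t)) i x) := by
  refine ⟨fun i j => A.contDiff_reg_time (V := fun t => col j (timeMoll T n V t)) ?_ i, ?_⟩
  · refine contDiff_pi.2 fun m => ?_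
    exact contDiff_pi.1 (contDiff_pi.1 (contDiff_timeMoll h.integrable n) m) j
  · intro t _ x hx j
    refine A.div_reg hd ?_
    simp only [col, timeMoll_apply h.integrable, timeMoll_apply (h.integrable.eval _)]
    refine div_moll_timeMoll (fun k => (h.integrable.eval k).eval j) ?_ n t
    filter_upwards [h.mem] with s hs
    exact div_moll_of_HSpace _ hs (hA x (subset_closure hx)) j

end IsRegularDeformation

end Approximation

/-! ### Flux functionals: continuity, bounds, limits -/

section WeakForms

set_option linter.unusedSectionVars false

variable {d : ℕ} {Ω : Set (Eu d)}

theorem integral_mul_eq_inner_of_ae {a P : L2 Ω} {q : Eu d → ℝ} (hP : P =ᵐ[volume.restrict Ω] q) :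
    ∫ x in Ω, a x * q x = inner ℝ a P := by
  rw [← integral_mul_eq_inner]
  refine integral_congr_ae ?_
  filter_upwards [hP] with x hx
  rw [hx]

theorem integrable_mul_of_ae {a P : L2 Ω} {q : Eu d → ℝ} (hP : P =ᵐ[volume.restrict Ω] q) :
    Integrable (fun x => a x * q x) (volume.restrict Ω) := by
  refine (integrable_mul_L2 a P).congr ?_
  filter_upwards [hP] with x hx
  rw [hx]

theorem ae_abs_le_of_ae {P : L2 Ω} {q : Eu d → ℝ} (hP : P =ᵐ[volume.restrict Ω] q) {M : ℝ}
    (hq : ∀ᵐ x ∂(volume.restrict Ω), |q x| ≤ M) : ∀ᵐ x ∂(volume.restrict Ω), |P x| ≤ M := by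
  filter_upwards [hP, hq] with x hx h
  rwa [hx]

theorem integral_mul_mul_eq_tri {a b P : L2 Ω} {q : Eu d → ℝ} (hP : P =ᵐ[volume.restrict Ω] q)
    {M : ℝ} (hq : ∀ᵐ x ∂(volume.restrict Ω), |q x| ≤ M) :
    ∫ x in Ω, a x * b x * q x = tri M a b P := by
  rw [tri_eq_of_abs_le (ae_abs_le_of_ae hP hq)]
  refine integral_congr_ae ?_
  filter_upwards [hP] with x hx
  rw [hx]

theorem integrable_mul_mul_of_ae {a b P : L2 Ω} {q : Eu d → ℝ} (hP : P =ᵐ[volume.restrict Ω] q)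
    {M : ℝ} (hM : 0 ≤ M) (hq : ∀ᵐ x ∂(volume.restrict Ω), |q x| ≤ M) :
    Integrable (fun x => a x * b x * q x) (volume.restrict Ω) := by
  refine (integrable_tri hM a b P).congr ?_
  filter_upwards [hP, hq] with x hx h
  rw [hx, clamp_of_abs_le h]

/-- The momentum flux tested with a field with gradient `P`. -/
def momentumFlux (M : ℝ) (u : Fin d → L2 Ω) (Du F P : Fin d → Fin d → L2 Ω) : ℝ :=
  (∑ i, ∑ j, tri M (u i) (u j) (P i j))
    - ∑ i, ∑ j, (inner ℝ (Du i j) (P i j) + ∑ k, tri M (F i k) (F j k) (P i j))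

/-- The transport terms tested with a field `Q` with gradient `P`. -/
def transportFlux (M : ℝ) (u : Fin d → L2 Ω) (Du F : Fin d → Fin d → L2 Ω)
    (P : Fin d → Fin d → Fin d → L2 Ω) (Q : Fin d → Fin d → L2 Ω) : ℝ :=
  (∑ k, ∑ i, ∑ j, tri M (u k) (F i j) (P i j k))
    + ∑ i, ∑ j, ∑ k, tri M (Du i k) (F k j) (Q i j)

theorem momentumFlux_eq_integral {M : ℝ} (hM : 0 ≤ M) {u : Fin d → L2 Ω}
    {Du F P : Fin d → Fin d → L2 Ω} {q : Fin d → Fin d → Eu d → ℝ}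
    (hP : ∀ i j, P i j =ᵐ[volume.restrict Ω] q i j)
    (hq : ∀ i j, ∀ᵐ x ∂(volume.restrict Ω), |q i j x| ≤ M) :
    (∑ i, ∑ j, ∫ x in Ω, u i x * u j x * q i j x)
      - (∑ i, ∑ j, ∫ x in Ω, (Du i j x + ∑ k, F i k x * F j k x) * q i j x)
      = momentumFlux M u Du F P := by
  unfold momentumFlux
  congr 1
  · exact Finset.sum_congr rfl fun i _ => Finset.sum_congr rfl fun j _ =>
      integral_mul_mul_eq_tri (hP i j) (hq i j)
  · refine Finset.sum_congr rfl fun i _ => Finset.sum_congr rfl fun j _ => ?_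
    rw [← integral_mul_eq_inner_of_ae (hP i j)]
    simp only [← integral_mul_mul_eq_tri (hP i j) (hq i j)]
    rw [← integral_finsetSum _ fun k _ => integrable_mul_mul_of_ae (hP i j) hM (hq i j),
      ← integral_add (integrable_mul_of_ae (hP i j)) (integrable_finsetSum _ fun k _ =>
        integrable_mul_mul_of_ae (hP i j) hM (hq i j))]
    refine integral_congr_ae (Eventually.of_forall fun x => ?_)
    simp only [add_mul, Finset.sum_mul]

theorem transportFlux_eq_integral {M : ℝ} (hM : 0 ≤ M) {u : Fin d → L2 Ω}
    {Du F Q : Fin d → Fin d → L2 Ω} {P : Fin d → Fin d → Fin d → L2 Ω}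
    {p : Fin d → Fin d → Fin d → Eu d → ℝ} {q : Fin d → Fin d → Eu d → ℝ}
    (hP : ∀ i j k, P i j k =ᵐ[volume.restrict Ω] p i j k)
    (hp : ∀ i j k, ∀ᵐ x ∂(volume.restrict Ω), |p i j k x| ≤ M)
    (hQ : ∀ i j, Q i j =ᵐ[volume.restrict Ω] q i j)
    (hq : ∀ i j, ∀ᵐ x ∂(volume.restrict Ω), |q i j x| ≤ M) :
    (∑ k, ∑ i, ∑ j, ∫ x in Ω, u k x * F i j x * p i j k x)
      + (∑ i, ∑ j, ∫ x in Ω, (∑ k, Du i k x * F k j x) * q i j x)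
      = transportFlux M u Du F P Q := by
  unfold transportFlux
  congr 1
  · exact Finset.sum_congr rfl fun k _ => Finset.sum_congr rfl fun i _ =>
      Finset.sum_congr rfl fun j _ => integral_mul_mul_eq_tri (hP i j k) (hp i j k)
  · refine Finset.sum_congr rfl fun i _ => Finset.sum_congr rfl fun j _ => ?_
    simp only [← integral_mul_mul_eq_tri (hQ i j) (hq i j)]
    rw [← integral_finsetSum _ fun k _ => integrable_mul_mul_of_ae (hQ i j) hM (hq i j)]
    refine integral_congr_ae (Eventually.of_forall fun x => ?_)
    simp only [Finset.sum_mul]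

theorem aestronglyMeasurable_momentumFlux {β : Type*} [MeasurableSpace β] {ν : Measure β} {M : ℝ}
    (hM : 0 ≤ M) {u : β → Fin d → L2 Ω} {Du F P : β → Fin d → Fin d → L2 Ω}
    (hu : AEStronglyMeasurable u ν) (hDu : AEStronglyMeasurable Du ν)
    (hF : AEStronglyMeasurable F ν) (hP : AEStronglyMeasurable P ν) :
    AEStronglyMeasurable (fun s => momentumFlux M (u s) (Du s) (F s) (P s)) ν := by
  have hu' : ∀ i, AEStronglyMeasurable (fun s => u s i) ν := fun i =>
    (continuous_apply i).comp_aestronglyMeasurable hu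
  have h2 : ∀ {f : β → Fin d → Fin d → L2 Ω}, AEStronglyMeasurable f ν →
      ∀ i j, AEStronglyMeasurable (fun s => f s i j) ν := fun hf i j =>
    (continuous_apply_apply i j).comp_aestronglyMeasurable hf
  unfold momentumFlux
  refine AEStronglyMeasurable.sub ?_ ?_
  · exact Finset.aestronglyMeasurable_fun_sum _ fun i _ =>
      Finset.aestronglyMeasurable_fun_sum _ fun j _ =>
        aestronglyMeasurable_tri hM (hu' i) (hu' j) (h2 hP i j)
  · refine Finset.aestronglyMeasurable_fun_sum _ fun i _ =>
      Finset.aestronglyMeasurable_fun_sum _ fun j _ => ?_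
    exact ((h2 hDu i j).inner (h2 hP i j)).add (Finset.aestronglyMeasurable_fun_sum _ fun k _ =>
      aestronglyMeasurable_tri hM (h2 hF i k) (h2 hF j k) (h2 hP i j))

theorem tendsto_momentumFlux {ι : Type*} {l : Filter ι} {M : ℝ} (hM : 0 ≤ M) (u : Fin d → L2 Ω)
    (Du F : Fin d → Fin d → L2 Ω) {P : ι → Fin d → Fin d → L2 Ω} {P' : Fin d → Fin d → L2 Ω}
    (hP : ∀ i j, Tendsto (fun n => P n i j) l (𝓝 (P' i j))) :
    Tendsto (fun n => momentumFlux M u Du F (P n)) l (𝓝 (momentumFlux M u Du F P')) := by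
  unfold momentumFlux
  refine Tendsto.sub ?_ ?_
  · exact tendsto_finsetSum _ fun i _ => tendsto_finsetSum _ fun j _ =>
      tendsto_tri hM tendsto_const_nhds tendsto_const_nhds (hP i j)
  · refine tendsto_finsetSum _ fun i _ => tendsto_finsetSum _ fun j _ => ?_
    exact (tendsto_const_nhds.inner (hP i j)).add (tendsto_finsetSum _ fun k _ =>
      tendsto_tri hM tendsto_const_nhds tendsto_const_nhds (hP i j))

theorem abs_momentumFlux_le {M K B : ℝ} (hM : 0 ≤ M) {u : Fin d → L2 Ω}
    {Du F P : Fin d → Fin d → L2 Ω} (hu : ‖u‖ ≤ K) (hF : ‖F‖ ≤ K) (hP : ∀ i j, ‖P i j‖ ≤ B) :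
    |momentumFlux M u Du F P|
      ≤ (∑ _i : Fin d, ∑ _j : Fin d, M * (K * K)) +
        ∑ i, ∑ j, (‖Du i j‖ * B + ∑ _k : Fin d, M * (K * K)) := by
  have hK : 0 ≤ K := (norm_nonneg _).trans hu
  have hu' : ∀ i, ‖u i‖ ≤ K := fun i => (norm_le_pi_norm u i).trans hu
  have hF' : ∀ i j, ‖F i j‖ ≤ K := fun i j =>
    ((norm_le_pi_norm (F i) j).trans (norm_le_pi_norm F i)).trans hF
  unfold momentumFlux
  refine (abs_sub _ _).trans (add_le_add ?_ ?_)
  · refine (Finset.abs_sum_le_sum_abs _ _).trans (Finset.sum_le_sum fun i _ => ?_)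
    refine (Finset.abs_sum_le_sum_abs _ _).trans (Finset.sum_le_sum fun j _ => ?_)
    exact (abs_tri_le hM _ _ _).trans (by gcongr <;> apply hu')
  · refine (Finset.abs_sum_le_sum_abs _ _).trans (Finset.sum_le_sum fun i _ => ?_)
    refine (Finset.abs_sum_le_sum_abs _ _).trans (Finset.sum_le_sum fun j _ => ?_)
    refine (abs_add_le _ _).trans (add_le_add ?_ ?_)
    · exact (abs_real_inner_le_norm _ _).trans (by gcongr; exact hP i j)
    · refine (Finset.abs_sum_le_sum_abs _ _).trans (Finset.sum_le_sum fun k _ => ?_)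
      exact (abs_tri_le hM _ _ _).trans (by gcongr <;> apply hF')

theorem aestronglyMeasurable_transportFlux {β : Type*} [MeasurableSpace β] {ν : Measure β} {M : ℝ}
    (hM : 0 ≤ M) {u : β → Fin d → L2 Ω} {Du F Q : β → Fin d → Fin d → L2 Ω}
    {P : β → Fin d → Fin d → Fin d → L2 Ω}
    (hu : AEStronglyMeasurable u ν) (hDu : AEStronglyMeasurable Du ν)
    (hF : AEStronglyMeasurable F ν) (hP : AEStronglyMeasurable P ν)
    (hQ : AEStronglyMeasurable Q ν) :
    AEStronglyMeasurable (fun s => transportFlux M (u s) (Du s) (F s) (P s) (Q s)) ν := by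
  have hu' : ∀ i, AEStronglyMeasurable (fun s => u s i) ν := fun i =>
    (continuous_apply i).comp_aestronglyMeasurable hu
  have h2 : ∀ {f : β → Fin d → Fin d → L2 Ω}, AEStronglyMeasurable f ν →
      ∀ i j, AEStronglyMeasurable (fun s => f s i j) ν := fun hf i j =>
    (continuous_apply_apply i j).comp_aestronglyMeasurable hf
  unfold transportFlux
  refine AEStronglyMeasurable.add ?_ ?_
  · exact Finset.aestronglyMeasurable_fun_sum _ fun k _ =>
      Finset.aestronglyMeasurable_fun_sum _ fun i _ =>
      Finset.aestronglyMeasurable_fun_sum _ fun j _ =>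
        aestronglyMeasurable_tri hM (hu' k) (h2 hF i j) ((continuous_apply k).comp_aestronglyMeasurable
          ((continuous_apply_apply i j).comp_aestronglyMeasurable hP))
  · exact Finset.aestronglyMeasurable_fun_sum _ fun i _ =>
      Finset.aestronglyMeasurable_fun_sum _ fun j _ =>
      Finset.aestronglyMeasurable_fun_sum _ fun k _ =>
        aestronglyMeasurable_tri hM (h2 hDu i k) (h2 hF k j) (h2 hQ i j)

theorem tendsto_transportFlux {ι : Type*} {l : Filter ι} {M : ℝ} (hM : 0 ≤ M) (u : Fin d → L2 Ω)
    (Du F : Fin d → Fin d → L2 Ω) {P : ι → Fin d → Fin d → Fin d → L2 Ω}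
    {P' : Fin d → Fin d → Fin d → L2 Ω} {Q : ι → Fin d → Fin d → L2 Ω} {Q' : Fin d → Fin d → L2 Ω}
    (hP : ∀ i j k, Tendsto (fun n => P n i j k) l (𝓝 (P' i j k)))
    (hQ : ∀ i j, Tendsto (fun n => Q n i j) l (𝓝 (Q' i j))) :
    Tendsto (fun n => transportFlux M u Du F (P n) (Q n)) l
      (𝓝 (transportFlux M u Du F P' Q')) := by
  unfold transportFlux
  refine Tendsto.add ?_ ?_
  · exact tendsto_finsetSum _ fun k _ => tendsto_finsetSum _ fun i _ =>
      tendsto_finsetSum _ fun j _ =>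
      tendsto_tri hM tendsto_const_nhds tendsto_const_nhds (hP i j k)
  · exact tendsto_finsetSum _ fun i _ => tendsto_finsetSum _ fun j _ =>
      tendsto_finsetSum _ fun k _ =>
      tendsto_tri hM tendsto_const_nhds tendsto_const_nhds (hQ i j)

theorem abs_transportFlux_le {M K : ℝ} (hM : 0 ≤ M) {u : Fin d → L2 Ω}
    {Du F Q : Fin d → Fin d → L2 Ω} {P : Fin d → Fin d → Fin d → L2 Ω} (hu : ‖u‖ ≤ K)
    (hF : ‖F‖ ≤ K) :
    |transportFlux M u Du F P Q|
      ≤ (∑ _k : Fin d, ∑ _i : Fin d, ∑ _j : Fin d, M * (K * K)) +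
        ∑ i, ∑ _j : Fin d, ∑ k, M * (‖Du i k‖ * K) := by
  have hK : 0 ≤ K := (norm_nonneg _).trans hu
  have hu' : ∀ i, ‖u i‖ ≤ K := fun i => (norm_le_pi_norm u i).trans hu
  have hF' : ∀ i j, ‖F i j‖ ≤ K := fun i j =>
    ((norm_le_pi_norm (F i) j).trans (norm_le_pi_norm F i)).trans hF
  unfold transportFlux
  refine (abs_add_le _ _).trans (add_le_add ?_ ?_)
  · refine (Finset.abs_sum_le_sum_abs _ _).trans (Finset.sum_le_sum fun i _ => ?_)
    refine (Finset.abs_sum_le_sum_abs _ _).trans (Finset.sum_le_sum fun j _ => ?_)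
    refine (Finset.abs_sum_le_sum_abs _ _).trans (Finset.sum_le_sum fun k _ => ?_)
    exact (abs_tri_le hM _ _ _).trans (by gcongr; exacts [hu' _, hF' _ _])
  · refine (Finset.abs_sum_le_sum_abs _ _).trans (Finset.sum_le_sum fun i _ => ?_)
    refine (Finset.abs_sum_le_sum_abs _ _).trans (Finset.sum_le_sum fun j _ => ?_)
    refine (Finset.abs_sum_le_sum_abs _ _).trans (Finset.sum_le_sum fun k _ => ?_)
    exact (abs_tri_le hM _ _ _).trans (by gcongr; exact hF' _ _)

theorem restrict_Ioc_le {T t : ℝ} (ht : t < T) :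
    (volume : Measure ℝ).restrict (Ioc 0 t) ≤ timeMeasure T :=
  Measure.restrict_mono_set _ fun _ hs => ⟨hs.1, hs.2.trans_lt ht⟩

theorem exists_ae_norm_le {X : Type*} [NormedAddCommGroup X] {T : ℝ} {f : ℝ → X}
    (hf : MemLp f ⊤ (timeMeasure T)) : ∃ K, 0 ≤ K ∧ ∀ᵐ t ∂timeMeasure T, ‖f t‖ ≤ K := by
  have h1 : eLpNormEssSup f (timeMeasure T) ≠ ⊤ := by simpa using hf.2.ne
  refine ⟨(eLpNormEssSup f (timeMeasure T)).toReal, ENNReal.toReal_nonneg, ?_⟩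
  filter_upwards [ae_le_eLpNormEssSup (f := f) (μ := timeMeasure T)] with t ht
  rw [← toReal_enorm]
  exact ENNReal.toReal_mono h1 ht

/-- A weak state: bounded energy, square integrable velocity gradient `Du`. -/
structure IsWeakState (Ω : Set (Eu d)) (T : ℝ) (u : ℝ → Fin d → L2 Ω)
    (Du F : ℝ → Fin d → Fin d → L2 Ω) : Prop where
  u_memLp : MemLp u ⊤ (timeMeasure T)
  F_memLp : MemLp F ⊤ (timeMeasure T)
  Du_memLp : MemLp Du 2 (timeMeasure T)
  grad : ∀ᵐ s ∂timeMeasure T, ∀ i j, HasWeakDeriv Ω j (u s i) (Du s i j)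

theorem IsWeakState.exists_bound {T : ℝ} {u : ℝ → Fin d → L2 Ω}
    {Du F : ℝ → Fin d → Fin d → L2 Ω} (h : IsWeakState Ω T u Du F) :
    ∃ K, 0 ≤ K ∧ ∀ᵐ t ∂timeMeasure T, ‖u t‖ ≤ K ∧ ‖F t‖ ≤ K := by
  obtain ⟨K, hK, hu⟩ := exists_ae_norm_le h.u_memLp
  obtain ⟨K', hK', hF⟩ := exists_ae_norm_le h.F_memLp
  refine ⟨max K K', le_max_of_le_left hK, ?_⟩
  filter_upwards [hu, hF] with t h1 h2
  exact ⟨h1.trans (le_max_left _ _), h2.trans (le_max_right _ _)⟩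

variable [IsFiniteMeasure (volume.restrict Ω : Measure (Eu d))]

theorem norm_le_of_ae_abs_le {P : L2 Ω} {M : ℝ} (hM : 0 ≤ M)
    (hP : ∀ᵐ x ∂(volume.restrict Ω), |P x| ≤ M) :
    ‖P‖ ≤ (measureUnivNNReal (volume.restrict Ω : Measure (Eu d)) : ℝ) ^ (2⁻¹ : ℝ) * M := by
  have := Lp.norm_le_of_ae_bound (p := 2) (f := P) hM hP
  simpa using this

theorem integrable_norm_bound {T t : ℝ} (ht : t < T) {Du : ℝ → Fin d → Fin d → L2 Ω}
    (hDu : MemLp Du 2 (timeMeasure T)) (i j : Fin d) :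
    Integrable (fun s => ‖Du s i j‖) ((volume : Measure ℝ).restrict (Ioc 0 t)) :=
  ((((hDu.eval i).eval j).integrable (by norm_num)).mono_measure (restrict_Ioc_le ht)).norm

/-- The error is split into the regularizer applied to the time-averaging error, small in L¹ in time
by the uniform operator bound, and the regularization error of g itself, small by dominated
convergence. As f is bounded in time, L¹ convergence of the other factor is enough. -/
theorem tendsto_integral_inner_regL {A : ℕ → Regularizer Ω}
    (hA : Tendsto (fun n => (A n).e) atTop (𝓝 0)) (hΩ : MeasurableSet Ω) {T t : ℝ} (ht : t < T)
    {f : ℝ → L2 Ω} (hf : MemLp f ⊤ (timeMeasure T)) {g : ℝ → Fin d → L2 Ω}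
    (hg : MemLp g 2 (timeMeasure T)) {ns : ℕ → ℕ} (hns : StrictMono ns) (i : Fin d) :
    Tendsto (fun n => ∫ s in Ioc 0 t, inner ℝ (f s) ((A n).regL hΩ i (timeMoll T (ns n) g s)))
      atTop (𝓝 (∫ s in Ioc 0 t, inner ℝ (f s) (g s i))) ∧
    ∀ n, Integrable (fun s => (inner ℝ (f s) ((A n).regL hΩ i (timeMoll T (ns n) g s)) : ℝ))
      (volume.restrict (Ioc 0 t)) := by
  set ν := (volume : Measure ℝ).restrict (Ioc 0 t) with hν
  have hle : ν ≤ timeMeasure T := restrict_Ioc_le ht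
  obtain ⟨K, hK0, hK⟩ := exists_ae_norm_le hf
  have hKν := ae_mono hle hK
  have hgi := hg.integrable (by norm_num : (1 : ENNReal) ≤ 2)
  have hgν : Integrable g ν := hgi.mono_measure hle
  have hfm : AEStronglyMeasurable f ν := hf.1.mono_measure hle
  have hmoll : ∀ n, Integrable (timeMoll T (ns n) g) ν := fun n =>
    ((contDiff_timeMoll hgi _).continuous.integrableOn_Icc).mono_set Ioc_subset_Icc_self
  have hreg : ∀ n, Integrable (fun s => (A n).regL hΩ i (timeMoll T (ns n) g s)) ν := fun n =>
    ((A n).regL hΩ i).integrable_comp (hmoll n)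
  have hreg' : ∀ n, Integrable (fun s => (A n).regL hΩ i (g s)) ν := fun n =>
    ((A n).regL hΩ i).integrable_comp hgν
  have hint : ∀ {p : ℝ → L2 Ω}, Integrable p ν →
      Integrable (fun s => (inner ℝ (f s) (p s) : ℝ)) ν := by
    intro p hp
    refine Integrable.mono' (hp.norm.const_mul K) (hfm.inner hp.1) ?_
    filter_upwards [hKν] with s hs
    exact (abs_real_inner_le_norm _ _).trans (by gcongr)
  refine ⟨?_, fun n => hint (hreg n)⟩
  have hgi' : Integrable (fun s => g s i) ν := hgν.eval i
  rw [tendsto_iff_norm_sub_tendsto_zero]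
  have h1 : Tendsto (fun n => ∫ s, ‖timeMoll T (ns n) g s - g s‖ ∂ν) atTop (𝓝 0) := by
    refine squeeze_zero (fun n => integral_nonneg fun s => norm_nonneg _) (fun n => ?_)
      ((tendsto_integral_norm_timeMoll_sub hg).comp hns.tendsto_atTop)
    refine integral_mono_measure hle (Eventually.of_forall fun s => norm_nonneg _) ?_
    refine Integrable.norm (Integrable.sub ?_ hgi)
    exact ((contDiff_timeMoll hgi _).continuous.integrableOn_Icc).mono_set Ioo_subset_Icc_self
  have h2 : Tendsto (fun n => ∫ s, ‖(A n).regL hΩ i (g s) - g s i‖ ∂ν) atTop (𝓝 0) := by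
    have := tendsto_integral_of_dominated_convergence
      (F := fun n s => ‖(A n).regL hΩ i (g s) - g s i‖) (f := fun _ => (0 : ℝ)) (μ := ν)
      (fun s => d * (4 * ‖g s‖) + ‖g s‖) (fun n => ((hreg' n).sub hgi').norm.1)
      (((hgν.norm.const_mul 4).const_mul _).add hgν.norm)
      (fun n => Eventually.of_forall fun s => ?_) (Eventually.of_forall fun s => ?_)
    · simpa using this
    · rw [norm_norm]
      exact (norm_sub_le _ _).trans (add_le_add ((A n).norm_regL_le hΩ i _) (norm_le_pi_norm _ i))
    · have := Regularizer.tendsto_regL hA hΩ (tendsto_const_nhds (x := g s)) i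
      exact tendsto_iff_norm_sub_tendsto_zero.1 this
  have h3 := ((h1.const_mul ((d : ℝ) * 4)).add h2).const_mul K
  simp only [mul_zero, add_zero] at h3
  refine squeeze_zero (fun _ => norm_nonneg _) (fun n => ?_) h3
  rw [← integral_sub (hint (hreg n)) (hint hgi'), ← integral_const_mul, ← integral_add,
    ← integral_const_mul]
  · refine norm_integral_le_of_norm_le ?_ ?_
    · exact (((((hmoll n).sub hgν).norm.const_mul _).add ((hreg' n).sub hgi').norm).const_mul K)
    · filter_upwards [hKν] with s hs
      rw [← inner_sub_right]
      refine (abs_real_inner_le_norm _ _).trans ?_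
      refine mul_le_mul hs ?_ (norm_nonneg _) hK0
      have e : (A n).regL hΩ i (timeMoll T (ns n) g s) - g s i
          = (A n).regL hΩ i (timeMoll T (ns n) g s - g s) + ((A n).regL hΩ i (g s) - g s i) := by
        rw [map_sub]; abel
      rw [e]
      refine (norm_add_le _ _).trans (add_le_add_left ?_ _)
      refine ((A n).norm_regL_le hΩ i _).trans (le_of_eq ?_)
      ring
  · exact ((hmoll n).sub hgν).norm.const_mul _
  · exact ((hreg' n).sub hgi').norm

end WeakForms

/-! ### Measure-valued correctors and their total variation -/

section Corrector

set_option linter.unusedSectionVars false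

variable {K : Type*} [MeasurableSpace K]

theorem abs_integral_signed_le (μ : SignedMeasure K) {f : K → ℝ} {B : ℝ} (hf : ∀ x, |f x| ≤ B) :
    |∫ᵛ x, f x ∂•μ| ≤ B * (μ.totalVariation univ).toReal := by
  have h := VectorMeasure.norm_integral_le_integral_norm (μ := μ) (f := f)
    (B := ContinuousLinearMap.lsmul ℝ ℝ)
  have h1 : ∫ x, ‖f x‖ ∂μ.variation ≤ B * (μ.totalVariation univ).toReal := by
    rw [← SignedMeasure.totalVariation_eq_variation]
    have := norm_integral_le_of_norm_le_const (μ := μ.totalVariation) (f := fun x => ‖f x‖) (C := B)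
      (Eventually.of_forall fun x => by simpa using hf x)
    exact (le_abs_self _).trans this
  have h2 : ‖(ContinuousLinearMap.lsmul ℝ ℝ : ℝ →L[ℝ] ℝ →L[ℝ] ℝ)‖ ≤ 1 :=
    ContinuousLinearMap.opNorm_lsmul_le
  have h3 : 0 ≤ ∫ x, ‖f x‖ ∂μ.variation := integral_nonneg fun _ => norm_nonneg _
  calc |∫ᵛ x, f x ∂•μ| ≤ _ := h
    _ ≤ 1 * ∫ x, ‖f x‖ ∂μ.variation := by gcongr
    _ ≤ _ := by rw [one_mul]; exact h1

theorem integral_signed_eq_sub (μ : SignedMeasure K) {f : K → ℝ}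
    (hf : Integrable f μ.totalVariation) :
    ∫ᵛ x, f x ∂•μ = (∫ x, f x ∂μ.toJordanDecomposition.posPart)
      - ∫ x, f x ∂μ.toJordanDecomposition.negPart := by
  have hflip : (ContinuousLinearMap.lsmul ℝ ℝ : ℝ →L[ℝ] ℝ →L[ℝ] ℝ)
      = (ContinuousLinearMap.lsmul ℝ ℝ : ℝ →L[ℝ] ℝ →L[ℝ] ℝ).flip := by
    ext; simp
  rw [SignedMeasure.totalVariation, integrable_add_measure] at hf
  have h := congrArg (fun ν : SignedMeasure K => ∫ᵛ x, f x ∂•ν)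
    μ.toSignedMeasure_toJordanDecomposition.symm
  rw [h, JordanDecomposition.toSignedMeasure, VectorMeasure.integral_sub_vectorMeasure, hflip,
    VectorMeasure.integral_toSignedMeasure, VectorMeasure.integral_toSignedMeasure]
  · simpa [VectorMeasure.Integrable] using hf.1
  · simpa [VectorMeasure.Integrable] using hf.2

variable [TopologicalSpace K] [CompactSpace K] [TopologicalSpace.MetrizableSpace K] [BorelSpace K]

/-- The total variation is attained in the limit along continuous functions bounded by `1`. -/
theorem exists_continuous_integral_gt (μ : SignedMeasure K) {ε : ℝ} (hε : 0 < ε) :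
    ∃ φ : C(K, ℝ), (∀ x, |φ x| ≤ 1) ∧ (μ.totalVariation univ).toReal - ε ≤ ∫ᵛ x, φ x ∂•μ := by
  classical
  let := TopologicalSpace.pseudoMetrizableSpacePseudoMetric K
  obtain ⟨i, hi, hi2, hi3, hpos, hneg⟩ := μ.toJordanDecomposition_spec
  set J := μ.toJordanDecomposition
  -- The sign given by the Hahn decomposition; its integral is the total variation.
  set f : K → ℝ := fun x => if x ∈ i then 1 else -1 with hf
  have hfm : Measurable f := Measurable.ite hi measurable_const measurable_const
  have hf1 : ∀ x, |f x| ≤ 1 := fun x => by by_cases hx : x ∈ i <;> simp [f, hx]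
  have hbdd : ∀ {g : K → ℝ}, Measurable g → (∀ x, |g x| ≤ 1) →
      Integrable g μ.totalVariation := fun hg hg1 =>
    Integrable.of_bound hg.aestronglyMeasurable 1 (Eventually.of_forall hg1)
  have hint := hbdd hfm hf1
  have hposf : ∀ᵐ x ∂J.posPart, f x = 1 := by
    rw [ae_iff, hpos]
    have : {a | ¬f a = 1} = iᶜ := by
      ext x; by_cases hx : x ∈ i <;> simp [f, hx]; norm_num
    rw [this, SignedMeasure.toMeasureOfZeroLE_apply _ _ _ hi.compl]
    simp
  have hnegf : ∀ᵐ x ∂J.negPart, f x = -1 := by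
    rw [ae_iff, hneg]
    have : {a | ¬f a = -1} = i := by
      ext x; by_cases hx : x ∈ i <;> simp [f, hx]; norm_num
    rw [this, SignedMeasure.toMeasureOfLEZero_apply _ _ _ hi]
    simp
  have hTV : ∫ᵛ x, f x ∂•μ = (μ.totalVariation univ).toReal := by
    rw [integral_signed_eq_sub μ hint, integral_congr_ae hposf, integral_congr_ae hnegf,
      SignedMeasure.totalVariation, Measure.add_apply,
      ENNReal.toReal_add (measure_ne_top _ _) (measure_ne_top _ _)]
    simp [Measure.real, J]
  obtain ⟨g, hg, -⟩ := (memLp_one_iff_integrable.2 hint).exists_boundedContinuous_eLpNorm_sub_le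
    (by norm_num) (ε := ENNReal.ofReal ε) (by simpa using hε)
  set φ : C(K, ℝ) := ⟨fun x => clamp 1 (g x), (continuous_clamp 1).comp g.continuous⟩ with hφ
  have hφ1 : ∀ x, |φ x| ≤ 1 := fun x => abs_clamp_le zero_le_one _
  have hφi : Integrable φ μ.totalVariation := hbdd φ.continuous.measurable hφ1
  refine ⟨φ, hφ1, ?_⟩
  rw [← hTV]
  -- Truncation to [-1, 1] does not increase the distance to a function with values ±1.
  have hclose : ∀ x, |f x - φ x| ≤ |f x - g x| := by
    intro x
    have h1 := hf1 x
    simp only [hφ, ContinuousMap.coe_mk, clamp]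
    rw [abs_le] at h1
    rcases le_total (g x) 1 with h | h <;> rcases le_total (g x) (-1) with h' | h' <;>
      simp only [min_eq_left, min_eq_right, max_eq_left, max_eq_right, h, h'] <;>
      first
        | exact le_rfl
        | (rw [abs_of_nonneg (by linarith), abs_of_nonneg (by linarith)]; linarith)
        | (rw [abs_of_nonpos, abs_of_nonpos] <;>
            first | linarith | (rw [max_eq_right (by linarith)]; linarith))
  have hdiff : (∫ᵛ x, f x ∂•μ) - ∫ᵛ x, φ x ∂•μ ≤ ε := by
    rw [← VectorMeasure.integral_fun_sub (by
      rwa [VectorMeasure.Integrable, ← SignedMeasure.totalVariation_eq_variation]) (by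
      rwa [VectorMeasure.Integrable, ← SignedMeasure.totalVariation_eq_variation])]
    refine (le_abs_self _).trans ?_
    have h := VectorMeasure.norm_integral_le_integral_norm (μ := μ) (f := fun x => f x - φ x)
      (B := ContinuousLinearMap.lsmul ℝ ℝ)
    rw [← SignedMeasure.totalVariation_eq_variation] at h
    have h2 : ‖(ContinuousLinearMap.lsmul ℝ ℝ : ℝ →L[ℝ] ℝ →L[ℝ] ℝ)‖ ≤ 1 :=
      ContinuousLinearMap.opNorm_lsmul_le
    have h3 : ∫ x, ‖f x - φ x‖ ∂μ.totalVariation ≤ ε := by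
      have hgi : Integrable (fun x => f x - g x) μ.totalVariation :=
        hint.sub (g.integrable _)
      calc ∫ x, ‖f x - φ x‖ ∂μ.totalVariation ≤ ∫ x, ‖f x - g x‖ ∂μ.totalVariation :=
            integral_mono (hint.sub hφi).norm hgi.norm hclose
        _ ≤ ε := by
            rw [integral_norm_eq_lintegral_enorm hgi.1]
            refine ENNReal.toReal_le_of_le_ofReal hε.le ?_
            rw [← eLpNorm_one_eq_lintegral_enorm]
            exact hg
    calc |∫ᵛ x, (f x - φ x) ∂•μ| ≤ _ := h
      _ ≤ 1 * ∫ x, ‖f x - φ x‖ ∂μ.totalVariation := by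
          gcongr
      _ ≤ ε := by rw [one_mul]; exact h3
  linarith

/-- The total variation is the supremum of the integrals of continuous functions bounded by 1, and a
countable dense family of these suffices. -/
theorem aemeasurable_totalVariation {β : Type*} [MeasurableSpace β] {ν : Measure β}
    {R : β → SignedMeasure K}
    (hR : ∀ φ : C(K, ℝ), AEMeasurable (fun t => ∫ᵛ x, φ x ∂•(R t)) ν) :
    AEMeasurable (fun t => ((R t).totalVariation univ).toReal) ν := by
  obtain ⟨s, hsc, hsd⟩ := TopologicalSpace.exists_countable_dense
    {φ : C(K, ℝ) // ∀ x, |φ x| ≤ 1}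
  have hlub : ∀ t, ((R t).totalVariation univ).toReal
      = ⨆ φ : s, ∫ᵛ x, (φ : {φ : C(K, ℝ) // ∀ x, |φ x| ≤ 1}).1 x ∂•(R t) := by
    intro t
    have hle : ∀ φ : {φ : C(K, ℝ) // ∀ x, |φ x| ≤ 1},
        ∫ᵛ x, φ.1 x ∂•(R t) ≤ ((R t).totalVariation univ).toReal := fun φ =>
      (le_abs_self _).trans (by simpa using abs_integral_signed_le (R t) φ.2)
    have hbdd : BddAbove (range fun φ : s =>
        ∫ᵛ x, (φ : {φ : C(K, ℝ) // ∀ x, |φ x| ≤ 1}).1 x ∂•(R t)) :=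
      ⟨_, by rintro _ ⟨φ, rfl⟩; exact hle φ.1⟩
    have hne : Nonempty s := by
      have : Nonempty {φ : C(K, ℝ) // ∀ x, |φ x| ≤ 1} := ⟨⟨0, fun x => by simp⟩⟩
      exact hsd.nonempty.to_subtype
    refine le_antisymm ?_ (ciSup_le fun φ => hle φ.1)
    refine le_of_forall_pos_le_add fun ε hε => ?_
    obtain ⟨φ, hφ, hφε⟩ := exists_continuous_integral_gt (R t) (half_pos hε)
    set B := ((R t).totalVariation univ).toReal with hB
    have hB0 : 0 ≤ B := ENNReal.toReal_nonneg
    obtain ⟨ψ, hψs, hψ⟩ := hsd.exists_dist_lt ⟨φ, hφ⟩ (ε := ε / (2 * (B + 1))) (by positivity)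
    have hd : ∀ x, |φ x - ψ.1 x| ≤ ε / (2 * (B + 1)) := fun x => by
      have h1 := ContinuousMap.dist_apply_le_dist (f := φ) (g := ψ.1) x
      rw [Real.dist_eq] at h1
      exact h1.trans hψ.le
    have hi : ∀ φ : C(K, ℝ), (R t).Integrable φ := fun φ => by
      rw [VectorMeasure.Integrable, ← SignedMeasure.totalVariation_eq_variation]
      exact (BoundedContinuousFunction.mkOfCompact φ).integrable _
    have h2 := abs_integral_signed_le (R t) hd
    rw [VectorMeasure.integral_fun_sub (hi φ) (hi ψ.1)] at h2
    have h3 : ε / (2 * (B + 1)) * B ≤ ε / 2 := by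
      rw [div_mul_eq_mul_div, div_le_div_iff₀ (by positivity) two_pos]
      nlinarith
    have h4 := le_ciSup hbdd ⟨ψ, hψs⟩
    simp only at h4
    have h5 := (abs_le.1 h2).2
    linarith
  simp only [hlub]
  have : Countable s := hsc.to_subtype
  exact AEMeasurable.iSup fun φ => hR _

variable {d : ℕ} {Ω : Set (Eu d)}

theorem abs_sum_integral_le_matMeasNorm (R : MatMeas Ω) {f : Fin d → Fin d → closure Ω → ℝ}
    {B : ℝ} (hf : ∀ i j x, |f i j x| ≤ B) :
    |∑ i, ∑ j, ∫ᵛ x, f i j x ∂•(R i j)| ≤ B * matMeasNorm R := by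
  unfold matMeasNorm
  simp only [Finset.mul_sum]
  refine (Finset.abs_sum_le_sum_abs _ _).trans (Finset.sum_le_sum fun i _ => ?_)
  exact (Finset.abs_sum_le_sum_abs _ _).trans (Finset.sum_le_sum fun j _ =>
    abs_integral_signed_le _ (hf i j))

theorem matMeasNorm_nonneg (R : MatMeas Ω) : 0 ≤ matMeasNorm R :=
  Finset.sum_nonneg fun _ _ => Finset.sum_nonneg fun _ _ => ENNReal.toReal_nonneg

/-- A Bochner integral of a nonintegrable function is 0 by default, so without this the bound of ∫
‖R‖ by the defect would carry no information. Only weak-* measurability is assumed, hence the detour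
through the total variation. -/
theorem MemLinftyMeas.integrable (hΩ : IsCompact (closure Ω)) {T : ℝ} {R : ℝ → MatMeas Ω}
    (hR : MemLinftyMeas Ω T R) : Integrable (fun t => matMeasNorm (R t)) (timeMeasure T) := by
  have : CompactSpace (closure Ω) := isCompact_iff_compactSpace.1 hΩ
  obtain ⟨hm, C, hC⟩ := hR
  refine Integrable.of_bound (C := C) (AEMeasurable.aestronglyMeasurable ?_) ?_
  · unfold matMeasNorm
    exact Finset.aemeasurable_fun_sum _ fun i _ => Finset.aemeasurable_fun_sum _ fun j _ =>
      aemeasurable_totalVariation (hm i j)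
  · filter_upwards [hC] with t ht
    rwa [Real.norm_of_nonneg (matMeasNorm_nonneg _)]

end Corrector

/-! ### Testing the weak equations with regular fields -/

section CrossIdentities

set_option linter.unusedSectionVars false

variable {d : ℕ} {Ω : Set (Eu d)}

theorem aestronglyMeasurable_of_continuous_real {X : Type*} [NormedAddCommGroup X] {f : ℝ → X}
    (hf : Continuous f) {μ : Measure ℝ} : AEStronglyMeasurable f μ := hf.aestronglyMeasurable

/-- Averaging the pair (V, D) gives one subsequence for both. Two primitives of V that agree at one
time have the same constant, so the limit of the averages at 0 is c. -/
theorem exists_joint_subseq {X Y : Type*} [NormedAddCommGroup X] [NormedSpace ℝ X]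
    [CompleteSpace X] [NormedAddCommGroup Y] [NormedSpace ℝ Y] [CompleteSpace Y] {T : ℝ}
    (hT : 0 < T) {V g : ℝ → X} {D : ℝ → Y} (hV : MemLp V 2 (timeMeasure T))
    (hD : MemLp D 2 (timeMeasure T)) (hg : MemLp g 2 (timeMeasure T))
    (h : HasWeakTimeDeriv T V g) {c : X}
    (hc : ∀ᵐ t ∂timeMeasure T, V t = c + ∫ s in (0 : ℝ)..t, g s) :
    ∃ ns : ℕ → ℕ, StrictMono ns ∧
      (∀ᵐ t ∂timeMeasure T, Tendsto (fun n => timeMoll T (ns n) V t) atTop (𝓝 (V t))) ∧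
      (∀ᵐ t ∂timeMeasure T, Tendsto (fun n => timeMoll T (ns n) D t) atTop (𝓝 (D t))) ∧
      ∀ t ∈ Ico 0 T, Tendsto (fun n => timeMoll T (ns n) V t) atTop
        (𝓝 (c + ∫ s in (0 : ℝ)..t, g s)) := by
  have hVD : MemLp (fun s => (V s, D s)) 2 (timeMeasure T) := memLp_prod_iff.2 ⟨hV, hD⟩
  obtain ⟨ns, hns, hlim⟩ := exists_subseq_tendsto_timeMoll hVD
  have hi := hVD.integrable (by norm_num)
  have h1 : ∀ᵐ t ∂timeMeasure T, Tendsto (fun n => timeMoll T (ns n) V t) atTop (𝓝 (V t)) := by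
    filter_upwards [hlim] with t ht
    refine ((continuous_fst.tendsto _).comp ht).congr fun n => ?_
    exact clm_timeMoll hi (ContinuousLinearMap.fst ℝ X Y) _ t
  have h2 : ∀ᵐ t ∂timeMeasure T, Tendsto (fun n => timeMoll T (ns n) D t) atTop (𝓝 (D t)) := by
    filter_upwards [hlim] with t ht
    refine ((continuous_snd.tendsto _).comp ht).congr fun n => ?_
    exact clm_timeMoll hi (ContinuousLinearMap.snd ℝ X Y) _ t
  obtain ⟨c', hc', hae⟩ := h.exists_primitive hT hV hg hns h1
  have : (ae (timeMeasure T)).NeBot := by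
    rw [ae_neBot, Ne, Measure.restrict_eq_zero, Real.volume_Ioo]
    simpa using hT
  obtain ⟨t, ht, ht'⟩ := (hc.and hae).exists
  have : c = c' := by rw [ht] at ht'; exact add_right_cancel ht'
  exact ⟨ns, hns, h1, h2, this ▸ hc'⟩

theorem eventually_add_lt {T t : ℝ} (ht : t < T) {ns : ℕ → ℕ} (hns : StrictMono ns) :
    ∀ᶠ n in atTop, t + 3 / ((ns n : ℝ) + 1) < T := by
  have hlim : Tendsto (fun n : ℕ => t + 3 / ((ns n : ℝ) + 1)) atTop (𝓝 (t + 0)) := by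
    refine Tendsto.const_add _ ?_
    have := (tendsto_one_div_add_atTop_nhds_zero_nat (𝕜 := ℝ)).const_mul 3
    simpa [div_eq_mul_inv, Function.comp_def] using this.comp hns.tendsto_atTop
  rw [add_zero] at hlim
  exact hlim.eventually (gt_mem_nhds ht)

variable [IsFiniteMeasure (volume.restrict Ω : Measure (Eu d))]

/-- The weak momentum equation tested with a regular velocity. -/
theorem IsWeakState.momentum_cross (hd : d = 2 ∨ d = 3) (hΩ : IsSmoothBoundedDomain Ω) {T M : ℝ}
    (hT : 0 < T) {u : ℝ → Fin d → L2 Ω} {Du F : ℝ → Fin d → Fin d → L2 Ω}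
    (hw : IsWeakState Ω T u Du F) {V g : ℝ → Fin d → L2 Ω} {D : ℝ → Fin d → Fin d → L2 Ω}
    (hV : IsRegularVelocity Ω T M V g D) {u₀ : Fin d → L2 Ω} {R : ℝ → MatMeas Ω}
    (hR : Integrable (fun s => matMeasNorm (R s)) (timeMeasure T))
    (hmom : MomentumWeakForm Ω T u₀ u F R) {c : Fin d → L2 Ω}
    (hc : ∀ᵐ t ∂timeMeasure T, V t = c + ∫ s in (0 : ℝ)..t, g s) {t : ℝ} (ht : t ∈ Ioo 0 T) :
    |(∑ i, inner ℝ (u t i) ((c + ∫ s in (0 : ℝ)..t, g s) i)) - (∑ i, inner ℝ (u₀ i) (c i))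
      - ((∑ i, ∫ s in Ioc 0 t, inner ℝ (u s i) (g s i))
        + ∫ s in Ioc 0 t, momentumFlux (gradBound d M) (u s) (Du s) (F s) (D s))|
      ≤ gradBound d M * ∫ s in Ioc 0 t, matMeasNorm (R s) := by
  have hm := hΩ.isOpen.measurableSet
  have hle := restrict_Ioc_le (T := T) ht.2
  set B := gradBound d M with hB
  have hB0 : 0 ≤ B := gradBound_nonneg hV.nonneg
  obtain ⟨A, hA, hAc⟩ := hΩ.exists_seq_contracting
  obtain ⟨ns, hns, hVae, hDae, hVt⟩ := exists_joint_subseq hT (hV.memLp.mono_exponent le_top)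
    (hV.memLp_grad.mono_exponent le_top) hV.memLp_deriv hV.hasWeakTimeDeriv hc
  obtain ⟨K, hK, hbd⟩ := hw.exists_bound
  set W := (measureUnivNNReal (volume.restrict Ω : Measure (Eu d)) : ℝ) ^ (2⁻¹ : ℝ) * B with hW
  let P : ℕ → ℝ → Fin d → Fin d → L2 Ω := fun n s i j =>
    (A n).regGradL hm i j (timeMoll T (ns n) V s, timeMoll T (ns n) D s)
  have hPae : ∀ n s i j, P n s i j =ᵐ[volume.restrict Ω]
      (A n).regGrad (timeMoll T (ns n) V s) (timeMoll T (ns n) D s) i j := fun n s i j =>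
    (A n).coeFn_regGradL hm i j _ _
  have hPb : ∀ n s i j, ∀ᵐ x ∂(volume.restrict Ω),
      |(A n).regGrad (timeMoll T (ns n) V s) (timeMoll T (ns n) D s) i j x| ≤ B := fun n s i j => by
    filter_upwards [ae_restrict_mem hm] with x hx
    exact hV.abs_regGrad_le (A n) (ns n) s i j (subset_closure hx)
  have hPn : ∀ n s i j, ‖P n s i j‖ ≤ W := fun n s i j =>
    norm_le_of_ae_abs_le hB0 (ae_abs_le_of_ae (hPae n s i j) (hPb n s i j))
  have hPm : ∀ n, AEStronglyMeasurable (P n) ((volume : Measure ℝ).restrict (Ioc 0 t)) := by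
    intro n
    refine aestronglyMeasurable_of_continuous_real ?_
    refine continuous_pi fun i => continuous_pi fun j => ?_
    exact ((A n).regGradL hm i j).continuous.comp
      ((contDiff_timeMoll hV.integrable _).continuous.prodMk
        (contDiff_timeMoll hV.integrable_grad _).continuous)
  have hum := hw.u_memLp.1.mono_measure hle
  have hDum := hw.Du_memLp.1.mono_measure hle
  have hFm := hw.F_memLp.1.mono_measure hle
  have hfm : ∀ n, AEStronglyMeasurable (fun s => momentumFlux B (u s) (Du s) (F s) (P n s))
      ((volume : Measure ℝ).restrict (Ioc 0 t)) := fun n =>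
    aestronglyMeasurable_momentumFlux hB0 hum hDum hFm (hPm n)
  set bound : ℝ → ℝ := fun s => (∑ _i : Fin d, ∑ _j : Fin d, B * (K * K)) +
        ∑ i, ∑ j, (‖Du s i j‖ * W + ∑ _k : Fin d, B * (K * K)) with hbound
  have hbi : Integrable bound ((volume : Measure ℝ).restrict (Ioc 0 t)) := by
    refine (integrable_const _).add (integrable_finsetSum _ fun i _ =>
      integrable_finsetSum _ fun j _ => ?_)
    exact ((integrable_norm_bound ht.2 hw.Du_memLp i j).mul_const W).add (integrable_const _)
  have hfb : ∀ n, ∀ᵐ s ∂((volume : Measure ℝ).restrict (Ioc 0 t)),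
      ‖momentumFlux B (u s) (Du s) (F s) (P n s)‖ ≤ bound s := by
    intro n
    filter_upwards [ae_mono hle hbd] with s hs
    exact abs_momentumFlux_le hB0 hs.1 hs.2 (hPn n s)
  have hflux : Tendsto (fun n => ∫ s in Ioc 0 t, momentumFlux B (u s) (Du s) (F s) (P n s)) atTop
      (𝓝 (∫ s in Ioc 0 t, momentumFlux B (u s) (Du s) (F s) (D s))) := by
    refine tendsto_integral_of_dominated_convergence bound hfm hbi hfb ?_
    filter_upwards [ae_mono hle hVae, ae_mono hle hDae] with s h1 h2
    exact tendsto_momentumFlux hB0 _ _ _ fun i j => Regularizer.tendsto_regGradL hA hm h1 h2 i j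
  have hdt : ∀ i, _ := fun i => tendsto_integral_inner_regL hA hm ht.2 (hw.u_memLp.eval i)
    hV.memLp_deriv hns i
  have hlim := (((tendsto_finsetSum Finset.univ fun i _ => (tendsto_const_nhds (x := u t i)).inner
      (𝕜 := ℝ) (Regularizer.tendsto_regL hA hm (hVt t ⟨ht.1.le, ht.2⟩) i)).sub
    (tendsto_finsetSum Finset.univ fun i _ => (tendsto_const_nhds (x := u₀ i)).inner
      (𝕜 := ℝ) (Regularizer.tendsto_regL hA hm (hVt 0 ⟨le_rfl, hT⟩) i))).sub
    ((tendsto_finsetSum Finset.univ fun i _ => (hdt i).1).add hflux)).abs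
  simp only [intervalIntegral.integral_same, add_zero] at hlim
  -- All terms except the corrector converge. The corrector is only estimated, uniformly in n, by
  -- the sup bound on the regularized gradient; this is why the statement is an inequality.
  refine le_of_tendsto hlim ?_
  filter_upwards [eventually_add_lt ht.2 hns] with n hn
  have hwf := hmom _ (hV.isVelocityTest_reg hd (hAc n) (ns n)) t ht
  simp only [integral_mul_eq_inner_of_ae ((A n).coeFn_regL hm _ _)] at hwf
  have hcong : (∫ s in (0 : ℝ)..t,
      ((∑ i, ∫ x in Ω, u s i x * deriv (fun r => (A n).reg (timeMoll T (ns n) V r) i x) s)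
        + (∑ i, ∑ j, ∫ x in Ω, u s i x * u s j x *
            partialDeriv j ((A n).reg (timeMoll T (ns n) V s) i) x)
        - (∑ i, ∑ j, ∫ x in Ω, (weakDeriv Ω j (u s i) x + ∑ k, F s i k x * F s j k x)
            * partialDeriv j ((A n).reg (timeMoll T (ns n) V s) i) x)))
      = (∑ i, ∫ s in Ioc 0 t, inner ℝ (u s i) ((A n).regL hm i (timeMoll T (ns n) g s)))
        + ∫ s in Ioc 0 t, momentumFlux B (u s) (Du s) (F s) (P n s) := by
    rw [intervalIntegral.integral_of_le ht.1.le, ← integral_finsetSum _ fun i _ => (hdt i).2 n,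
      ← integral_add (integrable_finsetSum _ fun i _ => (hdt i).2 n) (hbi.mono' (hfm n) (hfb n))]
    refine integral_congr_ae ?_
    filter_upwards [ae_restrict_mem measurableSet_Ioc, ae_mono hle hw.grad] with s hs hgr
    have hder : ∀ i x, deriv (fun r => (A n).reg (timeMoll T (ns n) V r) i x) s
        = (A n).reg (timeMoll T (ns n) g s) i x := fun i x =>
      (A n).deriv_reg_time (hasDerivAt_timeMoll hV.integrable hV.hasWeakTimeDeriv hs.1.le
        (by linarith [hs.2])) i x
    simp only [hder, hV.partialDeriv_reg, fun i j => weakDeriv_eq hΩ.isOpen (hgr i j),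
      integral_mul_eq_inner_of_ae ((A n).coeFn_regL hm _ _)]
    rw [← momentumFlux_eq_integral hB0 (hPae n s) (hPb n s)]
    ring
  rw [hcong] at hwf
  have hpair : |∫ s in (0 : ℝ)..t, ∑ i, ∑ j, ∫ᵛ x,
      partialDeriv j ((A n).reg (timeMoll T (ns n) V s) i) (x : Eu d) ∂•(R s i j)|
      ≤ B * ∫ s in Ioc 0 t, matMeasNorm (R s) := by
    rw [← integral_const_mul, intervalIntegral.integral_of_le ht.1.le, ← Real.norm_eq_abs]
    refine norm_integral_le_of_norm_le ((hR.mono_measure hle).const_mul B)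
      (Eventually.of_forall fun s => ?_)
    refine abs_sum_integral_le_matMeasNorm (R s) fun i j x => ?_
    rw [hV.partialDeriv_reg]
    exact hV.abs_regGrad_le (A n) (ns n) s i j x.2
  refine le_trans (le_of_eq ?_) hpair
  rw [hwf]
  congr 1
  ring

/-- The weak transport equation tested with a regular deformation. -/
theorem IsWeakState.transport_cross (hd : d = 2 ∨ d = 3) (hΩ : IsSmoothBoundedDomain Ω) {T M : ℝ}
    (hT : 0 < T) {u : ℝ → Fin d → L2 Ω} {Du F : ℝ → Fin d → Fin d → L2 Ω}
    (hw : IsWeakState Ω T u Du F) {V g : ℝ → Fin d → Fin d → L2 Ω}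
    {D : ℝ → Fin d → Fin d → Fin d → L2 Ω}
    (hV : IsRegularDeformation Ω T M V g D) {F₀ : Fin d → Fin d → L2 Ω}
    (htr : TransportWeakForm Ω T F₀ u F) {c : Fin d → Fin d → L2 Ω}
    (hc : ∀ᵐ t ∂timeMeasure T, V t = c + ∫ s in (0 : ℝ)..t, g s) {t : ℝ} (ht : t ∈ Ioo 0 T) :
    (∑ i, ∑ j, inner ℝ (F t i j) ((c + ∫ s in (0 : ℝ)..t, g s) i j))
        - (∑ i, ∑ j, inner ℝ (F₀ i j) (c i j))
      = (∑ i, ∑ j, ∫ s in Ioc 0 t, inner ℝ (F s i j) (g s i j))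
        + ∫ s in Ioc 0 t, transportFlux (gradBound d M) (u s) (Du s) (F s) (D s) (V s) := by
  have hm := hΩ.isOpen.measurableSet
  have hle := restrict_Ioc_le (T := T) ht.2
  set B := gradBound d M with hB
  have hB0 : 0 ≤ B := gradBound_nonneg hV.nonneg
  obtain ⟨A, hA, hAe⟩ := hΩ.exists_seq_expanding
  obtain ⟨ns, hns, hVae, hDae, hVt⟩ := exists_joint_subseq hT (hV.memLp.mono_exponent le_top)
    (hV.memLp_grad.mono_exponent le_top) hV.memLp_deriv hV.hasWeakTimeDeriv hc
  obtain ⟨K, hK, hbd⟩ := hw.exists_bound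
  have hcol : ∀ {α : Type _} [TopologicalSpace α] (j : Fin d),
      Continuous (IsRegularDeformation.col j : (Fin d → Fin d → α) → Fin d → α) := fun j =>
    continuous_pi fun i => continuous_apply_apply i j
  let P : ℕ → ℝ → Fin d → Fin d → Fin d → L2 Ω := fun n s i j k =>
    (A n).regGradL hm i k (IsRegularDeformation.col j (timeMoll T (ns n) V s),
      IsRegularDeformation.col j (timeMoll T (ns n) D s))
  let Q : ℕ → ℝ → Fin d → Fin d → L2 Ω := fun n s i j =>
    (A n).regL hm i (IsRegularDeformation.col j (timeMoll T (ns n) V s))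
  have hPae : ∀ n s i j k, P n s i j k =ᵐ[volume.restrict Ω]
      (A n).regGrad (IsRegularDeformation.col j (timeMoll T (ns n) V s))
        (IsRegularDeformation.col j (timeMoll T (ns n) D s)) i k := fun n s i j k =>
    (A n).coeFn_regGradL hm i k _ _
  have hPb : ∀ n s i j k, ∀ᵐ x ∂(volume.restrict Ω),
      |(A n).regGrad (IsRegularDeformation.col j (timeMoll T (ns n) V s))
        (IsRegularDeformation.col j (timeMoll T (ns n) D s)) i k x| ≤ B := fun n s i j k => by
    filter_upwards [ae_restrict_mem hm] with x hx
    exact hV.abs_regGrad_le (A n) (ns n) s i j k (subset_closure hx)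
  have hQae : ∀ n s i j, Q n s i j =ᵐ[volume.restrict Ω]
      (A n).reg (IsRegularDeformation.col j (timeMoll T (ns n) V s)) i := fun n s i j =>
    (A n).coeFn_regL hm i _
  have hQb : ∀ n s i j, ∀ᵐ x ∂(volume.restrict Ω),
      |(A n).reg (IsRegularDeformation.col j (timeMoll T (ns n) V s)) i x| ≤ B := fun n s i j => by
    filter_upwards [ae_restrict_mem hm] with x hx
    exact hV.abs_reg_le (A n) (ns n) s i j (subset_closure hx)
  have hPm : ∀ n, AEStronglyMeasurable (P n) ((volume : Measure ℝ).restrict (Ioc 0 t)) := by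
    intro n
    refine aestronglyMeasurable_of_continuous_real ?_
    refine continuous_pi fun i => continuous_pi fun j => continuous_pi fun k => ?_
    exact ((A n).regGradL hm i k).continuous.comp
      (((hcol j).comp (contDiff_timeMoll hV.integrable _).continuous).prodMk
        ((hcol j).comp (contDiff_timeMoll hV.integrable_grad _).continuous))
  have hQm : ∀ n, AEStronglyMeasurable (Q n) ((volume : Measure ℝ).restrict (Ioc 0 t)) := by
    intro n
    refine aestronglyMeasurable_of_continuous_real ?_
    refine continuous_pi fun i => continuous_pi fun j => ?_
    exact ((A n).regL hm i).continuous.comp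
      ((hcol j).comp (contDiff_timeMoll hV.integrable _).continuous)
  have hum := hw.u_memLp.1.mono_measure hle
  have hDum := hw.Du_memLp.1.mono_measure hle
  have hFm := hw.F_memLp.1.mono_measure hle
  have hfm : ∀ n, AEStronglyMeasurable
      (fun s => transportFlux B (u s) (Du s) (F s) (P n s) (Q n s))
      ((volume : Measure ℝ).restrict (Ioc 0 t)) := fun n =>
    aestronglyMeasurable_transportFlux hB0 hum hDum hFm (hPm n) (hQm n)
  set bound : ℝ → ℝ := fun s => (∑ _k : Fin d, ∑ _i : Fin d, ∑ _j : Fin d, B * (K * K)) +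
        ∑ i, ∑ _j : Fin d, ∑ k, B * (‖Du s i k‖ * K) with hbound
  have hbi : Integrable bound ((volume : Measure ℝ).restrict (Ioc 0 t)) := by
    refine (integrable_const _).add (integrable_finsetSum _ fun i _ =>
      integrable_finsetSum _ fun j _ => integrable_finsetSum _ fun k _ => ?_)
    exact ((integrable_norm_bound ht.2 hw.Du_memLp i k).mul_const K).const_mul B
  have hfb : ∀ n, ∀ᵐ s ∂((volume : Measure ℝ).restrict (Ioc 0 t)),
      ‖transportFlux B (u s) (Du s) (F s) (P n s) (Q n s)‖ ≤ bound s := by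
    intro n
    filter_upwards [ae_mono hle hbd] with s hs
    exact abs_transportFlux_le hB0 hs.1 hs.2
  have hcolt : ∀ {α : Type _} [TopologicalSpace α] {f : ℕ → Fin d → Fin d → α}
      {f' : Fin d → Fin d → α} (j : Fin d), Tendsto f atTop (𝓝 f') →
      Tendsto (fun n => IsRegularDeformation.col j (f n)) atTop
        (𝓝 (IsRegularDeformation.col j f')) := fun j hf => ((hcol j).tendsto _).comp hf
  have hflux : Tendsto (fun n => ∫ s in Ioc 0 t, transportFlux B (u s) (Du s) (F s) (P n s) (Q n s))
      atTop (𝓝 (∫ s in Ioc 0 t, transportFlux B (u s) (Du s) (F s) (D s) (V s))) := by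
    refine tendsto_integral_of_dominated_convergence bound hfm hbi hfb ?_
    filter_upwards [ae_mono hle hVae, ae_mono hle hDae] with s h1 h2
    refine tendsto_transportFlux hB0 _ _ _ (fun i j k => ?_) fun i j => ?_
    · exact Regularizer.tendsto_regGradL hA hm (hcolt j h1) (hcolt j h2) i k
    · exact Regularizer.tendsto_regL hA hm (hcolt j h1) i
  have hgcol : ∀ j, MemLp (fun s => IsRegularDeformation.col j (g s)) 2 (timeMeasure T) := fun j =>
    memLp_pi_iff.2 fun i => (hV.memLp_deriv.eval i).eval j
  have hmcol : ∀ n s j, timeMoll T n (fun s => IsRegularDeformation.col j (g s)) s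
      = IsRegularDeformation.col j (timeMoll T n g s) := by
    intro n s j
    funext i
    rw [timeMoll_apply ((hgcol j).integrable (by norm_num))]
    simp only [IsRegularDeformation.col]
    rw [timeMoll_apply hV.integrable_deriv, timeMoll_apply (hV.integrable_deriv.eval i)]
  have hdt : ∀ i j, _ := fun i j => tendsto_integral_inner_regL hA hm ht.2
    ((hw.F_memLp.eval i).eval j) (hgcol j) hns i
  simp only [hmcol] at hdt
  have hl := ((tendsto_finsetSum Finset.univ fun i _ => tendsto_finsetSum Finset.univ fun j _ =>
      (tendsto_const_nhds (x := F t i j)).inner (𝕜 := ℝ)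
      (Regularizer.tendsto_regL hA hm (hcolt j (hVt t ⟨ht.1.le, ht.2⟩)) i)).sub
    (tendsto_finsetSum Finset.univ fun i _ => tendsto_finsetSum Finset.univ fun j _ =>
      (tendsto_const_nhds (x := F₀ i j)).inner
      (𝕜 := ℝ) (Regularizer.tendsto_regL hA hm (hcolt j (hVt 0 ⟨le_rfl, hT⟩)) i)))
  have hr := ((tendsto_finsetSum Finset.univ fun i _ => tendsto_finsetSum Finset.univ fun j _ =>
    (hdt i j).1).add hflux)
  simp only [intervalIntegral.integral_same, add_zero] at hl
  refine tendsto_nhds_unique_of_eventuallyEq hl hr ?_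
  filter_upwards [eventually_add_lt ht.2 hns] with n hn
  have hwf := htr _ (hV.isDeformationTest_reg hd (hAe n) (ns n)) t ht
  simp only [integral_mul_eq_inner_of_ae ((A n).coeFn_regL hm _ _)] at hwf
  rw [hwf, intervalIntegral.integral_of_le ht.1.le]
  have hsum : ∀ i, (∑ j, ∫ s in Ioc 0 t, inner ℝ (F s i j)
      ((A n).regL hm i (IsRegularDeformation.col j (timeMoll T (ns n) g s)))) =
      ∫ s in Ioc 0 t, ∑ j, inner ℝ (F s i j)
      ((A n).regL hm i (IsRegularDeformation.col j (timeMoll T (ns n) g s))) := fun i =>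
    (integral_finsetSum _ fun j _ => (hdt i j).2 n).symm
  simp only [hsum]
  rw [← integral_finsetSum _ fun i _ => integrable_finsetSum _ fun j _ => (hdt i j).2 n,
    ← integral_add (integrable_finsetSum _ fun i _ => integrable_finsetSum _ fun j _ =>
      (hdt i j).2 n) (hbi.mono' (hfm n) (hfb n))]
  refine integral_congr_ae ?_
  filter_upwards [ae_restrict_mem measurableSet_Ioc, ae_mono hle hw.grad] with s hs hgr
  have hder : ∀ i j x, deriv (fun r => (A n).reg
      (IsRegularDeformation.col j (timeMoll T (ns n) V r)) i x) s
      = (A n).reg (IsRegularDeformation.col j (timeMoll T (ns n) g s)) i x := fun i j x => by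
    have h1 := hasDerivAt_timeMoll hV.integrable hV.hasWeakTimeDeriv hs.1.le
      (n := ns n) (by linarith [hs.2])
    refine (A n).deriv_reg_time (V := fun r => IsRegularDeformation.col j
      (timeMoll T (ns n) V r)) ?_ i x
    exact hasDerivAt_pi.2 fun m => hasDerivAt_pi.1 (hasDerivAt_pi.1 h1 m) j
  -- Unlike in the velocity case the gradient formula is available only on the closure of Ω, so it
  -- is inserted under the integral.
  have hpd : ∀ i j k, (∫ x in Ω, u s k x * F s i j x * partialDeriv k ((A n).reg
      (IsRegularDeformation.col j (timeMoll T (ns n) V s)) i) x)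
      = ∫ x in Ω, u s k x * F s i j x * (A n).regGrad
        (IsRegularDeformation.col j (timeMoll T (ns n) V s))
        (IsRegularDeformation.col j (timeMoll T (ns n) D s)) i k x := by
    intro i j k
    refine integral_congr_ae ?_
    filter_upwards [ae_restrict_mem hm] with x hx
    rw [hV.partialDeriv_reg (hAe n) (ns n) s i j k (subset_closure hx)]
  simp only [hder, hpd, fun i j => weakDeriv_eq hΩ.isOpen (hgr i j),
    integral_mul_eq_inner_of_ae ((A n).coeFn_regL hm _ _)]
  rw [add_assoc, transportFlux_eq_integral hB0 (hPae n s) (hPb n s) (hQae n s) (hQb n s)]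

end CrossIdentities

/-! ### From weak forms to equations at almost every time -/

section StrongEquations

set_option linter.unusedSectionVars false

/-- The primitive is continuous, so it vanishes on all of [0,T]. Its value at 0 gives c, and
Lebesgue differentiation gives h. -/
theorem eq_zero_of_primitive_eq_zero {T : ℝ} (hT : 0 < T) {h : ℝ → ℝ} {c : ℝ}
    (hh : Integrable h (timeMeasure T))
    (hc : ∀ᵐ t ∂timeMeasure T, c + ∫ s in (0 : ℝ)..t, h s = 0) :
    c = 0 ∧ ∀ᵐ t ∂timeMeasure T, h t = 0 := by
  set h' := (Ioo 0 T).indicator h with hh'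
  have hi : Integrable h' := (integrable_indicator_iff measurableSet_Ioo).2 hh
  have heq : ∀ t ∈ Ioo 0 T, ∫ s in (0 : ℝ)..t, h s = ∫ s in (0 : ℝ)..t, h' s := by
    intro t ht
    refine intervalIntegral.integral_congr_ae (Eventually.of_forall fun s hs => ?_)
    rw [uIoc_of_le ht.1.le] at hs
    rw [hh', indicator_of_mem]
    exact ⟨hs.1, hs.2.trans_lt ht.2⟩
  set H : ℝ → ℝ := fun t => c + ∫ s in (0 : ℝ)..t, h' s with hH
  have hHc : Continuous H := continuous_const.add
    (intervalIntegral.continuous_primitive (fun a b => hi.intervalIntegrable) 0)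
  have hEq : EqOn H 0 (Icc 0 T) := by
    refine Measure.eqOn_Icc_of_ae_eq (μ := volume) hT.ne ?_ hHc.continuousOn continuousOn_const
    rw [← restrict_Ioo_eq_restrict_Icc]
    filter_upwards [hc, ae_restrict_mem measurableSet_Ioo] with t ht hm
    simp only [hH]; rw [← heq t hm, ht, Pi.zero_apply]
  refine ⟨?_, ?_⟩
  · have := hEq (left_mem_Icc.2 hT.le)
    simpa [hH] using this
  · have hd := LocallyIntegrable.ae_hasDerivAt_integral hi.locallyIntegrable
    filter_upwards [ae_restrict_of_ae hd, ae_restrict_mem measurableSet_Ioo] with t ht hm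
    have h1 : HasDerivAt H (h' t) t := (ht 0).const_add c
    have h2 : H =ᶠ[𝓝 t] fun _ => 0 :=
      eventually_of_mem (Icc_mem_nhds hm.1 hm.2) hEq
    have h3 := (h1.congr_of_eventuallyEq h2.symm).unique (hasDerivAt_const t (0 : ℝ))
    rwa [hh', indicator_of_mem hm] at h3

variable {d : ℕ} {Ω : Set (Eu d)}

/-- Moves the truncation from the test factor to the bounded state. The form then becomes continuous
in test fields that are merely square integrable. -/
theorem tri_eq_tri_of_bounds {M B : ℝ} {a b q : L2 Ω} (hb : ∀ᵐ x ∂(volume.restrict Ω), |b x| ≤ M)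
    (hq : ∀ᵐ x ∂(volume.restrict Ω), |q x| ≤ B) : tri B a b q = tri M q a b := by
  rw [tri_eq_of_abs_le hq, tri_eq_of_abs_le hb]
  exact integral_congr_ae (Eventually.of_forall fun x => by ring)

/-- The momentum flux of a bounded state, as a functional of the gradient `P` of the test field. -/
def strongMomentumFlux (M : ℝ) (V : Fin d → L2 Ω) (D W P : Fin d → Fin d → L2 Ω) : ℝ :=
  (∑ i, ∑ j, tri M (P i j) (V i) (V j))
    - ∑ i, ∑ j, (inner ℝ (D i j) (P i j) + ∑ k, tri M (P i j) (W i k) (W j k))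

theorem momentumFlux_eq_strong {M B : ℝ} {V : Fin d → L2 Ω} {D W P : Fin d → Fin d → L2 Ω}
    (hV : ∀ i, ∀ᵐ x ∂(volume.restrict Ω), |V i x| ≤ M)
    (hW : ∀ i j, ∀ᵐ x ∂(volume.restrict Ω), |W i j x| ≤ M)
    (hP : ∀ i j, ∀ᵐ x ∂(volume.restrict Ω), |P i j x| ≤ B) :
    momentumFlux B V D W P = strongMomentumFlux M V D W P := by
  unfold momentumFlux strongMomentumFlux
  simp only [fun i j => tri_eq_tri_of_bounds (a := V i) (hV j) (hP i j),
    fun i j k => tri_eq_tri_of_bounds (a := W i k) (hW j k) (hP i j)]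

theorem continuous_strongMomentumFlux {M : ℝ} (hM : 0 ≤ M) (V : Fin d → L2 Ω)
    (D W : Fin d → Fin d → L2 Ω) : Continuous (strongMomentumFlux M V D W) := by
  have h : ∀ (a b : L2 Ω) (i j : Fin d),
      Continuous fun P : Fin d → Fin d → L2 Ω => tri M (P i j) a b := fun a b i j =>
    (continuous_tri hM).comp (f := fun P : Fin d → Fin d → L2 Ω => (P i j, a, b)) (by fun_prop)
  unfold strongMomentumFlux
  refine Continuous.sub ?_ ?_
  · exact continuous_finsetSum _ fun i _ => continuous_finsetSum _ fun j _ => h _ _ i j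
  · exact continuous_finsetSum _ fun i _ => continuous_finsetSum _ fun j _ =>
      (continuous_const.inner (continuous_apply_apply i j)).add
        (continuous_finsetSum _ fun k _ => h _ _ i j)

/-- The transport terms of a bounded state, as a functional of the test field `Q`. -/
def strongTransportFlux (M : ℝ) (V : Fin d → L2 Ω) (D W : Fin d → Fin d → L2 Ω)
    (DW : Fin d → Fin d → Fin d → L2 Ω) (Q : Fin d → Fin d → L2 Ω) : ℝ :=
  (∑ i, ∑ j, ∑ k, tri M (Q i j) (D i k) (W k j)) - ∑ i, ∑ j, ∑ k, tri M (Q i j) (V k) (DW i j k)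

theorem continuous_strongTransportFlux {M : ℝ} (hM : 0 ≤ M) (V : Fin d → L2 Ω)
    (D W : Fin d → Fin d → L2 Ω) (DW : Fin d → Fin d → Fin d → L2 Ω) :
    Continuous (strongTransportFlux M V D W DW) := by
  have h : ∀ (a b : L2 Ω) (i j : Fin d),
      Continuous fun P : Fin d → Fin d → L2 Ω => tri M (P i j) a b := fun a b i j =>
    (continuous_tri hM).comp (f := fun P : Fin d → Fin d → L2 Ω => (P i j, a, b)) (by fun_prop)
  unfold strongTransportFlux
  refine Continuous.sub ?_ ?_ <;>
  exact continuous_finsetSum _ fun i _ => continuous_finsetSum _ fun j _ =>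
    continuous_finsetSum _ fun k _ => h _ _ i j

variable [IsFiniteMeasure (volume.restrict Ω : Measure (Eu d))]

/-- Integration by parts along the solenoidal V moves the derivative from Q to W. The result is
meaningful for Q in L² only, which is essential because the weak deformation gradient has no spatial
derivative. -/
theorem transportFlux_eq_strong (hΩ : IsOpen Ω) {M B : ℝ} (hM : 0 ≤ M) {V : Fin d → L2 Ω}
    {D W Q : Fin d → Fin d → L2 Ω} {DW P : Fin d → Fin d → Fin d → L2 Ω} (hdiv : V ∈ L2Div Ω)
    (hDW : ∀ i j k, HasWeakDeriv Ω k (W i j) (DW i j k))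
    (hW : ∀ i j, ∀ᵐ x ∂(volume.restrict Ω), |W i j x| ≤ M)
    (hDWM : ∀ i j k, ∀ᵐ x ∂(volume.restrict Ω), |DW i j k x| ≤ M)
    (hQP : ∀ i j k, HasWeakDeriv Ω k (Q i j) (P i j k))
    (hQ : ∀ i j, ∀ᵐ x ∂(volume.restrict Ω), |Q i j x| ≤ B)
    (hP : ∀ i j k, ∀ᵐ x ∂(volume.restrict Ω), |P i j k x| ≤ B) :
    transportFlux B V D W P Q = strongTransportFlux M V D W DW Q := by
  unfold transportFlux strongTransportFlux
  have h1 : (∑ k, ∑ i, ∑ j, tri B (V k) (W i j) (P i j k))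
      = -∑ i, ∑ j, ∑ k, tri M (Q i j) (V k) (DW i j k) := by
    rw [Finset.sum_comm, ← Finset.sum_neg_distrib]
    refine Finset.sum_congr rfl fun i _ => ?_
    rw [Finset.sum_comm, ← Finset.sum_neg_distrib]
    refine Finset.sum_congr rfl fun j _ => ?_
    have := sum_tri_eq_zero_of_L2Div hΩ hdiv hM (hDW i j) (hQP i j) (hW i j) (hDWM i j)
    rw [Finset.sum_add_distrib, add_comm] at this
    rw [eq_neg_iff_add_eq_zero, ← this]
    congr 1
    · refine Finset.sum_congr rfl fun k _ => ?_
      rw [tri_eq_tri_of_bounds (hW i j) (hP i j k), tri_comm]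
    · exact Finset.sum_congr rfl fun k _ => tri_comm _ _ _ _
  rw [h1, neg_add_eq_sub]
  congr 1
  exact Finset.sum_congr rfl fun i _ => Finset.sum_congr rfl fun j _ =>
    Finset.sum_congr rfl fun k _ => tri_eq_tri_of_bounds (hW k j) (hQ i j)

theorem isClosed_HSpace : IsClosed (HSpace Ω) := by
  have : HSpace Ω = ⋂ (φ : Fin d → Eu d → ℝ) (h : ∀ j, IsTest Ω (φ j)),
      {Φ | ∑ i, ∑ j, inner ℝ (Φ i j) (((h j).partialDeriv i).memLp.toLp _) = 0} := by
    ext Φ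
    simp only [HSpace, mem_iInter, mem_ofPred_eq]
    refine forall₂_congr fun φ h => ?_
    simp only [fun i j => integral_mul_eq_inner_toLp (Φ i j) ((h j).partialDeriv i).memLp]
  rw [this]
  refine isClosed_iInter fun φ => isClosed_iInter fun h => isClosed_eq ?_ continuous_const
  exact continuous_finsetSum _ fun i _ => continuous_finsetSum _ fun j _ =>
    (continuous_apply_apply i j).inner continuous_const

/-- The initial value of the continuous representative lies in every closed set containing almost
all values. -/
theorem initial_mem_of_ae {X : Type*} [NormedAddCommGroup X] [NormedSpace ℝ X] [CompleteSpace X]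
    {T : ℝ} (hT : 0 < T) {V g : ℝ → X} {c : X} (hg : Integrable g (timeMeasure T))
    (hc : ∀ᵐ t ∂timeMeasure T, V t = c + ∫ s in (0 : ℝ)..t, g s) {S : Set X} (hS : IsClosed S)
    (hV : ∀ᵐ t ∂timeMeasure T, V t ∈ S) : c ∈ S := by
  set g' := (Ioo 0 T).indicator g with hg'
  have hi : Integrable g' := (integrable_indicator_iff measurableSet_Ioo).2 hg
  have hcont : Continuous fun t => c + ∫ s in (0 : ℝ)..t, g' s := continuous_const.add
    (intervalIntegral.continuous_primitive (fun a b => hi.intervalIntegrable) 0)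
  have hlim : Tendsto (fun t => c + ∫ s in (0 : ℝ)..t, g' s) (𝓝[>] 0) (𝓝 c) := by
    have := (hcont.tendsto 0).mono_left (nhdsWithin_le_nhds (s := Ioi 0))
    simpa using this
  refine hS.mem_of_frequently_of_tendsto ?_ hlim
  rw [Filter.Frequently]
  intro hev
  obtain ⟨δ, hδ, hsub⟩ := mem_nhdsGT_iff_exists_Ioo_subset.1 hev
  have hδ0 : (0 : ℝ) < min δ T := lt_min hδ hT
  have hgood : ∀ᵐ t ∂timeMeasure T, t ∈ Ioo 0 T ∧ c + ∫ s in (0 : ℝ)..t, g' s ∈ S := by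
    filter_upwards [hc, hV, ae_restrict_mem measurableSet_Ioo] with t h1 h2 ht
    refine ⟨ht, ?_⟩
    have : ∫ s in (0 : ℝ)..t, g' s = ∫ s in (0 : ℝ)..t, g s := by
      refine intervalIntegral.integral_congr_ae (Eventually.of_forall fun s hs => ?_)
      rw [uIoc_of_le ht.1.le] at hs
      rw [hg', indicator_of_mem]
      exact ⟨hs.1, hs.2.trans_lt ht.2⟩
    rw [this, ← h1]
    exact h2
  have h3 : ∀ᵐ t ∂(volume.restrict (Ioo 0 (min δ T))), False := by
    have hle : (volume : Measure ℝ).restrict (Ioo 0 (min δ T)) ≤ timeMeasure T :=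
      Measure.restrict_mono_set _ (Ioo_subset_Ioo_right (min_le_right _ _))
    filter_upwards [ae_mono hle hgood, ae_restrict_mem measurableSet_Ioo] with t h1 ht
    exact hsub ⟨ht.1, ht.2.trans_le (min_le_left _ _)⟩ h1.2
  rw [ae_iff] at h3
  simp only [not_false_eq_true] at h3
  have : (volume : Measure ℝ) (Ioo 0 (min δ T)) = 0 := by simpa using h3
  rw [Real.volume_Ioo, ENNReal.ofReal_eq_zero] at this
  linarith

instance : TopologicalSpace.SeparableSpace (L2 Ω) := by
  have : Fact ((2 : ENNReal) ≠ ⊤) := ⟨by norm_num⟩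
  infer_instance

end StrongEquations

/-! ### The momentum equation of the strong solution -/

section PointwiseMomentum

set_option linter.unusedSectionVars false

variable {d : ℕ} {Ω : Set (Eu d)}

/-- The pairing with a fixed vector field. -/
def pairing (v : Fin d → L2 Ω) : (Fin d → L2 Ω) →L[ℝ] ℝ :=
  ∑ i, (innerSL ℝ (v i)).comp (ContinuousLinearMap.proj i)

theorem pairing_apply (v w : Fin d → L2 Ω) : pairing v w = ∑ i, inner ℝ (w i) (v i) := by
  simp [pairing, real_inner_comm]

/-- The pairing with a fixed matrix field. -/
def matPairing (Q : Fin d → Fin d → L2 Ω) : (Fin d → Fin d → L2 Ω) →L[ℝ] ℝ :=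
  ∑ i, (pairing (Q i)).comp (ContinuousLinearMap.proj i)

theorem matPairing_apply (Q W : Fin d → Fin d → L2 Ω) :
    matPairing Q W = ∑ i, ∑ j, inner ℝ (W i j) (Q i j) := by
  simp [matPairing, pairing_apply]

theorem hasWeakTimeDeriv_const {X : Type*} [NormedAddCommGroup X] [NormedSpace ℝ X]
    [CompleteSpace X] (T : ℝ) (v : X) : HasWeakTimeDeriv T (fun _ => v) (fun _ => (0 : X)) := by
  intro θ hθ hc hs
  have h0 : ∫ t, deriv θ t = 0 := by
    have hd : Continuous (deriv θ) := hθ.continuous_deriv (by simp)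
    refine integral_eq_zero_of_hasDerivAt_of_integrable
      (fun t => ((hθ.differentiable (by simp)) t).hasDerivAt)
      (hd.integrable_of_hasCompactSupport hc.deriv)
      (hθ.continuous.integrable_of_hasCompactSupport hc)
  have h1 : ∫ t in Ioo 0 T, deriv θ t = 0 := by
    rw [setIntegral_eq_integral_of_forall_compl_eq_zero, h0]
    intro t ht
    by_contra h
    exact ht (hs (tsupport_deriv_subset (subset_tsupport _ h)))
  simp only [smul_zero, integral_zero, neg_zero]
  rw [integral_smul_const, h1, zero_smul]

theorem abs_le_of_isTest {φ : Eu d → ℝ} (hφ : IsTest Ω φ) : ∃ C, ∀ x, |φ x| ≤ C :=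
  exists_bound_of_compact hφ.1.continuous hφ.2.1

/-- Pairs consisting of a solenoidal test field and its gradient. -/
def testPairs (Ω : Set (Eu d)) : Set ((Fin d → L2 Ω) × (Fin d → Fin d → L2 Ω)) :=
  {p | ∃ φ, IsSolenoidalTest Ω φ ∧ (∀ i, p.1 i =ᵐ[volume.restrict Ω] φ i) ∧
        ∀ i j, p.2 i j =ᵐ[volume.restrict Ω] partialDeriv j (φ i)}

theorem exists_isRegularVelocity_const [IsFiniteMeasure (volume.restrict Ω : Measure (Eu d))]
    (T : ℝ) {v : Fin d → L2 Ω} {G : Fin d → Fin d → L2 Ω} (h : (v, G) ∈ testPairs Ω) :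
    ∃ B, IsRegularVelocity Ω T B (fun _ => v) (fun _ => 0) (fun _ => G) := by
  have hcl := subset_closure h
  obtain ⟨φ, hφ, h1, h2⟩ := h
  choose C hC using fun i => abs_le_of_isTest (hφ.1 i)
  choose C' hC' using fun i j => abs_le_of_isTest ((hφ.1 i).partialDeriv j)
  set B := (∑ i, |C i|) + ∑ i, ∑ j, |C' i j| with hB
  have hs1 : ∀ i, |C i| ≤ ∑ i, |C i| := fun i =>
    Finset.single_le_sum (f := fun i => |C i|) (fun _ _ => abs_nonneg _) (Finset.mem_univ i)
  have hs2 : ∀ i j, |C' i j| ≤ ∑ i, ∑ j, |C' i j| := fun i j =>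
    (Finset.single_le_sum (f := fun j => |C' i j|) (fun _ _ => abs_nonneg _)
      (Finset.mem_univ j)).trans (Finset.single_le_sum (f := fun i => ∑ j, |C' i j|)
        (fun _ _ => Finset.sum_nonneg fun _ _ => abs_nonneg _) (Finset.mem_univ i))
  have p1 : 0 ≤ ∑ i, |C i| := Finset.sum_nonneg fun _ _ => abs_nonneg _
  have p2 : 0 ≤ ∑ i, ∑ j, |C' i j| :=
    Finset.sum_nonneg fun _ _ => Finset.sum_nonneg fun _ _ => abs_nonneg _
  refine ⟨B, add_nonneg p1 p2, memLp_const _, memLp_const _, memLp_const _,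
    hasWeakTimeDeriv_const T v, Eventually.of_forall fun _ => ⟨G, hcl⟩,
    Eventually.of_forall fun _ => hasZeroWeakDeriv_of_mem_closure hcl,
    Eventually.of_forall fun _ i => ?_, Eventually.of_forall fun _ i j => ?_⟩
  · filter_upwards [h1 i] with x hx
    rw [hx]
    linarith [hC i x, le_abs_self (C i), hs1 i]
  · filter_upwards [h2 i j] with x hx
    rw [hx]
    linarith [hC' i j x, le_abs_self (C' i j), hs2 i j]

variable [IsFiniteMeasure (volume.restrict Ω : Measure (Eu d))] {T M : ℝ}

theorem IsWeakState.integrable_momentumFlux {B : ℝ} (hB : 0 ≤ B) {u : ℝ → Fin d → L2 Ω}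
    {Du F P : ℝ → Fin d → Fin d → L2 Ω} (hw : IsWeakState Ω T u Du F)
    (hP : MemLp P ⊤ (timeMeasure T)) :
    Integrable (fun s => momentumFlux B (u s) (Du s) (F s) (P s)) (timeMeasure T) := by
  obtain ⟨K, hK0, hK⟩ := hw.exists_bound
  obtain ⟨L, hL0, hL⟩ := exists_ae_norm_le hP
  have hb : Integrable (fun s => (∑ _i : Fin d, ∑ _j : Fin d, B * (K * K)) +
        ∑ i, ∑ j, (‖Du s i j‖ * L + ∑ _k : Fin d, B * (K * K))) (timeMeasure T) := by
    refine (integrable_const _).add (integrable_finsetSum _ fun i _ =>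
      integrable_finsetSum _ fun j _ => Integrable.add ?_ (integrable_const _))
    exact (((hw.Du_memLp.eval i).eval j).integrable (by norm_num)).norm.mul_const _
  refine hb.mono' (aestronglyMeasurable_momentumFlux hB hw.u_memLp.1 hw.Du_memLp.1 hw.F_memLp.1
    hP.1) ?_
  filter_upwards [hK, hL] with s hs hPs
  exact abs_momentumFlux_le hB hs.1 hs.2 fun i j =>
    ((norm_le_pi_norm (P s i) j).trans (norm_le_pi_norm (P s) i)).trans hPs

theorem IsWeakState.integrable_transportFlux {B : ℝ} (hB : 0 ≤ B) {u : ℝ → Fin d → L2 Ω}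
    {Du F Q : ℝ → Fin d → Fin d → L2 Ω} {P : ℝ → Fin d → Fin d → Fin d → L2 Ω}
    (hw : IsWeakState Ω T u Du F) (hP : MemLp P ⊤ (timeMeasure T))
    (hQ : MemLp Q ⊤ (timeMeasure T)) :
    Integrable (fun s => transportFlux B (u s) (Du s) (F s) (P s) (Q s)) (timeMeasure T) := by
  obtain ⟨K, hK0, hK⟩ := hw.exists_bound
  have hb : Integrable (fun s => (∑ _k : Fin d, ∑ _i : Fin d, ∑ _j : Fin d, B * (K * K)) +
        ∑ i, ∑ _j : Fin d, ∑ k, B * (‖Du s i k‖ * K)) (timeMeasure T) := by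
    refine (integrable_const _).add (integrable_finsetSum _ fun i _ =>
      integrable_finsetSum _ fun j _ => integrable_finsetSum _ fun k _ => ?_)
    exact ((((hw.Du_memLp.eval i).eval k).integrable (by norm_num)).norm.mul_const _).const_mul _
  refine hb.mono' (aestronglyMeasurable_transportFlux hB hw.u_memLp.1 hw.Du_memLp.1 hw.F_memLp.1
    hP.1 hQ.1) ?_
  filter_upwards [hK] with s hs
  exact abs_transportFlux_le hB hs.1 hs.2

theorem matMeasNorm_zero : matMeasNorm (0 : MatMeas Ω) = 0 := by
  simp [matMeasNorm, SignedMeasure.totalVariation_zero]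

theorem intervalIntegrable_of_timeMeasure {X : Type*} [NormedAddCommGroup X] {f : ℝ → X}
    (hf : Integrable f (timeMeasure T)) {t : ℝ} (ht : t ∈ Ioo 0 T) :
    IntervalIntegrable f volume 0 t := by
  rw [intervalIntegrable_iff_integrableOn_Ioc_of_le ht.1.le]
  exact hf.mono_measure (restrict_Ioc_le ht.2)

section

variable (hd : d = 2 ∨ d = 3) (hΩ : IsSmoothBoundedDomain Ω) (hT : 0 < T)
  {V g : ℝ → Fin d → L2 Ω} {D W : ℝ → Fin d → Fin d → L2 Ω} (hw : IsWeakState Ω T V D W)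
  (hV : IsRegularVelocity Ω T M V g D)
  (hW : ∀ᵐ s ∂timeMeasure T, ∀ i j, ∀ᵐ x ∂(volume.restrict Ω), |W s i j x| ≤ M)
  {u₀ : Fin d → L2 Ω} (hmom : MomentumWeakForm Ω T u₀ V W 0) {c : Fin d → L2 Ω}
  (hc : ∀ᵐ t ∂timeMeasure T, V t = c + ∫ s in (0 : ℝ)..t, g s)

include hd hΩ hT hw hV hW hmom hc in
-- For a time-independent field and zero corrector the cross inequality is an identity saying that a
-- primitive vanishes for almost every t; both conclusions follow from
-- `eq_zero_of_primitive_eq_zero`.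
theorem momentum_tested {v : Fin d → L2 Ω} {G : Fin d → Fin d → L2 Ω}
    (h : (v, G) ∈ testPairs Ω) : pairing v (c - u₀) = 0 ∧
      ∀ᵐ s ∂timeMeasure T, pairing v (g s) = strongMomentumFlux M (V s) (D s) (W s) G := by
  obtain ⟨B, hB⟩ := exists_isRegularVelocity_const T h
  have hB0 := gradBound_nonneg (d := d) hB.nonneg
  have hfi := hw.integrable_momentumFlux hB0 (memLp_const G)
  have hgi := (pairing v).integrable_comp hV.integrable_deriv
  have hR : Integrable (fun s => matMeasNorm ((0 : ℝ → MatMeas Ω) s)) (timeMeasure T) := by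
    simp [matMeasNorm_zero]
  obtain ⟨h1, h2⟩ := eq_zero_of_primitive_eq_zero hT (hgi.sub hfi) (c := pairing v (c - u₀)) (by
    filter_upwards [hc, ae_restrict_mem measurableSet_Ioo] with t hct ht
    have := hw.momentum_cross hd hΩ hT hB hR hmom (c := v) (by simp) ht
    simp only [Pi.zero_apply, matMeasNorm_zero, integral_zero, mul_zero, abs_nonpos_iff,
      intervalIntegral.integral_zero, add_zero, inner_zero_right, Finset.sum_const_zero,
      zero_add] at this
    rw [← pairing_apply, ← pairing_apply, hct, map_add,
      ← (pairing v).intervalIntegral_comp_comm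
        (intervalIntegrable_of_timeMeasure hV.integrable_deriv ht),
      ← intervalIntegral.integral_of_le ht.1.le] at this
    simp only [Pi.sub_apply]
    rw [intervalIntegral.integral_sub (intervalIntegrable_of_timeMeasure hgi ht)
      (intervalIntegrable_of_timeMeasure hfi ht), map_sub]
    linarith)
  refine ⟨h1, ?_⟩
  -- The bound on the constant field is stored for almost every time; since (0,T) has positive
  -- length there is a time at which to read it off.
  have hGb : ∀ i j, ∀ᵐ x ∂(volume.restrict Ω), |G i j x| ≤ gradBound d B := by
    by_contra hcon
    have := hB.bound_grad
    have hne : (timeMeasure T) ≠ 0 := by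
      rw [Ne, Measure.restrict_eq_zero, Real.volume_Ioo, ENNReal.ofReal_eq_zero]
      linarith
    have : NeZero (timeMeasure T) := ⟨hne⟩
    obtain ⟨_, hs⟩ := hB.bound_grad.exists
    exact hcon fun i j => (hs i j).mono fun x hx => hx.trans (le_gradBound hB.nonneg)
  filter_upwards [h2, hV.bound, hW] with s hs hVs hWs
  rw [Pi.sub_apply, sub_eq_zero] at hs
  rw [hs, momentumFlux_eq_strong hVs hWs hGb]

include hd hΩ hT hw hV hW hmom hc in
-- One null set of times has to serve all test fields, so the identity is first taken on a countable
-- dense family and then extended by continuity. Fields are paired with their gradients because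
-- density holds in the W^{1,2} topology. The velocity of a dissipative solution thereby becomes
-- admissible.
theorem ae_momentum_equation : ∀ᵐ s ∂timeMeasure T, ∀ v ∈ W12ZeroDiv Ω, ∀ G : Fin d → Fin d → L2 Ω,
    (∀ i j, HasWeakDeriv Ω j (v i) (G i j)) →
      ∑ i, inner ℝ (g s i) (v i) = strongMomentumFlux M (V s) (D s) (W s) G := by
  obtain ⟨S, hS, hSc, hSd⟩ :=
    (TopologicalSpace.IsSeparable.of_separableSpace (testPairs Ω)).exists_countable_dense_subset
  have hall : ∀ᵐ s ∂timeMeasure T, ∀ p ∈ S,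
      pairing p.1 (g s) = strongMomentumFlux M (V s) (D s) (W s) p.2 := by
    rw [ae_ball_iff hSc]
    exact fun p hp => (momentum_tested hd hΩ hT hw hV hW hmom hc (hS hp)).2
  filter_upwards [hall] with s hs v hv G hG
  obtain ⟨G', hG'⟩ := hv
  have hGG : G = G' := by
    funext i j
    exact (hG i j).unique hΩ.isOpen (hasZeroWeakDeriv_of_mem_closure hG' i j).hasWeakDeriv
  have hcl : (v, G) ∈ closure S := by
    rw [hGG]
    exact closure_minimal hSd isClosed_closure hG'
  have hcont : IsClosed {p : (Fin d → L2 Ω) × (Fin d → Fin d → L2 Ω) |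
      ∑ i, inner ℝ (g s i) (p.1 i) = strongMomentumFlux M (V s) (D s) (W s) p.2} := by
    refine isClosed_eq ?_ ((continuous_strongMomentumFlux hV.nonneg _ _ _).comp continuous_snd)
    exact continuous_finsetSum _ fun i _ => continuous_const.inner
      ((continuous_apply i).comp continuous_fst)
  refine closure_minimal (fun p hp => ?_) hcont hcl
  rw [mem_ofPred_eq, ← pairing_apply]
  exact hs p hp

theorem exists_testPair {v : Fin d → L2 Ω} {φ : Fin d → Eu d → ℝ} (hφ : IsSolenoidalTest Ω φ)
    (h : ∀ i, v i =ᵐ[volume.restrict Ω] φ i) :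
    ∃ G : Fin d → Fin d → L2 Ω, (v, G) ∈ testPairs Ω :=
  ⟨fun i j => ((hφ.1 i).partialDeriv j).memLp.toLp _, φ, hφ, h, fun i j =>
    ((hφ.1 i).partialDeriv j).memLp.coeFn_toLp⟩

theorem eq_of_inner_self {a b : Fin d → L2 Ω} (h1 : ∑ i, inner ℝ (a i - b i) (a i) = 0)
    (h2 : ∑ i, inner ℝ (a i - b i) (b i) = 0) : a = b := by
  have : ∑ i, ‖a i - b i‖ ^ 2 = 0 := by
    have e : ∀ i, ‖a i - b i‖ ^ 2 = inner ℝ (a i - b i) (a i) - inner ℝ (a i - b i) (b i) :=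
      fun i => by rw [← inner_sub_right, real_inner_self_eq_norm_sq]
    simp only [e, Finset.sum_sub_distrib, h1, h2, sub_zero]
  funext i
  have := (Finset.sum_eq_zero_iff_of_nonneg fun i _ => sq_nonneg ‖a i - b i‖).1 this i
    (Finset.mem_univ i)
  rw [sq_eq_zero_iff, norm_eq_zero, sub_eq_zero] at this
  exact this

include hd hΩ hT hw hV hW hmom hc in
-- c and u₀ both lie in `L2Div Ω`, and their difference is orthogonal to that space.
theorem velocity_initial (hu₀ : u₀ ∈ L2Div Ω) : c = u₀ := by
  have hc' : c ∈ L2Div Ω := initial_mem_of_ae hT hV.integrable_deriv hc isClosed_L2Div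
    (hV.mem.mono fun s hs => W12ZeroDiv.subset_L2Div hs)
  have key : ∀ v ∈ L2Div Ω, ∑ i, inner ℝ (c i - u₀ i) (v i) = 0 := by
    have hcont : IsClosed {v : Fin d → L2 Ω | ∑ i, inner ℝ (c i - u₀ i) (v i) = 0} :=
      isClosed_eq (continuous_finsetSum _ fun i _ => continuous_const.inner (continuous_apply i))
        continuous_const
    refine fun v hv => closure_minimal ?_ hcont hv
    rintro v ⟨φ, hφ, hv⟩
    obtain ⟨G, hG⟩ := exists_testPair hφ hv
    have := (momentum_tested hd hΩ hT hw hV hW hmom hc hG).1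
    rwa [pairing_apply] at this
  exact eq_of_inner_self (key c hc') (key u₀ hu₀)

end

end PointwiseMomentum

/-! ### The transport equation of the strong solution -/

section PointwiseTransport

set_option linter.unusedSectionVars false

variable {d : ℕ} {Ω : Set (Eu d)}

/-- Matrix fields that are smooth up to the boundary and divergence free. -/
def smoothFields (Ω : Set (Eu d)) : Set (Fin d → Fin d → L2 Ω) :=
  {Q | ∃ Ψ : Fin d → Fin d → Eu d → ℝ, (∀ i j, ContDiff ℝ ∞ (Ψ i j)) ∧
    (∀ x ∈ Ω, ∀ j, ∑ i, partialDeriv i (Ψ i j) x = 0) ∧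
    ∀ i j, Q i j =ᵐ[volume.restrict Ω] Ψ i j}

theorem exists_finite_bound {ι : Type*} [Fintype ι] (C : ι → ℝ) : ∃ B, 0 ≤ B ∧ ∀ i, C i ≤ B :=
  ⟨∑ i, |C i|, Finset.sum_nonneg fun _ _ => abs_nonneg _, fun i => (le_abs_self _).trans
    (Finset.single_le_sum (f := fun i => |C i|) (fun _ _ => abs_nonneg _) (Finset.mem_univ i))⟩

theorem hasWeakDeriv_of_contDiff {Q P : L2 Ω} {Ψ : Eu d → ℝ} (hΨ : ContDiff ℝ ∞ Ψ) {k : Fin d}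
    (hQ : Q =ᵐ[volume.restrict Ω] Ψ) (hP : P =ᵐ[volume.restrict Ω] partialDeriv k Ψ) :
    HasWeakDeriv Ω k Q P := by
  intro φ hφ
  rw [integral_congr_mul_ae hQ, integral_congr_mul_ae hP]
  have := integral_test_mul_partialDeriv hφ hΨ k
  simp only [mul_comm (Ψ _), mul_comm (partialDeriv k Ψ _)]
  linarith

theorem smoothFields_subset_HSpace : smoothFields Ω ⊆ HSpace Ω := by
  rintro Q ⟨Ψ, hΨ, hdiv, hQ⟩ φ hφ
  have e : ∀ i j, ∫ x in Ω, Q i j x * partialDeriv i (φ j) x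
      = -∫ x in Ω, φ j x * partialDeriv i (Ψ i j) x := by
    intro i j
    rw [integral_congr_mul_ae (hQ i j), integral_test_mul_partialDeriv (hφ j) (hΨ i j) i, neg_neg]
    simp only [mul_comm]
  have hint : ∀ i j, Integrable (fun x => φ j x * partialDeriv i (Ψ i j) x)
      (volume.restrict Ω) := fun i j =>
    (((hφ j).1.continuous.mul (contDiff_partialDeriv (hΨ i j) i).continuous).integrable_of_hasCompactSupport
      (hφ j).2.1.mul_right).mono_measure Measure.restrict_le_self
  simp only [e, Finset.sum_neg_distrib, neg_eq_zero]
  rw [Finset.sum_comm]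
  refine Finset.sum_eq_zero fun j _ => ?_
  rw [← integral_finsetSum _ fun i _ => hint i j]
  by_cases hm : AEStronglyMeasurable (fun x => ∑ i, φ j x * partialDeriv i (Ψ i j) x)
      (volume.restrict Ω)
  · refine setIntegral_eq_zero_of_forall_eq_zero fun x hx => ?_
    rw [← Finset.mul_sum, hdiv x hx j, mul_zero]
  · exact integral_non_aestronglyMeasurable hm

theorem exists_isRegularDeformation_const (hΩ : IsSmoothBoundedDomain Ω) (T : ℝ)
    {Q : Fin d → Fin d → L2 Ω} (h : Q ∈ smoothFields Ω) :
    ∃ B P, IsRegularDeformation Ω T B (fun _ => Q) (fun _ => 0) (fun _ => P) ∧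
      (∀ i j k, HasWeakDeriv Ω k (Q i j) (P i j k)) ∧
      (∀ i j, ∀ᵐ x ∂(volume.restrict Ω), |Q i j x| ≤ B) ∧
      ∀ i j k, ∀ᵐ x ∂(volume.restrict Ω), |P i j k x| ≤ B := by
  have := hΩ.isFiniteMeasure
  have hm := hΩ.isOpen.measurableSet
  have hH := smoothFields_subset_HSpace h
  obtain ⟨Ψ, hΨ, -, hQ⟩ := h
  have hb : ∀ φ : Eu d → ℝ, Continuous φ → ∃ C, ∀ᵐ x ∂(volume.restrict Ω), ‖φ x‖ ≤ C := by
    intro φ hφ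
    obtain ⟨C, hC⟩ := hΩ.isCompact_closure.exists_bound_of_continuousOn hφ.continuousOn
    refine ⟨C, ?_⟩
    filter_upwards [ae_restrict_mem hm] with x hx using hC x (subset_closure hx)
  have hc : ∀ i j k, Continuous (partialDeriv k (Ψ i j)) := fun i j k =>
    (contDiff_partialDeriv (hΨ i j) k).continuous
  choose C hC using fun i j => hb _ (hΨ i j).continuous
  choose C' hC' using fun i j k => hb _ (hc i j k)
  have hmem : ∀ i j k, MemLp (partialDeriv k (Ψ i j)) 2 (volume.restrict Ω) := fun i j k =>
    MemLp.of_bound (hc i j k).aestronglyMeasurable (C' i j k) (hC' i j k)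
  obtain ⟨B, hB0, hB⟩ := exists_finite_bound fun p : Fin d × Fin d => C p.1 p.2
  obtain ⟨B', hB0', hB'⟩ := exists_finite_bound fun p : Fin d × Fin d × Fin d =>
    C' p.1 p.2.1 p.2.2
  have h1 : ∀ i j k, HasWeakDeriv Ω k (Q i j) ((hmem i j k).toLp _) := fun i j k =>
    hasWeakDeriv_of_contDiff (hΨ i j) (hQ i j) (hmem i j k).coeFn_toLp
  have h2 : ∀ i j, ∀ᵐ x ∂(volume.restrict Ω), |Q i j x| ≤ max B B' := fun i j => by
    filter_upwards [hQ i j, hC i j] with x hx h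
    rw [hx]
    exact h.trans ((hB (i, j)).trans (le_max_left _ _))
  have h3 : ∀ i j k, ∀ᵐ x ∂(volume.restrict Ω), |(hmem i j k).toLp _ x| ≤ max B B' :=
      fun i j k => by
    filter_upwards [(hmem i j k).coeFn_toLp, hC' i j k] with x hx h
    rw [hx]
    exact h.trans ((hB' (i, j, k)).trans (le_max_right _ _))
  exact ⟨max B B', fun i j k => (hmem i j k).toLp _,
    ⟨le_max_of_le_left hB0, memLp_const _, memLp_const _, memLp_const _,
      hasWeakTimeDeriv_const T Q, Eventually.of_forall fun _ => hH, Eventually.of_forall fun _ => h1,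
      Eventually.of_forall fun _ => h2, Eventually.of_forall fun _ => h3⟩, h1, h2, h3⟩

/-- Expanding regularizations of the columns are smooth up to the boundary, solenoidal, and converge
in L². -/
theorem HSpace_subset_closure_smoothFields (hd : d = 2 ∨ d = 3) (hΩ : IsSmoothBoundedDomain Ω) :
    HSpace Ω ⊆ closure (smoothFields Ω) := by
  have := hΩ.isFiniteMeasure
  have hm := hΩ.isOpen.measurableSet
  intro Φ hΦ
  obtain ⟨A, hA, hAe⟩ := hΩ.exists_seq_expanding
  refine mem_closure_of_tendsto (f := fun n i j => (A n).regL hm i (IsRegularDeformation.col j Φ))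
    (b := atTop) ?_ (Eventually.of_forall fun n => ?_)
  · refine tendsto_pi_nhds.2 fun i => tendsto_pi_nhds.2 fun j => ?_
    exact Regularizer.tendsto_regL hA hm (tendsto_const_nhds (x := IsRegularDeformation.col j Φ)) i
  · refine ⟨fun i j => (A n).reg (IsRegularDeformation.col j Φ) i, fun i j =>
      (A n).contDiff_reg _ i, fun x hx j => (A n).div_reg hd ?_, fun i j => (A n).coeFn_regL hm i _⟩
    exact div_moll_of_HSpace _ hΦ (hAe n x (subset_closure hx)) j

variable [IsFiniteMeasure (volume.restrict Ω : Measure (Eu d))] {T M : ℝ}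

section

variable (hd : d = 2 ∨ d = 3) (hΩ : IsSmoothBoundedDomain Ω) (hT : 0 < T)
  {V : ℝ → Fin d → L2 Ω} {D W g : ℝ → Fin d → Fin d → L2 Ω}
  {DW : ℝ → Fin d → Fin d → Fin d → L2 Ω} (hw : IsWeakState Ω T V D W)
  (hV : ∀ᵐ s ∂timeMeasure T, V s ∈ L2Div Ω)
  (hW : IsRegularDeformation Ω T M W g DW)
  {F₀ : Fin d → Fin d → L2 Ω} (htr : TransportWeakForm Ω T F₀ V W) {c : Fin d → Fin d → L2 Ω}
  (hc : ∀ᵐ t ∂timeMeasure T, W t = c + ∫ s in (0 : ℝ)..t, g s)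

include hd hΩ hT hw hV hW htr hc in
theorem transport_tested {Q : Fin d → Fin d → L2 Ω} (h : Q ∈ smoothFields Ω) :
    matPairing Q (c - F₀) = 0 ∧
      ∀ᵐ s ∂timeMeasure T, matPairing Q (g s)
        = strongTransportFlux M (V s) (D s) (W s) (DW s) Q := by
  obtain ⟨B, P, hB, hQP, hQ, hP⟩ := exists_isRegularDeformation_const hΩ T h
  have hB0 := gradBound_nonneg (d := d) hB.nonneg
  have hfi := hw.integrable_transportFlux hB0 (memLp_const P) (memLp_const Q)
  have hgi := (matPairing Q).integrable_comp hW.integrable_deriv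
  obtain ⟨h1, h2⟩ := eq_zero_of_primitive_eq_zero hT (hgi.sub hfi) (c := matPairing Q (c - F₀)) (by
    filter_upwards [hc, ae_restrict_mem measurableSet_Ioo] with t hct ht
    have := hw.transport_cross hd hΩ hT hB htr (c := Q) (by simp) ht
    simp only [Pi.zero_apply,
      intervalIntegral.integral_zero, add_zero, inner_zero_right, Finset.sum_const_zero,
      integral_zero, zero_add] at this
    rw [← matPairing_apply, ← matPairing_apply, hct, map_add,
      ← (matPairing Q).intervalIntegral_comp_comm
        (intervalIntegrable_of_timeMeasure hW.integrable_deriv ht),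
      ← intervalIntegral.integral_of_le ht.1.le] at this
    simp only [Pi.sub_apply]
    rw [intervalIntegral.integral_sub (intervalIntegrable_of_timeMeasure hgi ht)
      (intervalIntegrable_of_timeMeasure hfi ht), map_sub]
    linarith)
  refine ⟨h1, ?_⟩
  have hle := le_gradBound (d := d) hB.nonneg
  filter_upwards [h2, hV, hW.grad, hW.bound, hW.bound_grad] with s hs hVs h1 h2 h3
  rw [Pi.sub_apply, sub_eq_zero] at hs
  rw [hs, transportFlux_eq_strong hΩ.isOpen hW.nonneg hVs h1 h2 h3 hQP
    (fun i j => (hQ i j).mono fun x hx => hx.trans hle)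
    (fun i j k => (hP i j k).mono fun x hx => hx.trans hle)]

include hd hΩ hT hw hV hW htr hc in
-- No derivative of Q occurs any more, so the deformation gradient of a dissipative solution can be
-- inserted at almost every time.
theorem ae_transport_equation : ∀ᵐ s ∂timeMeasure T, ∀ Q ∈ HSpace Ω,
      ∑ i, ∑ j, inner ℝ (g s i j) (Q i j) = strongTransportFlux M (V s) (D s) (W s) (DW s) Q := by
  obtain ⟨S, hS, hSc, hSd⟩ :=
    (TopologicalSpace.IsSeparable.of_separableSpace (smoothFields Ω)).exists_countable_dense_subset
  have hall : ∀ᵐ s ∂timeMeasure T, ∀ Q ∈ S,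
      matPairing Q (g s) = strongTransportFlux M (V s) (D s) (W s) (DW s) Q := by
    rw [ae_ball_iff hSc]
    exact fun p hp => (transport_tested hd hΩ hT hw hV hW htr hc (hS hp)).2
  filter_upwards [hall] with s hs Q hQ
  have hcl : Q ∈ closure S := closure_minimal hSd isClosed_closure
    (HSpace_subset_closure_smoothFields hd hΩ hQ)
  have hcont : IsClosed {Q : Fin d → Fin d → L2 Ω |
      ∑ i, ∑ j, inner ℝ (g s i j) (Q i j)
        = strongTransportFlux M (V s) (D s) (W s) (DW s) Q} := by
    refine isClosed_eq ?_ (continuous_strongTransportFlux hW.nonneg _ _ _ _)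
    exact continuous_finsetSum _ fun i _ => continuous_finsetSum _ fun j _ =>
      continuous_const.inner (continuous_apply_apply i j)
  refine closure_minimal (fun p hp => ?_) hcont hcl
  rw [mem_ofPred_eq, ← matPairing_apply]
  exact hs p hp

include hd hΩ hT hw hV hW htr hc in
theorem deformation_initial (hF₀ : F₀ ∈ HSpace Ω) : c = F₀ := by
  have hc' : c ∈ HSpace Ω := initial_mem_of_ae hT hW.integrable_deriv hc isClosed_HSpace hW.mem
  have key : ∀ Q ∈ HSpace Ω, ∑ i, ∑ j, inner ℝ (c i j - F₀ i j) (Q i j) = 0 := by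
    have hcont : IsClosed {Q : Fin d → Fin d → L2 Ω |
        ∑ i, ∑ j, inner ℝ (c i j - F₀ i j) (Q i j) = 0} :=
      isClosed_eq (continuous_finsetSum _ fun i _ => continuous_finsetSum _ fun j _ =>
        continuous_const.inner (continuous_apply_apply i j)) continuous_const
    refine fun Q hQ => closure_minimal (fun Q hQ => ?_) hcont
      (HSpace_subset_closure_smoothFields hd hΩ hQ)
    have := (transport_tested hd hΩ hT hw hV hW htr hc hQ).1
    rwa [matPairing_apply] at this
  have : ∑ i, ∑ j, ‖c i j - F₀ i j‖ ^ 2 = 0 := by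
    have e : ∀ i j, ‖c i j - F₀ i j‖ ^ 2
        = inner ℝ (c i j - F₀ i j) (c i j) - inner ℝ (c i j - F₀ i j) (F₀ i j) :=
      fun i j => by rw [← inner_sub_right, real_inner_self_eq_norm_sq]
    simp only [e, Finset.sum_sub_distrib, key c hc', key F₀ hF₀, sub_zero]
  funext i j
  have := (Finset.sum_eq_zero_iff_of_nonneg fun i _ => Finset.sum_nonneg fun j _ =>
    sq_nonneg ‖c i j - F₀ i j‖).1 this i (Finset.mem_univ i)
  have := (Finset.sum_eq_zero_iff_of_nonneg fun j _ => sq_nonneg ‖c i j - F₀ i j‖).1 this j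
    (Finset.mem_univ j)
  rwa [sq_eq_zero_iff, norm_eq_zero, sub_eq_zero] at this

end

end PointwiseTransport

/-! ### Relative energy: cancellations and estimate -/

section RelativeEnergy

set_option linter.unusedSectionVars false

variable {d : ℕ} {Ω : Set (Eu d)}

theorem tri_mono_bound {M B : ℝ} (hMB : M ≤ B) {a b q : L2 Ω}
    (hq : ∀ᵐ x ∂(volume.restrict Ω), |q x| ≤ M) : tri B a b q = tri M a b q := by
  rw [tri_eq_of_abs_le hq, tri_eq_of_abs_le (hq.mono fun x hx => hx.trans hMB)]

theorem momentumFlux_mono_bound {M B : ℝ} (hMB : M ≤ B) {u : Fin d → L2 Ω}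
    {Du F P : Fin d → Fin d → L2 Ω} (hP : ∀ i j, ∀ᵐ x ∂(volume.restrict Ω), |P i j x| ≤ M) :
    momentumFlux B u Du F P = momentumFlux M u Du F P := by
  simp only [momentumFlux, fun a b i j => tri_mono_bound (a := a) (b := b) hMB (hP i j)]

theorem transportFlux_mono_bound {M B : ℝ} (hMB : M ≤ B) {u : Fin d → L2 Ω}
    {Du F Q : Fin d → Fin d → L2 Ω} {P : Fin d → Fin d → Fin d → L2 Ω}
    (hP : ∀ i j k, ∀ᵐ x ∂(volume.restrict Ω), |P i j k x| ≤ M)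
    (hQ : ∀ i j, ∀ᵐ x ∂(volume.restrict Ω), |Q i j x| ≤ M) :
    transportFlux B u Du F P Q = transportFlux M u Du F P Q := by
  simp only [transportFlux, fun a b i j => tri_mono_bound (a := a) (b := b) hMB (hQ i j),
    fun a b i j k => tri_mono_bound (a := a) (b := b) hMB (hP i j k)]

theorem tri_sub_sub {M : ℝ} (hM : 0 ≤ M) (a a' b b' q : L2 Ω) :
    tri M (a - a') (b - b') q = tri M a b q - tri M a b' q - tri M a' b q + tri M a' b' q := by
  rw [tri_sub_left hM, tri_sub_mid hM, tri_sub_mid hM]; ring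

section

variable [IsFiniteMeasure (volume.restrict Ω : Measure (Eu d))] (hΩ : IsOpen Ω) {M : ℝ}
  (hM : 0 ≤ M) {u V : Fin d → L2 Ω} {Du F D W : Fin d → Fin d → L2 Ω}
  {DW : Fin d → Fin d → Fin d → L2 Ω}
  (hu : u ∈ L2Div Ω) (hV : V ∈ L2Div Ω)
  (hDu : ∀ i j, HasWeakDeriv Ω j (u i) (Du i j)) (hD : ∀ i j, HasWeakDeriv Ω j (V i) (D i j))
  (hDW : ∀ i j k, HasWeakDeriv Ω k (W i j) (DW i j k))
  (bV : ∀ i, ∀ᵐ x ∂(volume.restrict Ω), |V i x| ≤ M)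
  (bD : ∀ i j, ∀ᵐ x ∂(volume.restrict Ω), |D i j x| ≤ M)
  (bW : ∀ i j, ∀ᵐ x ∂(volume.restrict Ω), |W i j x| ≤ M)
  (bDW : ∀ i j k, ∀ᵐ x ∂(volume.restrict Ω), |DW i j k x| ≤ M)

include hΩ hM hu hV hDu hD bV bD in
-- Each of ∫ V·∇(Vᵢ uᵢ), ∫ V·∇(Vᵢ²) and ∫ u·∇(Vᵢ²) vanishes because V and u are solenoidal. The rest
-- is the expansion of the product on the right.
theorem convective_identity :
    (∑ i, ∑ j, tri M (D i j) (V i) (V j)) - (∑ i, ∑ j, tri M (Du i j) (V i) (V j))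
      - ∑ i, ∑ j, tri M (u i) (u j) (D i j)
    = -∑ i, ∑ j, tri M (u i - V i) (u j - V j) (D i j) := by
  simp only [← Finset.sum_sub_distrib, ← Finset.sum_neg_distrib]
  refine Finset.sum_congr rfl fun i _ => ?_
  have h1 := sum_tri_eq_zero_of_L2Div hΩ hV hM (hD i) (hDu i) (bV i) (bD i)
  have h2 := sum_tri_eq_zero_of_L2Div hΩ hV hM (hD i) (hD i) (bV i) (bD i)
  have h3 := sum_tri_eq_zero_of_L2Div hΩ hu hM (hD i) (hD i) (bV i) (bD i)
  have e1 : ∀ j, tri M (Du i j) (V i) (V j) = tri M (V j) (Du i j) (V i) := fun j => by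
    rw [tri_swap (bV i) (bV j), tri_comm]
  have e2 : ∀ j, tri M (D i j) (V i) (V j) = tri M (V i) (V j) (D i j) := fun j => by
    rw [tri_comm, tri_swap (bD i j) (bV j)]
  have e3 : ∀ (a : L2 Ω) j, tri M a (D i j) (V i) = tri M a (V i) (D i j) := fun a j =>
    tri_swap (bD i j) (bV i)
  have e4 : ∀ j, tri M (V j) (V i) (D i j) = tri M (V i) (V j) (D i j) := fun j =>
    tri_comm _ _ _ _
  have e5 : ∀ j, tri M (u j) (V i) (D i j) = tri M (V i) (u j) (D i j) := fun j =>
    tri_comm _ _ _ _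
  have e6 : ∀ j, tri M (V j) (u i) (D i j) = tri M (u i) (V j) (D i j) := fun j =>
    tri_comm _ _ _ _
  simp only [e3, e4, e5, e6, Finset.sum_add_distrib] at h1 h2 h3
  simp only [e1, e2, tri_sub_sub hM, Finset.sum_sub_distrib, Finset.sum_add_distrib,
    Finset.sum_neg_distrib]
  linarith

include hM bD bW in
-- There is no integration by parts here: after exchanging j and k in the last three sums on the
-- left, the identity holds for every triple of indices. Boundedness of W and D lets the truncation
-- sit on whichever factor is convenient.
theorem elastic_identity :
    -(∑ i, ∑ j, ∑ k, tri M (D i j) (W i k) (W j k))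
      + (∑ i, ∑ j, ∑ k, tri M (Du i j) (W i k) (W j k))
      + (∑ i, ∑ j, ∑ k, tri M (F i k) (F j k) (D i j))
      + (∑ i, ∑ j, ∑ k, tri M (W i j) (D i k) (W k j))
      - (∑ i, ∑ j, ∑ k, tri M (F i j) (D i k) (W k j))
      - (∑ i, ∑ j, ∑ k, tri M (Du i k) (F k j) (W i j))
    = (∑ i, ∑ j, ∑ k, tri M (F i k - W i k) (F j k - W j k) (D i j))
      - ∑ i, ∑ j, ∑ k, tri M (Du i j - D i j) (F j k - W j k) (W i k) := by
  have c1 : (∑ i, ∑ j, ∑ k, tri M (W i j) (D i k) (W k j))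
      = ∑ i, ∑ j, ∑ k, tri M (W i k) (D i j) (W j k) :=
    Finset.sum_congr rfl fun i _ => Finset.sum_comm
  have c2 : (∑ i, ∑ j, ∑ k, tri M (F i j) (D i k) (W k j))
      = ∑ i, ∑ j, ∑ k, tri M (F i k) (D i j) (W j k) :=
    Finset.sum_congr rfl fun i _ => Finset.sum_comm
  have c3 : (∑ i, ∑ j, ∑ k, tri M (Du i k) (F k j) (W i j))
      = ∑ i, ∑ j, ∑ k, tri M (Du i j) (F j k) (W i k) :=
    Finset.sum_congr rfl fun i _ => Finset.sum_comm
  rw [c1, c2, c3]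
  simp only [← Finset.sum_sub_distrib, ← Finset.sum_neg_distrib, ← Finset.sum_add_distrib]
  refine Finset.sum_congr rfl fun i _ => Finset.sum_congr rfl fun j _ =>
    Finset.sum_congr rfl fun k _ => ?_
  rw [tri_sub_sub hM, tri_sub_sub hM, tri_comm M (D i j) (W i k) (W j k),
    tri_swap (a := F i k) (bD i j) (bW j k), tri_swap (a := Du i j) (bW i k) (bW j k),
    tri_swap (a := W i k) (bD i j) (bW j k),
    tri_comm M (D i j) (F j k), tri_swap (a := F j k) (bD i j) (bW i k),
    tri_comm M (W i k) (F j k), tri_comm M (D i j) (W j k), tri_swap (a := W j k) (bD i j) (bW i k),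
    tri_comm M (W j k) (W i k)]
  ring

include hΩ hM hu hDW bW bDW in
-- The only cancellation is ∫ u·∇(Wᵢⱼ²) = 0.
theorem transport_identity :
    -(∑ i, ∑ j, ∑ k, tri M (W i j) (V k) (DW i j k))
      + (∑ i, ∑ j, ∑ k, tri M (F i j) (V k) (DW i j k))
      - (∑ k, ∑ i, ∑ j, tri M (u k) (F i j) (DW i j k))
    = -∑ i, ∑ j, ∑ k, tri M (u k - V k) (F i j - W i j) (DW i j k) := by
  have c1 : (∑ k, ∑ i, ∑ j, tri M (u k) (F i j) (DW i j k))
      = ∑ i, ∑ j, ∑ k, tri M (u k) (F i j) (DW i j k) := by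
    rw [Finset.sum_comm]
    exact Finset.sum_congr rfl fun i _ => Finset.sum_comm
  rw [c1]
  simp only [← Finset.sum_sub_distrib, ← Finset.sum_neg_distrib, ← Finset.sum_add_distrib]
  refine Finset.sum_congr rfl fun i _ => Finset.sum_congr rfl fun j _ => ?_
  have h1 := sum_tri_eq_zero_of_L2Div hΩ hu hM (hDW i j) (hDW i j) (bW i j) (bDW i j)
  have e1 : ∀ k, tri M (u k) (DW i j k) (W i j) = tri M (u k) (W i j) (DW i j k) := fun k =>
    tri_swap (bDW i j k) (bW i j)
  have e2 : ∀ (f : L2 Ω) k, tri M f (V k) (DW i j k) = tri M (V k) f (DW i j k) := fun f k =>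
    tri_comm _ _ _ _
  simp only [e1, Finset.sum_add_distrib] at h1
  simp only [e2, tri_sub_sub hM, Finset.sum_sub_distrib, Finset.sum_add_distrib,
    Finset.sum_neg_distrib]
  linarith

/-- The integrand of the relative energy inequality. -/
def relativeFlux (M : ℝ) (u V : Fin d → L2 Ω) (Du F D W : Fin d → Fin d → L2 Ω)
    (DW : Fin d → Fin d → Fin d → L2 Ω) : ℝ :=
  strongMomentumFlux M V D W D - strongMomentumFlux M V D W Du
    + strongTransportFlux M V D W DW W - strongTransportFlux M V D W DW F
    - momentumFlux M u Du F D - transportFlux M u Du F DW W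

include hΩ hM hu hV hDu hD hDW bV bD bW bDW in
-- Completing the square turns the viscous terms into minus the squared norm of ∇(u - V). In all
-- other terms two factors are differences and the third is bounded by M.
theorem relativeFlux_eq :
    relativeFlux M u V Du F D W DW - (∑ i, ∑ j, ‖Du i j‖ ^ 2)
    = -(∑ i, ∑ j, ‖Du i j - D i j‖ ^ 2) - (∑ i, ∑ j, tri M (u i - V i) (u j - V j) (D i j))
      + (∑ i, ∑ j, ∑ k, tri M (F i k - W i k) (F j k - W j k) (D i j))
      - (∑ i, ∑ j, ∑ k, tri M (Du i j - D i j) (F j k - W j k) (W i k))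
      - ∑ i, ∑ j, ∑ k, tri M (u k - V k) (F i j - W i j) (DW i j k) := by
  have h1 := convective_identity hΩ hM hu hV hDu hD bV bD
  have h2 := elastic_identity (Du := Du) (F := F) hM bD bW
  have h3 := transport_identity (V := V) (F := F) hΩ hM hu hDW bW bDW
  have h4 : (∑ i, ∑ j, ‖Du i j - D i j‖ ^ 2) = (∑ i, ∑ j, ‖Du i j‖ ^ 2)
      - (∑ i, ∑ j, inner ℝ (Du i j) (D i j)) - (∑ i, ∑ j, inner ℝ (D i j) (Du i j))
      + ∑ i, ∑ j, inner ℝ (D i j) (D i j) := by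
    simp only [← Finset.sum_sub_distrib, ← Finset.sum_add_distrib]
    refine Finset.sum_congr rfl fun i _ => Finset.sum_congr rfl fun j _ => ?_
    rw [norm_sub_sq_real, real_inner_self_eq_norm_sq, real_inner_comm (Du i j)]
    ring
  unfold relativeFlux strongMomentumFlux strongTransportFlux momentumFlux transportFlux
  simp only [Finset.sum_add_distrib]
  linarith

/-- The squared distance of two states. -/
def stateDist (u V : Fin d → L2 Ω) (F W : Fin d → Fin d → L2 Ω) : ℝ :=
  (∑ i, ‖u i - V i‖ ^ 2) + ∑ i, ∑ j, ‖F i j - W i j‖ ^ 2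

theorem stateDist_nonneg (u V : Fin d → L2 Ω) (F W : Fin d → Fin d → L2 Ω) :
    0 ≤ stateDist u V F W := by
  unfold stateDist; positivity

theorem le_sum_add_sum {a : Fin d → ℝ} {b : Fin d → Fin d → ℝ} (ha : ∀ i, 0 ≤ a i)
    (hb : ∀ i j, 0 ≤ b i j) : (∀ i, a i ≤ (∑ i, a i) + ∑ i, ∑ j, b i j) ∧
      ∀ i j, b i j ≤ (∑ i, a i) + ∑ i, ∑ j, b i j := by
  have p1 : 0 ≤ ∑ i, a i := Finset.sum_nonneg fun i _ => ha i
  have p2 : ∀ i, 0 ≤ ∑ j, b i j := fun i => Finset.sum_nonneg fun j _ => hb i j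
  have p3 : 0 ≤ ∑ i, ∑ j, b i j := Finset.sum_nonneg fun i _ => p2 i
  refine ⟨fun i => ?_, fun i j => ?_⟩
  · linarith [Finset.single_le_sum (fun i _ => ha i) (Finset.mem_univ i)]
  · linarith [Finset.single_le_sum (fun j _ => hb i j) (Finset.mem_univ j),
      Finset.single_le_sum (fun i _ => p2 i) (Finset.mem_univ i)]

theorem norm_sq_le_stateDist (u V : Fin d → L2 Ω) (F W : Fin d → Fin d → L2 Ω) :
    (∀ i, ‖u i - V i‖ ^ 2 ≤ stateDist u V F W) ∧
      ∀ i j, ‖F i j - W i j‖ ^ 2 ≤ stateDist u V F W :=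
  le_sum_add_sum (fun _ => sq_nonneg _) fun _ _ => sq_nonneg _

theorem abs_tri_le_of_sq {N : ℝ} (hM : 0 ≤ M) {a b : L2 Ω} (q : L2 Ω) (ha : ‖a‖ ^ 2 ≤ N)
    (hb : ‖b‖ ^ 2 ≤ N) : |tri M a b q| ≤ M * N := by
  refine (abs_tri_le hM a b q).trans (mul_le_mul_of_nonneg_left ?_ hM)
  nlinarith [sq_nonneg (‖a‖ - ‖b‖)]

/-- The constant in the relative energy inequality. -/
def relativeConst (d : ℕ) (M : ℝ) : ℝ :=
  d * (d * M) + d * (d * (d * M)) + d * (d * (d * (d * M ^ 2))) + d * (d * (d * M))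

theorem relativeConst_nonneg (hM : 0 ≤ M) : 0 ≤ relativeConst d M := by
  unfold relativeConst; positivity

include hΩ hM hu hV hDu hD hDW bV bD bW bDW in
-- Three of the terms are at once at most a multiple of the squared distance. The one containing ∇(u
-- - V) is split by Young's inequality and absorbed by the viscous term.
theorem relativeFlux_le :
    relativeFlux M u V Du F D W DW - (∑ i, ∑ j, ‖Du i j‖ ^ 2)
      ≤ relativeConst d M * stateDist u V F W := by
  rw [relativeFlux_eq hΩ hM hu hV hDu hD hDW bV bD bW bDW]
  obtain ⟨hw, hH⟩ := norm_sq_le_stateDist u V F W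
  set N := stateDist u V F W
  have b1 : -(∑ i, ∑ j, tri M (u i - V i) (u j - V j) (D i j)) ≤ d * (d * (M * N)) := by
    rw [← Finset.sum_neg_distrib]
    simp only [← Finset.sum_neg_distrib]
    calc _ ≤ ∑ _i : Fin d, ∑ _j : Fin d, M * N := Finset.sum_le_sum fun i _ =>
          Finset.sum_le_sum fun j _ =>
            (neg_le_abs _).trans (abs_tri_le_of_sq hM _ (hw i) (hw j))
      _ = _ := by simp
  have b2 : (∑ i, ∑ j, ∑ k, tri M (F i k - W i k) (F j k - W j k) (D i j))
      ≤ d * (d * (d * (M * N))) := by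
    calc _ ≤ ∑ _i : Fin d, ∑ _j : Fin d, ∑ _k : Fin d, M * N := Finset.sum_le_sum fun i _ =>
          Finset.sum_le_sum fun j _ => Finset.sum_le_sum fun k _ =>
            (le_abs_self _).trans (abs_tri_le_of_sq hM _ (hH i k) (hH j k))
      _ = _ := by simp
  have b4 : -(∑ i, ∑ j, ∑ k, tri M (u k - V k) (F i j - W i j) (DW i j k))
      ≤ d * (d * (d * (M * N))) := by
    simp only [← Finset.sum_neg_distrib]
    calc _ ≤ ∑ _i : Fin d, ∑ _j : Fin d, ∑ _k : Fin d, M * N := Finset.sum_le_sum fun i _ =>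
          Finset.sum_le_sum fun j _ => Finset.sum_le_sum fun k _ =>
            (neg_le_abs _).trans (abs_tri_le_of_sq hM _ (hw k) (hH i j))
      _ = _ := by simp
  have b3 : -(∑ i, ∑ j, ∑ k, tri M (Du i j - D i j) (F j k - W j k) (W i k))
      ≤ (∑ i, ∑ j, ‖Du i j - D i j‖ ^ 2) + d * (d * (d * (d * M ^ 2 * N))) := by
    simp only [← Finset.sum_neg_distrib]
    calc _ ≤ ∑ i : Fin d, ∑ j : Fin d, ∑ _k : Fin d,
          (‖Du i j - D i j‖ ^ 2 / d + d * M ^ 2 * N) := Finset.sum_le_sum fun i _ =>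
          Finset.sum_le_sum fun j _ => Finset.sum_le_sum fun k _ => by
            have hd0 : (0 : ℝ) < d := by
              have : 0 < d := i.pos
              exact_mod_cast this
            refine (neg_le_abs _).trans ((abs_tri_le hM _ _ _).trans ?_)
            have h1 := hH j k
            set x := ‖Du i j - D i j‖
            set y := ‖F j k - W j k‖
            have h2 : d * M ^ 2 * y ^ 2 ≤ d * M ^ 2 * N := by gcongr
            -- The weight 1/d is chosen because each pair (i, j) occurs d times in the sum over k;
            -- the squares then add up to exactly the available dissipation.
            have h3 : M * (x * y) ≤ x ^ 2 / d + d * M ^ 2 * y ^ 2 := by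
              have h5 : d * (x ^ 2 / d) = x ^ 2 := by field_simp
              have h6 : d * (M * (x * y)) ≤ d * (x ^ 2 / d + d * M ^ 2 * y ^ 2) := by
                rw [mul_add, h5]
                nlinarith [sq_nonneg (x - d * M * y), sq_nonneg x, sq_nonneg (d * M * y)]
              exact le_of_mul_le_mul_left h6 hd0
            linarith
      _ = _ := by
          rw [← sub_eq_iff_eq_add']
          simp only [← Finset.sum_sub_distrib]
          simp only [Finset.sum_const, Finset.card_univ, Fintype.card_fin, nsmul_eq_mul]
          have : ∀ i j : Fin d, (d : ℝ) * (‖Du i j - D i j‖ ^ 2 / d + d * M ^ 2 * N)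
              - ‖Du i j - D i j‖ ^ 2 = d * (d * M ^ 2 * N) := fun i j => by
            have : (d : ℝ) ≠ 0 := by
              have : d ≠ 0 := i.pos.ne'
              exact_mod_cast this
            field_simp
            ring
          simp only [this]
          simp
  have e : relativeConst d M * N = d * (d * (M * N)) + d * (d * (d * (M * N)))
      + d * (d * (d * (d * M ^ 2 * N))) + d * (d * (d * (M * N))) := by
    unfold relativeConst; ring
  rw [e]
  linarith

end

end RelativeEnergy

/-! ### Gronwall's inequality and the relative energy inequality -/

section Uniqueness

set_option linter.unusedSectionVars false

/-- The integral form of Gronwall's inequality with zero initial value. -/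
theorem ae_eq_zero_of_le_integral {T K : ℝ} (hK : 0 ≤ K) {y : ℝ → ℝ}
    (hy : Integrable y (timeMeasure T)) (hy0 : ∀ᵐ t ∂timeMeasure T, 0 ≤ y t)
    (hle : ∀ᵐ t ∂timeMeasure T, y t ≤ K * ∫ s in Ioc 0 t, y s) :
    ∀ᵐ t ∂timeMeasure T, y t = 0 := by
  set y' := (Ioo 0 T).indicator y with hy'
  have hi : Integrable y' := (integrable_indicator_iff measurableSet_Ioo).2 hy
  have h0 : ∀ᵐ t, 0 ≤ y' t := by
    have := (ae_restrict_iff' measurableSet_Ioo).1 hy0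
    filter_upwards [this] with t ht
    by_cases hm : t ∈ Ioo 0 T
    · rw [hy', indicator_of_mem hm]; exact ht hm
    · rw [hy', indicator_of_notMem hm]
  set Y : ℝ → ℝ := fun t => ∫ s in (0 : ℝ)..t, y' s with hY
  have hYc : Continuous Y :=
    intervalIntegral.continuous_primitive (fun a b => hi.intervalIntegrable) 0
  have hYnn : ∀ t, 0 ≤ t → 0 ≤ Y t := fun t ht =>
    intervalIntegral.integral_nonneg_of_ae_restrict ht (ae_restrict_of_ae h0)
  have hle' : ∀ᵐ t, y' t ≤ K * Y t ∨ t < 0 := by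
    have := (ae_restrict_iff' measurableSet_Ioo).1 hle
    filter_upwards [this] with t ht
    by_cases hm : t ∈ Ioo 0 T
    · left
      rw [hy', indicator_of_mem hm]
      refine (ht hm).trans (le_of_eq ?_)
      congr 1
      rw [hY]
      simp only
      rw [intervalIntegral.integral_of_le hm.1.le]
      refine setIntegral_congr_fun measurableSet_Ioc fun s hs => ?_
      rw [hy', indicator_of_mem]
      exact ⟨hs.1, hs.2.trans_lt hm.2⟩
    · rcases lt_or_ge t 0 with h | h
      · exact Or.inr h
      · left
        rw [hy', indicator_of_notMem hm]
        exact mul_nonneg hK (hYnn t h)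
  -- y is merely integrable, so the differential form of Gronwall's inequality is applied to the
  -- second primitive Z, which is C¹ with Z' = Y ≤ K Z.
  set Z : ℝ → ℝ := fun t => ∫ s in (0 : ℝ)..t, Y s with hZ
  have hZd : ∀ t, HasDerivAt Z (Y t) t := fun t =>
    intervalIntegral.integral_hasDerivAt_right (hYc.intervalIntegrable _ _)
      (hYc.stronglyMeasurableAtFilter _ _) hYc.continuousAt
  have hYZ : ∀ t, 0 ≤ t → Y t ≤ K * Z t := by
    intro t ht
    rw [hY, hZ]
    simp only
    rw [← intervalIntegral.integral_const_mul]
    refine intervalIntegral.integral_mono_ae_restrict ht hi.intervalIntegrable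
      ((hYc.const_mul K).intervalIntegrable _ _) ?_
    filter_upwards [ae_restrict_of_ae hle', ae_restrict_mem measurableSet_Icc] with s hs hm
    exact hs.resolve_right (not_lt.2 hm.1)
  have hZnn : ∀ t, 0 ≤ t → 0 ≤ Z t := fun t ht =>
    intervalIntegral.integral_nonneg ht fun s hs => hYnn s hs.1
  have hZ0 : ∀ t ∈ Icc 0 T, Z t = 0 := by
    intro t ht
    have := norm_le_gronwallBound_of_norm_deriv_right_le (f := Z) (f' := Y) (δ := 0) (K := K)
      (ε := 0) (a := 0) (b := T) (fun t _ => (hZd t).continuousAt.continuousWithinAt)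
      (fun t _ => (hZd t).hasDerivWithinAt) (by simp [hZ]) (fun t ht => by
        rw [Real.norm_of_nonneg (hYnn t ht.1), Real.norm_of_nonneg (hZnn t ht.1), add_zero]
        exact hYZ t ht.1) t ht
    rw [gronwallBound_ε0, zero_mul] at this
    exact norm_le_zero_iff.1 this
  filter_upwards [ae_restrict_of_ae hle', hy0, ae_restrict_mem measurableSet_Ioo] with t h1 h2 hm
  have h3 := hYZ t hm.1.le
  rw [hZ0 t ⟨hm.1.le, hm.2.le⟩, mul_zero] at h3
  have h4 := h1.resolve_right (not_lt.2 hm.1.le)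
  rw [hy', indicator_of_mem hm] at h4
  have : K * Y t ≤ 0 := mul_nonpos_of_nonneg_of_nonpos hK h3
  linarith

variable {d : ℕ} {Ω : Set (Eu d)}

theorem integral_balance {α : Type*} [MeasurableSpace α] {ν : Measure α}
    {a a' b b' m m' q q' e : α → ℝ} (ha : Integrable a ν) (ha' : Integrable a' ν)
    (hb : Integrable b ν) (hb' : Integrable b' ν) (hm : Integrable m ν) (hm' : Integrable m' ν)
    (hq : Integrable q ν) (hq' : Integrable q' ν) (he : Integrable e ν) :
    ∫ x, ((1 / 2 : ℝ) * (a' x + m' x) + (1 / 2 : ℝ) * (b' x + q' x) - (a x + m x) - (b x + q x)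
      - e x) ∂ν
    = (1 / 2 : ℝ) * ((∫ x, a' x ∂ν) + ∫ x, m' x ∂ν) + (1 / 2 : ℝ) * ((∫ x, b' x ∂ν) + ∫ x, q' x ∂ν)
      - ((∫ x, a x ∂ν) + ∫ x, m x ∂ν) - ((∫ x, b x ∂ν) + ∫ x, q x ∂ν) - ∫ x, e x ∂ν := by
  have h1 : Integrable (fun x => (1 / 2 : ℝ) * (a' x + m' x)) ν := (ha'.add hm').const_mul _
  have h2 : Integrable (fun x => (1 / 2 : ℝ) * (b' x + q' x)) ν := (hb'.add hq').const_mul _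
  have h3 : Integrable (fun x => a x + m x) ν := ha.add hm
  have h4 : Integrable (fun x => b x + q x) ν := hb.add hq
  have h5 : Integrable (fun x => (1 / 2 : ℝ) * (a' x + m' x) + (1 / 2 : ℝ) * (b' x + q' x)) ν :=
    h1.add h2
  have h6 : Integrable (fun x => (1 / 2 : ℝ) * (a' x + m' x) + (1 / 2 : ℝ) * (b' x + q' x)
      - (a x + m x)) ν := h5.sub h3
  have h7 : Integrable (fun x => (1 / 2 : ℝ) * (a' x + m' x) + (1 / 2 : ℝ) * (b' x + q' x)
      - (a x + m x) - (b x + q x)) ν := h6.sub h4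
  rw [integral_sub h7 he, integral_sub h6 h4, integral_sub h5 h3, integral_add h1 h2, integral_const_mul, integral_const_mul,
    integral_add ha' hm', integral_add hb' hq', integral_add ha hm, integral_add hb hq]

theorem integrable_inner_of_memLp {T : ℝ} {f g : ℝ → L2 Ω} (hf : MemLp f ⊤ (timeMeasure T))
    (hg : Integrable g (timeMeasure T)) :
    Integrable (fun s => (inner ℝ (f s) (g s) : ℝ)) (timeMeasure T) := by
  obtain ⟨K, hK0, hK⟩ := exists_ae_norm_le hf
  refine Integrable.mono' (hg.norm.const_mul K) (hf.1.inner hg.1) ?_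
  filter_upwards [hK] with s hs
  exact (abs_real_inner_le_norm _ _).trans (by gcongr)

theorem integrable_norm_sub_sq {T : ℝ} {f g : ℝ → L2 Ω} (hf : MemLp f ⊤ (timeMeasure T))
    (hg : MemLp g ⊤ (timeMeasure T)) :
    Integrable (fun s => ‖f s - g s‖ ^ 2) (timeMeasure T) := by
  have := ((hf.sub hg).mono_exponent (p := 2) le_top).integrable_norm_pow (by norm_num)
  simpa using this

variable [IsFiniteMeasure (volume.restrict Ω : Measure (Eu d))] {T M : ℝ}

section

variable (hd : d = 2 ∨ d = 3) (hΩ : IsSmoothBoundedDomain Ω) (hT : 0 < T)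
  {u : ℝ → Fin d → L2 Ω} {Du F : ℝ → Fin d → Fin d → L2 Ω} (hw : IsWeakState Ω T u Du F)
  (hu : ∀ᵐ s ∂timeMeasure T, u s ∈ W12ZeroDiv Ω) (hF : ∀ᵐ s ∂timeMeasure T, F s ∈ HSpace Ω)
  {V g : ℝ → Fin d → L2 Ω} {D : ℝ → Fin d → Fin d → L2 Ω}
  (hV : IsRegularVelocity Ω T M V g D)
  {W G : ℝ → Fin d → Fin d → L2 Ω} {DW : ℝ → Fin d → Fin d → Fin d → L2 Ω}
  (hW : IsRegularDeformation Ω T M W G DW)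
  {u₀ : Fin d → L2 Ω} {F₀ : Fin d → Fin d → L2 Ω} (hu₀ : u₀ ∈ L2Div Ω) (hF₀ : F₀ ∈ HSpace Ω)
  (hmomV : MomentumWeakForm Ω T u₀ V W 0) (htrW : TransportWeakForm Ω T F₀ V W)
  {R : ℝ → MatMeas Ω} (hR : Integrable (fun s => matMeasNorm (R s)) (timeMeasure T))
  (hmom : MomentumWeakForm Ω T u₀ u F R) (htr : TransportWeakForm Ω T F₀ u F)
  {𝒟 : ℝ → ℝ}
  (henergy : ∀ᵐ t ∂timeMeasure T,
    (1 / 2 : ℝ) * ((∑ i, ‖u t i‖ ^ 2) + ∑ i, ∑ j, ‖F t i j‖ ^ 2)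
        + (∫ s in Ioc 0 t, ∑ i, ∑ j, ‖Du s i j‖ ^ 2) + 𝒟 t
      ≤ (1 / 2 : ℝ) * ((∑ i, ‖u₀ i‖ ^ 2) + ∑ i, ∑ j, ‖F₀ i j‖ ^ 2))

include hV hW in
theorem isWeakState_of_regular : IsWeakState Ω T V D W where
  u_memLp := hV.memLp
  F_memLp := hW.memLp
  Du_memLp := hV.memLp_grad.mono_exponent le_top
  grad := hV.grad.mono fun _ hs i j => (hs i j).hasWeakDeriv

theorem stateDist_eq (u V : Fin d → L2 Ω) (F W : Fin d → Fin d → L2 Ω) :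
    stateDist u V F W = ((∑ i, ‖u i‖ ^ 2) + ∑ i, ∑ j, ‖F i j‖ ^ 2)
      + ((∑ i, inner ℝ (V i) (V i)) + ∑ i, ∑ j, inner ℝ (W i j) (W i j))
      - 2 * ((∑ i, inner ℝ (u i) (V i)) + ∑ i, ∑ j, inner ℝ (F i j) (W i j)) := by
  simp only [stateDist, norm_sub_sq_real, Finset.sum_add_distrib, Finset.sum_sub_distrib,
    real_inner_self_eq_norm_sq, ← Finset.mul_sum]
  ring

include hw hV hW in
theorem integrable_stateDist :
    Integrable (fun s => stateDist (u s) (V s) (F s) (W s)) (timeMeasure T) := by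
  unfold stateDist
  exact (integrable_finsetSum _ fun i _ => integrable_norm_sub_sq (hw.u_memLp.eval i)
    (hV.memLp.eval i)).add (integrable_finsetSum _ fun i _ => integrable_finsetSum _ fun j _ =>
      integrable_norm_sub_sq ((hw.F_memLp.eval i).eval j) ((hW.memLp.eval i).eval j))

include hd hΩ hT hw hu hF hV hW hu₀ hF₀ hmomV htrW hR hmom htr henergy in
-- By polarization, half the squared distance is half of each energy minus the cross products. The
-- first energy is bounded by the energy inequality, the second is known from the strong equations
-- tested with themselves, and the cross products come from the weak equations tested with (V, W).
-- The time integrand that remains is `relativeFlux` minus the dissipation.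
theorem relative_energy_inequality : ∀ᵐ t ∂timeMeasure T,
    (1 / 2 : ℝ) * stateDist (u t) (V t) (F t) (W t) + 𝒟 t
      ≤ relativeConst d M * (∫ s in Ioc 0 t, stateDist (u s) (V s) (F s) (W s))
        + gradBound d M * ∫ s in Ioc 0 t, matMeasNorm (R s) := by
  have hwV := isWeakState_of_regular hV hW
  set B := gradBound d M with hB
  have hB0 : 0 ≤ B := gradBound_nonneg hV.nonneg
  have hMB : M ≤ B := le_gradBound hV.nonneg
  obtain ⟨c, hc⟩ : ∃ c, ∀ᵐ t ∂timeMeasure T, V t = c + ∫ s in (0 : ℝ)..t, g s := by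
    have h2 := hV.memLp.mono_exponent (p := 2) le_top
    obtain ⟨ns, hns, hae⟩ := exists_subseq_tendsto_timeMoll h2
    obtain ⟨c, -, hc⟩ := hV.hasWeakTimeDeriv.exists_primitive hT h2 hV.memLp_deriv hns hae
    exact ⟨c, hc⟩
  obtain ⟨c', hc'⟩ : ∃ c', ∀ᵐ t ∂timeMeasure T, W t = c' + ∫ s in (0 : ℝ)..t, G s := by
    have h2 := hW.memLp.mono_exponent (p := 2) le_top
    obtain ⟨ns, hns, hae⟩ := exists_subseq_tendsto_timeMoll h2
    obtain ⟨c, -, hc⟩ := hW.hasWeakTimeDeriv.exists_primitive hT h2 hW.memLp_deriv hns hae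
    exact ⟨c, hc⟩
  have hVdiv : ∀ᵐ s ∂timeMeasure T, V s ∈ L2Div Ω :=
    hV.mem.mono fun s hs => W12ZeroDiv.subset_L2Div hs
  -- Equal initial data make all terms at time 0 cancel.
  have hcu := velocity_initial hd hΩ hT hwV hV hW.bound hmomV hc hu₀
  have hcF := deformation_initial hd hΩ hT hwV hVdiv hW htrW hc' hF₀
  subst hcu hcF
  have eqV := ae_momentum_equation hd hΩ hT hwV hV hW.bound hmomV hc
  have eqW := ae_transport_equation hd hΩ hT hwV hVdiv hW htrW hc'
  have hR0 : Integrable (fun s => matMeasNorm ((0 : ℝ → MatMeas Ω) s)) (timeMeasure T) := by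
    simp [matMeasNorm_zero]
  have iA : Integrable (fun s => ∑ i, (inner ℝ (u s i) (g s i) : ℝ)) (timeMeasure T) :=
    integrable_finsetSum _ fun i _ => integrable_inner_of_memLp (hw.u_memLp.eval i)
      (hV.integrable_deriv.eval i)
  have iA' : Integrable (fun s => ∑ i, (inner ℝ (V s i) (g s i) : ℝ)) (timeMeasure T) :=
    integrable_finsetSum _ fun i _ => integrable_inner_of_memLp (hV.memLp.eval i)
      (hV.integrable_deriv.eval i)
  have iB : Integrable (fun s => ∑ i, ∑ j, (inner ℝ (F s i j) (G s i j) : ℝ)) (timeMeasure T) :=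
    integrable_finsetSum _ fun i _ => integrable_finsetSum _ fun j _ =>
      integrable_inner_of_memLp ((hw.F_memLp.eval i).eval j) ((hW.integrable_deriv.eval i).eval j)
  have iB' : Integrable (fun s => ∑ i, ∑ j, (inner ℝ (W s i j) (G s i j) : ℝ)) (timeMeasure T) :=
    integrable_finsetSum _ fun i _ => integrable_finsetSum _ fun j _ =>
      integrable_inner_of_memLp ((hW.memLp.eval i).eval j) ((hW.integrable_deriv.eval i).eval j)
  have im := hw.integrable_momentumFlux hB0 hV.memLp_grad
  have im' := hwV.integrable_momentumFlux hB0 hV.memLp_grad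
  have it := hw.integrable_transportFlux hB0 hW.memLp_grad hW.memLp
  have it' := hwV.integrable_transportFlux hB0 hW.memLp_grad hW.memLp
  have iE : Integrable (fun s => ∑ i, ∑ j, ‖Du s i j‖ ^ 2) (timeMeasure T) :=
    integrable_finsetSum _ fun i _ => integrable_finsetSum _ fun j _ => by
      simpa using ((hw.Du_memLp.eval i).eval j).integrable_norm_pow (by norm_num)
  have iN := integrable_stateDist hw hV hW
  -- The terms with time derivatives are replaced using the strong equations, tested both with (V,
  -- W) and with (u, F).
  have hpt : ∀ᵐ s ∂timeMeasure T,
      (1 / 2 : ℝ) * ((∑ i, inner ℝ (V s i) (g s i)) + momentumFlux B (V s) (D s) (W s) (D s))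
        + (1 / 2 : ℝ) * ((∑ i, ∑ j, inner ℝ (W s i j) (G s i j))
          + transportFlux B (V s) (D s) (W s) (DW s) (W s))
        - ((∑ i, inner ℝ (u s i) (g s i)) + momentumFlux B (u s) (Du s) (F s) (D s))
        - ((∑ i, ∑ j, inner ℝ (F s i j) (G s i j))
          + transportFlux B (u s) (Du s) (F s) (DW s) (W s))
        - (∑ i, ∑ j, ‖Du s i j‖ ^ 2)
      ≤ relativeConst d M * stateDist (u s) (V s) (F s) (W s) := by
    filter_upwards [eqV, eqW, hu, hF, hw.grad, hV.mem, hV.grad, hV.bound, hV.bound_grad, hW.mem,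
      hW.grad, hW.bound, hW.bound_grad] with s h1 h2 hus hFs hgu hVm hVg hVb hVgb hWm hWg hWb hWgb
    have hVg' : ∀ i j, HasWeakDeriv Ω j (V s i) (D s i j) := fun i j => (hVg i j).hasWeakDeriv
    have := relativeFlux_le (F := F s) hΩ.isOpen hV.nonneg (W12ZeroDiv.subset_L2Div hus)
      (W12ZeroDiv.subset_L2Div hVm) hgu hVg' hWg hVb hVgb hWb hWgb
    have e1 := h1 _ hVm _ hVg'
    have e2 := h1 _ hus _ hgu
    have e3 := h2 _ hWm
    have e4 := h2 _ hFs
    have e5 : momentumFlux B (V s) (D s) (W s) (D s) = strongMomentumFlux M (V s) (D s) (W s) (D s) :=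
      momentumFlux_eq_strong hVb hWb fun i j => (hVgb i j).mono fun x hx => hx.trans hMB
    have e6 : transportFlux B (V s) (D s) (W s) (DW s) (W s)
        = strongTransportFlux M (V s) (D s) (W s) (DW s) (W s) :=
      transportFlux_eq_strong hΩ.isOpen hV.nonneg (W12ZeroDiv.subset_L2Div hVm) hWg hWb hWgb hWg
        (fun i j => (hWb i j).mono fun x hx => hx.trans hMB)
        (fun i j k => (hWgb i j k).mono fun x hx => hx.trans hMB)
    rw [e5, e6, momentumFlux_mono_bound hMB hVgb, transportFlux_mono_bound hMB hWgb hWb]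
    simp only [fun i => real_inner_comm (g s i) (V s i), fun i => real_inner_comm (g s i) (u s i),
      fun i j => real_inner_comm (G s i j) (W s i j),
      fun i j => real_inner_comm (G s i j) (F s i j)]
    rw [e1, e2, e3, e4]
    unfold relativeFlux at this
    linarith
  filter_upwards [henergy, hc, hc', ae_restrict_mem measurableSet_Ioo] with t hen hct hct' ht
  have hle : (volume : Measure ℝ).restrict (Ioc 0 t) ≤ timeMeasure T := restrict_Ioc_le ht.2
  -- The product of u and V enters with a minus sign, so only the lower bound is needed.
  have m1 := (abs_le.1 (hw.momentum_cross hd hΩ hT hV hR hmom hc ht)).1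
  have m2 := hwV.momentum_cross hd hΩ hT hV hR0 hmomV hc ht
  have t1 := hw.transport_cross hd hΩ hT hW htr hc' ht
  have t2 := hwV.transport_cross hd hΩ hT hW htrW hc' ht
  simp only [Pi.zero_apply, matMeasNorm_zero, integral_zero, mul_zero, abs_nonpos_iff] at m2
  rw [← hct] at m1 m2
  rw [← hct'] at t1 t2
  have s1 : ∀ {f : ℝ → Fin d → L2 Ω}, MemLp f ⊤ (timeMeasure T) →
      (∑ i, ∫ s in Ioc 0 t, (inner ℝ (f s i) (g s i) : ℝ))
        = ∫ s in Ioc 0 t, ∑ i, (inner ℝ (f s i) (g s i) : ℝ) := fun hf =>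
    (integral_finsetSum _ fun i _ => (integrable_inner_of_memLp (hf.eval i)
      (hV.integrable_deriv.eval i)).mono_measure hle).symm
  have s2 : ∀ {f : ℝ → Fin d → Fin d → L2 Ω}, MemLp f ⊤ (timeMeasure T) →
      (∑ i, ∑ j, ∫ s in Ioc 0 t, (inner ℝ (f s i j) (G s i j) : ℝ))
        = ∫ s in Ioc 0 t, ∑ i, ∑ j, (inner ℝ (f s i j) (G s i j) : ℝ) := by
    intro f hf
    have hi : ∀ i j, Integrable (fun s => (inner ℝ (f s i j) (G s i j) : ℝ))
        ((volume : Measure ℝ).restrict (Ioc 0 t)) := fun i j =>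
      (integrable_inner_of_memLp ((hf.eval i).eval j)
        ((hW.integrable_deriv.eval i).eval j)).mono_measure hle
    rw [integral_finsetSum _ fun i _ => integrable_finsetSum _ fun j _ => hi i j]
    exact Finset.sum_congr rfl fun i _ => (integral_finsetSum _ fun j _ => hi i j).symm
  rw [s1 hw.u_memLp] at m1
  rw [s1 hV.memLp] at m2
  rw [s2 hw.F_memLp] at t1
  rw [s2 hW.memLp] at t2
  have hint := integral_mono_ae
    ((((((iA'.add im').const_mul (1 / 2 : ℝ)).add ((iB'.add it').const_mul (1 / 2 : ℝ))).sub
      (iA.add im)).sub (iB.add it)).sub iE |>.mono_measure hle)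
    ((iN.const_mul (relativeConst d M)).mono_measure hle) (ae_mono hle hpt)
  have jA := iA.mono_measure hle
  have jA' := iA'.mono_measure hle
  have jB := iB.mono_measure hle
  have jB' := iB'.mono_measure hle
  have jm := im.mono_measure hle
  have jm' := im'.mono_measure hle
  have jt := it.mono_measure hle
  have jt' := it'.mono_measure hle
  have jE := iE.mono_measure hle
  simp only [Pi.add_apply, Pi.sub_apply] at hint
  rw [integral_balance jA jA' jB jB' jm jm' jt jt' jE, integral_const_mul] at hint
  rw [stateDist_eq]
  simp only [real_inner_self_eq_norm_sq] at m1 m2 t1 t2 ⊢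
  linarith

end

end Uniqueness

/-! ### Application to dissipative and strong solutions -/

section Solutions

variable {d : ℕ} {Ω : Set (Eu d)} {T : ℝ}

theorem MemBochnerSobolev.memLp {p : ENNReal} {k : ℕ} {f : ℝ → L2 Ω}
    (h : MemBochnerSobolev Ω T p k f) : MemLp f p (timeMeasure T) := by
  cases k with
  | zero => exact h
  | succ k => exact h.1

theorem MemBochnerSobolev.of_succ {p : ENNReal} {k : ℕ} {f : ℝ → L2 Ω}
    (h : MemBochnerSobolev Ω T p (k + 1) f) : MemBochnerSobolev Ω T p k f := by
  induction k generalizing f with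
  | zero => exact h.1
  | succ k ih =>
    obtain ⟨hf, g, hg⟩ := h
    exact ⟨hf, g, fun j => ⟨(hg j).1, ih (hg j).2⟩⟩

theorem hasZeroWeakDeriv_of_W12ZeroDiv (hΩ : IsOpen Ω) {v : Fin d → L2 Ω}
    {D : Fin d → Fin d → L2 Ω} (hv : v ∈ W12ZeroDiv Ω)
    (hD : ∀ i j, HasWeakDeriv Ω j (v i) (D i j)) (i j : Fin d) :
    HasZeroWeakDeriv Ω j (v i) (D i j) := by
  obtain ⟨G, hG⟩ := hv
  have h := hasZeroWeakDeriv_of_mem_closure hG i j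
  rwa [(hD i j).unique hΩ h.hasWeakDeriv]

variable {u₀ : Fin d → L2 Ω} {F₀ : Fin d → Fin d → L2 Ω} {u : ℝ → Fin d → L2 Ω}
  {F : ℝ → Fin d → Fin d → L2 Ω}

/-- Three derivatives in L^∞(0,T; L²) put u, F and their gradients into L^∞(0,T; W^{2,2}), so all of
them are essentially bounded; M is the sum of the individual bounds. -/
theorem IsStrongSolution.exists_regular (hd : d ≤ 3) (hΩ : IsSmoothBoundedDomain Ω)
    (h : IsStrongSolution Ω T u₀ F₀ u F) : ∃ M g D G DF,
      IsRegularVelocity Ω T M u g D ∧ IsRegularDeformation Ω T M F G DF := by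
  choose hu D hD using h.u_memSobolev_three
  choose hF DF hDF using h.F_memSobolev_three
  obtain ⟨v, hv, hvS⟩ := h.u_timeDeriv
  obtain ⟨G, hG, hGS⟩ := h.F_timeDeriv
  choose M₁ hM₁ b₁ using fun i => (h.u_memSobolev_three i).of_succ.exists_ae_bound hd hΩ
  choose M₂ hM₂ b₂ using fun i j => (hD i j).2.exists_ae_bound hd hΩ
  choose M₃ hM₃ b₃ using fun i j => (h.F_memSobolev_three i j).of_succ.exists_ae_bound hd hΩ
  choose M₄ hM₄ b₄ using fun i j k => (hDF i j k).2.exists_ae_bound hd hΩ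
  obtain ⟨B₁, hB₁, c₁⟩ := exists_finite_bound M₁
  obtain ⟨B₂, hB₂, c₂⟩ := exists_finite_bound fun p : Fin d × Fin d => M₂ p.1 p.2
  obtain ⟨B₃, hB₃, c₃⟩ := exists_finite_bound fun p : Fin d × Fin d => M₃ p.1 p.2
  obtain ⟨B₄, hB₄, c₄⟩ := exists_finite_bound fun p : Fin d × Fin d × Fin d => M₄ p.1 p.2.1 p.2.2
  refine ⟨B₁ + B₂ + B₃ + B₄, v, fun t i j => D i j t, G, fun t i j k => DF i j k t, ?_, ?_⟩
  · have hgr : ∀ᵐ s ∂timeMeasure T, ∀ i j, HasWeakDeriv Ω j (u s i) (D i j s) :=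
      ae_all_iff.2 fun i => ae_all_iff.2 fun j => (hD i j).1
    refine ⟨by positivity, memLp_pi_iff.2 fun i => hu i,
      memLp_pi_iff.2 fun i => memLp_pi_iff.2 fun j => (hD i j).2.memLp,
      memLp_pi_iff.2 fun i => (hvS i).memLp, hv, h.u_memV.mono fun s hs => hs.1, ?_, ?_, ?_⟩
    · filter_upwards [h.u_memV, hgr] with s hs hs'
      exact hasZeroWeakDeriv_of_W12ZeroDiv hΩ.isOpen hs.1 hs'
    · filter_upwards [ae_all_iff.2 b₁] with s hs i
      filter_upwards [hs i] with x hx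
      linarith [c₁ i]
    · filter_upwards [ae_all_iff.2 fun i => ae_all_iff.2 (b₂ i)] with s hs i j
      filter_upwards [hs i j] with x hx
      linarith [c₂ (i, j)]
  · refine ⟨by positivity, memLp_pi_iff.2 fun i => memLp_pi_iff.2 (hF i),
      memLp_pi_iff.2 fun i => memLp_pi_iff.2 fun j => memLp_pi_iff.2 fun k => (hDF i j k).2.memLp,
      memLp_pi_iff.2 fun i => memLp_pi_iff.2 fun j =>
        (hGS i j).memLp.mono_exponent le_top, hG, h.F_memW.mono fun s hs => hs.1,
      ae_all_iff.2 fun i => ae_all_iff.2 fun j => ae_all_iff.2 fun k => (hDF i j k).1, ?_, ?_⟩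
    · filter_upwards [ae_all_iff.2 fun i => ae_all_iff.2 (b₃ i)] with s hs i j
      filter_upwards [hs i j] with x hx
      linarith [c₃ (i, j)]
    · filter_upwards [ae_all_iff.2 fun i => ae_all_iff.2 fun j => ae_all_iff.2 (b₄ i j)]
        with s hs i j k
      filter_upwards [hs i j k] with x hx
      linarith [c₄ (i, j, k)]

theorem IsDissipativeSolutionWithDefect.exists_isWeakState {𝒟 : ℝ → ℝ}
    (h : IsDissipativeSolutionWithDefect Ω T u₀ F₀ 𝒟 u F) : ∃ Du, IsWeakState Ω T u Du F := by
  choose _ D hD using h.u_memSobolev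
  exact ⟨fun t i j => D i j t, h.u_memCw.2.1, h.F_memCw.2.1,
    memLp_pi_iff.2 fun i => memLp_pi_iff.2 fun j => (hD i j).2,
    ae_all_iff.2 fun i => ae_all_iff.2 fun j => (hD i j).1⟩

theorem ae_eq_of_dissipative_of_strong (hd : d = 2 ∨ d = 3) (hΩ : IsSmoothBoundedDomain Ω)
    (hT : 0 < T) (hdiss : IsDissipativeSolution Ω T u₀ F₀ u F) {u' : ℝ → Fin d → L2 Ω}
    {F' : ℝ → Fin d → Fin d → L2 Ω} (hstrong : IsStrongSolution Ω T u₀ F₀ u' F') :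
    ∀ᵐ t ∂timeMeasure T, u t = u' t ∧ F t = F' t := by
  have := hΩ.isFiniteMeasure
  obtain ⟨𝒟, h⟩ := hdiss
  obtain ⟨M, g, D, G, DF, hV, hW⟩ :=
    hstrong.exists_regular (by rcases hd with rfl | rfl <;> norm_num) hΩ
  obtain ⟨Du, hw⟩ := h.exists_isWeakState
  obtain ⟨R, hR, ⟨c, hc⟩, hmom, htr⟩ := h.weak_forms
  have hRi := hR.integrable hΩ.isCompact_closure
  have hF : ∀ᵐ s ∂timeMeasure T, F s ∈ HSpace Ω := by
    filter_upwards [ae_restrict_mem measurableSet_Ioo] with s hs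
    exact h.F_memCw.1 s ⟨hs.1.le, hs.2.le⟩
  have henergy : ∀ᵐ t ∂timeMeasure T,
      (1 / 2 : ℝ) * ((∑ i, ‖u t i‖ ^ 2) + ∑ i, ∑ j, ‖F t i j‖ ^ 2)
          + (∫ s in Ioc 0 t, ∑ i, ∑ j, ‖Du s i j‖ ^ 2) + 𝒟 t
        ≤ (1 / 2 : ℝ) * ((∑ i, ‖u₀ i‖ ^ 2) + ∑ i, ∑ j, ‖F₀ i j‖ ^ 2) := by
    filter_upwards [h.energy_inequality, ae_restrict_mem measurableSet_Ioo] with t ht hm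
    rw [intervalIntegral.integral_of_le hm.1.le] at ht
    convert ht using 3
    refine integral_congr_ae ?_
    filter_upwards [ae_mono (restrict_Ioc_le hm.2) hw.grad] with s hs
    simp only [fun i j => weakDeriv_eq hΩ.isOpen (hs i j)]
  have key := relative_energy_inequality hd hΩ hT hw h.u_memW12ZeroDiv hF hV hW h.u₀_mem h.F₀_mem
    hstrong.momentum hstrong.transport hRi hmom htr henergy
  have iN := integrable_stateDist hw hV hW
  have iD : Integrable 𝒟 (timeMeasure T) := h.D_memLp.integrable le_top
  have hC := relativeConst_nonneg (d := d) hV.nonneg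
  have hB := gradBound_nonneg (d := d) hV.nonneg
  set N : ℝ → ℝ := fun s => stateDist (u s) (u' s) (F s) (F' s) with hN
  have hN0 : ∀ s, 0 ≤ N s := fun s => stateDist_nonneg _ _ _ _
  -- The defect is part of the Gronwall quantity because it dominates the corrector. The factor 2
  -- compensates the 1/2 in front of N, and |c| replaces c, whose sign is unknown.
  have hzero := ae_eq_zero_of_le_integral (T := T)
    (K := 2 * relativeConst d M + gradBound d M * |c|) (by positivity)
    (y := fun s => (1 / 2 : ℝ) * N s + 𝒟 s) ((iN.const_mul _).add iD)
    (h.D_nonneg.mono fun s hs => add_nonneg (mul_nonneg (by norm_num) (hN0 s)) hs) (by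
      filter_upwards [key, ae_restrict_mem measurableSet_Ioo] with t ht hm
      have hle := restrict_Ioc_le hm.2
      have h1 := hc t hm
      rw [intervalIntegral.integral_of_le hm.1.le, intervalIntegral.integral_of_le hm.1.le] at h1
      have h2 : 0 ≤ ∫ s in Ioc 0 t, 𝒟 s := integral_nonneg_of_ae (ae_mono hle h.D_nonneg)
      have h3 : 0 ≤ ∫ s in Ioc 0 t, N s := integral_nonneg hN0
      have h4 : ∫ s in Ioc 0 t, matMeasNorm (R s) ≤ |c| * ∫ s in Ioc 0 t, 𝒟 s :=
        h1.trans (mul_le_mul_of_nonneg_right (le_abs_self c) h2)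
      rw [integral_add ((iN.mono_measure hle).const_mul _) (iD.mono_measure hle),
        integral_const_mul]
      refine ht.trans ?_
      have h5 := mul_le_mul_of_nonneg_left h4 hB
      have h6 : 0 ≤ relativeConst d M * ∫ s in Ioc 0 t, 𝒟 s := mul_nonneg hC h2
      have h7 : 0 ≤ gradBound d M * |c| * ∫ s in Ioc 0 t, N s :=
        mul_nonneg (mul_nonneg hB (abs_nonneg c)) h3
      nlinarith)
  filter_upwards [hzero, h.D_nonneg] with t ht hDt
  have hNt : stateDist (u t) (u' t) (F t) (F' t) = 0 := by
    have := hN0 t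
    simp only [hN] at this ht
    linarith
  obtain ⟨h1, h2⟩ := norm_sq_le_stateDist (u t) (u' t) (F t) (F' t)
  rw [hNt] at h1 h2
  refine ⟨funext fun i => ?_, funext fun i => funext fun j => ?_⟩
  · have := (sq_nonneg _).antisymm' (h1 i)
    rwa [sq_eq_zero_iff, norm_eq_zero, sub_eq_zero] at this
  · have := (sq_nonneg _).antisymm' (h2 i j)
    rwa [sq_eq_zero_iff, norm_eq_zero, sub_eq_zero] at this

end Solutions

end Viscoelastic

end

theorem theorem2 {d : ℕ} (hd : d = 2 ∨ d = 3) {Ω : Set (Viscoelastic.Eu d)}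
    (hΩ : Viscoelastic.IsSmoothBoundedDomain Ω) {T : ℝ} (hT : 0 < T)
    {u₀ : Fin d → Viscoelastic.L2 Ω} {F₀ : Fin d → Fin d → Viscoelastic.L2 Ω}
    (hu₀ : u₀ ∈ Viscoelastic.VSpace Ω)
    (hF₀ : F₀ ∈ Viscoelastic.WSpace Ω ∧ ∀ i j, Viscoelastic.MemSobolev Ω 3 (F₀ i j))
    {u : ℝ → Fin d → Viscoelastic.L2 Ω} {F : ℝ → Fin d → Fin d → Viscoelastic.L2 Ω}
    (hdiss : Viscoelastic.IsDissipativeSolution Ω T u₀ F₀ u F)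
    {u' : ℝ → Fin d → Viscoelastic.L2 Ω} {F' : ℝ → Fin d → Fin d → Viscoelastic.L2 Ω}
    (hstrong : Viscoelastic.IsStrongSolution Ω T u₀ F₀ u' F') :
    ∀ᵐ p : ℝ × Viscoelastic.Eu d ∂(volume.restrict (Ioo 0 T ×ˢ Ω)),
      (∀ i, u p.1 i p.2 = u' p.1 i p.2) ∧ (∀ i j, F p.1 i j p.2 = F' p.1 i j p.2) := by

  have hae := Viscoelastic.ae_eq_of_dissipative_of_strong hd hΩ hT hdiss hstrong
  rw [Measure.volume_eq_prod, ← Measure.prod_restrict]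
  -- Equality in L²(Ω) at time t makes the chosen representatives equal at every x, so only the null
  -- set of times has to be pulled back to the product.
  filter_upwards [Measure.quasiMeasurePreserving_fst.ae hae] with p hp
  rw [hp.1, hp.2]
  exact ⟨fun _ => rfl, fun _ _ => rfl⟩
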